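/- An instance consists of a graph $G=(V,E)$ with $n=|V|$ vertices, a distance metric $d\colon V\times V\to\mathbb R_{\ge 0}$, a facility set $F\subseteq V$ and a natural number $k$. In the connected $k$-center with facilities problem one looks for a tuple $(c_1,\dots,c_k)\in F^k$ of facilities (repetitions allowed; $c_i$ need not belong to $P_i$) and a partition $P_1,\dots,P_k$ of $V$ into $k$ nonempty clusters, each of which induces a connected subgraph of $G$, such that the radius $\max_{i}\max_{v\in P_i} d(v,c_i)$ is minimized. A nice tree decomposition of $G$ is a tree decomposition $(T,\{B_t\}_{t\in V_T})$ with a root $z$ such that $B_z=\emptyset$, in which every node $t$ is of one of the following types: a leaf with $B_t=\emptyset$; an introduce vertex node with exactly one child $s$ and $B_t=B_s\cup\{v\}$ for some $v\notin B_s$; an introduce edge node, labeled with an edge $\{u,v\}\in E$, with exactly one child $s$, $B_t=B_s$ and $u,v\in B_t$; a forget node with exactly one child $s$ and $B_t=B_s\setminus\{v\}$ for some $v\in B_s$; a join node with exactly two children $s_1,s_2$ and $B_{s_1}=B_{s_2}=B_t$. Every edge is introduced exactly once and every vertex is forgotten exactly once. The treewidth $w$ of the decomposition is the size of its largest bag minus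 one. Let $b_m$ denote the $m$-th Bell number. Theorem. There are an algorithm and a polynomial $p$ such that the following holds. Given an instance $(G,d,F,k)$ together with a nice tree decomposition of $G$ of treewidth $w$, the algorithm computes an optimal connected $k$-center with facilities solution, or reports that no feasible solution exists. If $n\ge 2$ and the decomposition has $O(n(w+1))$ nodes, then the running time is $$O\left(n^2\log n+\log n\cdot n\cdot |F|^{w+1}\,(b_{w+1})^2\,p(w)\right),$$ where the constant hidden in this bound depends only on the constant hidden in the bound on the number of nodes. Running time is counted on a unit-cost random access machine whose only arithmetic is addition and (truncated) subtraction of natural numbers, and which can copy and compare the real numbers $d(u,v)$. -/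

import Mathlib

open scoped NNReal

/-! ## Tree decompositions and nice tree decompositions -/

/-- A tree decomposition of `G` with node set `ι`: a tree on `ι` and a bag for every node, such
that the bags cover the vertices, every edge lies in some bag, and the nodes whose bags contain
a fixed vertex form a connected subtree. -/
structure TreeDecomposition {V : Type} (G : SimpleGraph V) (ι : Type) where
  tree : SimpleGraph ι
  isTree : tree.IsTree
  bag : ι → Finset V
  vertex_covered : ∀ v, ∃ t, v ∈ bag t
  edge_covered : ∀ u v, G.Adj u v → ∃ t, u ∈ bag t ∧ v ∈ bag t
  connected_occurrences : ∀ v, (tree.induce {t | v ∈ bag t}).Connected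

/-- The size of the largest bag minus one. -/
def TreeDecomposition.width {V ι : Type} [Fintype ι] {G : SimpleGraph V}
    (D : TreeDecomposition G ι) : ℕ :=
  (Finset.univ.sup fun t => (D.bag t).card) - 1

/-- The label of a node of a nice tree decomposition: its type, its children, and the vertex or
the edge which it introduces or forgets. -/
inductive NodeKind (V ι : Type) where
  | leaf : NodeKind V ι
  | introduceVertex (v : V) (s : ι) : NodeKind V ι
  | introduceEdge (u v : V) (s : ι) : NodeKind V ι
  | forget (v : V) (s : ι) : NodeKind V ι
  | join (s₁ s₂ : ι) : NodeKind V ι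

/-- `IsValidNode G children bag t κ`: the node `t`, whose set of children is `children`, satisfies
the requirements on a node of kind `κ`. -/
def IsValidNode {V ι : Type} [DecidableEq V] (G : SimpleGraph V) (children : Set ι)
    (bag : ι → Finset V) (t : ι) : NodeKind V ι → Prop
  | .leaf => children = ∅ ∧ bag t = ∅
  | .introduceVertex v s => children = {s} ∧ v ∉ bag s ∧ bag t = insert v (bag s)
  | .introduceEdge u v s => children = {s} ∧ G.Adj u v ∧ u ∈ bag t ∧ v ∈ bag t ∧ bag t = bag s
  | .forget v s => children = {s} ∧ v ∈ bag s ∧ bag t = (bag s).erase v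
  | .join s₁ s₂ => s₁ ≠ s₂ ∧ children = {s₁, s₂} ∧ bag s₁ = bag t ∧ bag s₂ = bag t

/-- A nice tree decomposition (with introduce edge nodes). The children of a node are its
neighbours that are farther away from the root. -/
structure NiceTreeDecomposition {V : Type} [DecidableEq V] (G : SimpleGraph V) (ι : Type)
    extends TreeDecomposition G ι where
  root : ι
  bag_root : bag root = ∅
  kind : ι → NodeKind V ι
  valid : ∀ t, IsValidNode G {s | tree.Adj t s ∧ tree.dist root s = tree.dist root t + 1} bag t
    (kind t)
  edge_introduced_once : ∀ u v, G.Adj u v →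
    ∃! t, ∃ s, kind t = .introduceEdge u v s ∨ kind t = .introduceEdge v u s
  vertex_forgotten_once : ∀ v, ∃! t, ∃ s, kind t = .forget v s

/-! ## The connected `k`-center with facilities problem -/

/-- `d` is a distance metric. -/
structure IsMetric {V : Type} (d : V → V → ℝ≥0) : Prop where
  eq_zero_iff : ∀ u v, d u v = 0 ↔ u = v
  symm : ∀ u v, d u v = d v u
  triangle : ∀ u v x, d u x ≤ d u v + d v x

/-- A tuple of `k` centers together with `k` clusters. -/
structure Clustering (V : Type) (k : ℕ) where
  center : Fin k → V
  cluster : Fin k → Finset V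

namespace Clustering

variable {V : Type} {k : ℕ}

/-- The centers are facilities (repetitions are allowed, and a center need not lie in its cluster),
the clusters partition the vertex set, and every cluster induces a (nonempty) connected
subgraph of `G`. -/
structure IsFeasible (G : SimpleGraph V) (F : Finset V) (S : Clustering V k) : Prop where
  center_mem : ∀ i, S.center i ∈ F
  partition : ∀ v, ∃! i, v ∈ S.cluster i
  connected : ∀ i, (G.induce (S.cluster i : Set V)).Connected

/-- The largest distance of a vertex to the center of its cluster. -/
def radius (d : V → V → ℝ≥0) (S : Clustering V k) : ℝ≥0 :=
  Finset.univ.sup fun i => (S.cluster i).sup fun v => d v (S.center i)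

/-- An optimal solution of the connected `k`-center with facilities problem. -/
def IsOptimal (G : SimpleGraph V) (F : Finset V) (d : V → V → ℝ≥0) (S : Clustering V k) : Prop :=
  S.IsFeasible G F ∧ ∀ S' : Clustering V k, S'.IsFeasible G F → S.radius d ≤ S'.radius d

end Clustering

/-! ## The machine model

A unit-cost random access machine, programmed in a structured language. It has natural number
variables, arrays of natural numbers, and arrays of real numbers (there is a fixed number of names
in each program). The only arithmetic operations are addition and truncated subtraction of natural
numbers; real numbers can only be copied and compared. Every evaluation of a constant, a variable,
an array access, an arithmetic operation, a comparison, an assignment costs one step. -/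

namespace RAM

/-- A memory content: the natural number variables, the natural number arrays and the real
arrays. Variables and arrays are named by natural numbers. -/
structure State where
  var : ℕ → ℕ
  arr : ℕ → ℕ → ℕ
  real : ℕ → ℕ → ℝ

/-- `x := m` -/
def State.setVar (σ : State) (x m : ℕ) : State :=
  { σ with var := Function.update σ.var x m }

/-- `a[i] := m` -/
def State.setArr (σ : State) (a i m : ℕ) : State :=
  { σ with arr := Function.update σ.arr a (Function.update (σ.arr a) i m) }

/-- `a[i] := r` for a real array `a` -/
def State.setReal (σ : State) (a i : ℕ) (r : ℝ) : State :=
  { σ with real := Function.update σ.real a (Function.update (σ.real a) i r) }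

/-- Natural number expressions; `get a i` is the `i`-th cell of the array named `a`. -/
inductive Expr where
  | const (m : ℕ) : Expr
  | var (x : ℕ) : Expr
  | get (a : ℕ) (i : Expr) : Expr
  | add (e₁ e₂ : Expr) : Expr
  | sub (e₁ e₂ : Expr) : Expr

def Expr.eval (σ : State) : Expr → ℕ
  | .const m => m
  | .var x => σ.var x
  | .get a i => σ.arr a (i.eval σ)
  | .add e₁ e₂ => e₁.eval σ + e₂.eval σ
  | .sub e₁ e₂ => e₁.eval σ - e₂.eval σ

def Expr.cost : Expr → ℕ
  | .const _ => 1
  | .var _ => 1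
  | .get _ i => i.cost + 1
  | .add e₁ e₂ => e₁.cost + e₂.cost + 1
  | .sub e₁ e₂ => e₁.cost + e₂.cost + 1

/-- Comparisons of two natural numbers, comparisons of cell `i` of the real array `a` with
cell `j` of the real array `b`, and Boolean combinations. -/
inductive Test where
  | le (e₁ e₂ : Expr) : Test
  | realLe (a : ℕ) (i : Expr) (b : ℕ) (j : Expr) : Test
  | neg (q : Test) : Test
  | conj (q₁ q₂ : Test) : Test

def Test.Holds (σ : State) : Test → Prop
  | .le e₁ e₂ => e₁.eval σ ≤ e₂.eval σ
  | .realLe a i b j => σ.real a (i.eval σ) ≤ σ.real b (j.eval σ)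
  | .neg q => ¬ q.Holds σ
  | .conj q₁ q₂ => q₁.Holds σ ∧ q₂.Holds σ

def Test.cost : Test → ℕ
  | .le e₁ e₂ => e₁.cost + e₂.cost + 1
  | .realLe _ i _ j => i.cost + j.cost + 1
  | .neg q => q.cost + 1
  | .conj q₁ q₂ => q₁.cost + q₂.cost + 1

/-- Programs: `setVar x e` is `x := e`, `setArr a i e` is `a[i] := e`, and `setReal a i b j` copies
cell `j` of the real array `b` into cell `i` of the real array `a`. -/
inductive Program where
  | skip : Program
  | setVar (x : ℕ) (e : Expr) : Program
  | setArr (a : ℕ) (i e : Expr) : Program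
  | setReal (a : ℕ) (i : Expr) (b : ℕ) (j : Expr) : Program
  | seq (P Q : Program) : Program
  | ite (q : Test) (P Q : Program) : Program
  | loop (q : Test) (P : Program) : Program

/-- `Exec P σ T τ`: started in the state `σ`, the program `P` halts after exactly `T` steps, in the
state `τ`. Here `loop q P` repeats `P` while `q` holds. -/
inductive Exec : Program → State → ℕ → State → Prop where
  | skip (σ : State) : Exec .skip σ 1 σ
  | setVar (x : ℕ) (e : Expr) (σ : State) :
      Exec (.setVar x e) σ (e.cost + 1) (σ.setVar x (e.eval σ))
  | setArr (a : ℕ) (i e : Expr) (σ : State) :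
      Exec (.setArr a i e) σ (i.cost + e.cost + 1)
        (σ.setArr a (i.eval σ) (e.eval σ))
  | setReal (a : ℕ) (i : Expr) (b : ℕ) (j : Expr) (σ : State) :
      Exec (.setReal a i b j) σ (i.cost + j.cost + 1)
        (σ.setReal a (i.eval σ) (σ.real b (j.eval σ)))
  | seq {P Q : Program} {σ τ ρ : State} {T U : ℕ} (hP : Exec P σ T τ) (hQ : Exec Q τ U ρ) :
      Exec (.seq P Q) σ (T + U) ρ
  | iteTrue {q : Test} {P Q : Program} {σ τ : State} {T : ℕ} (hq : q.Holds σ)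
      (hP : Exec P σ T τ) : Exec (.ite q P Q) σ (q.cost + T) τ
  | iteFalse {q : Test} {P Q : Program} {σ τ : State} {T : ℕ} (hq : ¬ q.Holds σ)
      (hQ : Exec Q σ T τ) : Exec (.ite q P Q) σ (q.cost + T) τ
  | loopDone {q : Test} {P : Program} {σ : State} (hq : ¬ q.Holds σ) :
      Exec (.loop q P) σ q.cost σ
  | loopStep {q : Test} {P : Program} {σ τ ρ : State} {T U : ℕ} (hq : q.Holds σ)
      (hP : Exec P σ T τ) (hL : Exec (.loop q P) τ U ρ) :
      Exec (.loop q P) σ (q.cost + T + U) ρ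

end RAM

/-! ## Input and output of the machine -/

/-- The cells `0, …, m - 1` contain the values of `f`, all other cells contain `0`. -/
def cells {α : Type} [Zero α] {m : ℕ} (f : Fin m → α) : ℕ → α :=
  fun i => if h : i < m then f ⟨i, h⟩ else 0

/-- The row-major layout of a matrix with rows of length `m`: the entry `f i j` is in
cell `i * m + j`. -/
def matrixCells {α : Type} [Zero α] {l m : ℕ} (f : Fin l → ℕ → α) : ℕ → α :=
  fun q => cells (fun i => f i (q % m)) (q / m)

/-- The code of the type of a node, its two children and its two vertices (`0` if absent). -/
def nodeCode {n N : ℕ} : NodeKind (Fin n) (Fin N) → Fin 5 → ℕ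
  | .leaf => ![0, 0, 0, 0, 0]
  | .introduceVertex v s => ![1, s, 0, v, 0]
  | .introduceEdge u v s => ![2, s, 0, u, v]
  | .forget v s => ![3, s, 0, v, 0]
  | .join s₁ s₂ => ![4, s₁, s₂, 0, 0]

open Classical in
/-- The initial memory.
* variables: `0 ↦ n`, `1 ↦ k`, `2 ↦` number of nodes, `3 ↦` root, `4 ↦` width `w`;
* array `0`: adjacency matrix of `G`; array `1`: indicator of `F`;
* arrays `2, …, 6`: for every node its type, its two children and its two vertices;
* array `7`: for every node the size of its bag; array `8`: for every node a row of length
  `w + 1` with the increasing list of the elements of its bag;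
* real array `0`: the distance matrix.
All other cells are `0`. -/
noncomputable def inputState {n N : ℕ} (G : SimpleGraph (Fin n))
    (D : NiceTreeDecomposition G (Fin N)) (k : ℕ) (F : Finset (Fin n))
    (d : Fin n → Fin n → ℝ≥0) : RAM.State where
  var
    | 0 => n
    | 1 => k
    | 2 => N
    | 3 => D.root
    | 4 => D.width
    | _ => 0
  arr
    | 0 => matrixCells (m := n) fun u => cells fun v => if G.Adj u v then 1 else 0
    | 1 => cells fun v => if v ∈ F then 1 else 0
    | 2 => cells fun t => nodeCode (D.kind t) 0
    | 3 => cells fun t => nodeCode (D.kind t) 1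
    | 4 => cells fun t => nodeCode (D.kind t) 2
    | 5 => cells fun t => nodeCode (D.kind t) 3
    | 6 => cells fun t => nodeCode (D.kind t) 4
    | 7 => cells fun t => (D.bag t).card
    | 8 => matrixCells (m := D.width + 1) fun t j =>
        (((D.bag t).sort (· ≤ ·)).map fun v : Fin n => (v : ℕ)).getD j 0
    | _ => fun _ => 0
  real
    | 0 => matrixCells (m := n) fun u => cells fun v => (d u v : ℝ)
    | _ => fun _ => 0

/-- In the final memory `τ`, array `9` contains the centers and array `10` contains, for every
vertex, the index of its cluster. -/
def Represents {n k : ℕ} (τ : RAM.State) (S : Clustering (Fin n) k) : Prop :=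
  (∀ i : Fin k, τ.arr 9 i = S.center i) ∧
    ∀ (v : Fin n) (i : Fin k), v ∈ S.cluster i ↔ τ.arr 10 v = i

/-- The final memory `τ` is a correct answer: if there is a feasible solution, then variable `5`
is `1` and arrays `9` and `10` contain an optimal solution; otherwise variable `5` is `0`. -/
def IsCorrectOutput {n : ℕ} (G : SimpleGraph (Fin n)) (k : ℕ) (F : Finset (Fin n))
    (d : Fin n → Fin n → ℝ≥0) (τ : RAM.State) : Prop :=
  ((∃ S : Clustering (Fin n) k, S.IsFeasible G F) →
      τ.var 5 = 1 ∧ ∃ S : Clustering (Fin n) k, Represents τ S ∧ S.IsOptimal G F d) ∧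
    ((¬ ∃ S : Clustering (Fin n) k, S.IsFeasible G F) → τ.var 5 = 0)

/-! ## The rooted tree of a nice tree decomposition -/

/-! Fix a threshold r. A feasible clustering of radius at most r exists iff k ≤ n and the vertices
can be coloured by facilities within distance r so that the monochromatic edges leave at most k
components. Colouring by centres gives one direction (`IsFeasible.isColoring`). For the other, start
from n singletons and merge along monochromatic edges. The number of parts drops by one per merge,
and it can be stopped at exactly k because components ≤ k ≤ n (`PartsInv.exists_parts`,
`runs_clusters`). The optimal radius is one of the n² distances, so a binary search over the sorted
distances needs O(log n) tests of a threshold.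

A test is a dynamic program over the tree decomposition. Each component is counted at the forget
node of its last vertex. These closing vertices are a system of representatives (`exists_closes`,
`closes_unique`), so `cost` at the root is the number of components. Below a node t a colouring
matters only through its colours on the bag, the partition of the bag into classes connected below
t, and the number of classes already closed. The rules `rel_introduceEdge`, `rel_join`,
`cost_forget` and `cost_join` express these data by those of the children, and `Trans` turns them
into transitions between table entries. Soundness is `matches_of_selection`, which reads a colouring
off along back pointers. Completeness is `exists_entry`, which finds for every colouring an entry
that is at least as cheap.

For the running time, a bag of m vertices has at most |F|^m · b_m entries (`Table.card_le`, from
`card_labelings_le_bell`). At a join node the entries of the second child are first collected in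
lists by their colours. An entry of the first child then meets at most b_m partners
(`Table.length_group_le`), which gives |F|^(w+1) · b_(w+1)². Each candidate costs time polynomial in
w. Its colours and canonical labels are the digits of a number, and this number is used as an
address, so finding an equivalent entry takes one memory access. The required multiples of powers
are tabulated using additions only, and every node uses a fresh range of addresses, so nothing has
to be cleared. Sorting costs O(n² log n), and merging parts costs O(n²) by amortisation.

Programs are treated through `Runs`, which combines a time bound, a postcondition and the fact that
names not written by the program keep their values. Loops are handled by invariants. -/

theorem Relation.eqvGen_imp {α : Type} {r r' : α → α → Prop} (h : ∀ x y, r x y → r' x y) {x y : α}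
    (hxy : Relation.EqvGen r x y) : Relation.EqvGen r' x y := by
  induction hxy with
  | rel x y hr => exact .rel _ _ (h _ _ hr)
  | refl x => exact .refl x
  | symm x y _ ih => exact ih.symm
  | trans x y z _ _ ih1 ih2 => exact ih1.trans _ _ _ ih2

/-- A chain that uses the new pair twice can be shortened: two passages in the same direction leave
one, two in opposite directions leave none. So one crossing in either direction is enough. This is
the rule by which an introduced edge, or a relabelling, merges two classes. -/
theorem Relation.eqvGen_insert_iff {α : Type} {r r' : α → α → Prop} {a b : α}
    (h : ∀ x y, r' x y ↔ r x y ∨ (x = a ∧ y = b)) (x y : α) :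
    Relation.EqvGen r' x y ↔ Relation.EqvGen r x y ∨
      (Relation.EqvGen r x a ∧ Relation.EqvGen r b y) ∨
      (Relation.EqvGen r x b ∧ Relation.EqvGen r a y) := by
  have mono : ∀ {x y}, Relation.EqvGen r x y → Relation.EqvGen r' x y := fun {x y} hxy =>
    Relation.eqvGen_imp (fun _ _ h' => (h _ _).2 (Or.inl h')) hxy
  have hab : Relation.EqvGen r' a b := .rel _ _ ((h _ _).2 (Or.inr ⟨rfl, rfl⟩))
  constructor
  · intro hxy
    induction hxy with
    | rel x y hr =>
      rcases (h _ _).1 hr with h1 | ⟨rfl, rfl⟩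
      · exact Or.inl (.rel _ _ h1)
      · exact Or.inr (Or.inl ⟨.refl _, .refl _⟩)
    | refl x => exact Or.inl (.refl x)
    | symm x y _ ih =>
      rcases ih with h1 | ⟨h1, h2⟩ | ⟨h1, h2⟩
      · exact Or.inl (h1.symm _ _)
      · exact Or.inr (Or.inr ⟨h2.symm _ _, h1.symm _ _⟩)
      · exact Or.inr (Or.inl ⟨h2.symm _ _, h1.symm _ _⟩)
    | trans x y z _ _ ih1 ih2 =>
      rcases ih1 with h1 | ⟨h1, h2⟩ | ⟨h1, h2⟩ <;> rcases ih2 with h3 | ⟨h3, h4⟩ | ⟨h3, h4⟩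
      · exact Or.inl (h1.trans _ _ _ h3)
      · exact Or.inr (Or.inl ⟨h1.trans _ _ _ h3, h4⟩)
      · exact Or.inr (Or.inr ⟨h1.trans _ _ _ h3, h4⟩)
      · exact Or.inr (Or.inl ⟨h1, h2.trans _ _ _ h3⟩)
      · exact Or.inr (Or.inl ⟨h1, h4⟩)
      · exact Or.inl (h1.trans _ _ _ h4)
      · exact Or.inr (Or.inr ⟨h1, h2.trans _ _ _ h3⟩)
      · exact Or.inl (h1.trans _ _ _ h4)
      · exact Or.inr (Or.inr ⟨h1, h4⟩)
  · rintro (h1 | ⟨h1, h2⟩ | ⟨h1, h2⟩)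
    · exact mono h1
    · exact ((mono h1).trans _ _ _ hab).trans _ _ _ (mono h2)
    · exact ((mono h1).trans _ _ _ (hab.symm _ _)).trans _ _ _ (mono h2)

namespace NiceTreeDecomposition

variable {V ι : Type} [DecidableEq V] {G : SimpleGraph V} (D : NiceTreeDecomposition G ι)

/-- `s` is a child of `t`. -/
def Child (t s : ι) : Prop := D.tree.Adj t s ∧ D.tree.dist D.root s = D.tree.dist D.root t + 1

/-- `s` is a node of the subtree rooted at `t`. -/
def Desc (t s : ι) : Prop := Relation.ReflTransGen D.Child t s

variable {D}

theorem Child.desc {t s : ι} (h : D.Child t s) : D.Desc t s := Relation.ReflTransGen.single h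

theorem desc_refl (t : ι) : D.Desc t t := Relation.ReflTransGen.refl

theorem child_or_child {a b : ι} (h : D.tree.Adj a b) : D.Child a b ∨ D.Child b a :=
  (D.isTree.dist_eq_dist_add_one_of_adj D.root h).elim (fun e => Or.inr ⟨h.symm, e⟩)
    fun e => Or.inl ⟨h, e⟩

theorem exists_parent {t : ι} (h : t ≠ D.root) : ∃ p, D.Child p t := by
  obtain ⟨w, hw, hl⟩ := D.isTree.connected.exists_path_of_dist D.root t
  have hn : ¬ w.Nil := fun hn => h hn.eq.symm
  refine ⟨w.penultimate, w.adj_penultimate hn, ?_⟩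
  rcases child_or_child (w.adj_penultimate hn) with hc | hc
  · exact hc.2
  · exfalso
    have h1 := SimpleGraph.dist_le w.dropLast
    have h2 : w.dropLast.length + 1 = w.length := by
      simpa using w.length_dropLast_add_one hn
    have := hc.2
    omega

/-- Shortest walks from the root to p and to q, prolonged by the edge to t, are both paths from the
root to t. A tree has only one, so their penultimate vertices agree. -/
theorem parent_unique {p q t : ι} (hp : D.Child p t) (hq : D.Child q t) : p = q := by
  obtain ⟨w, hw, hl⟩ := D.isTree.connected.exists_path_of_dist D.root p
  obtain ⟨w', hw', hl'⟩ := D.isTree.connected.exists_path_of_dist D.root q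
  have h1 : (w.concat hp.1).length = D.tree.dist D.root t := by
    rw [SimpleGraph.Walk.length_concat, hl, hp.2]
  have h2 : (w'.concat hq.1).length = D.tree.dist D.root t := by
    rw [SimpleGraph.Walk.length_concat, hl', hq.2]
  have e := (D.isTree.existsUnique_path D.root t).unique
    (SimpleGraph.Walk.isPath_of_length_eq_dist _ h1)
    (SimpleGraph.Walk.isPath_of_length_eq_dist _ h2)
  have := congrArg SimpleGraph.Walk.penultimate e
  simpa using this

theorem not_child_root {p : ι} : ¬ D.Child p D.root := fun h => by
  have := h.2; simp at this

theorem Desc.dist_le {t s : ι} (h : D.Desc t s) : D.tree.dist D.root t ≤ D.tree.dist D.root s := by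
  induction h with
  | refl => rfl
  | tail _ hc ih => rw [hc.2]; omega

theorem desc_iff {t q : ι} : D.Desc t q ↔ q = t ∨ ∃ s, D.Child t s ∧ D.Desc s q := by
  rw [Desc, Relation.ReflTransGen.cases_head_iff]
  exact or_congr_left eq_comm

theorem Child.not_desc {t s : ι} (h : D.Child t s) : ¬ D.Desc s t := fun h' => by
  have := h'.dist_le; have := h.2; omega

/-- If a were not s itself, the parent of a, which is b, would still lie in the subtree. So the only
way out of a subtree leads from its top node to the parent. -/
theorem desc_exit {s a b : ι} (hab : D.tree.Adj a b) (ha : D.Desc s a) (hb : ¬ D.Desc s b) :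
    a = s ∧ D.Child b s := by
  have hc : D.Child b a := (child_or_child hab).resolve_left fun h => hb (ha.tail h)
  rcases Relation.ReflTransGen.cases_tail ha with h | ⟨p, hp, hpa⟩
  · exact ⟨h, h ▸ hc⟩
  · exact absurd (parent_unique hpa hc ▸ hp) hb

theorem Desc.root (t : ι) : D.Desc D.root t := by
  generalize hn : D.tree.dist D.root t = n
  induction n generalizing t with
  | zero =>
    rw [D.isTree.connected.dist_eq_zero_iff] at hn
    exact hn ▸ desc_refl _
  | succ n ih =>
    have : t ≠ D.root := by rintro rfl; simp at hn
    obtain ⟨p, hp⟩ := exists_parent this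
    exact (ih p (by have := hp.2; omega)).tail hp

/-- A connected set of nodes that contains nodes inside and outside of the subtree of `s` contains
`s` and the parent of `s`. -/
theorem mem_bag_of_desc {v : V} {s a b : ι} (hva : v ∈ D.bag a) (ha : D.Desc s a)
    (hvb : v ∈ D.bag b) (hb : ¬ D.Desc s b) :
    v ∈ D.bag s ∧ ∀ p, D.Child p s → v ∈ D.bag p := by
  obtain ⟨w⟩ := (D.connected_occurrences v).preconnected ⟨a, hva⟩ ⟨b, hvb⟩
  have key : ∀ (x y : {t | v ∈ D.bag t}), (D.tree.induce {t | v ∈ D.bag t}).Walk x y →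
      D.Desc s x → ¬ D.Desc s y → v ∈ D.bag s ∧ ∀ p, D.Child p s → v ∈ D.bag p := by
    intro x y w
    induction w with
    | nil => intro h1 h2; exact absurd h1 h2
    | @cons x z y hxz w ih =>
      intro h1 h2
      by_cases hz : D.Desc s z
      · exact ih hz h2
      · obtain ⟨e, hc⟩ := desc_exit (by simpa using hxz) h1 hz
        exact ⟨e ▸ x.2, fun p hp => parent_unique hc hp ▸ z.2⟩
  exact key _ _ w ha hb

/-- Unique parents push a common descendant upwards through both subtrees, until t would lie in the
subtree of one of its own children. -/
theorem disjoint_children {t s₁ s₂ q : ι} (h₁ : D.Child t s₁) (h₂ : D.Child t s₂) (hne : s₁ ≠ s₂)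
    (hq : D.Desc s₁ q) : ¬ D.Desc s₂ q := by
  intro hq2
  induction hq with
  | refl =>
    rcases Relation.ReflTransGen.cases_tail hq2 with h | ⟨p, hp, hps⟩
    · exact hne h
    · exact h₂.not_desc (parent_unique h₁ hps ▸ hp)
  | @tail x y hx hxy ih =>
    rcases Relation.ReflTransGen.cases_tail hq2 with h | ⟨p, hp, hps⟩
    · subst h
      exact h₁.not_desc (parent_unique h₂ hxy ▸ hx)
    · exact ih (parent_unique hps hxy ▸ hp)

/-! ### The relations and costs of a colouring -/

variable (D) in
/-- Vertices connected by monochromatic edges that are introduced in the subtree of `t`. -/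
def Rel {α : Type} (f : V → α) (t : ι) : V → V → Prop :=
  Relation.EqvGen fun u v => f u = f v ∧ ∃ q s, D.Desc t q ∧ D.kind q = .introduceEdge u v s

variable (D) in
/-- `v` is forgotten in the subtree of `t`, as the last vertex of its class. -/
def Closes {α : Type} (f : V → α) (t : ι) (v : V) : Prop :=
  ∃ q s, D.Desc t q ∧ D.kind q = .forget v s ∧ ∀ u ∈ D.bag q, ¬ D.Rel f s u v

variable (D) in
-- The number of classes that are complete below t. At the root the closing vertices represent the
-- monochromatic components, each exactly once, so this is the number of components.
noncomputable def cost {α : Type} (f : V → α) (t : ι) : ℕ := {v | D.Closes f t v}.ncard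

theorem child_leaf {t : ι} (h : D.kind t = .leaf) (s : ι) : ¬ D.Child t s := by
  have := D.valid t
  rw [h] at this
  intro hs
  have h2 : s ∈ (∅ : Set ι) := this.1 ▸ hs
  exact h2

theorem child_introduceVertex {t : ι} {v : V} {s : ι} (h : D.kind t = .introduceVertex v s)
    {q : ι} : D.Child t q ↔ q = s := by
  have := D.valid t
  rw [h] at this
  exact Set.ext_iff.1 this.1 q

theorem child_introduceEdge {t : ι} {u v : V} {s : ι} (h : D.kind t = .introduceEdge u v s)
    {q : ι} : D.Child t q ↔ q = s := by
  have := D.valid t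
  rw [h] at this
  exact Set.ext_iff.1 this.1 q

theorem child_forget {t : ι} {v : V} {s : ι} (h : D.kind t = .forget v s)
    {q : ι} : D.Child t q ↔ q = s := by
  have := D.valid t
  rw [h] at this
  exact Set.ext_iff.1 this.1 q

theorem child_join {t : ι} {s₁ s₂ : ι} (h : D.kind t = .join s₁ s₂)
    {q : ι} : D.Child t q ↔ q = s₁ ∨ q = s₂ := by
  have := D.valid t
  rw [h] at this
  exact Set.ext_iff.1 this.2.1 q

theorem bag_leaf {t : ι} (h : D.kind t = .leaf) : D.bag t = ∅ := by
  have := D.valid t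
  rw [h] at this
  exact this.2

theorem bag_introduceVertex {t : ι} {v : V} {s : ι} (h : D.kind t = .introduceVertex v s) :
    v ∉ D.bag s ∧ D.bag t = insert v (D.bag s) := by
  have := D.valid t
  rw [h] at this
  exact this.2

theorem bag_introduceEdge {t : ι} {u v : V} {s : ι} (h : D.kind t = .introduceEdge u v s) :
    G.Adj u v ∧ u ∈ D.bag t ∧ v ∈ D.bag t ∧ D.bag t = D.bag s := by
  have := D.valid t
  rw [h] at this
  exact this.2

theorem bag_forget {t : ι} {v : V} {s : ι} (h : D.kind t = .forget v s) :
    v ∈ D.bag s ∧ D.bag t = (D.bag s).erase v := by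
  have := D.valid t
  rw [h] at this
  exact this.2

theorem bag_join {t : ι} {s₁ s₂ : ι} (h : D.kind t = .join s₁ s₂) :
    s₁ ≠ s₂ ∧ D.bag s₁ = D.bag t ∧ D.bag s₂ = D.bag t := by
  have := D.valid t
  rw [h] at this
  exact ⟨this.1, this.2.2⟩

theorem kind_eq_of_forget {q q' : ι} {v : V} {s s' : ι} (h : D.kind q = .forget v s)
    (h' : D.kind q' = .forget v s') : q = q' ∧ s = s' := by
  obtain rfl := (D.vertex_forgotten_once v).unique ⟨s, h⟩ ⟨s', h'⟩
  rw [h] at h'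
  simpa using h'

variable {α : Type} {f : V → α} {t : ι}

/-- Both ends of a generating edge lie in the bag that introduces it, and a nontrivial chain begins
and ends with such an edge. Vertices not seen below t are therefore isolated. -/
theorem rel_mem {u v : V} (h : D.Rel f t u v) (hne : u ≠ v) :
    (∃ a, D.Desc t a ∧ u ∈ D.bag a) ∧ ∃ a, D.Desc t a ∧ v ∈ D.bag a := by
  induction h with
  | rel x y hr =>
    obtain ⟨_, q, s, hq, hk⟩ := hr
    obtain ⟨_, h1, h2, _⟩ := bag_introduceEdge hk
    exact ⟨⟨q, hq, h1⟩, ⟨q, hq, h2⟩⟩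
  | refl x => exact absurd rfl hne
  | symm x y _ ih => exact (ih hne.symm).symm
  | trans x y z _ _ ih1 ih2 =>
    by_cases hxy : x = y
    · subst hxy; exact ih2 hne
    · by_cases hyz : y = z
      · subst hyz; exact ih1 hne
      · exact ⟨(ih1 hxy).1, (ih2 hyz).2⟩

theorem Rel.mono {s : ι} (hs : D.Desc t s) {u v : V} (h : D.Rel f s u v) : D.Rel f t u v :=
  Relation.eqvGen_imp (fun _ _ ⟨h1, q, s', h2, h3⟩ => ⟨h1, q, s', hs.trans h2, h3⟩) h

theorem rel_of_unique_child {s : ι} (hs : ∀ q, D.Child t q ↔ q = s)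
    (hk : ∀ u v s', D.kind t ≠ .introduceEdge u v s') {u v : V} :
    D.Rel f t u v ↔ D.Rel f s u v := by
  refine ⟨fun h => ?_, fun h => Rel.mono ((hs s).2 rfl).desc h⟩
  refine Relation.eqvGen_imp (fun a b ⟨h1, q, s', h2, h3⟩ => ⟨h1, q, s', ?_, h3⟩) h
  rcases desc_iff.1 h2 with rfl | ⟨x, hx, hxq⟩
  · exact absurd h3 (hk _ _ _)
  · exact (hs x).1 hx ▸ hxq

theorem rel_introduceVertex {w : V} {s : ι} (h : D.kind t = .introduceVertex w s) {u v : V} :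
    D.Rel f t u v ↔ D.Rel f s u v :=
  rel_of_unique_child (fun _ => child_introduceVertex h) fun _ _ _ => by simp [h]

theorem rel_forget {w : V} {s : ι} (h : D.kind t = .forget w s) {u v : V} :
    D.Rel f t u v ↔ D.Rel f s u v :=
  rel_of_unique_child (fun _ => child_forget h) fun _ _ _ => by simp [h]

/-- A vertex related below s to a different vertex occurs in some bag below s. As it also occurs at
t, connectedness would put it into the bag of s, which excludes the introduced vertex. -/
theorem not_rel_introduceVertex {w : V} {s : ι} (h : D.kind t = .introduceVertex w s) {u : V}
    (hu : u ∈ D.bag s) : ¬ D.Rel f s u w := by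
  intro hr
  obtain ⟨h1, h2⟩ := bag_introduceVertex h
  have hc : D.Child t s := (child_introduceVertex h).2 rfl
  obtain ⟨-, ⟨a, ha, hwa⟩⟩ := rel_mem hr (fun e => h1 (e ▸ hu))
  exact h1 (mem_bag_of_desc hwa ha (b := t) (by simp [h2]) hc.not_desc).1

theorem rel_introduceEdge {u v : V} {s : ι} (h : D.kind t = .introduceEdge u v s) (x y : V) :
    D.Rel f t x y ↔ D.Rel f s x y ∨ (f u = f v ∧ ((D.Rel f s x u ∧ D.Rel f s v y) ∨
      (D.Rel f s x v ∧ D.Rel f s u y))) := by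
  have hc : D.Child t s := (child_introduceEdge h).2 rfl
  by_cases hf : f u = f v
  · simp only [hf, true_and]
    refine Relation.eqvGen_insert_iff (fun a b => ⟨?_, ?_⟩) x y
    · rintro ⟨h1, q, s', h2, h3⟩
      rcases desc_iff.1 h2 with rfl | ⟨x, hx, hxq⟩
      · rw [h] at h3
        simp only [NodeKind.introduceEdge.injEq] at h3
        exact Or.inr ⟨h3.1.symm, h3.2.1.symm⟩
      · exact Or.inl ⟨h1, q, s', (child_introduceEdge h).1 hx ▸ hxq, h3⟩
    · rintro (⟨h1, q, s', h2, h3⟩ | ⟨rfl, rfl⟩)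
      · exact ⟨h1, q, s', hc.desc.trans h2, h3⟩
      · exact ⟨hf, t, s, desc_refl t, h⟩
  · simp only [hf, false_and, or_false]
    refine ⟨fun h' => ?_, fun h => Rel.mono hc.desc h⟩
    refine Relation.eqvGen_imp (fun a b ⟨h1, q, s', h2, h3⟩ => ⟨h1, q, s', ?_, h3⟩) h'
    rcases desc_iff.1 h2 with rfl | ⟨x, hx, hxq⟩
    · rw [h] at h3
      simp only [NodeKind.introduceEdge.injEq] at h3
      exact absurd (by rw [h3.1, h3.2.1]; exact h1) hf
    · exact (child_introduceEdge h).1 hx ▸ hxq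

/-- The relation of a join node, restricted to its bag, is generated by the restrictions of the
relations of the children. -/
theorem rel_join {s₁ s₂ : ι} (h : D.kind t = .join s₁ s₂) {x y : V} (hx : x ∈ D.bag t)
    (hy : y ∈ D.bag t) :
    D.Rel f t x y ↔ Relation.EqvGen
      (fun a b => a ∈ D.bag t ∧ b ∈ D.bag t ∧ (D.Rel f s₁ a b ∨ D.Rel f s₂ a b)) x y := by
  have hc1 : D.Child t s₁ := (child_join h).2 (Or.inl rfl)
  have hc2 : D.Child t s₂ := (child_join h).2 (Or.inr rfl)
  obtain ⟨hne, -, -⟩ := bag_join h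
  set J := Relation.EqvGen
      (fun a b => a ∈ D.bag t ∧ b ∈ D.bag t ∧ (D.Rel f s₁ a b ∨ D.Rel f s₂ a b)) with hJ
  constructor
  · intro hr
    -- Occurrences of a vertex are connected, so a vertex seen below both children lies in the bag
    -- of t.
    have sep : ∀ v, (∃ a, D.Desc s₁ a ∧ v ∈ D.bag a) → (∃ a, D.Desc s₂ a ∧ v ∈ D.bag a) →
        v ∈ D.bag t := fun v ⟨a, ha, hva⟩ ⟨b, hb, hvb⟩ =>
      (mem_bag_of_desc hva ha hvb fun hb' => disjoint_children hc1 hc2 hne hb' hb).2 _ hc1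
    have stepJ : ∀ a b, a ∈ D.bag t → b ∈ D.bag t → (D.Rel f s₁ a b ∨ D.Rel f s₂ a b) → J a b :=
      fun a b ha hb hab => .rel _ _ ⟨ha, hb, hab⟩
    -- Invariant along a chain: some c in the bag is reached by `J` and is related to the current
    -- end within one child. Where the chain changes sides, the vertex at the change occurs below
    -- both children, hence lies in the bag, and it becomes the new c.
    have step : ∀ a b, (D.Rel f s₁ a b ∨ D.Rel f s₂ a b) →
        (∃ c ∈ D.bag t, J x c ∧ (D.Rel f s₁ c a ∨ D.Rel f s₂ c a)) →
        ∃ c ∈ D.bag t, J x c ∧ (D.Rel f s₁ c b ∨ D.Rel f s₂ c b) := by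
      rintro a b hab ⟨c, hc, hxc, hca⟩
      by_cases hab' : a = b
      · subst hab'; exact ⟨c, hc, hxc, hca⟩
      by_cases hca' : c = a
      · subst hca'; exact ⟨c, hc, hxc, hab⟩
      rcases hca with hca | hca <;> rcases hab with hab | hab
      · exact ⟨c, hc, hxc, Or.inl (hca.trans _ _ _ hab)⟩
      · have ha := sep a (rel_mem hca hca').2 (rel_mem hab hab').1
        exact ⟨a, ha, hxc.trans _ _ _ (stepJ _ _ hc ha (Or.inl hca)), Or.inr hab⟩
      · have ha := sep a (rel_mem hab hab').1 (rel_mem hca hca').2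
        exact ⟨a, ha, hxc.trans _ _ _ (stepJ _ _ hc ha (Or.inr hca)), Or.inl hab⟩
      · exact ⟨c, hc, hxc, Or.inr (hca.trans _ _ _ hab)⟩
    have main : ∀ a b, D.Rel f t a b →
        ((∃ c ∈ D.bag t, J x c ∧ (D.Rel f s₁ c a ∨ D.Rel f s₂ c a)) ↔
        ∃ c ∈ D.bag t, J x c ∧ (D.Rel f s₁ c b ∨ D.Rel f s₂ c b)) := by
      intro a b hab
      induction hab with
      | rel a b hr =>
        obtain ⟨h1, q, s', h2, h3⟩ := hr
        have hab : D.Rel f s₁ a b ∨ D.Rel f s₂ a b := by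
          rcases desc_iff.1 h2 with rfl | ⟨z, hz, hzq⟩
          · rw [h] at h3; cases h3
          · rcases (child_join h).1 hz with rfl | rfl
            · exact Or.inl (.rel _ _ ⟨h1, q, s', hzq, h3⟩)
            · exact Or.inr (.rel _ _ ⟨h1, q, s', hzq, h3⟩)
        exact ⟨step a b hab, step b a (hab.imp (fun h => h.symm _ _) (fun h => h.symm _ _))⟩
      | refl => rfl
      | symm _ _ _ ih => exact ih.symm
      | trans _ _ _ _ _ ih1 ih2 => exact ih1.trans ih2
    obtain ⟨c, hc, hxc, hcy⟩ := (main x y hr).1 ⟨x, hx, .refl _, Or.inl (.refl _)⟩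
    exact hxc.trans _ _ _ (stepJ _ _ hc hy hcy)
  · intro hr
    induction hr with
    | rel a b hr =>
      obtain ⟨-, -, h1 | h1⟩ := hr
      · exact Rel.mono hc1.desc h1
      · exact Rel.mono hc2.desc h1
    | refl x => exact .refl _
    | symm x y _ ih => exact (ih hy hx).symm _ _
    | trans x y z h1 h2 ih1 ih2 =>
      by_cases hyt : y ∈ D.bag t
      · exact (ih1 hx hyt).trans _ _ _ (ih2 hyt hy)
      -- The generators of `J` live on the bag, so `J` never leaves it and a middle vertex outside
      -- of the bag is impossible.
      · have key : ∀ a b, J a b → (a ∈ D.bag t ↔ b ∈ D.bag t) ∧ (a ∉ D.bag t → a = b) := by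
          intro a b hab
          induction hab with
          | rel a b hr => exact ⟨by simp [hr.1, hr.2.1], fun h => absurd hr.1 h⟩
          | refl => simp
          | symm a b _ ih => exact ⟨ih.1.symm, fun hb => (ih.2 (mt ih.1.1 hb)).symm⟩
          | trans a b c _ _ ih1 ih2 =>
            exact ⟨ih1.1.trans ih2.1, fun ha => (ih1.2 ha).trans (ih2.2 (mt ih1.1.2 ha))⟩
        exact absurd ((key _ _ h1).1.1 hx) hyt

theorem cost_leaf (h : D.kind t = .leaf) : D.cost f t = 0 := by
  have : {v | D.Closes f t v} = ∅ := by
    ext v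
    simp only [Set.mem_ofPred_eq, Set.mem_empty_iff_false, iff_false]
    rintro ⟨q, s, hq, hk, -⟩
    rcases desc_iff.1 hq with rfl | ⟨s, hs, -⟩
    · rw [h] at hk; cases hk
    · exact child_leaf h _ hs
  rw [cost, this, Set.ncard_empty]

theorem cost_of_unique_child {s : ι} (hs : ∀ q, D.Child t q ↔ q = s)
    (hk : ∀ v s', D.kind t ≠ .forget v s') : D.cost f t = D.cost f s := by
  unfold cost
  congr 1
  ext v
  constructor
  · rintro ⟨q, s', hq, h⟩
    rcases desc_iff.1 hq with rfl | ⟨x, hx, hxq⟩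
    · exact absurd h.1 (hk _ _)
    · exact ⟨q, s', (hs x).1 hx ▸ hxq, h⟩
  · rintro ⟨q, s', hq, h⟩
    exact ⟨q, s', ((hs s).2 rfl).desc.trans hq, h⟩

theorem cost_introduceVertex {w : V} {s : ι} (h : D.kind t = .introduceVertex w s) :
    D.cost f t = D.cost f s :=
  cost_of_unique_child (fun _ => child_introduceVertex h) fun _ _ => by simp [h]

theorem cost_introduceEdge {u w : V} {s : ι} (h : D.kind t = .introduceEdge u w s) :
    D.cost f t = D.cost f s :=
  cost_of_unique_child (fun _ => child_introduceEdge h) fun _ _ => by simp [h]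

open Classical in
-- The only new forget node is t itself. It closes a class exactly when no vertex of the remaining
-- bag is related to v, and v was not counted below s because it is forgotten only once.
theorem cost_forget [Finite V] {v : V} {s : ι} (h : D.kind t = .forget v s) :
    D.cost f t = D.cost f s + if ∃ u ∈ D.bag t, D.Rel f s u v then 0 else 1 := by
  have hc : D.Child t s := (child_forget h).2 rfl
  have hv : ¬ D.Closes f s v := by
    rintro ⟨q, s', hq, hk, -⟩
    obtain rfl := (kind_eq_of_forget h hk).1
    exact hc.not_desc hq
  have hx : ∀ x, D.Closes f t x ↔ D.Closes f s x ∨ (x = v ∧ ¬ ∃ u ∈ D.bag t, D.Rel f s u v) := by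
    intro x
    constructor
    · rintro ⟨q, s', hq, hk, h'⟩
      rcases desc_iff.1 hq with rfl | ⟨y, hy, hyq⟩
      · rw [h] at hk
        simp only [NodeKind.forget.injEq] at hk
        obtain ⟨rfl, rfl⟩ := hk
        exact Or.inr ⟨rfl, fun ⟨u, hu, hu'⟩ => h' u hu hu'⟩
      · exact Or.inl ⟨q, s', (child_forget h).1 hy ▸ hyq, hk, h'⟩
    · rintro (⟨q, s', hq, h'⟩ | ⟨rfl, h'⟩)
      · exact ⟨q, s', hc.desc.trans hq, h'⟩
      · exact ⟨t, s, desc_refl t, h, fun u hu hu' => h' ⟨u, hu, hu'⟩⟩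
  unfold cost
  split_ifs with hu
  · congr 1
    ext x
    simp [hx, hu]
  · have : {x | D.Closes f t x} = insert v {x | D.Closes f s x} := by
      ext x
      simp only [Set.mem_ofPred_eq, hx, hu, not_false_eq_true, and_true, Set.mem_insert_iff]
      tauto
    have hv' : v ∉ {x | D.Closes f s x} := hv
    rw [this, Set.ncard_insert_of_notMem hv' (Set.toFinite _)]

/-- The join node forgets nothing, and the closing vertices of the two subtrees are distinct since
each vertex has a single forget node and the subtrees are disjoint. -/
theorem cost_join [Finite V] {s₁ s₂ : ι} (h : D.kind t = .join s₁ s₂) :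
    D.cost f t = D.cost f s₁ + D.cost f s₂ := by
  have hc1 : D.Child t s₁ := (child_join h).2 (Or.inl rfl)
  have hc2 : D.Child t s₂ := (child_join h).2 (Or.inr rfl)
  unfold cost
  rw [← Set.ncard_union_eq _ (Set.toFinite _) (Set.toFinite _)]
  · congr 1
    ext x
    constructor
    · rintro ⟨q, s', hq, h'⟩
      rcases desc_iff.1 hq with rfl | ⟨y, hy, hyq⟩
      · rw [h] at h'; cases h'.1
      · rcases (child_join h).1 hy with rfl | rfl
        · exact Or.inl ⟨q, s', hyq, h'⟩
        · exact Or.inr ⟨q, s', hyq, h'⟩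
    · rintro (⟨q, s', hq, h'⟩ | ⟨q, s', hq, h'⟩)
      · exact ⟨q, s', hc1.desc.trans hq, h'⟩
      · exact ⟨q, s', hc2.desc.trans hq, h'⟩
  · rw [Set.disjoint_left]
    rintro x ⟨q, s', hq, h', -⟩ ⟨q2, s2, hq2, h2, -⟩
    obtain rfl := (kind_eq_of_forget h' h2).1
    exact disjoint_children hc1 hc2 (bag_join h).1 hq hq2

/-! ### Classes of the whole graph and closing vertices -/

theorem rel_root_of_adj {u v : V} (h : G.Adj u v) (hf : f u = f v) : D.Rel f D.root u v := by
  obtain ⟨q, ⟨s, hs⟩, -⟩ := D.edge_introduced_once u v h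
  rcases hs with hs | hs
  · exact .rel _ _ ⟨hf, q, s, Desc.root q, hs⟩
  · exact (Relation.EqvGen.rel _ _ ⟨hf.symm, q, s, Desc.root q, hs⟩).symm

/-- A vertex in a bag is forgotten at a proper ancestor. -/
theorem exists_forget_above {u : V} (hu : u ∈ D.bag t) :
    ∃ q s, D.kind q = .forget u s ∧ D.Desc q t ∧ q ≠ t := by
  generalize hn : D.tree.dist D.root t = n
  induction n generalizing t with
  | zero =>
    rw [D.isTree.connected.dist_eq_zero_iff] at hn
    subst hn
    simp [D.bag_root] at hu
  | succ n ih =>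
    have hr : t ≠ D.root := by rintro rfl; simp at hn
    obtain ⟨p, hp⟩ := exists_parent hr
    have hpn : D.tree.dist D.root p = n := by have := hp.2; omega
    have hpt : p ≠ t := by rintro rfl; omega
    by_cases hup : u ∈ D.bag p
    · obtain ⟨q, s, hk, hq, hne⟩ := ih hup hpn
      refine ⟨q, s, hk, hq.tail hp, ?_⟩
      rintro rfl
      exact hp.not_desc hq
    · cases hk : D.kind p with
      | leaf => exact absurd hp (child_leaf hk _)
      | introduceVertex v s =>
        obtain rfl := (child_introduceVertex hk).1 hp
        exact absurd (by simp [(bag_introduceVertex hk).2, hu]) hup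
      | introduceEdge v w s =>
        obtain rfl := (child_introduceEdge hk).1 hp
        exact absurd ((bag_introduceEdge hk).2.2.2 ▸ hu) hup
      | forget v s =>
        obtain rfl := (child_forget hk).1 hp
        have : u = v := by
          by_contra hne
          exact hup (by simp [(bag_forget hk).2, hu, hne])
        subst this
        exact ⟨p, t, hk, hp.desc, hpt⟩
      | join s₁ s₂ =>
        exfalso
        rcases (child_join hk).1 hp with rfl | rfl
        · exact hup ((bag_join hk).2.1 ▸ hu)
        · exact hup ((bag_join hk).2.2 ▸ hu)

/-- Choose in the class of v a vertex whose forget node is nearest to the root. A related vertex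
still in the bag of that node would be forgotten at a proper ancestor, hence nearer to the root. -/
theorem exists_closes (v : V) : ∃ u, D.Rel f D.root v u ∧ D.Closes f D.root u := by
  have hdef : ∀ u, ∃ m q s, D.kind q = .forget u s ∧ D.tree.dist D.root q = m := fun u => by
    obtain ⟨q, ⟨s, hs⟩, -⟩ := D.vertex_forgotten_once u
    exact ⟨_, q, s, hs, rfl⟩
  have hex : ∃ m u q s, D.Rel f D.root v u ∧ D.kind q = .forget u s ∧
      D.tree.dist D.root q = m := by
    obtain ⟨m, q, s, h⟩ := hdef v
    exact ⟨m, v, q, s, .refl _, h⟩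
  classical
  obtain ⟨u, q, s, huv, hk, hm⟩ := Nat.find_spec hex
  refine ⟨u, huv, q, s, Desc.root q, hk, fun x hx hxu => ?_⟩
  obtain ⟨q', s', hk', hq', hne⟩ := exists_forget_above hx
  have hlt : D.tree.dist D.root q' < D.tree.dist D.root q := by
    rcases Relation.ReflTransGen.cases_tail hq' with h | ⟨p, hp, hpq⟩
    · exact absurd h.symm hne
    · have h1 := Desc.dist_le hp
      have h2 := hpq.2
      omega
  refine Nat.find_min hex (hm ▸ hlt) ⟨x, q', s', ?_, hk', rfl⟩
  exact huv.trans _ _ _ ((Rel.mono (Desc.root s) hxu).symm _ _)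

/-- A class that closes at q no longer grows. Its part below s avoids the bag of q, so its vertices
occur only below s, and all their edges are introduced there. Membership is thus preserved along
every edge. -/
theorem rel_of_closes {q s : ι} {v : V} (hk : D.kind q = .forget v s)
    (hv : ∀ u ∈ D.bag q, ¬ D.Rel f s u v) {x : V} (h : D.Rel f D.root x v) : D.Rel f s x v := by
  have hc : D.Child q s := (child_forget hk).2 rfl
  have hedge : ∀ x a, D.Rel f s x v → x ∈ D.bag a → D.Desc s a := by
    intro x a hx hxa
    have hxq : x ∉ D.bag q := fun hxq => hv x hxq hx
    have hxs : ∃ b, D.Desc s b ∧ x ∈ D.bag b := by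
      by_cases hxv : x = v
      · subst hxv; exact ⟨s, desc_refl s, (bag_forget hk).1⟩
      · exact (rel_mem hx hxv).1
    obtain ⟨b, hb, hxb⟩ := hxs
    by_contra hna
    exact hxq ((mem_bag_of_desc hxb hb hxa hna).2 _ hc)
  have main : ∀ x y, D.Rel f D.root x y → (D.Rel f s x v ↔ D.Rel f s y v) := by
    intro x y h
    induction h with
    | rel x y hr =>
      obtain ⟨h1, a, s', h2, h3⟩ := hr
      obtain ⟨-, hx, hy, -⟩ := bag_introduceEdge h3
      refine ⟨fun hxv => ?_, fun hyv => ?_⟩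
      · exact (Relation.EqvGen.rel _ _ ⟨h1, a, s', hedge x a hxv hx, h3⟩).symm.trans _ _ _ hxv
      · exact (Relation.EqvGen.rel _ _ ⟨h1, a, s', hedge y a hyv hy, h3⟩).trans _ _ _ hyv
    | refl => rfl
    | symm _ _ _ ih => exact ih.symm
    | trans _ _ _ _ _ ih1 ih2 => exact ih1.trans ih2
  exact (main x v h).2 (.refl _)

/-- By `rel_of_closes` a class that closes at q is confined to the subtree under q. If two vertices
closed the same class, the forget node of each would lie strictly below that of the other. -/
theorem closes_unique {u v : V} (hu : D.Closes f D.root u) (hv : D.Closes f D.root v)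
    (h : D.Rel f D.root u v) : u = v := by
  by_contra hne
  have main : ∀ {u v : V} {q s q' s' : ι}, u ≠ v → D.kind q = .forget v s →
      (∀ x ∈ D.bag q, ¬ D.Rel f s x v) → D.kind q' = .forget u s' →
      D.Rel f D.root u v → D.Desc s q' := by
    intro u v q s q' s' hne hk hv hk' h
    have hc : D.Child q s := (child_forget hk).2 rfl
    have hc' : D.Child q' s' := (child_forget hk').2 rfl
    have hr := rel_of_closes hk hv h
    obtain ⟨b, hb, hub⟩ := (rel_mem hr hne).1
    have huq : u ∉ D.bag q := fun h => hv u h hr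
    by_contra hn
    by_cases hs' : D.Desc s s'
    · rcases Relation.ReflTransGen.cases_tail hs' with h | ⟨p, hp, hps⟩
      · subst h
        obtain rfl := parent_unique hc hc'
        rw [hk] at hk'
        simp only [NodeKind.forget.injEq] at hk'
        exact hne hk'.1.symm
      · exact hn (parent_unique hps hc' ▸ hp)
    · exact huq ((mem_bag_of_desc hub hb (bag_forget hk').1 hs').2 _ hc)
  obtain ⟨q, s, -, hk, hq⟩ := hv
  obtain ⟨q', s', -, hk', hq'⟩ := hu
  have h1 := main hne hk hq hk' h
  have h2 := main (Ne.symm hne) hk' hq' hk (h.symm _ _)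
  have hc : D.Child q s := (child_forget hk).2 rfl
  have hc' : D.Child q' s' := (child_forget hk').2 rfl
  have := h1.dist_le; have := h2.dist_le; have := hc.2; have := hc'.2
  omega

end NiceTreeDecomposition

/-! ## Counting partitions -/

/-- At most `bell m` labelings of a set with `m` elements are pairwise inequivalent. -/
theorem card_labelings_le_bell {κ α β : Type} [DecidableEq α] [DecidableEq β] (l : κ → α → β) :
    ∀ (s : Finset α) (X : Finset κ),
      (∀ i ∈ X, ∀ j ∈ X, (∀ x ∈ s, ∀ y ∈ s, l i x = l i y ↔ l j x = l j y) → i = j) →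
      X.card ≤ Nat.bell s.card := by
  intro s
  induction hn : s.card using Nat.strong_induction_on generalizing s with
  | _ m ih =>
    intro X hX
    rcases s.eq_empty_or_nonempty with rfl | ⟨a, ha⟩
    · simp only [Finset.card_empty] at hn
      subst hn
      rw [Nat.bell_zero]
      exact Finset.card_le_one.2 fun i hi j hj => hX i hi j hj (by simp)
    · obtain ⟨m, rfl⟩ : ∃ m', m = m' + 1 :=
        ⟨m - 1, by have := Finset.card_pos.2 ⟨a, ha⟩; omega⟩
      have hs' : (s.erase a).card = m := by rw [Finset.card_erase_of_mem ha]; omega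
      -- The block of `a`, without `a`. Labelings with a common block B are distinguished on the
      -- remaining m - |B| elements, so the induction hypothesis and Bell's recursion, summed over
      -- all B, give the bound.
      let A : κ → Finset α := fun i => (s.erase a).filter fun x => l i x = l i a
      have hA : ∀ i ∈ X, A i ∈ (s.erase a).powerset := fun i _ => by simp [A]
      rw [Finset.card_eq_sum_card_fiberwise hA, Nat.bell_succ, ← Nat.range_succ_eq_Iic]
      have := Finset.sum_powerset_apply_card (fun j => Nat.bell (m - j)) (x := s.erase a)
      rw [hs'] at this
      simp only [smul_eq_mul] at this
      rw [← this]
      refine Finset.sum_le_sum fun B hB => ?_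
      have hB' := Finset.mem_powerset.1 hB
      have hcard : ((s.erase a) \ B).card = m - B.card := by
        rw [Finset.card_sdiff_of_subset hB', hs']
      refine ih (m - B.card) (by omega) ((s.erase a) \ B) hcard _ fun i hi j hj hij => ?_
      simp only [Finset.mem_filter] at hi hj
      refine hX i hi.1 j hj.1 ?_
      have hmem : ∀ k, A k = B → ∀ x ∈ s, l k x = l k a ↔ (x = a ∨ x ∈ B) := by
        intro k hk x hx
        by_cases hxa : x = a
        · simp [hxa]
        · rw [← hk]; simp [A, hxa, hx]
      intro x hx y hy
      have hi' := hmem i hi.2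
      have hj' := hmem j hj.2
      by_cases hxB : x = a ∨ x ∈ B
      · rw [(hi' x hx).2 hxB, (hj' x hx).2 hxB, eq_comm, hi' y hy, ← hj' y hy, eq_comm]
      · by_cases hyB : y = a ∨ y ∈ B
        · rw [(hi' y hy).2 hyB, (hj' y hy).2 hyB, hi' x hx, hj' x hx]
        · refine hij x ?_ y ?_ <;> simp_all

theorem Nat.bell_le_bell_succ (m : ℕ) : Nat.bell m ≤ Nat.bell (m + 1) := by
  rw [Nat.bell_succ]
  have := Finset.single_le_sum (f := fun i => m.choose i * (m - i).bell) (s := Finset.Iic m)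
    (fun _ _ => Nat.zero_le _) (Finset.mem_Iic.2 (Nat.zero_le m))
  simpa using this

theorem Nat.bell_mono : Monotone Nat.bell := monotone_nat_of_le_succ Nat.bell_le_bell_succ

theorem Nat.one_le_bell (m : ℕ) : 1 ≤ Nat.bell m := by
  simpa using Nat.bell_mono (Nat.zero_le m)

/-! ## The dynamic program -/

/-- The first child of a node. -/
def NodeKind.fst {V ι : Type} : NodeKind V ι → Option ι
  | .leaf => none
  | .introduceVertex _ s => some s
  | .introduceEdge _ _ s => some s
  | .forget _ s => some s
  | .join s₁ _ => some s₁

/-- The second child of a node. -/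
def NodeKind.snd {V ι : Type} : NodeKind V ι → Option ι
  | .join _ s₂ => some s₂
  | _ => none

/-- An entry of the table of a node: colours and labels of the vertices of the bag, where equal
labels stand for equal classes, the number of completed classes, and the entries of the children
from which it was obtained. -/
structure Ent (V : Type) where
  col : V → ℕ
  lab : V → ℕ
  cost : ℕ
  b1 : ℕ
  b2 : ℕ

namespace Ent

variable {V : Type}

/-- Equal colours and equal partitions of the bag `B`. -/
structure Sim (B : Finset V) (c c' : Ent V) : Prop where
  col : ∀ u ∈ B, c.col u = c'.col u
  lab : ∀ u ∈ B, ∀ v ∈ B, c.lab u = c.lab v ↔ c'.lab u = c'.lab v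

theorem Sim.symm {B : Finset V} {c c' : Ent V} (h : Sim B c c') : Sim B c' c :=
  ⟨fun u hu => (h.col u hu).symm, fun u hu v hv => (h.lab u hu v hv).symm⟩

theorem Sim.trans {B : Finset V} {c c' c'' : Ent V} (h : Sim B c c') (h' : Sim B c' c'') :
    Sim B c c'' :=
  ⟨fun u hu => (h.col u hu).trans (h'.col u hu),
    fun u hu v hv => (h.lab u hu v hv).trans (h'.lab u hu v hv)⟩

/-- Equality up to the names of the labels, on the bag `B`. -/
structure Eqv (B : Finset V) (c c' : Ent V) : Prop extends Sim B c c' where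
  cost : c.cost = c'.cost
  b1 : c.b1 = c'.b1
  b2 : c.b2 = c'.b2

end Ent

namespace NiceTreeDecomposition

variable {n : ℕ} {ι : Type} {G : SimpleGraph (Fin n)} (D : NiceTreeDecomposition G ι)

/-- The entry `c` of the node `t` is obtained from the entries `c.b1` and `c.b2` of the children. -/
def Trans (ok : Fin n → ℕ → Prop) (T : ι → ℕ → Prop) (E : ℕ → Ent (Fin n)) (t : ι)
    (c : Ent (Fin n)) : Prop :=
  (∀ v ∈ D.bag t, ok v (c.col v)) ∧
  match D.kind t with
  | .leaf => c.cost = 0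
  | .introduceVertex v s => T s c.b1 ∧ Ent.Sim (D.bag s) c (E c.b1) ∧
      (∀ u ∈ D.bag s, c.lab u ≠ c.lab v) ∧ c.cost = (E c.b1).cost
  | .introduceEdge u v s => T s c.b1 ∧ (∀ x ∈ D.bag t, c.col x = (E c.b1).col x) ∧
      (∀ x ∈ D.bag t, ∀ y ∈ D.bag t, c.lab x = c.lab y ↔ (E c.b1).lab x = (E c.b1).lab y ∨
        ((E c.b1).col u = (E c.b1).col v ∧
        (((E c.b1).lab x = (E c.b1).lab u ∧ (E c.b1).lab v = (E c.b1).lab y) ∨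
         ((E c.b1).lab x = (E c.b1).lab v ∧ (E c.b1).lab u = (E c.b1).lab y)))) ∧
      c.cost = (E c.b1).cost
  | .forget v s => T s c.b1 ∧ Ent.Sim (D.bag t) c (E c.b1) ∧
      ((∃ u ∈ D.bag t, (E c.b1).lab u = (E c.b1).lab v) → c.cost = (E c.b1).cost) ∧
      ((¬ ∃ u ∈ D.bag t, (E c.b1).lab u = (E c.b1).lab v) → c.cost = (E c.b1).cost + 1)
  | .join s₁ s₂ => T s₁ c.b1 ∧ T s₂ c.b2 ∧ (∀ x ∈ D.bag t, c.col x = (E c.b1).col x) ∧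
      (∀ x ∈ D.bag t, c.col x = (E c.b2).col x) ∧
      (∀ x ∈ D.bag t, ∀ y ∈ D.bag t, c.lab x = c.lab y ↔ Relation.EqvGen (fun a b =>
        a ∈ D.bag t ∧ b ∈ D.bag t ∧ ((E c.b1).lab a = (E c.b1).lab b ∨
          (E c.b2).lab a = (E c.b2).lab b)) x y) ∧
      c.cost = (E c.b1).cost + (E c.b2).cost

variable {D} {ok : Fin n → ℕ → Prop} {T : ι → ℕ → Prop} {E : ℕ → Ent (Fin n)} {t : ι}
  {c c' : Ent (Fin n)} {f : Fin n → ℕ}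

/-- The program stores a candidate with canonical labels in place of its own ones. This is harmless
because only the partition that the labels induce enters into `Trans`. -/
theorem Trans.congr (h : D.Trans ok T E t c) (hc : Ent.Eqv (D.bag t) c' c) :
    D.Trans ok T E t c' := by
  obtain ⟨h0, h⟩ := h
  refine ⟨fun v hv => hc.col v hv ▸ h0 v hv, ?_⟩
  cases hk : D.kind t with
  | leaf => rw [hk] at h; exact hc.cost.trans h
  | introduceVertex v s =>
    rw [hk] at h
    obtain ⟨-, hb⟩ := bag_introduceVertex hk
    obtain ⟨h1, h2, h3, h4⟩ := h
    refine ⟨hc.b1 ▸ h1, ⟨fun u hu => ?_, fun u hu w hw => ?_⟩, fun u hu => ?_, ?_⟩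
    · rw [hc.b1, hc.col u (by simp [hb, hu]), h2.col u hu]
    · rw [hc.b1, hc.lab u (by simp [hb, hu]) w (by simp [hb, hw]), h2.lab u hu w hw]
    · rw [ne_eq, hc.lab u (by simp [hb, hu]) v (by simp [hb])]; exact h3 u hu
    · rw [hc.b1, hc.cost, h4]
  | introduceEdge u v s =>
    rw [hk] at h
    obtain ⟨h1, h2, h3, h4⟩ := h
    refine ⟨hc.b1 ▸ h1, fun x hx => ?_, fun x hx y hy => ?_, ?_⟩
    · rw [hc.b1, hc.col x hx, h2 x hx]
    · rw [hc.b1, hc.lab x hx y hy, h3 x hx y hy]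
    · rw [hc.b1, hc.cost, h4]
  | forget v s =>
    rw [hk] at h
    obtain ⟨h1, h2, h3, h4⟩ := h
    refine ⟨hc.b1 ▸ h1, ?_, ?_, ?_⟩
    · rw [hc.b1]; exact hc.toSim.trans h2
    · rw [hc.b1, hc.cost]; exact h3
    · rw [hc.b1, hc.cost]; exact h4
  | join s₁ s₂ =>
    rw [hk] at h
    obtain ⟨h1, h2, h3, h4, h5, h6⟩ := h
    refine ⟨hc.b1 ▸ h1, hc.b2 ▸ h2, fun x hx => ?_, fun x hx => ?_, fun x hx y hy => ?_, ?_⟩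
    · rw [hc.b1, hc.col x hx, h3 x hx]
    · rw [hc.b2, hc.col x hx, h4 x hx]
    · rw [hc.b1, hc.b2, hc.lab x hx y hy, h5 x hx y hy]
    · rw [hc.b1, hc.b2, hc.cost, h6]

/-- `Trans` depends only on the entries of the children. -/
theorem Trans.congr_table {T' : ι → ℕ → Prop} {E' : ℕ → Ent (Fin n)} (h : D.Trans ok T E t c)
    (hT : ∀ s, D.Child t s → ∀ e, T s e → T' s e ∧ E e = E' e) : D.Trans ok T' E' t c := by
  obtain ⟨h0, h⟩ := h
  refine ⟨h0, ?_⟩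
  cases hk : D.kind t with
  | leaf => rw [hk] at h; exact h
  | introduceVertex v s =>
    rw [hk] at h
    obtain ⟨h1, h2⟩ := hT s ((child_introduceVertex hk).2 rfl) _ h.1
    exact ⟨h1, h2 ▸ h.2⟩
  | introduceEdge u v s =>
    rw [hk] at h
    obtain ⟨h1, h2⟩ := hT s ((child_introduceEdge hk).2 rfl) _ h.1
    exact ⟨h1, h2 ▸ h.2⟩
  | forget v s =>
    rw [hk] at h
    obtain ⟨h1, h2⟩ := hT s ((child_forget hk).2 rfl) _ h.1
    exact ⟨h1, h2 ▸ h.2⟩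
  | join s₁ s₂ =>
    rw [hk] at h
    obtain ⟨h1, h2⟩ := hT s₁ ((child_join hk).2 (Or.inl rfl)) _ h.1
    obtain ⟨h3, h4⟩ := hT s₂ ((child_join hk).2 (Or.inr rfl)) _ h.2.1
    exact ⟨h1, h3, h2 ▸ h4 ▸ h.2.2⟩

variable (D) in
/-- The entry `c` describes the colouring `f` at the node `t`. -/
structure Matches (f : Fin n → ℕ) (t : ι) (c : Ent (Fin n)) : Prop where
  col : ∀ v ∈ D.bag t, c.col v = f v
  lab : ∀ u ∈ D.bag t, ∀ v ∈ D.bag t, c.lab u = c.lab v ↔ D.Rel f t u v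

theorem Matches.congr (h : D.Matches f t c) (h' : Ent.Sim (D.bag t) c' c) : D.Matches f t c' :=
  ⟨fun v hv => (h'.col v hv).trans (h.col v hv),
    fun u hu v hv => (h'.lab u hu v hv).trans (h.lab u hu v hv)⟩

theorem eqvGen_bag_congr {B : Finset (Fin n)} {r r' : Fin n → Fin n → Prop}
    (h : ∀ a ∈ B, ∀ b ∈ B, r a b ↔ r' a b) (x y : Fin n) :
    Relation.EqvGen (fun a b => a ∈ B ∧ b ∈ B ∧ r a b) x y ↔
      Relation.EqvGen (fun a b => a ∈ B ∧ b ∈ B ∧ r' a b) x y :=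
  ⟨Relation.eqvGen_imp fun _ _ ⟨h1, h2, h3⟩ => ⟨h1, h2, (h _ h1 _ h2).1 h3⟩,
    Relation.eqvGen_imp fun _ _ ⟨h1, h2, h3⟩ => ⟨h1, h2, (h _ h1 _ h2).2 h3⟩⟩

theorem child_iff {s : ι} : D.Child t s ↔ (D.kind t).fst = some s ∨ (D.kind t).snd = some s := by
  cases hk : D.kind t with
  | leaf => simp [NodeKind.fst, NodeKind.snd, child_leaf hk]
  | introduceVertex v s => simp [NodeKind.fst, NodeKind.snd, child_introduceVertex hk, eq_comm]
  | introduceEdge u v s => simp [NodeKind.fst, NodeKind.snd, child_introduceEdge hk, eq_comm]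
  | forget v s => simp [NodeKind.fst, NodeKind.snd, child_forget hk, eq_comm]
  | join s₁ s₂ => simp [NodeKind.fst, NodeKind.snd, child_join hk, eq_comm]

/-- Correctness of one transition. The same increment δ occurs in the recorded and in the true cost,
so both equalities and inequalities for the children pass on to t. -/
theorem Trans.matches (h : D.Trans ok T E t c) (hcol : ∀ v ∈ D.bag t, c.col v = f v)
    (h₁ : ∀ s, (D.kind t).fst = some s → D.Matches f s (E c.b1))
    (h₂ : ∀ s, (D.kind t).snd = some s → D.Matches f s (E c.b2)) :
    D.Matches f t c ∧ ∃ δ,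
      c.cost = ((D.kind t).fst.elim 0 fun _ => (E c.b1).cost) +
        ((D.kind t).snd.elim 0 fun _ => (E c.b2).cost) + δ ∧
      D.cost f t = (D.kind t).fst.elim 0 (D.cost f) + (D.kind t).snd.elim 0 (D.cost f) + δ := by
  obtain ⟨-, h⟩ := h
  cases hk : D.kind t with
  | leaf =>
    rw [hk] at h
    refine ⟨⟨hcol, by simp [bag_leaf hk]⟩, 0, ?_, ?_⟩
    · exact h
    · simp [NodeKind.fst, NodeKind.snd, cost_leaf hk]
  | introduceVertex v s =>
    rw [hk] at h
    have hm := h₁ s (by rw [hk]; rfl)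
    obtain ⟨-, hb⟩ := bag_introduceVertex hk
    obtain ⟨-, hs, hv, hc⟩ := h
    refine ⟨⟨hcol, fun x hx y hy => ?_⟩, 0, ?_, ?_⟩
    · rw [rel_introduceVertex hk]
      rw [hb, Finset.mem_insert] at hx hy
      rcases hx with rfl | hx <;> rcases hy with rfl | hy
      · exact iff_of_true rfl (.refl _)
      · exact iff_of_false (hv y hy).symm
          fun h => not_rel_introduceVertex hk hy (h.symm _ _)
      · exact iff_of_false (hv x hx) (not_rel_introduceVertex hk hx)
      · rw [hs.lab x hx y hy, hm.lab x hx y hy]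
    · simpa [NodeKind.fst, NodeKind.snd] using hc
    · simp [NodeKind.fst, NodeKind.snd, cost_introduceVertex hk]
  | introduceEdge u v s =>
    rw [hk] at h
    have hm := h₁ s (by rw [hk]; rfl)
    obtain ⟨-, hu, hv, hb⟩ := bag_introduceEdge hk
    obtain ⟨-, hs, hl, hc⟩ := h
    refine ⟨⟨hcol, fun x hx y hy => ?_⟩, 0, ?_, ?_⟩
    · rw [rel_introduceEdge hk, hl x hx y hy, ← hs u hu, ← hs v hv, hcol u hu, hcol v hv]
      have hm' := hm.lab
      rw [hb] at hx hy hu hv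
      rw [hm' x hx y hy, hm' x hx u hu, hm' v hv y hy, hm' x hx v hv, hm' u hu y hy]
    · simpa [NodeKind.fst, NodeKind.snd] using hc
    · simp [NodeKind.fst, NodeKind.snd, cost_introduceEdge hk]
  | forget v s =>
    rw [hk] at h
    have hm := h₁ s (by rw [hk]; rfl)
    obtain ⟨hv, hb⟩ := bag_forget hk
    obtain ⟨-, hs, hc1, hc2⟩ := h
    have hsub : ∀ x ∈ D.bag t, x ∈ D.bag s := fun x hx => by
      rw [hb] at hx; exact Finset.mem_of_mem_erase hx
    have hiff : (∃ u ∈ D.bag t, (E c.b1).lab u = (E c.b1).lab v) ↔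
        ∃ u ∈ D.bag t, D.Rel f s u v :=
      exists_congr fun u => and_congr_right fun hu => hm.lab u (hsub u hu) v hv
    refine ⟨⟨hcol, fun x hx y hy => ?_⟩, ?_⟩
    · rw [rel_forget hk, hs.lab x hx y hy, hm.lab x (hsub x hx) y (hsub y hy)]
    · classical
      refine ⟨if ∃ u ∈ D.bag t, D.Rel f s u v then 0 else 1, ?_, ?_⟩
      · split_ifs with hu
        · simpa [NodeKind.fst, NodeKind.snd] using hc1 (hiff.2 hu)
        · simpa [NodeKind.fst, NodeKind.snd] using hc2 (mt hiff.1 hu)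
      · rw [cost_forget hk]; simp only [NodeKind.fst, NodeKind.snd, Option.elim, add_zero]; congr
  | join s₁ s₂ =>
    rw [hk] at h
    have hm1 := h₁ s₁ (by rw [hk]; rfl)
    have hm2 := h₂ s₂ (by rw [hk]; rfl)
    obtain ⟨-, hb1, hb2⟩ := bag_join hk
    obtain ⟨-, -, -, -, hl, hc⟩ := h
    refine ⟨⟨hcol, fun x hx y hy => ?_⟩, 0, ?_, ?_⟩
    · rw [rel_join hk hx hy, hl x hx y hy]
      refine eqvGen_bag_congr (fun a ha b hb => ?_) x y
      rw [hm1.lab a (hb1 ▸ ha) b (hb1 ▸ hb), hm2.lab a (hb2 ▸ ha) b (hb2 ▸ hb)]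
    · simpa [NodeKind.fst, NodeKind.snd] using hc
    · simp [NodeKind.fst, NodeKind.snd, cost_join hk]

/-- A selection of one entry for every node along the links describes one colouring. -/
theorem matches_of_selection (sel : ι → ℕ)
    (htr : ∀ t, D.Trans ok T E t (E (sel t)))
    (hb1 : ∀ t s, (D.kind t).fst = some s → (E (sel t)).b1 = sel s)
    (hb2 : ∀ t s, (D.kind t).snd = some s → (E (sel t)).b2 = sel s)
    (hf : ∀ t v s, D.kind t = .forget v s → f v = (E (sel s)).col v)
    (hfin : ∃ m, ∀ t, D.tree.dist D.root t ≤ m) (t : ι) :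
    D.Matches f t (E (sel t)) ∧ (E (sel t)).cost = D.cost f t := by
  -- Downwards: the colour of a vertex is read off at the child of its forget node, and every
  -- transition copies it, so the selected entries agree with f on all bags.
  have hcol : ∀ m t, D.tree.dist D.root t = m → ∀ v ∈ D.bag t, (E (sel t)).col v = f v := by
    intro m
    induction m with
    | zero =>
      intro t ht v hv
      rw [D.isTree.connected.dist_eq_zero_iff] at ht
      subst ht
      simp [D.bag_root] at hv
    | succ m ih =>
      intro t ht v hv
      have hr : t ≠ D.root := by rintro rfl; simp at ht
      obtain ⟨p, hp⟩ := exists_parent hr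
      have hih := ih p (by have := hp.2; omega) v
      have hpt := (htr p).2
      have h1 := hb1 p
      have h2 := hb2 p
      cases hk : D.kind p with
      | leaf => exact absurd hp (child_leaf hk _)
      | introduceVertex x s =>
        obtain rfl := (child_introduceVertex hk).1 hp
        rw [hk] at hpt h1
        rw [← hih (by simp [(bag_introduceVertex hk).2, hv]), hpt.2.1.col v hv, h1 _ rfl]
      | introduceEdge x w s =>
        obtain rfl := (child_introduceEdge hk).1 hp
        rw [hk] at hpt h1
        have hvp : v ∈ D.bag p := by rwa [(bag_introduceEdge hk).2.2.2]
        rw [← hih hvp, hpt.2.1 v hvp, h1 _ rfl]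
      | forget x s =>
        obtain rfl := (child_forget hk).1 hp
        rw [hk] at hpt h1
        by_cases hvx : v = x
        · subst hvx; exact (hf _ _ _ hk).symm
        · have hvp : v ∈ D.bag p := by simp [(bag_forget hk).2, hv, hvx]
          rw [← hih hvp, hpt.2.1.col v hvp, h1 _ rfl]
      | join s₁ s₂ =>
        rw [hk] at hpt h1 h2
        obtain ⟨-, e1, e2⟩ := bag_join hk
        rcases (child_join hk).1 hp with rfl | rfl
        · rw [e1] at hv
          rw [← hih hv, hpt.2.2.1 v hv, h1 _ rfl]
        · rw [e2] at hv
          rw [← hih hv, hpt.2.2.2.1 v hv, h2 _ rfl]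
  obtain ⟨M, hM⟩ := hfin
  -- Upwards from the largest depth, where nodes have no children: partitions and costs follow from
  -- `Trans.matches`.
  have main : ∀ m t, M ≤ D.tree.dist D.root t + m →
      D.Matches f t (E (sel t)) ∧ (E (sel t)).cost = D.cost f t := by
    intro m
    induction m with
    | zero =>
      intro t ht
      have hno : ∀ s, ¬ D.Child t s := fun s hs => by
        have := hs.2; have := hM s; omega
      have h1 : (D.kind t).fst = none := Option.eq_none_iff_forall_ne_some.2
        fun s hs => hno s (child_iff.2 (Or.inl hs))
      have h2 : (D.kind t).snd = none := Option.eq_none_iff_forall_ne_some.2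
        fun s hs => hno s (child_iff.2 (Or.inr hs))
      obtain ⟨hm, δ, e1, e2⟩ := (htr t).matches (hcol _ t rfl) (by simp [h1]) (by simp [h2])
      exact ⟨hm, by rw [e1, e2, h1, h2]; rfl⟩
    | succ m ih =>
      intro t ht
      have h1 : ∀ s, (D.kind t).fst = some s → D.Matches f s (E (E (sel t)).b1) ∧
          (E (E (sel t)).b1).cost = D.cost f s := fun s hs => by
        rw [hb1 t s hs]
        exact ih s (by have := (child_iff.2 (Or.inl hs)).2; omega)
      have h2 : ∀ s, (D.kind t).snd = some s → D.Matches f s (E (E (sel t)).b2) ∧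
          (E (E (sel t)).b2).cost = D.cost f s := fun s hs => by
        rw [hb2 t s hs]
        exact ih s (by have := (child_iff.2 (Or.inr hs)).2; omega)
      obtain ⟨hm, δ, e1, e2⟩ := (htr t).matches (hcol _ t rfl) (fun s hs => (h1 s hs).1)
        (fun s hs => (h2 s hs).1)
      refine ⟨hm, ?_⟩
      rw [e1, e2]
      congr 2
      · cases hk : (D.kind t).fst with
        | none => rfl
        | some s => exact (h1 s hk).2
      · cases hk : (D.kind t).snd with
        | none => rfl
        | some s => exact (h2 s hk).2
  exact main M t (by omega)

/-- If the tables of the children contain good entries for the colouring `f`, then a good entry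
can be obtained from them. -/
theorem exists_trans_matches (hok : ∀ v, ok v (f v))
    (hs : ∀ s, D.Child t s → ∃ e, T s e ∧ D.Matches f s (E e) ∧ (E e).cost ≤ D.cost f s) :
    ∃ c, D.Trans ok T E t c ∧ D.Matches f t c ∧ c.cost ≤ D.cost f t := by
  let S : Setoid (Fin n) := ⟨D.Rel f t, Relation.EqvGen.is_equivalence _⟩
  -- The label of a vertex is a chosen representative of its class below t.
  let lab : Fin n → ℕ := fun v => (Quotient.mk S v).out
  have hlab : ∀ u v, lab u = lab v ↔ D.Rel f t u v := fun u v => by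
    have : lab u = lab v ↔ Quotient.mk S u = Quotient.mk S v :=
      ⟨fun h => Quotient.out_injective (Fin.ext h), fun h => by simp only [lab, h]⟩
    rw [this]
    exact Quotient.eq
  suffices h : ∃ c : Ent (Fin n), D.Trans ok T E t c ∧ c.col = f ∧
      (∀ s, (D.kind t).fst = some s → D.Matches f s (E c.b1) ∧ (E c.b1).cost ≤ D.cost f s) ∧
      (∀ s, (D.kind t).snd = some s → D.Matches f s (E c.b2) ∧ (E c.b2).cost ≤ D.cost f s) by
    obtain ⟨c, hc, hcol, h1, h2⟩ := h
    obtain ⟨hm, δ, e1, e2⟩ := hc.matches (f := f) (fun v _ => by rw [hcol])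
      (fun s hs => (h1 s hs).1) (fun s hs => (h2 s hs).1)
    refine ⟨c, hc, hm, ?_⟩
    rw [e1, e2]
    refine Nat.add_le_add_right (Nat.add_le_add ?_ ?_) _
    · cases hk : (D.kind t).fst with
      | none => exact le_rfl
      | some s => exact (h1 s hk).2
    · cases hk : (D.kind t).snd with
      | none => exact le_rfl
      | some s => exact (h2 s hk).2
  cases hk : D.kind t with
  | leaf =>
    refine ⟨⟨f, lab, 0, 0, 0⟩, ⟨fun v _ => hok v, ?_⟩, rfl, by simp [NodeKind.fst],
      by simp [NodeKind.snd]⟩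
    rw [hk]
  | introduceVertex v s =>
    obtain ⟨e, hT, hm, hc⟩ := hs s ((child_introduceVertex hk).2 rfl)
    refine ⟨⟨f, lab, (E e).cost, e, 0⟩, ⟨fun v _ => hok v, ?_⟩, rfl, ?_, by simp [NodeKind.snd]⟩
    · rw [hk]
      refine ⟨hT, ⟨fun u hu => (hm.col u hu).symm, fun u hu w hw => ?_⟩, fun u hu => ?_, rfl⟩
      · rw [hm.lab u hu w hw, ← rel_introduceVertex hk]; exact hlab u w
      · rw [ne_eq, hlab, rel_introduceVertex hk]
        exact not_rel_introduceVertex hk hu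
    · rintro s' ⟨⟩; exact ⟨hm, hc⟩
  | introduceEdge u v s =>
    obtain ⟨e, hT, hm, hc⟩ := hs s ((child_introduceEdge hk).2 rfl)
    obtain ⟨-, hu, hv, hb⟩ := bag_introduceEdge hk
    refine ⟨⟨f, lab, (E e).cost, e, 0⟩, ⟨fun v _ => hok v, ?_⟩, rfl, ?_, by simp [NodeKind.snd]⟩
    · rw [hk]
      rw [hb] at hu hv
      refine ⟨hT, fun x hx => (hm.col x (hb ▸ hx)).symm, fun x hx y hy => ?_, rfl⟩
      rw [hb] at hx hy
      rw [hm.lab x hx y hy, hm.lab x hx u hu, hm.lab v hv y hy, hm.lab x hx v hv,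
        hm.lab u hu y hy, hm.col u hu, hm.col v hv, ← rel_introduceEdge hk]
      exact hlab x y
    · rintro s' ⟨⟩; exact ⟨hm, hc⟩
  | forget v s =>
    obtain ⟨e, hT, hm, hc⟩ := hs s ((child_forget hk).2 rfl)
    obtain ⟨hv, hb⟩ := bag_forget hk
    have hsub : ∀ x ∈ D.bag t, x ∈ D.bag s := fun x hx => by
      rw [hb] at hx; exact Finset.mem_of_mem_erase hx
    classical
    refine ⟨⟨f, lab, if ∃ u ∈ D.bag t, (E e).lab u = (E e).lab v then (E e).cost
      else (E e).cost + 1, e, 0⟩, ⟨fun v _ => hok v, ?_⟩, rfl, ?_, by simp [NodeKind.snd]⟩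
    · rw [hk]
      refine ⟨hT, ⟨fun u hu => (hm.col u (hsub u hu)).symm, fun u hu w hw => ?_⟩,
        fun h => if_pos h, fun h => if_neg h⟩
      rw [hm.lab u (hsub u hu) w (hsub w hw), ← rel_forget hk]
      exact hlab u w
    · rintro s' ⟨⟩; exact ⟨hm, hc⟩
  | join s₁ s₂ =>
    obtain ⟨e₁, hT₁, hm₁, hc₁⟩ := hs s₁ ((child_join hk).2 (Or.inl rfl))
    obtain ⟨e₂, hT₂, hm₂, hc₂⟩ := hs s₂ ((child_join hk).2 (Or.inr rfl))
    obtain ⟨-, hb1, hb2⟩ := bag_join hk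
    refine ⟨⟨f, lab, (E e₁).cost + (E e₂).cost, e₁, e₂⟩, ⟨fun v _ => hok v, ?_⟩, rfl, ?_, ?_⟩
    · rw [hk]
      refine ⟨hT₁, hT₂, fun x hx => (hm₁.col x (hb1 ▸ hx)).symm,
        fun x hx => (hm₂.col x (hb2 ▸ hx)).symm, fun x hx y hy => ?_, rfl⟩
      rw [← eqvGen_bag_congr (r := fun a b => D.Rel f s₁ a b ∨ D.Rel f s₂ a b),
        ← rel_join hk hx hy]
      · exact hlab x y
      · intro a ha b hb
        simp only
        rw [hm₁.lab a (hb1 ▸ ha) b (hb1 ▸ hb), hm₂.lab a (hb2 ▸ ha) b (hb2 ▸ hb)]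
    · rintro s' ⟨⟩; exact ⟨hm₁, hc₁⟩
    · rintro s' ⟨⟩; exact ⟨hm₂, hc₂⟩

end NiceTreeDecomposition

/-! ## Runs of programs -/

namespace RAM

/-- The program `P`, started in `σ`, halts after some number `T` of steps in a state `τ`
with `Q T τ`. -/
def Halts (P : Program) (σ : State) (Q : ℕ → State → Prop) : Prop :=
  ∃ T τ, Exec P σ T τ ∧ Q T τ

/-- Natural number variables written by a program. -/
def Program.wv : Program → List ℕ
  | .setVar x _ => [x]
  | .seq P Q => P.wv ++ Q.wv
  | .ite _ P Q => P.wv ++ Q.wv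
  | .loop _ P => P.wv
  | _ => []

/-- Natural number arrays written by a program. -/
def Program.wa : Program → List ℕ
  | .setArr a _ _ => [a]
  | .seq P Q => P.wa ++ Q.wa
  | .ite _ P Q => P.wa ++ Q.wa
  | .loop _ P => P.wa
  | _ => []

/-- Real arrays written by a program. -/
def Program.wr : Program → List ℕ
  | .setReal a _ _ _ => [a]
  | .seq P Q => P.wr ++ Q.wr
  | .ite _ P Q => P.wr ++ Q.wr
  | .loop _ P => P.wr
  | _ => []

/-- The states `σ` and `τ` agree on everything that `P` does not write. -/
structure Frame (P : Program) (σ τ : State) : Prop where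
  var : ∀ x, x ∉ P.wv → τ.var x = σ.var x
  arr : ∀ a, a ∉ P.wa → τ.arr a = σ.arr a
  real : ∀ a, a ∉ P.wr → τ.real a = σ.real a

theorem Frame.refl (P : Program) (σ : State) : Frame P σ σ :=
  ⟨fun _ _ => rfl, fun _ _ => rfl, fun _ _ => rfl⟩

theorem Frame.trans {P : Program} {σ τ ρ : State} (h : Frame P σ τ) (h' : Frame P τ ρ) :
    Frame P σ ρ :=
  ⟨fun x hx => (h'.var x hx).trans (h.var x hx), fun x hx => (h'.arr x hx).trans (h.arr x hx),
    fun x hx => (h'.real x hx).trans (h.real x hx)⟩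

theorem Frame.mono {P P' : Program} {σ τ : State} (h : Frame P σ τ) (hv : P.wv ⊆ P'.wv)
    (ha : P.wa ⊆ P'.wa) (hr : P.wr ⊆ P'.wr) : Frame P' σ τ :=
  ⟨fun x hx => h.var x (mt (@hv x) hx), fun x hx => h.arr x (mt (@ha x) hx),
    fun x hx => h.real x (mt (@hr x) hx)⟩

theorem Exec.frame {P : Program} {σ τ : State} {T : ℕ} (h : Exec P σ T τ) : Frame P σ τ := by
  induction h with
  | skip => exact .refl _ _
  | setVar x e σ =>
    refine ⟨fun y hy => ?_, fun _ _ => rfl, fun _ _ => rfl⟩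
    have : y ≠ x := by simpa [Program.wv] using hy
    simp [State.setVar, this]
  | setArr a i e σ =>
    refine ⟨fun _ _ => rfl, fun y hy => ?_, fun _ _ => rfl⟩
    have : y ≠ a := by simpa [Program.wa] using hy
    simp [State.setArr, this]
  | setReal a i b j σ =>
    refine ⟨fun _ _ => rfl, fun _ _ => rfl, fun y hy => ?_⟩
    have : y ≠ a := by simpa [Program.wr] using hy
    simp [State.setReal, this]
  | seq _ _ ih1 ih2 =>
    exact (ih1.mono (List.subset_append_left ..) (List.subset_append_left ..)
      (List.subset_append_left ..)).trans (ih2.mono (List.subset_append_right ..)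
      (List.subset_append_right ..) (List.subset_append_right ..))
  | iteTrue _ _ ih =>
    exact ih.mono (List.subset_append_left ..) (List.subset_append_left ..)
      (List.subset_append_left ..)
  | iteFalse _ _ ih =>
    exact ih.mono (List.subset_append_right ..) (List.subset_append_right ..)
      (List.subset_append_right ..)
  | loopDone => exact .refl _ _
  | @loopStep q P _ _ _ _ _ _ _ _ ih1 ih2 =>
    exact (ih1.mono (P' := .loop q P) (fun _ h => h) (fun _ h => h) (fun _ h => h)).trans ih2

/-- The program `P`, started in `σ`, halts after at most `B` steps in a state `τ` with `Q τ`. -/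
def Runs (P : Program) (σ : State) (B : ℕ) (Q : State → Prop) : Prop :=
  Halts P σ fun T τ => T ≤ B ∧ Q τ ∧ Frame P σ τ

variable {P P' : Program} {σ : State} {B B' : ℕ} {Q Q' : State → Prop}

theorem Runs.mono (h : Runs P σ B Q) (hB : B ≤ B') (hQ : ∀ τ, Q τ → Frame P σ τ → Q' τ) :
    Runs P σ B' Q' := by
  obtain ⟨T, τ, h1, h2, h3, h4⟩ := h
  exact ⟨T, τ, h1, h2.trans hB, hQ τ h3 h4, h4⟩

theorem Runs.le (h : Runs P σ B Q) (hB : B ≤ B') : Runs P σ B' Q := h.mono hB fun _ h _ => h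

theorem Runs.imp (h : Runs P σ B Q) (hQ : ∀ τ, Q τ → Frame P σ τ → Q' τ) :
    Runs P σ B Q' := h.mono le_rfl hQ

theorem Runs.seq (h : Runs P σ B Q) (h' : ∀ τ, Q τ → Frame P σ τ → Runs P' τ B' Q') :
    Runs (.seq P P') σ (B + B') Q' := by
  obtain ⟨T, τ, h1, h2, h3, h4⟩ := h
  obtain ⟨T', τ', h1', h2', h3', h4'⟩ := h' τ h3 h4
  exact ⟨_, _, .seq h1 h1', Nat.add_le_add h2 h2', h3', (h1.seq h1').frame⟩

theorem Runs.ite {q : Test} (h : q.Holds σ → Runs P σ B Q) (h' : ¬ q.Holds σ → Runs P' σ B Q) :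
    Runs (.ite q P P') σ (q.cost + B) Q := by
  by_cases hq : q.Holds σ
  · obtain ⟨T, τ, h1, h2, h3, h4⟩ := h hq
    exact ⟨_, _, .iteTrue hq h1, by omega, h3, (Exec.iteTrue (Q := P') hq h1).frame⟩
  · obtain ⟨T, τ, h1, h2, h3, h4⟩ := h' hq
    exact ⟨_, _, .iteFalse hq h1, by omega, h3, (Exec.iteFalse (P := P) hq h1).frame⟩

/-! ### Programs without loops -/

def Program.straight : Program → Bool
  | .seq P Q => P.straight && Q.straight
  | .ite _ P Q => P.straight && Q.straight
  | .loop _ _ => false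
  | _ => true

/-- An upper bound for the running time of a program without loops. -/
def Program.len : Program → ℕ
  | .skip => 1
  | .setVar _ e => e.cost + 1
  | .setArr _ i e => i.cost + e.cost + 1
  | .setReal _ i _ j => i.cost + j.cost + 1
  | .seq P Q => P.len + Q.len
  | .ite q P Q => q.cost + (P.len + Q.len)
  | .loop _ _ => 0

open Classical in
/-- The final state of a program without loops. -/
noncomputable def Program.den : Program → State → State
  | .skip, σ => σ
  | .setVar x e, σ => σ.setVar x (e.eval σ)
  | .setArr a i e, σ => σ.setArr a (i.eval σ) (e.eval σ)
  | .setReal a i b j, σ => σ.setReal a (i.eval σ) (σ.real b (j.eval σ))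
  | .seq P Q, σ => Q.den (P.den σ)
  | .ite q P Q, σ => if q.Holds σ then P.den σ else Q.den σ
  | .loop _ _, σ => σ

/-- Reduces a program without loops to the evaluation of `den`. Since `len` adds up both branches of
a conditional, the time bound does not depend on the state. -/
theorem Runs.straight (h : P.straight = true) (hQ : Q (P.den σ)) : Runs P σ P.len Q := by
  suffices h' : ∀ σ, Runs P σ P.len (fun τ => τ = P.den σ) from
    (h' σ).imp fun τ hτ _ => hτ ▸ hQ
  clear hQ
  induction P with
  | skip => exact fun σ => ⟨_, _, .skip σ, le_rfl, rfl, .refl _ _⟩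
  | setVar x e => exact fun σ => ⟨_, _, .setVar x e σ, le_rfl, rfl, (Exec.setVar x e σ).frame⟩
  | setArr a i e =>
    exact fun σ => ⟨_, _, .setArr a i e σ, le_rfl, rfl, (Exec.setArr a i e σ).frame⟩
  | setReal a i b j =>
    exact fun σ => ⟨_, _, .setReal a i b j σ, le_rfl, rfl, (Exec.setReal a i b j σ).frame⟩
  | seq P Q ih1 ih2 =>
    intro σ
    simp only [Program.straight, Bool.and_eq_true] at h
    exact (ih1 h.1 σ).seq fun τ hτ _ => (ih2 h.2 τ).imp fun ρ hρ _ => by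
      rw [hρ, hτ]; rfl
  | ite q P Q ih1 ih2 =>
    intro σ
    simp only [Program.straight, Bool.and_eq_true] at h
    refine Runs.ite (fun hq => (ih1 h.1 σ).mono (Nat.le_add_right _ _) ?_)
      fun hq => (ih2 h.2 σ).mono (Nat.le_add_left _ _) ?_
    · rintro τ rfl -; simp [Program.den, hq]
    · rintro τ rfl -; simp [Program.den, hq]
  | loop => cases h

@[simp] theorem State.var_setVar (σ : State) (x m y : ℕ) :
    (σ.setVar x m).var y = if y = x then m else σ.var y := by
  simp [State.setVar, Function.update_apply]

@[simp] theorem State.arr_setVar (σ : State) (x m : ℕ) : (σ.setVar x m).arr = σ.arr := rfl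

@[simp] theorem State.real_setVar (σ : State) (x m : ℕ) : (σ.setVar x m).real = σ.real := rfl

@[simp] theorem State.var_setArr (σ : State) (a i m : ℕ) : (σ.setArr a i m).var = σ.var := rfl

@[simp] theorem State.arr_setArr (σ : State) (a i m b : ℕ) :
    (σ.setArr a i m).arr b = if b = a then Function.update (σ.arr a) i m else σ.arr b := by
  simp [State.setArr, Function.update_apply]

@[simp] theorem State.real_setArr (σ : State) (a i m : ℕ) : (σ.setArr a i m).real = σ.real := rfl

@[simp] theorem State.var_setReal (σ : State) (a i : ℕ) (r : ℝ) :
    (σ.setReal a i r).var = σ.var := rfl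

@[simp] theorem State.arr_setReal (σ : State) (a i : ℕ) (r : ℝ) :
    (σ.setReal a i r).arr = σ.arr := rfl

@[simp] theorem State.real_setReal (σ : State) (a i : ℕ) (r : ℝ) (b : ℕ) :
    (σ.setReal a i r).real b = if b = a then Function.update (σ.real a) i r else σ.real b := by
  simp [State.setReal, Function.update_apply]

attribute [simp] Expr.eval Test.Holds Program.den

/-! ### Loops -/

/-- A loop with a known number `m` of iterations and a potential `Φ` which pays for expensive
iterations. -/
theorem Runs.loopAmortized {q : Test} (m : ℕ) (I : ℕ → State → Prop) (Φ : State → ℕ) (K : ℕ)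
    (hq : ∀ i τ, i ≤ m → I i τ → (q.Holds τ ↔ i < m)) (h0 : I 0 σ)
    (hstep : ∀ i τ, i < m → I i τ → Frame P σ τ →
      Halts P τ fun T ρ => T + K * Φ ρ ≤ B + K * Φ τ ∧ I (i + 1) ρ) :
    Halts (.loop q P) σ fun T τ => T + K * Φ τ ≤ m * (B + q.cost) + q.cost + K * Φ σ ∧ I m τ := by
  suffices h : ∀ j i τ, i + j = m → I i τ → Frame P σ τ → Halts (.loop q P) τ fun T ρ =>
      T + K * Φ ρ ≤ j * (B + q.cost) + q.cost + K * Φ τ ∧ I m ρ from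
    h m 0 σ (by simp) h0 (.refl _ _)
  intro j
  induction j with
  | zero =>
    intro i τ hi hI hF
    refine ⟨_, _, .loopDone (mt (hq i τ (by omega) hI).1 (by omega)), by omega, ?_⟩
    obtain rfl : i = m := by omega
    exact hI
  | succ j ih =>
    intro i τ hi hI hF
    obtain ⟨T, ρ, h1, h2, h3⟩ := hstep i τ (by omega) hI hF
    obtain ⟨T', ρ', h1', h2', h3'⟩ := ih (i + 1) ρ (by omega) h3 (hF.trans h1.frame)
    refine ⟨_, _, .loopStep ((hq i τ (by omega) hI).2 (by omega)) h1 h1', ?_, h3'⟩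
    rw [Nat.succ_mul]
    omega

theorem Runs.loop {q : Test} (m : ℕ) (I : ℕ → State → Prop)
    (hq : ∀ i τ, i ≤ m → I i τ → (q.Holds τ ↔ i < m)) (h0 : I 0 σ)
    (hstep : ∀ i τ, i < m → I i τ → Frame P σ τ → Runs P τ B (I (i + 1))) :
    Runs (.loop q P) σ (m * (B + q.cost) + q.cost) (I m) := by
  obtain ⟨T, τ, h1, h2, h3⟩ := Runs.loopAmortized (σ := σ) (P := P) (B := B) m I (fun _ => 0) 0 hq
    h0 fun i τ hi hI hF => by
      obtain ⟨T, ρ, h1, h2, h3, -⟩ := hstep i τ hi hI hF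
      exact ⟨T, ρ, h1, by simpa using h2, h3⟩
  exact ⟨T, τ, h1, by simpa using h2, h3, h1.frame⟩

/-- `e₁ < e₂` -/
def Test.lt (e₁ e₂ : Expr) : Test := .neg (.le e₂ e₁)

@[simp] theorem Test.holds_lt (σ : State) (e₁ e₂ : Expr) :
    (Test.lt e₁ e₂).Holds σ ↔ e₁.eval σ < e₂.eval σ := by simp [Test.lt]

/-- `e₁ = e₂` -/
def Test.eq (e₁ e₂ : Expr) : Test := .conj (.le e₁ e₂) (.le e₂ e₁)

@[simp] theorem Test.holds_eq (σ : State) (e₁ e₂ : Expr) :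
    (Test.eq e₁ e₂).Holds σ ↔ e₁.eval σ = e₂.eval σ := by
  simp only [Test.eq, Test.Holds]; omega

/-- `x := x + 1` -/
def Program.incr (x : ℕ) : Program := .setVar x (.add (.var x) (.const 1))

/-- `for x := 0, …, y - 1 do P` for variables `x`, `y` that `P` does not write. -/
def Program.for (x y : ℕ) (P : Program) : Program :=
  .seq (.setVar x (.const 0)) (.loop (.lt (.var x) (.var y)) (.seq P (.incr x)))

/-- A round pays B for the body, four steps for the increment and four for the test. The
initialisation takes two steps and the last test four, whence the six. The invariant is required
after the counter has advanced, so the potential must ignore the counter. -/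
theorem Runs.forAmortized {x y : ℕ} (m : ℕ) (I : ℕ → State → Prop) (Φ : State → ℕ) (K : ℕ)
    (hx : x ∉ P.wv) (hy : y ∉ P.wv) (hxy : x ≠ y) (hm : σ.var y = m)
    (hΦ : ∀ τ i, Φ (τ.setVar x i) = Φ τ)
    (h0 : I 0 (σ.setVar x 0))
    (hstep : ∀ i τ, i < m → I i τ → τ.var x = i → Frame (.for x y P) σ τ →
      Halts P τ fun T ρ => T + K * Φ ρ ≤ B + K * Φ τ ∧ I (i + 1) (ρ.setVar x (i + 1))) :
    Halts (.for x y P) σ fun T τ => T + K * Φ τ ≤ m * (B + 8) + 6 + K * Φ σ ∧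
      I m τ ∧ τ.var x = m := by
  have hF0 : Frame (.for x y P) σ (σ.setVar x 0) :=
    (Exec.setVar x (.const 0) σ).frame.mono (by simp [Program.for, Program.wv])
      (by simp [Program.wa]) (by simp [Program.wr])
  have key := Runs.loopAmortized (σ := σ.setVar x 0) (P := .seq P (.incr x)) (B := B + 4)
    (q := .lt (.var x) (.var y)) m
    (fun i τ => I i τ ∧ τ.var x = i ∧ τ.var y = m ∧ Frame (.for x y P) σ τ) Φ K
    (fun i τ _ h => by simp [h.2.1, h.2.2.1])
    ⟨h0, by simp, by simp [hxy.symm, hm], hF0⟩ (fun i τ hi ⟨h1, h2, h3, h4⟩ _ => by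
      obtain ⟨T, ρ, e1, e2, e3⟩ := hstep i τ hi h1 h2 h4
      have hρx : ρ.var x = i := (e1.frame.var x hx).trans h2
      have hρy : ρ.var y = m := (e1.frame.var y hy).trans h3
      have e4 := Exec.setVar x (.add (.var x) (.const 1)) ρ
      refine ⟨_, _, e1.seq e4, ?_, ?_, ?_, ?_, ?_⟩
      · rw [hΦ]; simp only [Expr.cost]; omega
      · simpa [hρx] using e3
      · simp [hρx]
      · simp [hxy.symm, hρy]
      · refine h4.trans ((e1.seq e4).frame.mono ?_ ?_ ?_)
        · simp [Program.for, Program.wv, Program.incr]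
        · simp [Program.for, Program.wa, Program.incr]
        · simp [Program.for, Program.wr, Program.incr])
  obtain ⟨T, τ, e1, e2, e3, e4, -⟩ := key
  refine ⟨_, _, (Exec.setVar x (.const 0) σ).seq e1, ?_, e3, e4⟩
  have hc : B + 4 + (Test.lt (.var x) (.var y)).cost = B + 8 := rfl
  have hc' : (Test.lt (.var x) (.var y)).cost = 4 := rfl
  rw [hΦ, hc, hc'] at e2
  simp only [Expr.cost]
  omega

theorem Runs.for {x y : ℕ} (m : ℕ) (I : ℕ → State → Prop)
    (hx : x ∉ P.wv) (hy : y ∉ P.wv) (hxy : x ≠ y) (hm : σ.var y = m)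
    (h0 : I 0 (σ.setVar x 0))
    (hstep : ∀ i τ, i < m → I i τ → τ.var x = i → Frame (.for x y P) σ τ →
      Runs P τ B fun ρ => I (i + 1) (ρ.setVar x (i + 1))) :
    Runs (.for x y P) σ (m * (B + 8) + 6) (I m) := by
  obtain ⟨T, τ, e1, e2, e3, -⟩ := Runs.forAmortized (σ := σ) (P := P) (B := B) m I (fun _ => 0) 0
    hx hy hxy hm (fun _ _ => rfl) h0 fun i τ hi hI hxi hF => by
      obtain ⟨T, ρ, h1, h2, h3, -⟩ := hstep i τ hi hI hxi hF
      exact ⟨T, ρ, h1, by simpa using h2, h3⟩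
  exact ⟨T, τ, e1, by simpa using e2, e3, e1.frame⟩

end RAM

/-! ## Memory layout of the program -/

/-! Variables of the input and output, and global variables. -/
notation "vN" => 0
notation "vK" => 1
notation "vNodes" => 2
notation "vRoot" => 3
notation "vWidth" => 4
notation "vOut" => 5
notation "vNF" => 10
notation "vW" => 11
notation "vQ" => 12
notation "vStep" => 13
notation "vLog" => 14
notation "vSize" => 15
notation "vSq" => 16

/-! Variables of the dynamic program. -/
notation "vT" => 20
notation "vM" => 21
notation "vRow" => 22
notation "vOff" => 23
notation "vCnt" => 24
notation "vCur" => 25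
notation "vCost" => 26
notation "vX1" => 27
notation "vX2" => 28
notation "vCode" => 29
notation "vColCode" => 30
notation "vMp" => 31
notation "vMp2" => 32
notation "vJ" => 33
notation "vV" => 34
notation "vI" => 35
notation "vU" => 36
notation "vE" => 37
notation "vC1" => 40
notation "vC2" => 41
notation "vA" => 42
notation "vB" => 43
notation "vS1" => 44
notation "vL1" => 45
notation "vS2" => 46
notation "vL2" => 47
notation "vI1" => 48
notation "vE1" => 49
notation "vP1" => 50
notation "vI2" => 51
notation "vE2" => 52
notation "vP2" => 53
notation "vH" => 54
notation "vLa" => 55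
notation "vLb" => 56
notation "vFl" => 57
notation "vTh" => 58
notation "vKind" => 59

/-! Arrays of the input and output, and global tables. -/
notation "aAdj" => 0
notation "aFac" => 1
notation "aKind" => 2
notation "aC1" => 3
notation "aC2" => 4
notation "aU1" => 5
notation "aU2" => 6
notation "aSz" => 7
notation "aBag" => 8
notation "aCenter" => 9
notation "aCluster" => 10
notation "aFL" => 11
notation "aRow" => 12
notation "aBagRow" => 13
notation "aMul" => 14
notation "aOrd" => 15
notation "aPow" => 16

/-! Arrays of the dynamic program. -/
notation "aStart" => 20
notation "aEnd" => 21
notation "aCol" => 22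
notation "aLab" => 23
notation "aCost" => 24
notation "aB1" => 25
notation "aB2" => 26
notation "aPtr" => 27
notation "aIdx" => 28
notation "aColCode" => 29
notation "aXCol" => 30
notation "aXLab" => 31
notation "aXCan" => 32
notation "aHead" => 33
notation "aNext" => 34
notation "aSel" => 35
notation "aHat" => 36
notation "aLbl" => 37
notation "aNum" => 38

/-! Real arrays. -/
notation "rDist" => 0
notation "rSort" => 1
notation "rTmp" => 2

namespace RAM

/-- `P; Q` -/
infixr:60 " ;; " => Program.seq

/-- Loop over the vertices `v` of the bag in the row `vRow`, of size `vM`, with the counter `j`. -/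
def Program.forBag (j v : ℕ) (P : Program) : Program :=
  .for j vM (.setVar v (.get aBag (.add (.var vRow) (.var j))) ;; P)

/-- The list `L` is the current bag. -/
structure BagLoaded {n : ℕ} (L : List (Fin n)) (σ : State) : Prop where
  size : σ.var vM = L.length
  get : ∀ (i : ℕ) (h : i < L.length), σ.arr aBag (σ.var vRow + i) = L[i]

theorem BagLoaded.congr {n : ℕ} {L : List (Fin n)} {σ τ : State} (h : BagLoaded L σ)
    (h1 : τ.var vM = σ.var vM) (h2 : τ.var vRow = σ.var vRow) (h3 : τ.arr aBag = σ.arr aBag) :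
    BagLoaded L τ := ⟨h1.trans h.size, fun i hi => by rw [h2, h3, h.get i hi]⟩

/-- The invariant is indexed by the prefix of the bag already processed. Loading a vertex costs five
steps and the counter eight, whence thirteen. The conditions on names form one Boolean, which
`decide` settles for concrete programs. -/
theorem Runs.forBag {n : ℕ} {L : List (Fin n)} {σ : State} {P : Program} {B : ℕ} {j v : ℕ}
    (hL : BagLoaded L σ) (I : List (Fin n) → State → Prop)
    (hdec : (decide (j ∉ P.wv) && decide (vM ∉ P.wv) && decide (vRow ∉ P.wv) &&
      decide (aBag ∉ P.wa) && decide (j ≠ v) && decide (j ≠ vM) && decide (v ≠ vM) &&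
      decide (j ≠ vRow) && decide (v ≠ vRow)) = true)
    (hI : ∀ pre τ x, I pre τ → I pre (τ.setVar j x))
    (hIv : ∀ pre τ x, I pre τ → I pre (τ.setVar v x))
    (h0 : I [] σ)
    (hstep : ∀ (pre : List (Fin n)) (u : Fin n) (post : List (Fin n)) τ,
      L = pre ++ u :: post → I pre τ → τ.var v = u →
      Frame (.forBag j v P) σ τ → Runs P τ B (I (pre ++ [u]))) :
    Runs (.forBag j v P) σ (L.length * (B + 13) + 6) (I L) := by
  simp only [Bool.and_eq_true, decide_eq_true_eq] at hdec
  obtain ⟨⟨⟨⟨⟨⟨⟨⟨h1, h2⟩, h3⟩, h4⟩, h5⟩, h6⟩, h7⟩, h8⟩, h9⟩ := hdec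
  have key := Runs.for (P := .setVar v (.get aBag (.add (.var vRow) (.var j))) ;; P) (x := j)
    (y := vM) (B := 4 + 1 + B) L.length (fun i τ => I (L.take i) τ)
    (by simp [Program.wv, h1, h5]) (by simp [Program.wv, h2, h7.symm]) h6 hL.size
    (by simpa using hI _ _ _ h0) (σ := σ) (fun i τ hi hIi hji hF => by
      refine Runs.seq (Q := fun τ' => τ' = τ.setVar v (L[i] : ℕ)) ?_ ?_
      · refine (Runs.straight rfl ?_).le le_rfl
        have e1 : τ.var vRow = σ.var vRow :=
          hF.var _ (by simp [Program.wv, Program.for, Program.incr, h3, h8.symm, h9.symm])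
        have e2 : τ.arr aBag = σ.arr aBag :=
          hF.arr _ (by simp [Program.wa, Program.for, Program.incr, h4])
        simp [hji, e1, e2, hL.get i hi]
      · rintro _ rfl -
        have e := List.drop_eq_getElem_cons hi
        have hF' : Frame (.forBag j v P) σ (τ.setVar v (L[i] : ℕ)) := by
          refine hF.trans ⟨fun x hx => ?_, fun _ _ => rfl, fun _ _ => rfl⟩
          have : x ≠ v := by
            rintro rfl
            simp [Program.wv, Program.for] at hx
          simp [this]
        refine (hstep (L.take i) L[i] (L.drop (i + 1)) _ ?_ (hIv _ _ _ hIi) (by simp) hF').imp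
          fun ρ hρ _ => hI _ _ _ ?_
        · rw [← e, List.take_append_drop]
        · rwa [List.take_append_getElem] at hρ)
  exact key.mono (by rw [show 4 + 1 + B + 8 = B + 13 by ring]) fun τ hτ _ => by simpa using hτ

theorem Frame.var_eq {P : Program} {σ τ : State} (h : Frame P σ τ) (x : ℕ)
    (hx : decide (x ∉ P.wv) = true) : τ.var x = σ.var x := h.var x (by simpa using hx)

theorem Frame.arr_eq {P : Program} {σ τ : State} (h : Frame P σ τ) (x : ℕ)
    (hx : decide (x ∉ P.wa) = true) : τ.arr x = σ.arr x := h.arr x (by simpa using hx)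

theorem Frame.real_eq {P : Program} {σ τ : State} (h : Frame P σ τ) (x : ℕ)
    (hx : decide (x ∉ P.wr) = true) : τ.real x = σ.real x := h.real x (by simpa using hx)

/-! ### Canonical labels and codes of entries -/

variable {n : ℕ}

/-- The last vertex in `L` with the same label as `v`. -/
def can (lab : Fin n → ℕ) (L : List (Fin n)) (v : Fin n) : ℕ :=
  (((L.filter fun u => lab u = lab v).getLast?).map Fin.val).getD 0

/-- The last occurrence wins, as in a loop over the bag that overwrites its result. -/
theorem can_append (lab : Fin n → ℕ) (L : List (Fin n)) (u v : Fin n) :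
    can lab (L ++ [u]) v = if lab u = lab v then (u : ℕ) else can lab L v := by
  unfold can
  rw [List.filter_append]
  split_ifs with h
  · simp [h]
  · simp [h]

theorem exists_can {lab : Fin n → ℕ} {L : List (Fin n)} {v : Fin n} (hv : v ∈ L) :
    ∃ u ∈ L, can lab L v = u ∧ lab u = lab v := by
  have hne : L.filter (fun u => lab u = lab v) ≠ [] :=
    List.ne_nil_of_mem (a := v) (by simp [hv])
  have h := List.getLast_mem hne
  simp only [List.mem_filter, decide_eq_true_eq] at h
  exact ⟨_, h.1, by rw [can, List.getLast?_eq_some_getLast hne]; rfl, h.2⟩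

theorem can_congr {lab lab' : Fin n → ℕ} {L : List (Fin n)} {v : Fin n}
    (h : ∀ u ∈ L, lab u = lab v ↔ lab' u = lab' v) : can lab L v = can lab' L v := by
  unfold can
  rw [List.filter_congr (q := fun u => decide (lab' u = lab' v))]
  intro u hu
  simp [h u hu]

theorem can_eq_iff {lab : Fin n → ℕ} {L : List (Fin n)} {u v : Fin n} (hu : u ∈ L) (hv : v ∈ L) :
    can lab L u = can lab L v ↔ lab u = lab v := by
  constructor
  · intro h
    obtain ⟨x, -, hx, hx'⟩ := exists_can (lab := lab) hu
    obtain ⟨y, -, hy, hy'⟩ := exists_can (lab := lab) hv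
    rw [hx, hy] at h
    rw [← hx', ← hy', Fin.ext h]
  · intro h
    unfold can
    rw [h]

/-- The digits that describe an entry up to `Ent.Sim`. -/
def key (L : List (Fin n)) (c : Ent (Fin n)) : List ℕ :=
  L.flatMap fun v => [c.col v, can c.lab L v]

/-- A canonical label is determined by the block of the vertex, and different blocks have different
last elements. Colours and canonical labels together are therefore a complete invariant for
`Ent.Sim`. -/
theorem key_eq_iff {L : List (Fin n)} {B : Finset (Fin n)} (hB : ∀ v, v ∈ L ↔ v ∈ B)
    {c c' : Ent (Fin n)} : key L c = key L c' ↔ Ent.Sim B c c' := by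
  have h : key L c = key L c' ↔ ∀ v ∈ L, c.col v = c'.col v ∧ can c.lab L v = can c'.lab L v := by
    unfold key
    have : ∀ M : List (Fin n), M.flatMap (fun v => [c.col v, can c.lab L v]) =
        M.flatMap (fun v => [c'.col v, can c'.lab L v]) ↔
        ∀ v ∈ M, c.col v = c'.col v ∧ can c.lab L v = can c'.lab L v := by
      intro M
      induction M with
      | nil => simp
      | cons a M ih => simp [List.flatMap_cons, ih, and_assoc]
    exact this L
  rw [h]
  constructor
  · intro h
    refine ⟨fun u hu => (h u ((hB u).2 hu)).1, fun u hu v hv => ?_⟩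
    rw [← hB] at hu hv
    rw [← can_eq_iff hu hv, (h u hu).2, (h v hv).2, can_eq_iff hu hv]
  · intro h v hv
    exact ⟨h.col v ((hB v).1 hv), can_congr fun u hu => h.lab u ((hB u).1 hu) v ((hB v).1 hv)⟩

theorem key_lt {L : List (Fin n)} {c : Ent (Fin n)} (hc : ∀ v ∈ L, c.col v < n + 1) :
    ∀ x ∈ key L c, x < n + 1 := by
  intro x hx
  simp only [key, List.mem_flatMap, List.mem_cons, List.not_mem_nil, or_false] at hx
  obtain ⟨v, hv, rfl | rfl⟩ := hx
  · exact hc v hv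
  · obtain ⟨u, -, hu, -⟩ := exists_can (lab := c.lab) hv
    rw [hu]; omega

theorem length_key (L : List (Fin n)) (c : Ent (Fin n)) : (key L c).length = 2 * L.length := by
  unfold key
  have : ∀ M : List (Fin n), (M.flatMap fun v => [c.col v, can c.lab L v]).length =
      2 * M.length := by
    intro M
    induction M with
    | nil => rfl
    | cons a M ih => simp [List.flatMap_cons, ih]; ring
  exact this L

/-- The keys have equal length and digits below n + 1, so positional notation is faithful. For n = 0
the base would be one, but then the bag is empty. -/
theorem ofDigits_key_inj {L : List (Fin n)} {B : Finset (Fin n)} (hB : ∀ v, v ∈ L ↔ v ∈ B)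
    {c c' : Ent (Fin n)} (hc : ∀ v ∈ L, c.col v < n + 1) (hc' : ∀ v ∈ L, c'.col v < n + 1) :
    Nat.ofDigits (n + 1) (key L c) = Nat.ofDigits (n + 1) (key L c') ↔ Ent.Sim B c c' := by
  rw [← key_eq_iff hB]
  refine ⟨fun h => ?_, fun h => by rw [h]⟩
  rcases Nat.eq_zero_or_pos n with rfl | hn
  · have : L = [] := List.eq_nil_iff_forall_not_mem.2 fun v => v.elim0
    subst this; rfl
  · exact Nat.ofDigits_inj_of_len_eq (by omega) (by rw [length_key, length_key]) (key_lt hc)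
      (key_lt hc') h

end RAM

/-! ### The input and the global tables in memory; codes of candidates -/

namespace RAM

/-- None of the listed variables and arrays is written by `P`. -/
def Program.keeps (P : Program) (vs as rs : List ℕ) : Bool :=
  vs.all (fun x => decide (x ∉ P.wv)) && as.all (fun x => decide (x ∉ P.wa)) &&
    rs.all fun x => decide (x ∉ P.wr)

theorem Frame.keep {P : Program} {σ τ : State} (h : Frame P σ τ) {vs as rs : List ℕ}
    (hd : P.keeps vs as rs = true) : (∀ x ∈ vs, τ.var x = σ.var x) ∧
      (∀ x ∈ as, τ.arr x = σ.arr x) ∧ ∀ x ∈ rs, τ.real x = σ.real x := by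
  simp only [Program.keeps, Bool.and_eq_true, List.all_eq_true, decide_eq_true_eq] at hd
  exact ⟨fun x hx => h.var x (hd.1.1 x hx), fun x hx => h.arr x (hd.1.2 x hx),
    fun x hx => h.real x (hd.2 x hx)⟩

variable {n N : ℕ} {G : SimpleGraph (Fin n)}

/-- The sorted list of the vertices in the bag of a node. -/
def bagL (D : NiceTreeDecomposition G (Fin N)) (t : Fin N) : List (Fin n) :=
  (D.bag t).sort (· ≤ ·)

theorem mem_bagL {D : NiceTreeDecomposition G (Fin N)} {t : Fin N} {v : Fin n} :
    v ∈ bagL D t ↔ v ∈ D.bag t := Finset.mem_sort _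

theorem length_bagL (D : NiceTreeDecomposition G (Fin N)) (t : Fin N) :
    (bagL D t).length = (D.bag t).card := Finset.length_sort _

theorem toFinset_bagL (D : NiceTreeDecomposition G (Fin N)) (t : Fin N) :
    (bagL D t).toFinset = D.bag t := Finset.sort_toFinset _ _

theorem length_bagL_le (D : NiceTreeDecomposition G (Fin N)) (t : Fin N) :
    (bagL D t).length ≤ D.width + 1 := by
  rw [length_bagL]
  have : (D.bag t).card ≤ Finset.univ.sup fun t => (D.bag t).card :=
    Finset.le_sup (f := fun t => (D.bag t).card) (Finset.mem_univ t)
  unfold TreeDecomposition.width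
  omega

/-- The variables and arrays that hold the input and the global tables. -/
abbrev envVars : List ℕ := [vN, vK, vNodes, vRoot, vWidth, vNF, vW, vQ, vStep]
abbrev envArrs : List ℕ :=
  [aAdj, aKind, aC1, aC2, aU1, aU2, aSz, aBag, aFL, aRow, aBagRow, aMul]
abbrev envReals : List ℕ := [rDist]

open Classical in
/-- The memory contains the input and the global tables. -/
structure Env (D : NiceTreeDecomposition G (Fin N)) (k : ℕ) (F : Finset (Fin n))
    (d : Fin n → Fin n → ℝ≥0) (σ : State) : Prop where
  hN : σ.var vN = n
  hK : σ.var vK = k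
  hNodes : σ.var vNodes = N
  hRoot : σ.var vRoot = D.root
  hNf : σ.var vNF = F.card
  hW : σ.var vW = D.width + 1
  hQ : σ.var vQ = n + 1
  hStep : σ.var vStep = (n + 1) ^ (2 * (D.width + 1))
  hAdj : ∀ u v : Fin n, σ.arr aAdj (u * n + v) = if G.Adj u v then 1 else 0
  hKind : ∀ t : Fin N, σ.arr aKind t = nodeCode (D.kind t) 0
  hC1 : ∀ t : Fin N, σ.arr aC1 t = nodeCode (D.kind t) 1
  hC2 : ∀ t : Fin N, σ.arr aC2 t = nodeCode (D.kind t) 2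
  hU1 : ∀ t : Fin N, σ.arr aU1 t = nodeCode (D.kind t) 3
  hU2 : ∀ t : Fin N, σ.arr aU2 t = nodeCode (D.kind t) 4
  hSize : ∀ t : Fin N, σ.arr aSz t = (bagL D t).length
  hBag : ∀ (t : Fin N) (i : ℕ) (h : i < (bagL D t).length),
    σ.arr aBag (t * (D.width + 1) + i) = (bagL D t)[i]
  hFac : ∀ i < F.card, ∃ a ∈ F, σ.arr aFL i = (a : ℕ)
  hFac' : ∀ a ∈ F, ∃ i < F.card, σ.arr aFL i = (a : ℕ)
  hRow : ∀ v : Fin n, σ.arr aRow v = v * n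
  hBagRow : ∀ t : Fin N, σ.arr aBagRow t = t * (D.width + 1)
  hMul : ∀ i < 2 * (D.width + 1), ∀ a < n + 1, σ.arr aMul (i * (n + 1) + a) = a * (n + 1) ^ i
  hDist : ∀ u v : Fin n, σ.real rDist (u * n + v) = d u v

variable {D : NiceTreeDecomposition G (Fin N)} {k : ℕ} {F : Finset (Fin n)}
  {d : Fin n → Fin n → ℝ≥0}

theorem Env.congr {σ τ : State} (h : Env D k F d σ) (hv : ∀ x ∈ envVars, τ.var x = σ.var x)
    (ha : ∀ x ∈ envArrs, τ.arr x = σ.arr x) (hr : ∀ x ∈ envReals, τ.real x = σ.real x) :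
    Env D k F d τ := by
  simp only [envVars, envArrs, envReals, List.forall_mem_cons, List.not_mem_nil, false_imp_iff,
    implies_true, and_true] at hv ha hr
  obtain ⟨v1, v2, v3, v4, v5, v6, v7, v8, v9⟩ := hv
  obtain ⟨a1, a2, a3, a4, a5, a6, a7, a8, a9, a10, a11, a12⟩ := ha
  constructor
  · rw [v1, h.hN]
  · rw [v2, h.hK]
  · rw [v3, h.hNodes]
  · rw [v4, h.hRoot]
  · rw [v6, h.hNf]
  · rw [v7, h.hW]
  · rw [v8, h.hQ]
  · rw [v9, h.hStep]
  · rw [a1]; exact h.hAdj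
  · rw [a2]; exact h.hKind
  · rw [a3]; exact h.hC1
  · rw [a4]; exact h.hC2
  · rw [a5]; exact h.hU1
  · rw [a6]; exact h.hU2
  · rw [a7]; exact h.hSize
  · rw [a8]; exact h.hBag
  · rw [a9]; exact h.hFac
  · rw [a9]; exact h.hFac'
  · rw [a10]; exact h.hRow
  · rw [a11]; exact h.hBagRow
  · rw [a12]; exact h.hMul
  · rw [hr]; exact h.hDist

theorem Env.frame {P : Program} {σ τ : State} (h : Env D k F d σ) (hF : Frame P σ τ)
    (hd : P.keeps envVars envArrs envReals = true) : Env D k F d τ :=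
  h.congr (hF.keep hd).1 (hF.keep hd).2.1 (hF.keep hd).2.2

/-! ### Insertion of a candidate into the table of a node -/

/-- The entry with the number `e`. -/
def ent (n : ℕ) (σ : State) (e : ℕ) : Ent (Fin n) :=
  ⟨fun v => σ.arr aCol (e * n + v), fun v => σ.arr aLab (e * n + v), σ.arr aCost e, σ.arr aB1 e,
    σ.arr aB2 e⟩

/-- The candidate for a new entry. -/
def cand (n : ℕ) (σ : State) : Ent (Fin n) :=
  ⟨fun v => σ.arr aXCol v, fun v => σ.arr aXLab v, σ.var vCost, σ.var vX1, σ.var vX2⟩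

def Program.canonical : Program :=
  .setArr aXCan (.var vV) (.const 0) ;;
  .forBag vI vU (.ite (.eq (.get aXLab (.var vU)) (.get aXLab (.var vV)))
    (.setArr aXCan (.var vV) (.var vU)) .skip)

/-- Row i of `aMul` holds the multiples of (n + 1)^i, so a digit is added by a look-up instead of a
multiplication. `vMp` and `vMp2` are the offsets of the current rows: a vertex contributes two
digits to the full code and one to the code of the colours. -/
def Program.addDigits : Program :=
  .setVar vColCode (.add (.var vColCode) (.get aMul (.add (.var vMp2) (.get aXCol (.var vV))))) ;;
  .setVar vCode (.add (.var vCode) (.add (.get aMul (.add (.var vMp) (.get aXCol (.var vV))))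
    (.get aMul (.add (.add (.var vMp) (.var vQ)) (.get aXCan (.var vV)))))) ;;
  .setVar vMp (.add (.var vMp) (.add (.var vQ) (.var vQ))) ;;
  .setVar vMp2 (.add (.var vMp2) (.var vQ))

/-- Compute the canonical labels and the codes of the candidate. -/
def Program.code : Program :=
  (.setVar vCode (.var vOff) ;; .setVar vColCode (.const 0) ;; .setVar vMp (.const 0) ;;
    .setVar vMp2 (.const 0)) ;;
  .forBag vJ vV (.canonical ;; .addDigits)

theorem runs_canonical {L : List (Fin n)} {σ : State} (hL : BagLoaded L σ) {v : Fin n}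
    (hv : σ.var vV = v) :
    Runs .canonical σ (L.length * 40 + 20) fun τ =>
      τ.arr aXCan v = can (cand n σ).lab L v ∧
      ∀ x, x ≠ (v : ℕ) → τ.arr aXCan x = σ.arr aXCan x := by
  refine (Runs.seq (B := 4) (Q := fun τ => τ = σ.setArr aXCan v 0)
    ((Runs.straight rfl (by simp [hv])).le (by decide)) ?_).le (B := _ + (L.length * (20 + 13) + 6))
      (by omega)
  rintro _ rfl -
  have hL' : BagLoaded L (σ.setArr aXCan v 0) := hL.congr rfl rfl rfl
  refine (Runs.forBag hL' (fun pre τ =>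
    τ.arr aXCan v = can (cand n σ).lab pre v ∧ ∀ x, x ≠ (v : ℕ) → τ.arr aXCan x = σ.arr aXCan x)
    ?_ ?_ ?_ ?_ ?_)
  · decide
  · exact fun _ _ _ h => h
  · exact fun _ _ _ h => h
  · refine ⟨by simp [can], fun x hx => by simp [hx]⟩
  · rintro pre u post τ - ⟨h1, h2⟩ hu hF
    have e1 : τ.var vV = v := by rw [hF.var_eq _ (by decide)]; simpa using hv
    have e2 : τ.arr aXLab = σ.arr aXLab := by rw [hF.arr_eq _ (by decide)]; simp
    refine (Runs.straight rfl ?_).le (by decide)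
    have h3 : (cand n σ).lab u = (cand n σ).lab v ↔ σ.arr aXLab u = σ.arr aXLab v := Iff.rfl
    simp only [Program.den, Test.holds_eq, Expr.eval, e1, hu, e2, can_append, h3]
    split_ifs with h
    · refine ⟨by simp, fun x hx => by simp [hx, h2 x hx]⟩
    · exact ⟨h1, h2⟩

theorem runs_code {L : List (Fin n)} {σ : State} (hE : Env D k F d σ) (hL : BagLoaded L σ)
    (hlen : L.length ≤ D.width + 1) (hcol : ∀ v ∈ L, (cand n σ).col v < n + 1) :
    Runs .code σ (L.length * (L.length * 40 + 80) + 20) fun τ =>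
      (∀ v ∈ L, τ.arr aXCan v = can (cand n σ).lab L v) ∧
      τ.var vCode = σ.var vOff + Nat.ofDigits (n + 1) (key L (cand n σ)) ∧
      τ.var vColCode = Nat.ofDigits (n + 1) (L.map (cand n σ).col) := by
  refine Runs.le (Runs.seq (Q := fun τ => τ = (((σ.setVar vCode (σ.var vOff)).setVar vColCode
    0).setVar vMp 0).setVar vMp2 0) (Runs.straight rfl (by simp)) (B' := L.length *
    (L.length * 40 + 20 + 35 + 13) + 6) ?_) ?_
  swap
  · simp only [Program.len, Expr.cost]; nlinarith
  rintro _ rfl -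
  have hL' : BagLoaded L ((((σ.setVar vCode (σ.var vOff)).setVar vColCode
    0).setVar vMp 0).setVar vMp2 0) := hL.congr rfl rfl rfl
  refine (Runs.forBag hL' (fun pre τ =>
    (∀ v ∈ pre, τ.arr aXCan v = can (cand n σ).lab L v) ∧
      τ.var vCode = σ.var vOff + Nat.ofDigits (n + 1)
        (pre.flatMap fun v => [(cand n σ).col v, can (cand n σ).lab L v]) ∧
      τ.var vColCode = Nat.ofDigits (n + 1) (pre.map (cand n σ).col) ∧
      τ.var vMp = 2 * pre.length * (n + 1) ∧ τ.var vMp2 = pre.length * (n + 1))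
    ?_ ?_ ?_ ?_ ?_).imp ?_
  · decide
  · exact fun _ _ _ h => by simpa using h
  · exact fun _ _ _ h => by simpa using h
  · simp
  · rintro pre v post τ hsplit ⟨h1, h2, h3, h4, h5⟩ hv hF
    have hLτ : BagLoaded L τ := hL.congr (by rw [hF.var_eq _ (by decide)]; rfl)
      (by rw [hF.var_eq _ (by decide)]; rfl) (by rw [hF.arr_eq _ (by decide)]; rfl)
    have hvL : v ∈ L := by simp [hsplit]
    -- The rows used for v are 2·|pre| and 2·|pre| + 1, while the table has two rows for each
    -- possible place in a bag.
    have hlt : 2 * pre.length + 1 < 2 * (D.width + 1) := by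
      have := congrArg List.length hsplit
      simp only [List.length_append, List.length_cons] at this
      omega
    have hlab : (cand n τ).lab = (cand n σ).lab := by
      simp only [cand]; rw [hF.arr_eq _ (by decide)]; rfl
    have hc : τ.arr aXCol = σ.arr aXCol := by rw [hF.arr_eq _ (by decide)]; rfl
    refine Runs.seq (B := L.length * 40 + 20) (B' := 35) (runs_canonical hLτ hv)
      fun ρ ⟨g1, g2⟩ hF' => ?_
    refine (Runs.straight rfl ?_).le (by decide)
    have hEρ : Env D k F d ρ :=
      ((hE.congr (τ := ((((σ.setVar vCode (σ.var vOff)).setVar vColCode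
        0).setVar vMp 0).setVar vMp2 0)) (by simp) (by simp) (by simp)).frame hF (by decide)).frame
        hF' (by decide)
    rw [hlab] at g1
    obtain ⟨u, -, hu, -⟩ := exists_can (lab := (cand n σ).lab) hvL
    have hcanlt : can (cand n σ).lab L v < n + 1 := by rw [hu]; omega
    have m1 := hEρ.hMul (2 * pre.length) (by omega) _ (hcol v hvL)
    have m2 := hEρ.hMul (2 * pre.length + 1) (by omega) _ hcanlt
    have m3 := hEρ.hMul pre.length (by omega) _ (hcol v hvL)
    have e1 : ρ.arr aXCol = σ.arr aXCol := by rw [hF'.arr_eq _ (by decide), hc]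
    have e2 : (cand n σ).col v = σ.arr aXCol v := rfl
    have hlenpre : (pre.flatMap fun v => [(cand n σ).col v, can (cand n σ).lab L v]).length =
        2 * pre.length := by
      clear * -
      induction pre with
      | nil => rfl
      | cons a l ih => simp [List.flatMap_cons, ih]; ring
    have f1 : ρ.var vV = v := by rw [hF'.var_eq _ (by decide), hv]
    have f2 := hF'.var_eq vCode (by decide)
    have f3 := hF'.var_eq vColCode (by decide)
    have f4 := hF'.var_eq vMp (by decide)
    have f5 := hF'.var_eq vMp2 (by decide)
    have f6 := hEρ.hQ
    rw [e2] at m1 m3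
    have m2' : ρ.arr aMul (2 * pre.length * (n + 1) + (n + 1) + can (cand n σ).lab L v) =
        can (cand n σ).lab L v * (n + 1) ^ (2 * pre.length + 1) := by
      rw [← m2]; congr 1; ring
    refine ⟨fun x hx => ?_, ?_, ?_, ?_, ?_⟩
    · have : ((Program.addDigits.den ρ).arr aXCan) = ρ.arr aXCan := by simp [Program.addDigits]
      rw [this]
      by_cases hxv : x = v
      · rw [hxv, g1]
      · rw [g2 x (by simpa [Fin.ext_iff] using hxv)]
        refine h1 x ?_
        simpa [hxv] using hx
    · rw [List.flatMap_append, Nat.ofDigits_append, hlenpre]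
      simp [Program.addDigits, f1, f2, f3, f4, f5, f6, e1, h2, h3, h4, h5, m1, m2', e2, g1,
        Nat.ofDigits_cons]
      ring
    · rw [List.map_append, Nat.ofDigits_append]
      simp [Program.addDigits, f1, f2, f3, f4, f5, f6, e1, h2, h3, h4, h5, m3, e2]
      ring
    · simp [Program.addDigits, f4, f6, h4]; ring
    · simp [Program.addDigits, f5, f6, h5]; ring
  · rintro τ ⟨h1, h2, h3, -, -⟩ -
    exact ⟨h1, h2, h3⟩

end RAM

/-! ### The table of a node under construction -/

namespace RAM

variable {n N : ℕ} {G : SimpleGraph (Fin n)} {D : NiceTreeDecomposition G (Fin N)} {k : ℕ}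
  {F : Finset (Fin n)} {d : Fin n → Fin n → ℝ≥0}

/-- The code of an entry of the current node, relative to the offset of the node. -/
def codeOf (L : List (Fin n)) (c : Ent (Fin n)) : ℕ := Nat.ofDigits (n + 1) (key L c)

/-- The table of a node with the bag `L` is under construction: it was started in the state `σ₀`,
and it represents the candidates in `S`. -/
structure Building (L : List (Fin n)) (σ₀ : State) (S : Ent (Fin n) → Prop) (σ : State) :
    Prop where
  cnt_le : σ₀.var vCnt ≤ σ.var vCnt
  off : σ.var vOff = σ₀.var vOff
  cur : σ.var vCur = σ.var vCnt * n
  ptr : ∀ e < σ.var vCnt, σ.arr aPtr e = e * n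
  old : ∀ e < σ₀.var vCnt, ent n σ e = ent n σ₀ e ∧ σ.arr aColCode e = σ₀.arr aColCode e
  sound : ∀ e, σ₀.var vCnt ≤ e → e < σ.var vCnt → S (ent n σ e)
  complete : ∀ c, S c → ∃ e, σ₀.var vCnt ≤ e ∧ e < σ.var vCnt ∧
    Ent.Sim L.toFinset (ent n σ e) c ∧ (ent n σ e).cost ≤ c.cost
  lab : ∀ e, σ₀.var vCnt ≤ e → e < σ.var vCnt → ∀ v ∈ L,
    ∃ u ∈ L, (ent n σ e).lab v = u ∧ (ent n σ e).lab u = (ent n σ e).lab v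
  col_lt : ∀ e, σ₀.var vCnt ≤ e → e < σ.var vCnt → ∀ v ∈ L, (ent n σ e).col v < n + 1
  colCode : ∀ e, σ₀.var vCnt ≤ e → e < σ.var vCnt →
    σ.arr aColCode e = Nat.ofDigits (n + 1) (L.map (ent n σ e).col)
  idx : ∀ e, σ₀.var vCnt ≤ e → e < σ.var vCnt →
    σ.arr aIdx (σ.var vOff + codeOf L (ent n σ e)) = e + 1
  exists_idx : ∀ x, σ.var vOff ≤ x → σ.arr aIdx x ≠ 0 → ∃ e, σ₀.var vCnt ≤ e ∧ e < σ.var vCnt ∧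
    x = σ.var vOff + codeOf L (ent n σ e) ∧ σ.arr aIdx x = e + 1

/-- Variables and arrays of the tables. -/
abbrev tabVars : List ℕ := [vCnt, vOff, vCur]
abbrev tabArrs : List ℕ := [aCol, aLab, aCost, aB1, aB2, aPtr, aIdx, aColCode]

theorem ent_congr {σ τ : State} (ha : ∀ x ∈ tabArrs, τ.arr x = σ.arr x) (e : ℕ) :
    ent n τ e = ent n σ e := by
  simp only [tabArrs, List.forall_mem_cons] at ha
  obtain ⟨a1, a2, a3, a4, a5, -⟩ := ha
  simp only [ent, a1, a2, a3, a4, a5]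

theorem Building.congr {L : List (Fin n)} {σ₀ σ τ : State} {S : Ent (Fin n) → Prop}
    (h : Building L σ₀ S σ) (hv : ∀ x ∈ tabVars, τ.var x = σ.var x)
    (ha : ∀ x ∈ tabArrs, τ.arr x = σ.arr x) : Building L σ₀ S τ := by
  have he : ∀ e, ent n τ e = ent n σ e := ent_congr ha
  simp only [tabVars, tabArrs, List.forall_mem_cons, List.not_mem_nil, false_imp_iff,
    implies_true, and_true] at hv ha
  obtain ⟨v1, v2, v3⟩ := hv
  obtain ⟨-, -, -, -, -, a6, a7, a8⟩ := ha
  constructor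
  · rw [v1]; exact h.cnt_le
  · rw [v2]; exact h.off
  · rw [v3, v1]; exact h.cur
  · rw [v1, a6]; exact h.ptr
  · simp only [he, a8]; exact h.old
  · simp only [he, v1]; exact h.sound
  · simp only [he, v1]; exact h.complete
  · simp only [he, v1]; exact h.lab
  · simp only [he, v1]; exact h.col_lt
  · simp only [he, v1, a8]; exact h.colCode
  · simp only [he, v1, v2, a7]; exact h.idx
  · simp only [he, v1, v2, a7]; exact h.exists_idx

theorem Building.frame {L : List (Fin n)} {σ₀ σ τ : State} {S : Ent (Fin n) → Prop} {P : Program}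
    (h : Building L σ₀ S σ) (hF : Frame P σ τ) (hd : P.keeps tabVars tabArrs [] = true) :
    Building L σ₀ S τ := h.congr (hF.keep hd).1 (hF.keep hd).2.1

theorem Building.imp {L : List (Fin n)} {σ₀ σ : State} {S S' : Ent (Fin n) → Prop}
    (h : Building L σ₀ S σ) (hS : ∀ c, S c ↔ S' c) : Building L σ₀ S' σ := by
  have : S = S' := funext fun c => propext (hS c)
  exact this ▸ h

/-- Append the candidate as a new entry. -/
def Program.append : Program :=
  (.setArr aIdx (.var vCode) (.add (.var vCnt) (.const 1)) ;;
    .setArr aPtr (.var vCnt) (.var vCur)) ;;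
  .forBag vJ vV (.setArr aCol (.add (.var vCur) (.var vV)) (.get aXCol (.var vV)) ;;
    .setArr aLab (.add (.var vCur) (.var vV)) (.get aXCan (.var vV))) ;;
  .setArr aColCode (.var vCnt) (.var vColCode) ;;
  .setArr aCost (.var vCnt) (.var vCost) ;;
  .setArr aB1 (.var vCnt) (.var vX1) ;;
  .setArr aB2 (.var vCnt) (.var vX2) ;;
  .setVar vCnt (.add (.var vCnt) (.const 1)) ;;
  .setVar vCur (.add (.var vCur) (.var vN))

/-- Replace the entry `vE - 1` by the candidate if the candidate is cheaper. -/
def Program.improve : Program :=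
  .ite (.lt (.var vCost) (.get aCost (.sub (.var vE) (.const 1))))
    (.setArr aCost (.sub (.var vE) (.const 1)) (.var vCost) ;;
      .setArr aB1 (.sub (.var vE) (.const 1)) (.var vX1) ;;
      .setArr aB2 (.sub (.var vE) (.const 1)) (.var vX2)) .skip

/-- Insert the candidate into the table of the current node. -/
def Program.insert : Program :=
  .code ;; .setVar vE (.get aIdx (.var vCode)) ;; .ite (.le (.var vE) (.const 0)) .append .improve

variable {L : List (Fin n)} {σ₀ σ : State} {S S' : Ent (Fin n) → Prop}

/-- `S'` stands for `S` enlarged by the candidate: `h₂` admits every entry that equals it up to the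
names of labels, and `h₃` says that whatever else is new is dominated by it. The cell addressed by
the code was zero, so it belongs to no earlier entry and the index remains correct. -/
theorem runs_append (hB : Building L σ₀ S σ) (hL : BagLoaded L σ) (hn : σ.var vN = n)
    (hcol : ∀ v ∈ L, (cand n σ).col v < n + 1)
    (hcan : ∀ v ∈ L, σ.arr aXCan v = can (cand n σ).lab L v)
    (hcode : σ.var vCode = σ.var vOff + codeOf L (cand n σ))
    (hcc : σ.var vColCode = Nat.ofDigits (n + 1) (L.map (cand n σ).col))
    (hnew : σ.arr aIdx (σ.var vCode) = 0)
    (h₁ : ∀ c, S c → S' c) (h₂ : ∀ c, Ent.Eqv L.toFinset c (cand n σ) → S' c)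
    (h₃ : ∀ c, S' c → S c ∨ Ent.Sim L.toFinset (cand n σ) c ∧ (cand n σ).cost ≤ c.cost) :
    Runs .append σ (L.length * 40 + 60) (Building L σ₀ S') := by
  refine Runs.le (Runs.seq (Q := fun τ => τ = (σ.setArr aIdx (σ.var vCode) (σ.var vCnt + 1)).setArr
    aPtr (σ.var vCnt) (σ.var vCur)) (Runs.straight rfl (by simp)) (B' := (L.length * (20 + 13) + 6)
    + 30) ?_) ?_
  swap
  · simp only [Program.len, Expr.cost]; omega
  rintro _ rfl -
  have hL' : BagLoaded L ((σ.setArr aIdx (σ.var vCode) (σ.var vCnt + 1)).setArr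
    aPtr (σ.var vCnt) (σ.var vCur)) := hL.congr rfl rfl rfl
  refine Runs.seq (Runs.forBag hL' (fun pre τ =>
    (∀ v ∈ pre, τ.arr aCol (σ.var vCur + v) = σ.arr aXCol v ∧
      τ.arr aLab (σ.var vCur + v) = σ.arr aXCan v) ∧
    ∀ x < σ.var vCur, τ.arr aCol x = σ.arr aCol x ∧ τ.arr aLab x = σ.arr aLab x) ?_ ?_ ?_ ?_ ?_) ?_
  · decide
  · exact fun _ _ _ h => h
  · exact fun _ _ _ h => h
  · exact ⟨by simp, fun x _ => ⟨rfl, rfl⟩⟩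
  · rintro pre u post τ - ⟨g1, g2⟩ hu hF
    have e1 : τ.arr aXCol = σ.arr aXCol := by rw [hF.arr_eq _ (by decide)]; rfl
    have e2 : τ.arr aXCan = σ.arr aXCan := by rw [hF.arr_eq _ (by decide)]; rfl
    have e3 : τ.var vCur = σ.var vCur := by rw [hF.var_eq _ (by decide)]; rfl
    refine (Runs.straight rfl ?_).le (by decide)
    refine ⟨fun v hv => ?_, fun x hx => ?_⟩
    · by_cases hvu : v = u
      · simp [hvu, e1, e2, e3, hu]
      · have hvu' : (v : ℕ) ≠ u := fun h => hvu (Fin.ext h)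
        simpa [hvu', e1, e2, e3, hu, Function.update_apply] using
          g1 v (by simpa [hvu] using hv)
    · have : x ≠ σ.var vCur + u := by omega
      simpa [this, e1, e2, e3, hu, Function.update_apply] using g2 x hx
  rintro τ ⟨g1, g2⟩ hF
  refine (Runs.straight rfl ?_).le (by decide)
  have hcur := hB.cur
  have v1 : τ.var vCnt = σ.var vCnt := by rw [hF.var_eq _ (by decide)]; rfl
  have v2 : τ.var vCur = σ.var vCur := by rw [hF.var_eq _ (by decide)]; rfl
  have v3 : τ.var vN = n := by rw [hF.var_eq _ (by decide)]; exact hn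
  have v4 : τ.var vOff = σ.var vOff := by rw [hF.var_eq _ (by decide)]; rfl
  have v5 : τ.var vCost = σ.var vCost := by rw [hF.var_eq _ (by decide)]; rfl
  have v6 : τ.var vX1 = σ.var vX1 := by rw [hF.var_eq _ (by decide)]; rfl
  have v7 : τ.var vX2 = σ.var vX2 := by rw [hF.var_eq _ (by decide)]; rfl
  have v8 : τ.var vColCode = σ.var vColCode := by rw [hF.var_eq _ (by decide)]; rfl
  have a1 : τ.arr aIdx = Function.update (σ.arr aIdx) (σ.var vCode) (σ.var vCnt + 1) := by
    rw [hF.arr_eq _ (by decide)]; simp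
  have a2 : τ.arr aPtr = Function.update (σ.arr aPtr) (σ.var vCnt) (σ.var vCur) := by
    rw [hF.arr_eq _ (by decide)]; simp
  have a3 : τ.arr aColCode = σ.arr aColCode := by rw [hF.arr_eq _ (by decide)]; rfl
  have a4 : τ.arr aCost = σ.arr aCost := by rw [hF.arr_eq _ (by decide)]; rfl
  have a5 : τ.arr aB1 = σ.arr aB1 := by rw [hF.arr_eq _ (by decide)]; rfl
  have a6 : τ.arr aB2 = σ.arr aB2 := by rw [hF.arr_eq _ (by decide)]; rfl
  generalize hρ : Program.den _ τ = ρ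
  simp only [Program.den, Expr.eval, State.var_setArr, State.var_setVar, v1, v2,
    v3, v5, v6, v7, v8] at hρ
  have w1 : ρ.var vCnt = σ.var vCnt + 1 := by rw [← hρ]; simp
  have w2 : ρ.var vCur = σ.var vCur + n := by rw [← hρ]; simp
  have w3 : ρ.var vOff = σ.var vOff := by rw [← hρ]; simp [v4]
  have b1 : ρ.arr aIdx = Function.update (σ.arr aIdx) (σ.var vCode) (σ.var vCnt + 1) := by
    rw [← hρ]; simp [a1]
  have b2 : ρ.arr aPtr = Function.update (σ.arr aPtr) (σ.var vCnt) (σ.var vCur) := by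
    rw [← hρ]; simp [a2]
  have b3 : ρ.arr aColCode = Function.update (σ.arr aColCode) (σ.var vCnt) (σ.var vColCode) := by
    rw [← hρ]; simp [a3]
  have b4 : ρ.arr aCost = Function.update (σ.arr aCost) (σ.var vCnt) (σ.var vCost) := by
    rw [← hρ]; simp [a4]
  have b5 : ρ.arr aB1 = Function.update (σ.arr aB1) (σ.var vCnt) (σ.var vX1) := by
    rw [← hρ]; simp [a5]
  have b6 : ρ.arr aB2 = Function.update (σ.arr aB2) (σ.var vCnt) (σ.var vX2) := by
    rw [← hρ]; simp [a6]
  have b7 : ρ.arr aCol = τ.arr aCol := by rw [← hρ]; simp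
  have b8 : ρ.arr aLab = τ.arr aLab := by rw [← hρ]; simp
  clear hρ
  have hold : ∀ e < σ.var vCnt, ent n ρ e = ent n σ e := by
    intro e he
    -- Entry e occupies the cells from e·n up to (e + 1)·n - 1, all of them before the new row.
    have hlt : ∀ v : Fin n, e * n + v < σ.var vCur := fun v => by
      rw [hcur]
      calc e * n + v < e * n + n := by omega
        _ = (e + 1) * n := by ring
        _ ≤ _ := Nat.mul_le_mul_right _ he
    have hne : e ≠ σ.var vCnt := he.ne
    simp only [ent, b4, b5, b6, b7, b8, Function.update_of_ne hne]
    congr 1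
    · funext v; exact (g2 _ (hlt v)).1
    · funext v; exact (g2 _ (hlt v)).2
  have hnewcol : ∀ v ∈ L, (ent n ρ (σ.var vCnt)).col v = (cand n σ).col v := fun v hv => by
    simp only [ent, b7]
    rw [← hcur]; exact (g1 v hv).1
  have hnewlab : ∀ v ∈ L, (ent n ρ (σ.var vCnt)).lab v = can (cand n σ).lab L v := fun v hv => by
    simp only [ent, b8]
    rw [← hcur, (g1 v hv).2, hcan v hv]
  have hEqv : Ent.Eqv L.toFinset (ent n ρ (σ.var vCnt)) (cand n σ) := by
    refine ⟨⟨fun v hv => hnewcol v (by simpa using hv), fun u hu v hv => ?_⟩, ?_, ?_, ?_⟩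
    · rw [List.mem_toFinset] at hu hv
      rw [hnewlab u hu, hnewlab v hv, can_eq_iff hu hv]
    · simp [ent, b4, cand]
    · simp [ent, b5, cand]
    · simp [ent, b6, cand]
  have hkey : codeOf L (ent n ρ (σ.var vCnt)) = codeOf L (cand n σ) := by
    unfold codeOf
    rw [(key_eq_iff (B := L.toFinset) (by simp)).2 hEqv.toSim]
  have hsplit : ∀ e, e < ρ.var vCnt → e < σ.var vCnt ∨ e = σ.var vCnt := fun e he => by omega
  have hle := hB.cnt_le
  constructor
  · omega
  · rw [w3, hB.off]
  · rw [w2, w1, hcur]; ring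
  · intro e he
    rw [b2]
    rcases hsplit e he with h | rfl
    · rw [Function.update_of_ne h.ne, hB.ptr e h]
    · simp [hcur]
  · intro e he
    have he' : e < σ.var vCnt := by omega
    rw [hold e he', b3, Function.update_of_ne he'.ne]
    exact hB.old e he
  · intro e he he'
    rcases hsplit e he' with h | rfl
    · rw [hold e h]; exact h₁ _ (hB.sound e he h)
    · exact h₂ _ hEqv
  · intro c hc
    rcases h₃ c hc with h | ⟨h, h'⟩
    · obtain ⟨e, he, he', h⟩ := hB.complete c h
      exact ⟨e, he, by omega, by rwa [hold e he']⟩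
    · exact ⟨_, hle, by omega, hEqv.toSim.trans h, hEqv.cost.le.trans h'⟩
  · intro e he he'
    rcases hsplit e he' with h | rfl
    · rw [hold e h]; exact hB.lab e he h
    · intro v hv
      obtain ⟨u, hu, huv, hl⟩ := exists_can (lab := (cand n σ).lab) hv
      refine ⟨u, hu, by rw [hnewlab v hv, huv], ?_⟩
      rw [hnewlab v hv, hnewlab u hu, can_eq_iff hu hv, hl]
  · intro e he he'
    rcases hsplit e he' with h | rfl
    · rw [hold e h]; exact hB.col_lt e he h
    · intro v hv
      rw [hnewcol v hv]; exact hcol v hv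
  · intro e he he'
    rw [b3]
    rcases hsplit e he' with h | rfl
    · rw [hold e h, Function.update_of_ne h.ne]; exact hB.colCode e he h
    · rw [Function.update_self, hcc]
      congr 1
      exact List.map_congr_left fun v hv => (hnewcol v hv).symm
  · intro e he he'
    rw [w3, b1]
    rcases hsplit e he' with h | rfl
    · rw [hold e h]
      have hi := hB.idx e he h
      rw [Function.update_of_ne, hi]
      intro h'
      rw [h', hnew] at hi
      omega
    · rw [hkey, ← hcode, Function.update_self]
  · intro x hx hx0
    rw [w3] at hx ⊢
    rw [b1] at hx0 ⊢
    by_cases hxc : x = σ.var vCode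
    · refine ⟨σ.var vCnt, hle, by omega, ?_, ?_⟩
      · rw [hkey, hxc, hcode]
      · rw [hxc, Function.update_self]
    · rw [Function.update_of_ne hxc] at hx0 ⊢
      obtain ⟨e, he, he', h1, h2⟩ := hB.exists_idx x hx hx0
      exact ⟨e, he, by omega, by rwa [hold e he'], h2⟩

/-- A nonzero index cell names an entry with the same code as the candidate, and codes are faithful,
so this entry is similar to the candidate. Only its cost and its back pointers may be overwritten,
which leaves codes and index valid. -/
theorem runs_improve (hB : Building L σ₀ S σ)
    (hcol : ∀ v ∈ L, (cand n σ).col v < n + 1)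
    (hcode : σ.var vCode = σ.var vOff + codeOf L (cand n σ))
    (hidx : σ.arr aIdx (σ.var vCode) = σ.var vE) (hne : σ.var vE ≠ 0)
    (h₁ : ∀ c, S c → S' c) (h₂ : ∀ c, Ent.Eqv L.toFinset c (cand n σ) → S' c)
    (h₃ : ∀ c, S' c → S c ∨ Ent.Sim L.toFinset (cand n σ) c ∧ (cand n σ).cost ≤ c.cost) :
    Runs .improve σ 60 (Building L σ₀ S') := by
  obtain ⟨e₀, he₀, he₀', hx, hxe⟩ := hB.exists_idx (σ.var vCode) (by omega) (by omega)
  have hE : σ.var vE - 1 = e₀ := by omega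
  have hsim : Ent.Sim L.toFinset (ent n σ e₀) (cand n σ) := by
    refine (ofDigits_key_inj (by simp) (hB.col_lt e₀ he₀ he₀') hcol).1 ?_
    have := hx.symm.trans hcode
    simpa [codeOf] using this
  refine (Runs.straight rfl ?_).le (by decide)
  simp only [Program.improve, Program.den, Expr.eval, Test.holds_lt, hE, State.var_setArr]
  split_ifs with hlt
  · set ρ := ((σ.setArr aCost e₀ (σ.var vCost)).setArr aB1 e₀ (σ.var vX1)).setArr aB2 e₀
      (σ.var vX2) with hρ
    have w : ρ.var = σ.var := rfl
    have b1 : ρ.arr aIdx = σ.arr aIdx := by simp [hρ]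
    have b2 : ρ.arr aPtr = σ.arr aPtr := by simp [hρ]
    have b3 : ρ.arr aColCode = σ.arr aColCode := by simp [hρ]
    have b4 : ρ.arr aCost = Function.update (σ.arr aCost) e₀ (σ.var vCost) := by simp [hρ]
    have b5 : ρ.arr aB1 = Function.update (σ.arr aB1) e₀ (σ.var vX1) := by simp [hρ]
    have b6 : ρ.arr aB2 = Function.update (σ.arr aB2) e₀ (σ.var vX2) := by simp [hρ]
    have b7 : ρ.arr aCol = σ.arr aCol := by simp [hρ]
    have b8 : ρ.arr aLab = σ.arr aLab := by simp [hρ]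
    clear_value ρ
    have hcolE : ∀ e, (ent n ρ e).col = (ent n σ e).col := fun e => by simp only [ent, b7]
    have hlabE : ∀ e, (ent n ρ e).lab = (ent n σ e).lab := fun e => by simp only [ent, b8]
    have hold : ∀ e, e ≠ e₀ → ent n ρ e = ent n σ e := fun e he => by
      simp only [ent, b4, b5, b6, b7, b8, Function.update_of_ne he]
    have hcodeE : ∀ e, codeOf L (ent n ρ e) = codeOf L (ent n σ e) := fun e => by
      simp only [codeOf, key, hcolE, hlabE]
    have hsimE : ∀ e, Ent.Sim L.toFinset (ent n ρ e) (ent n σ e) := fun e =>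
      ⟨fun _ _ => by rw [hcolE], fun _ _ _ _ => by rw [hlabE]⟩
    have hEqv : Ent.Eqv L.toFinset (ent n ρ e₀) (cand n σ) :=
      ⟨(hsimE e₀).trans hsim, by simp [ent, b4, cand], by simp [ent, b5, cand],
        by simp [ent, b6, cand]⟩
    have hcost : ∀ e, (ent n ρ e).cost ≤ (ent n σ e).cost := fun e => by
      by_cases he : e = e₀
      · subst he
        rw [hEqv.cost]
        exact hlt.le
      · rw [hold e he]
    constructor
    · rw [w]; exact hB.cnt_le
    · rw [w]; exact hB.off
    · rw [w]; exact hB.cur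
    · rw [w, b2]; exact hB.ptr
    · intro e he
      rw [hold e (by omega), b3]
      exact hB.old e he
    · intro e he he'
      by_cases h : e = e₀
      · subst h; exact h₂ _ hEqv
      · rw [hold e h]; exact h₁ _ (hB.sound e he (w ▸ he'))
    · intro c hc
      rcases h₃ c hc with h | ⟨h, h'⟩
      · obtain ⟨e, he, he', h1, h2⟩ := hB.complete c h
        exact ⟨e, he, w ▸ he', (hsimE e).trans h1, (hcost e).trans h2⟩
      · exact ⟨e₀, he₀, w ▸ he₀', hEqv.toSim.trans h, hEqv.cost.le.trans h'⟩
    · rw [w]; simp only [hlabE]; exact hB.lab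
    · rw [w]; simp only [hcolE]; exact hB.col_lt
    · rw [w, b3]; simp only [hcolE]; exact hB.colCode
    · rw [w, b1]; simp only [hcodeE]; exact hB.idx
    · rw [w, b1]; simp only [hcodeE]; exact hB.exists_idx
  · constructor
    · exact hB.cnt_le
    · exact hB.off
    · exact hB.cur
    · exact hB.ptr
    · exact hB.old
    · exact fun e he he' => h₁ _ (hB.sound e he he')
    · intro c hc
      rcases h₃ c hc with h | ⟨h, h'⟩
      · exact hB.complete c h
      · exact ⟨e₀, he₀, he₀', hsim.trans h, (not_lt.1 hlt).trans h'⟩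
    · exact hB.lab
    · exact hB.col_lt
    · exact hB.colCode
    · exact hB.idx
    · exact hB.exists_idx

/-- A bound for the running time of `Program.insert` for a bag with `m` vertices. -/
def insertTime (m : ℕ) : ℕ := m * (m * 40 + 120) + 200

theorem runs_insert (hE : Env D k F d σ) (hB : Building L σ₀ S σ) (hL : BagLoaded L σ)
    (hlen : L.length ≤ D.width + 1)
    (hcol : ∀ v ∈ L, (cand n σ).col v < n + 1)
    (h₁ : ∀ c, S c → S' c) (h₂ : ∀ c, Ent.Eqv L.toFinset c (cand n σ) → S' c)
    (h₃ : ∀ c, S' c → S c ∨ Ent.Sim L.toFinset (cand n σ) c ∧ (cand n σ).cost ≤ c.cost) :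
    Runs .insert σ (insertTime L.length) (Building L σ₀ S') := by
  refine Runs.le (Runs.seq (runs_code hE hL hlen hcol) (B' := 3 + (3 + (L.length * 40 + 60)))
    fun τ ⟨g1, g2, g3⟩ hF => ?_) (by unfold insertTime; nlinarith)
  refine Runs.seq (Q := fun ρ => ρ = τ.setVar vE (τ.arr aIdx (τ.var vCode)))
    ((Runs.straight rfl (by simp)).le (by decide)) ?_
  rintro ρ hρ hF'
  have hc : cand n ρ = cand n σ := by
    simp only [cand]
    rw [hF'.arr_eq aXCol (by decide), hF'.arr_eq aXLab (by decide), hF'.var_eq vCost (by decide),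
      hF'.var_eq vX1 (by decide), hF'.var_eq vX2 (by decide), hF.arr_eq aXCol (by decide),
      hF.arr_eq aXLab (by decide), hF.var_eq vCost (by decide),
      hF.var_eq vX1 (by decide), hF.var_eq vX2 (by decide)]
  have hBρ : Building L σ₀ S ρ := (hB.frame hF (by decide)).frame hF' (by decide)
  have hEρ := (hE.frame hF (by decide)).frame hF' (by decide)
  have hLρ : BagLoaded L ρ := (hL.congr (hF.var_eq _ (by decide)) (hF.var_eq _ (by decide))
    (hF.arr_eq _ (by decide))).congr (hF'.var_eq _ (by decide)) (hF'.var_eq _ (by decide))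
    (hF'.arr_eq _ (by decide))
  have e1 : ρ.var vCode = ρ.var vOff + codeOf L (cand n ρ) := by
    rw [hc, hF'.var_eq _ (by decide), hF'.var_eq _ (by decide), hF.var_eq vOff (by decide), g2]
    rfl
  have e2 : ρ.arr aIdx (ρ.var vCode) = ρ.var vE := by rw [hρ]; simp
  refine Runs.ite (fun hq => ?_) fun hq => ?_
  · have e3 : ρ.var vE = 0 := by simpa using hq
    refine runs_append hBρ hLρ hEρ.hN (by rwa [hc]) ?_ e1 ?_ (by rw [e2, e3]) h₁ (by rwa [hc])
      (by rwa [hc])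
    · rw [hc, hF'.arr_eq _ (by decide)]; exact g1
    · rw [hc, hF'.var_eq _ (by decide)]; exact g3
  · have e3 : ρ.var vE ≠ 0 := by simpa using hq
    exact (runs_improve hBρ (by rwa [hc]) e1 e2 e3 h₁ (by rwa [hc]) (by rwa [hc])).le (by omega)

end RAM

/-! ### Child entries and the new colour determine a candidate -/

namespace NiceTreeDecomposition

variable {n : ℕ} {ι : Type} {G : SimpleGraph (Fin n)} {D : NiceTreeDecomposition G ι}
  {ok : Fin n → ℕ → Prop} {T : ι → ℕ → Prop} {E : ℕ → Ent (Fin n)} {t : ι} {c c' : Ent (Fin n)}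

/-- An entry is determined by the entries of the children and the colour of the new vertex. -/
theorem Trans.sim (h : D.Trans ok T E t c) (h' : D.Trans ok T E t c') (h₁ : c.b1 = c'.b1)
    (h₂ : ∀ s₁ s₂, D.kind t = .join s₁ s₂ → c.b2 = c'.b2)
    (h₃ : ∀ v s, D.kind t = .introduceVertex v s → c.col v = c'.col v) :
    Ent.Sim (D.bag t) c c' ∧ c.cost = c'.cost := by
  obtain ⟨-, h⟩ := h
  obtain ⟨-, h'⟩ := h'
  cases hk : D.kind t with
  | leaf =>
    rw [hk] at h h'
    exact ⟨⟨by simp [bag_leaf hk], by simp [bag_leaf hk]⟩, h.trans h'.symm⟩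
  | introduceVertex v s =>
    rw [hk] at h h'
    obtain ⟨-, hb⟩ := bag_introduceVertex hk
    obtain ⟨-, a1, a2, a3⟩ := h
    obtain ⟨-, b1, b2, b3⟩ := h'
    rw [← h₁] at b1 b3
    refine ⟨⟨fun u hu => ?_, fun x hx y hy => ?_⟩, a3.trans b3.symm⟩
    · rw [hb, Finset.mem_insert] at hu
      rcases hu with rfl | hu
      · exact h₃ _ _ hk
      · rw [a1.col u hu, b1.col u hu]
    · rw [hb, Finset.mem_insert] at hx hy
      rcases hx with rfl | hx <;> rcases hy with rfl | hy
      · simp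
      · exact iff_of_false (a2 y hy).symm (b2 y hy).symm
      · exact iff_of_false (a2 x hx) (b2 x hx)
      · rw [a1.lab x hx y hy, b1.lab x hx y hy]
  | introduceEdge u v s =>
    rw [hk] at h h'
    obtain ⟨-, a1, a2, a3⟩ := h
    obtain ⟨-, b1, b2, b3⟩ := h'
    rw [← h₁] at b1 b2 b3
    exact ⟨⟨fun x hx => (a1 x hx).trans (b1 x hx).symm,
      fun x hx y hy => (a2 x hx y hy).trans (b2 x hx y hy).symm⟩, a3.trans b3.symm⟩
  | forget v s =>
    rw [hk] at h h'
    obtain ⟨-, a1, a2, a3⟩ := h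
    obtain ⟨-, b1, b2, b3⟩ := h'
    rw [← h₁] at b1 b2 b3
    refine ⟨a1.trans b1.symm, ?_⟩
    by_cases hu : ∃ u ∈ D.bag t, (E c.b1).lab u = (E c.b1).lab v
    · rw [a2 hu, b2 hu]
    · rw [a3 hu, b3 hu]
  | join s₁ s₂ =>
    rw [hk] at h h'
    obtain ⟨-, -, a1, a2, a3, a4⟩ := h
    obtain ⟨-, -, b1, b2, b3, b4⟩ := h'
    rw [← h₁] at b1 b3 b4
    rw [← h₂ _ _ hk] at b3 b4
    exact ⟨⟨fun x hx => (a1 x hx).trans (b1 x hx).symm,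
      fun x hx y hy => (a3 x hx y hy).trans (b3 x hx y hy).symm⟩, a4.trans b4.symm⟩

end NiceTreeDecomposition

/-! ### Complete tables, and the loops that build candidates -/

namespace RAM

variable {n N : ℕ} {G : SimpleGraph (Fin n)} {D : NiceTreeDecomposition G (Fin N)} {k : ℕ}
  {F : Finset (Fin n)} {d : Fin n → Fin n → ℝ≥0} {L : List (Fin n)} {σ₀ σ : State}

/-- `a` is a facility in distance at most `r` to `v`. -/
def OkAt (F : Finset (Fin n)) (d : Fin n → Fin n → ℝ≥0) (r : ℝ) (v : Fin n) (a : ℕ) : Prop :=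
  ∃ c ∈ F, (c : ℕ) = a ∧ (d v c : ℝ) ≤ r

/-- `e` is an entry of the table of the node `t`. -/
def Tab (σ : State) (t : Fin N) (e : ℕ) : Prop := σ.arr aStart t ≤ e ∧ e < σ.arr aEnd t

variable (D F d) in
/-- The table of the node `t` is complete. -/
structure Table (r : ℝ) (σ : State) (t : Fin N) : Prop where
  le : σ.arr aStart t ≤ σ.arr aEnd t
  le_cnt : σ.arr aEnd t ≤ σ.var vCnt
  trans : ∀ e, Tab σ t e → D.Trans (OkAt F d r) (Tab σ) (ent n σ) t (ent n σ e)
  complete : ∀ c, D.Trans (OkAt F d r) (Tab σ) (ent n σ) t c →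
    ∃ e, Tab σ t e ∧ Ent.Sim (D.bag t) (ent n σ e) c ∧ (ent n σ e).cost ≤ c.cost
  lab : ∀ e, Tab σ t e → ∀ v ∈ D.bag t,
    ∃ u ∈ D.bag t, (ent n σ e).lab v = u ∧ (ent n σ e).lab u = (ent n σ e).lab v
  colCode : ∀ e, Tab σ t e →
    σ.arr aColCode e = Nat.ofDigits (n + 1) ((bagL D t).map (ent n σ e).col)
  inj : ∀ e e', Tab σ t e → Tab σ t e' → Ent.Sim (D.bag t) (ent n σ e) (ent n σ e') → e = e'

abbrev nodeVars : List ℕ := envVars ++ [vT, vM, vRow, vC1, vC2, vA, vB, vTh]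
abbrev nodeArrs : List ℕ := envArrs ++ [aStart, aEnd]
abbrev nodeReals : List ℕ := [rDist, rSort]

/-- The states agree on everything that is fixed during the construction of a table. -/
structure Agree (σ₀ σ : State) : Prop where
  var : ∀ x ∈ nodeVars, σ.var x = σ₀.var x
  arr : ∀ x ∈ nodeArrs, σ.arr x = σ₀.arr x
  real : ∀ x ∈ nodeReals, σ.real x = σ₀.real x

theorem Agree.refl (σ : State) : Agree σ σ := ⟨fun _ _ => rfl, fun _ _ => rfl, fun _ _ => rfl⟩

theorem Agree.frame {P : Program} {τ : State} (h : Agree σ₀ σ) (hF : Frame P σ τ)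
    (hd : P.keeps nodeVars nodeArrs nodeReals = true) : Agree σ₀ τ :=
  ⟨fun x hx => ((hF.keep hd).1 x hx).trans (h.var x hx),
    fun x hx => ((hF.keep hd).2.1 x hx).trans (h.arr x hx),
    fun x hx => ((hF.keep hd).2.2 x hx).trans (h.real x hx)⟩

theorem Agree.env (h : Agree σ₀ σ) (hE : Env D k F d σ₀) : Env D k F d σ :=
  hE.congr (fun x hx => h.var x (List.mem_append_left _ hx))
    (fun x hx => h.arr x (List.mem_append_left _ hx))
    (fun x hx => h.real x (by simp only [envReals, List.mem_singleton] at hx; simp [hx]))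

theorem Agree.bag (h : Agree σ₀ σ) (hL : BagLoaded L σ₀) : BagLoaded L σ :=
  hL.congr (h.var _ (by decide)) (h.var _ (by decide)) (h.arr _ (by decide))

/-! ### Building blocks for candidates -/

/-- Copy the entry with the address `vP1` into the candidate. -/
def Program.copy : Program :=
  .forBag vJ vV (.setArr aXCol (.var vV) (.get aCol (.add (.var vP1) (.var vV))) ;;
    .setArr aXLab (.var vV) (.get aLab (.add (.var vP1) (.var vV))))

theorem runs_copy (hL : BagLoaded L σ) {e : ℕ} (he : σ.var vP1 = e * n) :
    Runs .copy σ (L.length * 30 + 6) fun τ => ∀ v ∈ L,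
      (cand n τ).col v = (ent n σ e).col v ∧ (cand n τ).lab v = (ent n σ e).lab v := by
  refine Runs.le (B := L.length * (17 + 13) + 6) (Runs.forBag hL (fun pre τ => ∀ v ∈ pre,
      (cand n τ).col v = (ent n σ e).col v ∧ (cand n τ).lab v = (ent n σ e).lab v)
      ?_ ?_ ?_ ?_ ?_) (by omega)
  · decide
  · exact fun _ _ _ h => h
  · exact fun _ _ _ h => h
  · simp
  · rintro pre u post τ - h hu hF
    have e1 : τ.arr aCol = σ.arr aCol := hF.arr_eq _ (by decide)
    have e2 : τ.arr aLab = σ.arr aLab := hF.arr_eq _ (by decide)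
    have e3 : τ.var vP1 = e * n := by rw [hF.var_eq _ (by decide), he]
    refine (Runs.straight rfl ?_).le (by decide)
    intro v hv
    by_cases hvu : v = u
    · simp [cand, ent, hvu, hu, e1, e2, e3]
    · have hvu' : (v : ℕ) ≠ u := fun h => hvu (Fin.ext h)
      have := h v (by simpa [hvu] using hv)
      simpa [cand, ent, hvu', hu, Function.update_apply] using this

/-- Replace the label `vLa` by `vLb`. -/
def Program.relabel : Program :=
  .forBag vI vU (.ite (.eq (.get aXLab (.var vU)) (.var vLa))
    (.setArr aXLab (.var vU) (.var vLb)) .skip)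

theorem runs_relabel (hL : BagLoaded L σ) :
    Runs .relabel σ (L.length * 33 + 6) fun τ => ∀ v ∈ L, τ.arr aXLab v =
      if σ.arr aXLab v = σ.var vLa then σ.var vLb else σ.arr aXLab v := by
  refine Runs.mono (B := L.length * (20 + 13) + 6) (Runs.forBag hL (fun pre τ => ∀ v : Fin n,
      τ.arr aXLab v = if v ∈ pre ∧ σ.arr aXLab v = σ.var vLa then σ.var vLb else σ.arr aXLab v)
      ?_ ?_ ?_ ?_ ?_) (by omega) ?_
  · decide
  · exact fun _ _ _ h => h
  · exact fun _ _ _ h => h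
  · simp
  · rintro pre u post τ - h hu hF
    have e1 : τ.var vLa = σ.var vLa := hF.var_eq _ (by decide)
    have e2 : τ.var vLb = σ.var vLb := hF.var_eq _ (by decide)
    refine (Runs.straight rfl ?_).le (by decide)
    intro v
    simp only [Program.den, Test.holds_eq, Expr.eval, hu, e1, e2]
    have h1 := h u
    have h2 := h v
    by_cases hvu : v = u
    · subst hvu
      split_ifs <;> simp_all
    · have hvu' : (v : ℕ) ≠ u := fun h => hvu (Fin.ext h)
      split_ifs <;> simp_all
  · intro τ h _ v hv
    simpa [hv] using h v

/-- Merging the labels of `x` and `y`. -/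
theorem relabel_iff {l l' : Fin n → ℕ} {u v : Fin n}
    (h : ∀ x ∈ L, l' x = if l x = l u then l v else l x) {x y : Fin n} (hx : x ∈ L) (hy : y ∈ L) :
    l' x = l' y ↔ l x = l y ∨ (l x = l u ∧ l v = l y) ∨ (l x = l v ∧ l u = l y) := by
  rw [h x hx, h y hy]
  split_ifs <;> grind

/-- Loop over the entries of the first child of the current node. -/
def Program.forEntries (P : Program) : Program :=
  (.setVar vS1 (.get aStart (.var vC1)) ;;
    .setVar vL1 (.sub (.get aEnd (.var vC1)) (.var vS1))) ;;
  .for vI1 vL1 ((.setVar vE1 (.add (.var vS1) (.var vI1)) ;; .setVar vP1 (.get aPtr (.var vE1))) ;;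
    P)

/-- `S e` stands for the candidates that come from entries before e. `H` is an additional invariant
insensitive to the loop variables; join nodes use it to keep their linked lists. -/
theorem runs_forEntries {P : Program} {B : ℕ} {s : Fin N} {S : ℕ → Ent (Fin n) → Prop}
    {H : State → Prop}
    (hA : Agree σ₀ σ) (hs : σ.var vC1 = s) (hle : σ₀.arr aEnd s ≤ σ₀.var vCnt)
    (hle' : σ₀.arr aStart s ≤ σ₀.arr aEnd s)
    (hB : Building L σ₀ (S (σ₀.arr aStart s)) σ) (hH : H σ)
    (hHc : ∀ τ x m, x ∈ [vS1, vL1, vI1, vE1, vP1] → H τ → H (τ.setVar x m))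
    (hP : (P.keeps (nodeVars ++ [vS1, vL1, vI1, vE1]) nodeArrs nodeReals) = true)
    (hstep : ∀ e τ, Tab σ₀ s e → Agree σ₀ τ → τ.var vE1 = e → τ.var vP1 = e * n →
      Building L σ₀ (S e) τ → H τ → Runs P τ B fun ρ => Building L σ₀ (S (e + 1)) ρ ∧ H ρ) :
    Runs (.forEntries P) σ ((σ₀.arr aEnd s - σ₀.arr aStart s) * (B + 20) + 20)
      fun ρ => Building L σ₀ (S (σ₀.arr aEnd s)) ρ ∧ H ρ := by
  have hs0 : σ.arr aStart = σ₀.arr aStart := hA.arr _ (by decide)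
  have hs1 : σ.arr aEnd = σ₀.arr aEnd := hA.arr _ (by decide)
  have hP' := hP
  simp only [Program.keeps, Bool.and_eq_true, List.all_eq_true, decide_eq_true_eq] at hP'
  refine Runs.le (Runs.seq (Q := fun τ => τ = (σ.setVar vS1 (σ₀.arr aStart s)).setVar vL1
    (σ₀.arr aEnd s - σ₀.arr aStart s)) (Runs.straight rfl (by simp [hs, hs0, hs1]))
    (B' := (σ₀.arr aEnd s - σ₀.arr aStart s) * (12 + B + 8) + 6) ?_) ?_
  swap
  · simp only [Program.len, Expr.cost, show 12 + B + 8 = B + 20 by omega]; omega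
  rintro _ rfl -
  set σ₁ := (σ.setVar vS1 (σ₀.arr aStart s)).setVar vL1 (σ₀.arr aEnd s - σ₀.arr aStart s)
  have hA1 : Agree σ₀ σ₁ := ⟨fun x hx => by
    have h1 : x ≠ vS1 := by rintro rfl; revert hx; decide
    have h2 : x ≠ vL1 := by rintro rfl; revert hx; decide
    simp only [σ₁, State.var_setVar, h1, h2, if_false]; exact hA.var x hx, hA.arr, hA.real⟩
  refine (Runs.for (σ := σ₁) (σ₀.arr aEnd s - σ₀.arr aStart s) (fun i τ =>
    Building L σ₀ (S (σ₀.arr aStart s + i)) τ ∧ H τ) ?_ ?_ (by decide) ?_ ?_ ?_).imp ?_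
  · simpa [Program.wv] using hP'.1.1 vI1 (by decide)
  · simpa [Program.wv] using hP'.1.1 vL1 (by decide)
  · simp [σ₁]
  · refine ⟨hB.congr ?_ ?_, ?_⟩
    · simp [σ₁]
    · simp [σ₁]
    · exact hHc _ _ _ (by decide) (hHc _ _ _ (by decide) (hHc _ _ _ (by decide) hH))
  · rintro i τ hi ⟨hBτ, hHτ⟩ hiτ hF
    set e := σ₀.arr aStart s + i with he
    have hAτ : Agree σ₀ τ := by
      refine hA1.frame hF ?_
      simp only [Program.keeps, Bool.and_eq_true, List.all_eq_true, decide_eq_true_eq]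
      have aux : ∀ x ∈ nodeVars, x ≠ vI1 ∧ x ≠ vE1 ∧ x ≠ vP1 := by decide
      refine ⟨⟨fun x hx => ?_, fun x hx => ?_⟩, fun x hx => ?_⟩
      · simpa [Program.wv, Program.for, Program.incr, aux x hx] using
          hP'.1.1 x (List.mem_append_left _ hx)
      · simpa [Program.wa, Program.for, Program.incr] using hP'.1.2 x hx
      · simpa [Program.wr, Program.for, Program.incr] using hP'.2 x hx
    have hsτ : τ.var vS1 = σ₀.arr aStart s := by
      rw [hF.var _ (by
        simpa [Program.wv, Program.for, Program.incr] using hP'.1.1 vS1 (by decide))]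
      simp [σ₁]
    have hcnt := hBτ.cnt_le
    have hptr := hBτ.ptr e (by omega)
    refine Runs.seq (B := 12) (Q := fun ρ => ρ = (τ.setVar vE1 e).setVar vP1 (e * n))
      ((Runs.straight rfl (by simp [hsτ, hiτ, ← he, hptr])).le (by decide)) ?_
    rintro _ rfl -
    refine (hstep e _ ⟨by omega, by omega⟩ ?_ (by simp) (by simp) (hBτ.congr (by simp) (by simp))
      (hHc _ _ _ (by decide) (hHc _ _ _ (by decide) hHτ))).imp fun ρ hρ _ => ⟨?_, ?_⟩
    · refine ⟨fun x hx => ?_, hAτ.arr, hAτ.real⟩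
      have aux : ∀ x ∈ nodeVars, x ≠ vI1 ∧ x ≠ vE1 ∧ x ≠ vP1 := by decide
      simp only [State.var_setVar, aux x hx, if_false]; exact hAτ.var x hx
    · exact (hρ.1.congr (by simp) (by simp)).imp fun c => by rw [← add_assoc]
    · exact hHc _ _ _ (by decide) hρ.2
  · rintro τ ⟨h1, h2⟩ -
    exact ⟨h1.imp fun c => by rw [Nat.add_sub_cancel' hle'], h2⟩

end RAM

namespace RAM

open NiceTreeDecomposition

variable {n N : ℕ} {G : SimpleGraph (Fin n)} {D : NiceTreeDecomposition G (Fin N)} {k : ℕ}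
  {F : Finset (Fin n)} {d : Fin n → Fin n → ℝ≥0} {σ₀ σ : State} {r : ℝ} {t : Fin N}

variable (D k F d) in
/-- The state in which the construction of the table of the node `t` starts. -/
structure NodeStart (r : ℝ) (t : Fin N) (σ₀ : State) : Prop where
  env : Env D k F d σ₀
  node : σ₀.var vT = t
  bag : BagLoaded (bagL D t) σ₀
  c1 : σ₀.var vC1 = nodeCode (D.kind t) 1
  c2 : σ₀.var vC2 = nodeCode (D.kind t) 2
  u1 : σ₀.var vA = nodeCode (D.kind t) 3
  u2 : σ₀.var vB = nodeCode (D.kind t) 4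
  th : σ₀.real rSort (σ₀.var vTh) = r
  table : ∀ s, D.Child t s → Table D F d r σ₀ s
  cur : σ₀.var vCur = σ₀.var vCnt * n
  ptr : ∀ e < σ₀.var vCnt, σ₀.arr aPtr e = e * n
  idx : ∀ x, σ₀.var vOff ≤ x → σ₀.arr aIdx x = 0
  head : ∀ x, σ₀.var vOff ≤ x → σ₀.arr aHead x = 0

theorem NodeStart.building (h : NodeStart D k F d r t σ₀) :
    Building (bagL D t) σ₀ (fun _ => False) σ₀ where
  cnt_le := le_rfl
  off := rfl
  cur := h.cur
  ptr := h.ptr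
  old := fun _ _ => ⟨rfl, rfl⟩
  sound := fun _ h1 h2 => absurd h1 (not_le.2 h2)
  complete := fun _ h => h.elim
  lab := fun _ h1 h2 => absurd h1 (not_le.2 h2)
  col_lt := fun _ h1 h2 => absurd h1 (not_le.2 h2)
  colCode := fun _ h1 h2 => absurd h1 (not_le.2 h2)
  idx := fun _ h1 h2 => absurd h1 (not_le.2 h2)
  exists_idx := fun x h1 h2 => absurd (h.idx x h1) h2

variable (D F d) in
/-- The entries that can be obtained from the tables of the children in the state `σ₀`. -/
def Cand (r : ℝ) (σ₀ : State) (t : Fin N) (c : Ent (Fin n)) : Prop :=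
  D.Trans (OkAt F d r) (Tab σ₀) (ent n σ₀) t c

theorem OkAt.lt {v : Fin n} {a : ℕ} (h : OkAt F d r v a) : a < n + 1 := by
  obtain ⟨c, -, rfl, -⟩ := h
  omega

/-- Insertion of a candidate which satisfies `Cand`. -/
theorem runs_insert_cand {S S' : Ent (Fin n) → Prop} (hS : NodeStart D k F d r t σ₀)
    (hA : Agree σ₀ σ) (hB : Building (bagL D t) σ₀ S σ) (hc : Cand D F d r σ₀ t (cand n σ))
    (h₁ : ∀ c, S c → S' c) (h₂ : ∀ c, Ent.Eqv (D.bag t) c (cand n σ) → S' c)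
    (h₃ : ∀ c, S' c → S c ∨ Ent.Sim (D.bag t) (cand n σ) c ∧ (cand n σ).cost ≤ c.cost) :
    Runs .insert σ (insertTime (bagL D t).length) (Building (bagL D t) σ₀ S') := by
  refine runs_insert (hA.env hS.env) hB (hA.bag hS.bag) (length_bagL_le D t)
    (fun v hv => (hc.1 v (mem_bagL.1 hv)).lt) h₁ ?_ ?_
  · rwa [toFinset_bagL]
  · rwa [toFinset_bagL]

/-- A bound for the time to build and insert one candidate for a bag with `m` vertices. -/
def stepTime (m : ℕ) : ℕ := insertTime m + m * (m * 60 + 150) + 150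

/-! ### Leaves -/

def Program.leafNode : Program :=
  .setVar vCost (.const 0) ;; .insert

theorem runs_leafNode (hS : NodeStart D k F d r t σ₀) (hk : D.kind t = .leaf) :
    Runs .leafNode σ₀ (stepTime (bagL D t).length)
      (Building (bagL D t) σ₀ (Cand D F d r σ₀ t)) := by
  refine Runs.le (Runs.seq (B := 2) (B' := insertTime (bagL D t).length)
    (Q := fun τ => τ = σ₀.setVar vCost 0)
    ((Runs.straight rfl (by simp)).le (by decide)) ?_) (by unfold stepTime; omega)
  rintro τ hτ hF
  have hA : Agree σ₀ τ := (Agree.refl σ₀).frame hF (by decide)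
  have hb : D.bag t = ∅ := bag_leaf hk
  have hc : Cand D F d r σ₀ t (cand n τ) := by
    refine ⟨by simp [hb], ?_⟩
    rw [hk]
    simp [cand, hτ]
  refine runs_insert_cand hS hA (hS.building.frame hF (by decide)) hc (fun _ h => h.elim) ?_ ?_
  · exact fun c h => hc.congr h
  · intro c hc'
    refine Or.inr ⟨⟨by simp [hb], by simp [hb]⟩, ?_⟩
    simp [cand, hτ]

/-! ### Introduce vertex nodes -/

def Program.introduceVertexNode : Program :=
  .forEntries (.for vI2 vNF (.setVar vH (.get aFL (.var vI2)) ;;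
    .ite (.realLe rDist (.add (.get aRow (.var vA)) (.var vH)) rSort (.var vTh))
      (.copy ;; (.setArr aXCol (.var vA) (.var vH) ;; .setArr aXLab (.var vA) (.var vA) ;;
        .setVar vCost (.get aCost (.var vE1)) ;; .setVar vX1 (.var vE1)) ;; .insert) .skip))

/-- Besides the candidates from earlier entries, the inner invariant contains those from entry e
whose colour at v is among the first j facilities. By `Trans.sim` the entry and this colour
determine the candidate up to similarity, so one insertion per facility suffices. A facility farther
than r admits no candidate. -/
theorem runs_introduceVertexNode (hS : NodeStart D k F d r t σ₀) {v : Fin n} {s : Fin N}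
    (hk : D.kind t = .introduceVertex v s) :
    Runs .introduceVertexNode σ₀ ((σ₀.arr aEnd s - σ₀.arr aStart s) *
      (F.card * (stepTime (bagL D t).length + 8) + 6 + 20) + 20)
      (Building (bagL D t) σ₀ (Cand D F d r σ₀ t)) := by
  have hch : D.Child t s := (child_introduceVertex hk).2 rfl
  have hT := hS.table s hch
  obtain ⟨hvs, hb⟩ := bag_introduceVertex hk
  have hvA : σ₀.var vA = v := by rw [hS.u1, hk]; rfl
  have hunf : ∀ {c}, Cand D F d r σ₀ t c → Tab σ₀ s c.b1 := by
    intro c hc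
    have := hc.2
    rw [hk] at this
    exact this.1
  refine (runs_forEntries (s := s) (L := bagL D t) (H := fun _ => True)
    (B := F.card * (stepTime (bagL D t).length + 8) + 6)
    (S := fun e c => Cand D F d r σ₀ t c ∧ c.b1 < e) (Agree.refl σ₀)
    (by rw [hS.c1, hk]; rfl) hT.le_cnt hT.le ?_ trivial (fun _ _ _ _ _ => trivial) (by decide)
    ?_).imp ?_
  · exact hS.building.imp fun c => ⟨fun h => h.elim, fun h => by
      have := (hunf h.1).1; omega⟩
  · intro e τ₁ he hA₁ hE₁ hP₁ hB₁ _
    refine Runs.le (Runs.for (B := stepTime (bagL D t).length) F.card (fun j τ =>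
      Building (bagL D t) σ₀ (fun c => Cand D F d r σ₀ t c ∧
        (c.b1 < e ∨ (c.b1 = e ∧ ∃ i < j, c.col v = σ₀.arr aFL i))) τ) (by decide) (by decide)
      (by decide) (hA₁.env hS.env).hNf ?_ ?_) (le_refl _) |>.imp ?_
    · exact (hB₁.congr (by simp) (by simp)).imp fun c => by simp
    · intro j τ₂ hj hB₂ hj₂ hF₂
      have hA₂ : Agree σ₀ τ₂ := hA₁.frame hF₂ (by decide)
      have hE₂ : τ₂.var vE1 = e := by rw [hF₂.var_eq _ (by decide), hE₁]
      have hP₂ : τ₂.var vP1 = e * n := by rw [hF₂.var_eq _ (by decide), hP₁]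
      have hFL : τ₂.arr aFL = σ₀.arr aFL := hA₂.arr _ (by decide)
      obtain ⟨a, haF, ha⟩ := hS.env.hFac j hj
      have hent : ent n τ₂ e = ent n σ₀ e := (hB₂.old e (lt_of_lt_of_le he.2 hT.le_cnt)).1
      suffices h : Runs (.setVar vH (.get aFL (.var vI2)) ;;
          .ite (.realLe rDist (.add (.get aRow (.var vA)) (.var vH)) rSort (.var vTh))
          (.copy ;; (.setArr aXCol (.var vA) (.var vH) ;; .setArr aXLab (.var vA) (.var vA) ;;
          .setVar vCost (.get aCost (.var vE1)) ;; .setVar vX1 (.var vE1)) ;; .insert) .skip) τ₂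
          (stepTime (bagL D t).length) (Building (bagL D t) σ₀ (fun c => Cand D F d r σ₀ t c ∧
            (c.b1 < e ∨ (c.b1 = e ∧ ∃ i < j + 1, c.col v = σ₀.arr aFL i)))) from
        h.imp fun ρ hρ _ => hρ.congr (by simp) (by simp)
      refine Runs.le (Runs.seq (B := 3) (Q := fun τ => τ = τ₂.setVar vH a) (B' := 6 +
        ((bagL D t).length * 30 + 6 + (14 + insertTime (bagL D t).length)))
        ((Runs.straight rfl (by simp [hj₂, hFL, ha])).le (by decide)) ?_)
        (by unfold stepTime; nlinarith)
      rintro τ₃ hτ₃ hF₃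
      have hA₃ : Agree σ₀ τ₃ := hA₂.frame hF₃ (by decide)
      have hB₃ := hB₂.frame hF₃ (by decide)
      have hH₃ : τ₃.var vH = a := by rw [hτ₃]; simp
      have hE₃ : τ₃.var vE1 = e := by rw [hF₃.var_eq _ (by decide), hE₂]
      have hP₃ : τ₃.var vP1 = e * n := by rw [hF₃.var_eq _ (by decide), hP₂]
      have hvA₃ : τ₃.var vA = v := by rw [hA₃.var _ (by decide), hvA]
      have hent₃ : ent n τ₃ e = ent n σ₀ e := (hB₃.old e (lt_of_lt_of_le he.2 hT.le_cnt)).1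
      have htest : (Test.realLe rDist (.add (.get aRow (.var vA)) (.var vH)) rSort
          (.var vTh)).Holds τ₃ ↔ (d v a : ℝ) ≤ r := by
        simp only [Test.Holds, Expr.eval, hvA₃, hH₃, (hA₃.env hS.env).hRow,
          (hA₃.env hS.env).hDist]
        rw [hA₃.real rSort (by decide), hA₃.var vTh (by decide), hS.th]
      refine Runs.ite (fun hq => ?_) fun hq => ?_
      · rw [htest] at hq
        refine Runs.seq (runs_copy (hA₃.bag hS.bag) hP₃) fun τ₄ h₄ hF₄ => ?_
        have hA₄ : Agree σ₀ τ₄ := hA₃.frame hF₄ (by decide)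
        have hB₄ := hB₃.frame hF₄ (by decide)
        have hH₄ : τ₄.var vH = a := by rw [hF₄.var_eq _ (by decide), hH₃]
        have hE₄ : τ₄.var vE1 = e := by rw [hF₄.var_eq _ (by decide), hE₃]
        have hvA₄ : τ₄.var vA = v := by rw [hA₄.var _ (by decide), hvA]
        have hent₄ : ent n τ₄ e = ent n σ₀ e := (hB₄.old e (lt_of_lt_of_le he.2 hT.le_cnt)).1
        refine Runs.seq (B := 14) (Q := fun τ => cand n τ = ⟨Function.update (cand n τ₄).col v a,
          Function.update (cand n τ₄).lab v v, (ent n σ₀ e).cost, e, τ₄.var vX2⟩)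
          ((Runs.straight rfl ?_).le (by decide)) ?_
        · have hc : τ₄.arr aCost e = (ent n σ₀ e).cost := by rw [← hent₄]; rfl
          simp only [cand, Ent.mk.injEq]
          refine ⟨?_, ?_, ?_, ?_, ?_⟩
          · funext x
            simp [hvA₄, hH₄, Function.update_apply, Fin.ext_iff]
          · funext x
            simp [hvA₄, Function.update_apply, Fin.ext_iff]
          · simp [hE₄, hc]
          · simp [hE₄]
          · simp
        · rintro τ₅ hτ₅ hF₅
          have hA₅ : Agree σ₀ τ₅ := hA₄.frame hF₅ (by decide)
          have hB₅ := hB₄.frame hF₅ (by decide)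
          rw [hent₃] at h₄
          have hne : ∀ u ∈ D.bag s, u ≠ v := fun u hu h => hvs (h ▸ hu)
          have hmem : ∀ u ∈ D.bag s, u ∈ bagL D t := fun u hu => by
            rw [mem_bagL, hb]; simp [hu]
          have hok := (hT.trans e he).1
          have hc : Cand D F d r σ₀ t (cand n τ₅) := by
            rw [hτ₅]
            refine ⟨fun u hu => ?_, ?_⟩
            · by_cases huv : u = v
              · subst huv; simpa using ⟨a, haF, rfl, hq⟩
              · have hus : u ∈ D.bag s := by simpa [hb, huv] using hu
                simpa [huv, (h₄ u (mem_bagL.2 hu)).1] using hok u hus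
            · rw [hk]
              refine ⟨he, ⟨fun u hu => ?_, fun u hu w hw => ?_⟩, fun u hu => ?_, rfl⟩
              · simp [hne u hu, (h₄ u (hmem u hu)).1]
              · simp [hne u hu, hne w hw, (h₄ u (hmem u hu)).2, (h₄ w (hmem w hw)).2]
              -- Stored labels are vertices of the child's bag. As v is not among them, its own
              -- number is a fresh label.
              · obtain ⟨x, hx, hx', -⟩ := hT.lab e he u hu
                simp only [Function.update_of_ne (hne u hu), Function.update_self,
                  (h₄ u (hmem u hu)).2, hx']
                exact fun h => hne x hx (Fin.ext h)
          have hb1 : (cand n τ₅).b1 = e := by rw [hτ₅]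
          have hcv : (cand n τ₅).col v = a := by rw [hτ₅]; simp
          refine runs_insert_cand hS hA₅ hB₅ hc ?_ ?_ ?_
          · rintro c ⟨h1, h2 | ⟨h2, i, hi, h3⟩⟩
            · exact ⟨h1, Or.inl h2⟩
            · exact ⟨h1, Or.inr ⟨h2, i, by omega, h3⟩⟩
          · intro c h
            exact ⟨hc.congr h, Or.inr ⟨h.b1.trans hb1, j, by omega, by
              rw [h.col v (by simp [hb]), hcv, ha]⟩⟩
          · rintro c ⟨h1, h2 | ⟨h2, i, hi, h3⟩⟩
            · exact Or.inl ⟨h1, Or.inl h2⟩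
            · by_cases hij : i = j
              · subst hij
                have := hc.sim h1 (hb1.trans h2.symm) (by simp [hk]) (by
                  intro v' s' hk'
                  rw [hk] at hk'
                  cases hk'
                  rw [hcv, h3, ha])
                exact Or.inr ⟨this.1, this.2.le⟩
              · exact Or.inl ⟨h1, Or.inr ⟨h2, i, by omega, h3⟩⟩
      · rw [htest] at hq
        refine ((Runs.straight rfl ?_).le (show Program.len .skip ≤ _ by
          simp only [Program.len]; omega))
        refine hB₃.imp fun c => ⟨?_, ?_⟩
        · rintro ⟨h1, h2 | ⟨h2, i, hi, h3⟩⟩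
          · exact ⟨h1, Or.inl h2⟩
          · exact ⟨h1, Or.inr ⟨h2, i, by omega, h3⟩⟩
        · rintro ⟨h1, h2 | ⟨h2, i, hi, h3⟩⟩
          · exact ⟨h1, Or.inl h2⟩
          · by_cases hij : i = j
            · subst hij
              exfalso
              obtain ⟨c', -, hc', hd⟩ := h1.1 v (by simp [hb])
              rw [h3, ha] at hc'
              rw [Fin.ext hc'] at hd
              exact hq hd
            · exact ⟨h1, Or.inr ⟨h2, i, by omega, h3⟩⟩
    · rintro τ hτ -
      refine ⟨hτ.imp fun c => ⟨?_, ?_⟩, trivial⟩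
      · rintro ⟨h1, h2 | ⟨h2, -⟩⟩
        · exact ⟨h1, by omega⟩
        · exact ⟨h1, by omega⟩
      · rintro ⟨h1, h2⟩
        refine ⟨h1, ?_⟩
        by_cases h : c.b1 < e
        · exact Or.inl h
        · obtain ⟨a, haF, ha, -⟩ := h1.1 v (by simp [hb])
          obtain ⟨i, hi, hi'⟩ := hS.env.hFac' a haF
          exact Or.inr ⟨by omega, i, hi, by rw [← ha, hi']⟩
  · rintro τ ⟨hτ, -⟩ -
    exact hτ.imp fun c => ⟨fun h => h.1, fun h => ⟨h, (hunf h).2⟩⟩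

end RAM

namespace RAM

open NiceTreeDecomposition

variable {n N : ℕ} {G : SimpleGraph (Fin n)} {D : NiceTreeDecomposition G (Fin N)} {k : ℕ}
  {F : Finset (Fin n)} {d : Fin n → Fin n → ℝ≥0} {σ₀ σ : State} {r : ℝ} {t : Fin N}

/-! ### Nodes with one candidate for every entry of the child -/

/-- When no vertex is introduced and there is no second child, `Trans.sim` makes the child's entry
determine the candidate up to similarity and cost. One insertion per entry then represents all of
`Cand`. -/
theorem runs_forEntries_insert {P : Program} {B : ℕ} {s : Fin N} (hS : NodeStart D k F d r t σ₀)
    (hch : D.Child t s) (hC1 : nodeCode (D.kind t) 1 = s)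
    (hunf : ∀ {c}, Cand D F d r σ₀ t c → Tab σ₀ s c.b1)
    (hj : ∀ s₁ s₂, D.kind t ≠ .join s₁ s₂) (hv : ∀ v s, D.kind t ≠ .introduceVertex v s)
    (hP : (P ;; .insert).keeps (nodeVars ++ [vS1, vL1, vI1, vE1]) nodeArrs nodeReals = true)
    (hP' : P.keeps (nodeVars ++ tabVars) (nodeArrs ++ tabArrs) nodeReals = true)
    (hstep : ∀ e τ, Tab σ₀ s e → Agree σ₀ τ → τ.var vE1 = e → τ.var vP1 = e * n →
      ent n τ e = ent n σ₀ e →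
      Runs P τ B fun ρ => Cand D F d r σ₀ t (cand n ρ) ∧ (cand n ρ).b1 = e) :
    Runs (.forEntries (P ;; .insert)) σ₀ ((σ₀.arr aEnd s - σ₀.arr aStart s) *
      (B + insertTime (bagL D t).length + 20) + 20)
      (Building (bagL D t) σ₀ (Cand D F d r σ₀ t)) := by
  have hT := hS.table s hch
  refine (runs_forEntries (s := s) (L := bagL D t) (H := fun _ => True)
    (B := B + insertTime (bagL D t).length)
    (S := fun e c => Cand D F d r σ₀ t c ∧ c.b1 < e) (Agree.refl σ₀)
    (by rw [hS.c1, hC1]) hT.le_cnt hT.le ?_ trivial (fun _ _ _ _ _ => trivial) hP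
    ?_).imp ?_
  · exact hS.building.imp fun c => ⟨fun h => h.elim, fun h => by
      have := (hunf h.1).1; omega⟩
  · intro e τ he hA hE hp hB _
    refine Runs.seq (hstep e τ he hA hE hp (hB.old e (lt_of_lt_of_le he.2 hT.le_cnt)).1)
      fun ρ ⟨h1, h2⟩ hF => ?_
    have hk := hF.keep hP'
    have hA' : Agree σ₀ ρ := ⟨fun x hx => ((hk.1 x (List.mem_append_left _ hx))).trans (hA.var x hx),
      fun x hx => ((hk.2.1 x (List.mem_append_left _ hx))).trans (hA.arr x hx),
      fun x hx => (hk.2.2 x hx).trans (hA.real x hx)⟩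
    refine (runs_insert_cand hS hA' (hB.congr (fun x hx => hk.1 x (List.mem_append_right _ hx))
      fun x hx => hk.2.1 x (List.mem_append_right _ hx)) h1 (fun c hc => ⟨hc.1, by
        have := hc.2; omega⟩) (fun c hc => ⟨h1.congr hc, by have := hc.b1; omega⟩) ?_).imp
      fun _ h _ => ⟨h, trivial⟩
    rintro c ⟨hc, hlt⟩
    by_cases h : c.b1 < e
    · exact Or.inl ⟨hc, h⟩
    · have := Trans.sim h1 hc (by omega) (fun s₁ s₂ h => absurd h (hj s₁ s₂))
        fun v s h => absurd h (hv v s)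
      exact Or.inr ⟨this.1, this.2.le⟩
  · rintro τ ⟨hτ, -⟩ -
    exact hτ.imp fun c => ⟨fun h => h.1, fun h => ⟨h, (hunf h).2⟩⟩

/-! ### Introduce edge nodes -/

def Program.mergeEdge : Program :=
  .copy ;; (.setVar vCost (.get aCost (.var vE1)) ;; .setVar vX1 (.var vE1)) ;;
    .ite (.eq (.get aXCol (.var vA)) (.get aXCol (.var vB)))
      ((.setVar vLa (.get aXLab (.var vA)) ;; .setVar vLb (.get aXLab (.var vB))) ;; .relabel) .skip

def Program.introduceEdgeNode : Program := .forEntries (.mergeEdge ;; .insert)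

theorem runs_introduceEdgeNode (hS : NodeStart D k F d r t σ₀) {u v : Fin n} {s : Fin N}
    (hk : D.kind t = .introduceEdge u v s) :
    Runs .introduceEdgeNode σ₀ ((σ₀.arr aEnd s - σ₀.arr aStart s) *
      (stepTime (bagL D t).length + 20) + 20)
      (Building (bagL D t) σ₀ (Cand D F d r σ₀ t)) := by
  have hch : D.Child t s := (child_introduceEdge hk).2 rfl
  have hT := hS.table s hch
  obtain ⟨-, hu, hv, hb⟩ := bag_introduceEdge hk
  have hvA : σ₀.var vA = u := by rw [hS.u1, hk]; rfl
  have hvB : σ₀.var vB = v := by rw [hS.u2, hk]; rfl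
  refine Runs.le (runs_forEntries_insert (B := (bagL D t).length * 30 + 6 + (5 + (11 + (6 +
    ((bagL D t).length * 33 + 6))))) hS hch (by rw [hk]; rfl) ?_ (by simp [hk]) (by simp [hk])
    (by decide) (by decide) ?_) ?_
  · intro c hc
    have := hc.2
    rw [hk] at this
    exact this.1
  swap
  · gcongr
    unfold stepTime
    nlinarith
  intro e τ he hA hE hP hent
  refine Runs.seq (runs_copy (hA.bag hS.bag) hP) fun τ₁ h₁ hF₁ => ?_
  have hA₁ : Agree σ₀ τ₁ := hA.frame hF₁ (by decide)
  have hE₁ : τ₁.var vE1 = e := by rw [hF₁.var_eq _ (by decide), hE]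
  have hent₁ : τ₁.arr aCost e = (ent n σ₀ e).cost := by
    rw [← hent, hF₁.arr_eq _ (by decide)]; rfl
  rw [hent] at h₁
  refine Runs.seq (Q := fun ρ => ρ = (τ₁.setVar vCost (τ₁.arr aCost e)).setVar vX1 e)
    ((Runs.straight rfl (by simp [hE₁])).le (by decide)) ?_
  rintro τ₂ hτ₂ hF₂
  have hA₂ : Agree σ₀ τ₂ := hA₁.frame hF₂ (by decide)
  have hc₂ : cand n τ₂ = ⟨(cand n τ₁).col, (cand n τ₁).lab, (ent n σ₀ e).cost, e, τ₁.var vX2⟩ := by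
    rw [hτ₂]; simp [cand, hent₁]
  have hcol : ∀ x ∈ D.bag t, (cand n τ₂).col x = (ent n σ₀ e).col x := fun x hx => by
    rw [hc₂]; exact (h₁ x (mem_bagL.2 hx)).1
  have hlab : ∀ x ∈ D.bag t, (cand n τ₂).lab x = (ent n σ₀ e).lab x := fun x hx => by
    rw [hc₂]; exact (h₁ x (mem_bagL.2 hx)).2
  have hA2 : τ₂.var vA = u := by rw [hA₂.var _ (by decide), hvA]
  have hB2 : τ₂.var vB = v := by rw [hA₂.var _ (by decide), hvB]
  have hok := (hT.trans e he).1
  have htest : (Test.eq (.get aXCol (.var vA)) (.get aXCol (.var vB))).Holds τ₂ ↔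
      (ent n σ₀ e).col u = (ent n σ₀ e).col v := by
    rw [← hcol u hu, ← hcol v hv, Test.holds_eq]
    simp [hA2, hB2, cand]
  -- Common end of both branches: they differ only in the labels, which have to realise the merging
  -- rule of the edge.
  have fin : ∀ ρ : State, (cand n ρ).col = (cand n τ₂).col → (cand n ρ).cost = (cand n τ₂).cost →
      (cand n ρ).b1 = (cand n τ₂).b1 →
      (∀ x ∈ D.bag t, ∀ y ∈ D.bag t, (cand n ρ).lab x = (cand n ρ).lab y ↔
        (ent n σ₀ e).lab x = (ent n σ₀ e).lab y ∨
        ((ent n σ₀ e).col u = (ent n σ₀ e).col v ∧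
        (((ent n σ₀ e).lab x = (ent n σ₀ e).lab u ∧ (ent n σ₀ e).lab v = (ent n σ₀ e).lab y) ∨
         ((ent n σ₀ e).lab x = (ent n σ₀ e).lab v ∧
          (ent n σ₀ e).lab u = (ent n σ₀ e).lab y)))) →
      Cand D F d r σ₀ t (cand n ρ) ∧ (cand n ρ).b1 = e := by
    intro ρ g1 g2 g3 g4
    have g5 : (cand n ρ).b1 = e := by rw [g3, hc₂]
    refine ⟨⟨fun x hx => ?_, ?_⟩, g5⟩
    · rw [g1, hcol x hx]; exact hok x (hb ▸ hx)
    · rw [hk]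
      simp only [g5]
      refine ⟨he, fun x hx => by rw [g1, hcol x hx], g4, by rw [g2, hc₂]⟩
  refine Runs.ite (fun hq => ?_) fun hq => ?_
  · rw [htest] at hq
    refine Runs.seq (Q := fun ρ => ρ = (τ₂.setVar vLa (τ₂.arr aXLab u)).setVar vLb
      (τ₂.arr aXLab v)) ((Runs.straight rfl (by simp [hA2, hB2])).le (by decide)) ?_
    rintro τ₃ hτ₃ hF₃
    have hA₃ : Agree σ₀ τ₃ := hA₂.frame hF₃ (by decide)
    refine (runs_relabel (hA₃.bag hS.bag)).imp fun ρ hρ hF => ?_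
    have h3 : τ₃.arr aXLab = τ₂.arr aXLab := hF₃.arr_eq _ (by decide)
    rw [h3, show τ₃.var vLa = τ₂.arr aXLab u by rw [hτ₃]; simp,
      show τ₃.var vLb = τ₂.arr aXLab v by rw [hτ₃]; simp] at hρ
    refine fin ρ ?_ ?_ ?_ fun x hx y hy => ?_
    · simp only [cand]; rw [hF.arr_eq _ (by decide), hF₃.arr_eq _ (by decide)]
    · simp only [cand]; rw [hF.var_eq _ (by decide), hF₃.var_eq _ (by decide)]
    · simp only [cand]; rw [hF.var_eq _ (by decide), hF₃.var_eq _ (by decide)]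
    · rw [relabel_iff (l := (cand n τ₂).lab) (l' := (cand n ρ).lab) (u := u) (v := v) hρ (mem_bagL.2 hx)
        (mem_bagL.2 hy), hlab x hx, hlab y hy, hlab u hu, hlab v hv]
      simp [hq]
  · rw [htest] at hq
    refine (Runs.straight rfl ?_).le (show Program.len .skip ≤ _ by simp only [Program.len]; omega)
    refine fin τ₂ rfl rfl rfl fun x hx y hy => ?_
    rw [hlab x hx, hlab y hy]
    simp [hq]

/-! ### Forget nodes -/

/-- `vFl` starts at one and drops to zero when a remaining bag vertex shares the label of the
forgotten one, so it is the increment of the cost. That label is read from the stored entry, because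
only the smaller bag is copied. -/
def Program.forgetEntry : Program :=
  .copy ;; (.setVar vFl (.const 1) ;; .setVar vLa (.get aLab (.add (.var vP1) (.var vA)))) ;;
    .forBag vJ vV (.ite (.eq (.get aXLab (.var vV)) (.var vLa)) (.setVar vFl (.const 0)) .skip) ;;
    (.setVar vCost (.add (.get aCost (.var vE1)) (.var vFl)) ;; .setVar vX1 (.var vE1))

def Program.forgetNode : Program := .forEntries (.forgetEntry ;; .insert)

theorem runs_forgetNode (hS : NodeStart D k F d r t σ₀) {v : Fin n} {s : Fin N}
    (hk : D.kind t = .forget v s) :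
    Runs .forgetNode σ₀ ((σ₀.arr aEnd s - σ₀.arr aStart s) *
      (stepTime (bagL D t).length + 20) + 20)
      (Building (bagL D t) σ₀ (Cand D F d r σ₀ t)) := by
  have hch : D.Child t s := (child_forget hk).2 rfl
  have hT := hS.table s hch
  obtain ⟨hvs, hb⟩ := bag_forget hk
  have hvA : σ₀.var vA = v := by rw [hS.u1, hk]; rfl
  refine Runs.le (runs_forEntries_insert (B := (bagL D t).length * 30 + 6 + (7 +
    (((bagL D t).length * (12 + 13) + 6) + 7))) hS hch (by rw [hk]; rfl) ?_ (by simp [hk])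
    (by simp [hk]) (by decide) (by decide) ?_) ?_
  · intro c hc
    have := hc.2
    rw [hk] at this
    exact this.1
  swap
  · gcongr
    unfold stepTime
    nlinarith
  intro e τ he hA hE hP hent
  refine Runs.seq (runs_copy (hA.bag hS.bag) hP) fun τ₁ h₁ hF₁ => ?_
  have hA₁ : Agree σ₀ τ₁ := hA.frame hF₁ (by decide)
  have hP₁ : τ₁.var vP1 = e * n := by rw [hF₁.var_eq _ (by decide), hP]
  have hA1 : τ₁.var vA = v := by rw [hA₁.var _ (by decide), hvA]
  have hlab₁ : τ₁.arr aLab (e * n + v) = (ent n σ₀ e).lab v := by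
    rw [← hent, hF₁.arr_eq _ (by decide)]; rfl
  have hcost₁ : τ₁.arr aCost e = (ent n σ₀ e).cost := by
    rw [← hent, hF₁.arr_eq _ (by decide)]; rfl
  have hE₁ : τ₁.var vE1 = e := by rw [hF₁.var_eq _ (by decide), hE]
  rw [hent] at h₁
  refine Runs.seq (Q := fun ρ => ρ = (τ₁.setVar vFl 1).setVar vLa ((ent n σ₀ e).lab v))
    ((Runs.straight rfl (by simp [hP₁, hA1, hlab₁])).le (by decide)) ?_
  rintro τ₂ hτ₂ hF₂
  have hA₂ : Agree σ₀ τ₂ := hA₁.frame hF₂ (by decide)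
  have hFl₂ : τ₂.var vFl = 1 := by rw [hτ₂]; simp
  have hLa₂ : τ₂.var vLa = (ent n σ₀ e).lab v := by rw [hτ₂]; simp
  have hX₂ : ∀ x ∈ bagL D t, τ₂.arr aXLab x = (ent n σ₀ e).lab x := fun x hx => by
    rw [hF₂.arr_eq _ (by decide)]; exact (h₁ x hx).2
  refine Runs.seq (Runs.forBag (hA₂.bag hS.bag) (fun pre τ => τ.var vFl =
    if ∃ u ∈ pre, (ent n σ₀ e).lab u = (ent n σ₀ e).lab v then 0 else 1) ?_ ?_ ?_ ?_ ?_) ?_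
  · decide
  · exact fun _ _ _ h => by simpa using h
  · exact fun _ _ _ h => by simpa using h
  · simpa using hFl₂
  · rintro pre u post τ' hL h hu hF
    have hmem : u ∈ bagL D t := by simp [hL]
    have e1 : τ'.arr aXLab u = (ent n σ₀ e).lab u := by
      rw [hF.arr_eq _ (by decide), hX₂ u hmem]
    have e2 : τ'.var vLa = (ent n σ₀ e).lab v := by rw [hF.var_eq _ (by decide), hLa₂]
    refine (Runs.straight rfl ?_).le (by decide)
    simp only [Program.den, Test.holds_eq, Expr.eval, hu, e1, e2]
    by_cases hq : (ent n σ₀ e).lab u = (ent n σ₀ e).lab v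
    · simp [hq]
    · rw [if_neg hq, h]
      simp only [List.mem_append, List.mem_singleton, or_and_right, exists_or, exists_eq_left, hq,
        or_false]
  · intro τ₃ h₃ hF₃
    refine (Runs.straight rfl ?_).le (by decide)
    have c1 : (cand n τ₃).col = (cand n τ₁).col := by
      simp only [cand]; rw [hF₃.arr_eq _ (by decide), hF₂.arr_eq _ (by decide)]
    have c2 : (cand n τ₃).lab = (cand n τ₁).lab := by
      simp only [cand]; rw [hF₃.arr_eq _ (by decide), hF₂.arr_eq _ (by decide)]
    have c3 : τ₃.var vE1 = e := by rw [hF₃.var_eq _ (by decide), hF₂.var_eq _ (by decide), hE₁]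
    have c4 : τ₃.arr aCost e = (ent n σ₀ e).cost := by
      rw [hF₃.arr_eq _ (by decide), hF₂.arr_eq _ (by decide), hcost₁]
    have hc : cand n (Program.den (.setVar vCost (.add (.get aCost (.var vE1)) (.var vFl)) ;;
        .setVar vX1 (.var vE1)) τ₃) = ⟨(cand n τ₁).col, (cand n τ₁).lab,
        (ent n σ₀ e).cost + τ₃.var vFl, e, τ₃.var vX2⟩ := by
      rw [← c1, ← c2]
      simp [cand, c3, c4]
    rw [hc]
    have hok := (hT.trans e he).1
    refine ⟨⟨fun x hx => ?_, ?_⟩, rfl⟩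
    · simp only [(h₁ x (mem_bagL.2 hx)).1]
      exact hok x (by rw [hb] at hx; exact Finset.mem_of_mem_erase hx)
    · rw [hk]
      refine ⟨he, ⟨fun x hx => (h₁ x (mem_bagL.2 hx)).1, fun x hx y hy => ?_⟩, fun h => ?_,
        fun h => ?_⟩
      · simp only [(h₁ x (mem_bagL.2 hx)).2, (h₁ y (mem_bagL.2 hy)).2]
      · simp only [mem_bagL] at h₃
        simp only [h₃, if_pos h, add_zero]
      · simp only [mem_bagL] at h₃
        simp only [h₃, if_neg h]

end RAM

theorem Relation.eqvGen_bind {α : Type} {r r' : α → α → Prop}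
    (h : ∀ x y, r x y → Relation.EqvGen r' x y) {x y : α} (hxy : Relation.EqvGen r x y) :
    Relation.EqvGen r' x y := by
  induction hxy with
  | rel x y hr => exact h _ _ hr
  | refl x => exact .refl x
  | symm x y _ ih => exact ih.symm
  | trans x y z _ _ ih1 ih2 => exact ih1.trans _ _ _ ih2

namespace RAM

open NiceTreeDecomposition

variable {n N : ℕ} {G : SimpleGraph (Fin n)} {D : NiceTreeDecomposition G (Fin N)} {k : ℕ}
  {F : Finset (Fin n)} {d : Fin n → Fin n → ℝ≥0} {σ₀ σ : State} {r : ℝ} {t : Fin N}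

/-! ### Join nodes -/

/-- The linked list with the head `h` and the links `nx` consists of the members of a list; the
number `e` is represented by `e + 1`, and `0` stands for the end of the list. -/
def IsChain (nx : ℕ → ℕ) : ℕ → List ℕ → Prop
  | h, [] => h = 0
  | h, e :: l => h = e + 1 ∧ IsChain nx (nx e) l

theorem IsChain.congr {nx nx' : ℕ → ℕ} : ∀ {l : List ℕ} {h : ℕ}, IsChain nx h l →
    (∀ e ∈ l, nx' e = nx e) → IsChain nx' h l
  | [], _, h, _ => h
  | e :: l, _, ⟨h1, h2⟩, h => ⟨h1, by
      rw [h e (by simp)]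
      exact h2.congr fun x hx => h x (by simp [hx])⟩

theorem IsChain.pos_iff {nx : ℕ → ℕ} : ∀ {l : List ℕ} {h : ℕ}, IsChain nx h l → (1 ≤ h ↔ l ≠ [])
  | [], _, h => by simp [show _ = 0 from h]
  | e :: l, _, ⟨h1, _⟩ => by simp [h1]

/-- The first `m` entries of the node `s` with the colour code `x`, in reverse order. -/
def group (σ₀ : State) (s : Fin N) (x m : ℕ) : List ℕ :=
  ((List.range' (σ₀.arr aStart s) m).filter fun e => σ₀.arr aColCode e = x).reverse

theorem group_succ (σ₀ : State) (s : Fin N) (x m : ℕ) :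
    group σ₀ s x (m + 1) = if σ₀.arr aColCode (σ₀.arr aStart s + m) = x then
      (σ₀.arr aStart s + m) :: group σ₀ s x m else group σ₀ s x m := by
  unfold group
  rw [List.range'_1_concat, List.filter_append]
  split_ifs with h <;> simp [h]

theorem mem_group {σ₀ : State} {s : Fin N} {x m e : ℕ} : e ∈ group σ₀ s x m ↔
    (σ₀.arr aStart s ≤ e ∧ e < σ₀.arr aStart s + m) ∧ σ₀.arr aColCode e = x := by
  simp [group, List.mem_range'_1]

theorem mem_full_group {σ₀ : State} {s : Fin N} (h : σ₀.arr aStart s ≤ σ₀.arr aEnd s) {x e : ℕ} :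
    e ∈ group σ₀ s x (σ₀.arr aEnd s - σ₀.arr aStart s) ↔ Tab σ₀ s e ∧ σ₀.arr aColCode e = x := by
  rw [mem_group, Tab, Nat.add_sub_cancel' h]

theorem Table.col_lt (h : Table D F d r σ₀ t) {e : ℕ} (he : Tab σ₀ t e) {v : Fin n}
    (hv : v ∈ D.bag t) : (ent n σ₀ e).col v < n + 1 := ((h.trans e he).1 v hv).lt

/-- Entries have equal colour codes if and only if they have equal colours. -/
theorem Table.colCode_eq_iff {s s' : Fin N} (h : Table D F d r σ₀ s) (h' : Table D F d r σ₀ s')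
    (hb : D.bag s = D.bag s') {e e' : ℕ} (he : Tab σ₀ s e) (he' : Tab σ₀ s' e') :
    σ₀.arr aColCode e = σ₀.arr aColCode e' ↔
      ∀ v ∈ D.bag s, (ent n σ₀ e).col v = (ent n σ₀ e').col v := by
  have hL : bagL D s = bagL D s' := by unfold bagL; rw [hb]
  rw [h.colCode e he, h'.colCode e' he', ← hL]
  constructor
  · intro heq v hv
    rcases Nat.eq_zero_or_pos n with rfl | hn
    · exact v.elim0
    · have := Nat.ofDigits_inj_of_len_eq (by omega) (by simp) (fun x hx => ?_) (fun x hx => ?_) heq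
      · exact List.map_inj_left.1 this v (mem_bagL.2 hv)
      · obtain ⟨u, hu, rfl⟩ := List.mem_map.1 hx
        exact h.col_lt he (mem_bagL.1 hu)
      · obtain ⟨u, hu, rfl⟩ := List.mem_map.1 hx
        exact h'.col_lt he' (hb ▸ mem_bagL.1 hu)
  · intro heq
    rw [List.map_congr_left fun v hv => heq v (mem_bagL.1 hv)]

/-- Keeps the list heads written at a join node inside the address range of this node. -/
theorem Table.colCode_lt (h : Table D F d r σ₀ t) {e : ℕ} (he : Tab σ₀ t e) :
    σ₀.arr aColCode e < (n + 1) ^ (2 * (D.width + 1)) := by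
  rw [h.colCode e he]
  rcases Nat.eq_zero_or_pos n with rfl | hn
  · have : bagL D t = [] := List.eq_nil_iff_forall_not_mem.2 fun v => v.elim0
    simp [this]
  · refine lt_of_lt_of_le (Nat.ofDigits_lt_base_pow_length (b := n + 1) (by omega) ?_) ?_
    · intro x hx
      obtain ⟨u, hu, rfl⟩ := List.mem_map.1 hx
      have := h.col_lt he (mem_bagL.1 hu)
      exact this
    · have := length_bagL_le D t
      rw [List.length_map]
      exact Nat.pow_le_pow_right (by omega) (by omega)

/-- Entries with one colour code have equal colours on the bag, so by `Table.inj` their partitions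
differ. This bounds the partners of an entry at a join node and is the source of the second Bell
factor. -/
theorem Table.length_group_le (h : Table D F d r σ₀ t) (x : ℕ) :
    (group σ₀ t x (σ₀.arr aEnd t - σ₀.arr aStart t)).length ≤ Nat.bell (bagL D t).length := by
  have hnd : (group σ₀ t x (σ₀.arr aEnd t - σ₀.arr aStart t)).Nodup := by
    refine List.nodup_reverse.2 (List.Nodup.filter _ ?_)
    exact List.nodup_range' (step := 1) (by decide)
  rw [← List.toFinset_card_of_nodup hnd, length_bagL]
  refine card_labelings_le_bell (fun e => (ent n σ₀ e).lab) (D.bag t) _ fun i hi j hj hij => ?_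
  rw [List.mem_toFinset, mem_full_group h.le] at hi hj
  exact h.inj i j hi.1 hj.1
    ⟨(h.colCode_eq_iff h rfl hi.1 hj.1).1 (hi.2.trans hj.2.symm), hij⟩

/-- Sort the entries of the second child by their colours. -/
def Program.chains : Program :=
  (.setVar vS2 (.get aStart (.var vC2)) ;;
    .setVar vL2 (.sub (.get aEnd (.var vC2)) (.var vS2))) ;;
  .for vI2 vL2 ((.setVar vE2 (.add (.var vS2) (.var vI2)) ;;
    .setVar vMp (.add (.var vOff) (.get aColCode (.var vE2)))) ;;
    (.setArr aNext (.var vE2) (.get aHead (.var vMp)) ;;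
    .setArr aHead (.var vMp) (.add (.var vE2) (.const 1))))

/-- Each entry is pushed to the front of the list for its colour code. Older links are untouched
because the new entry has a larger number, and beyond the address range of the node the heads stay
zero. -/
theorem runs_chains {s : Fin N} (hs : σ₀.var vC2 = s) (hT : Table D F d r σ₀ s)
    (h0 : ∀ x, σ₀.var vOff ≤ x → σ₀.arr aHead x = 0) :
    Runs .chains σ₀ ((σ₀.arr aEnd s - σ₀.arr aStart s) * 40 + 20) fun τ =>
      (∀ x, IsChain (τ.arr aNext) (τ.arr aHead (σ₀.var vOff + x))
        (group σ₀ s x (σ₀.arr aEnd s - σ₀.arr aStart s))) ∧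
      ∀ x, σ₀.var vOff + (n + 1) ^ (2 * (D.width + 1)) ≤ x → τ.arr aHead x = 0 := by
  refine Runs.le (Runs.seq (B := 9) (B' := (σ₀.arr aEnd s - σ₀.arr aStart s) * (20 + 8) + 6)
    (Q := fun τ => τ = (σ₀.setVar vS2 (σ₀.arr aStart s)).setVar vL2
    (σ₀.arr aEnd s - σ₀.arr aStart s))
    ((Runs.straight rfl (by simp [hs])).le (by decide)) ?_) (by omega)
  rintro σ₁ rfl -
  refine Runs.for (σ₀.arr aEnd s - σ₀.arr aStart s) (fun i τ =>
      (∀ x, IsChain (τ.arr aNext) (τ.arr aHead (σ₀.var vOff + x)) (group σ₀ s x i)) ∧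
      ∀ x, σ₀.var vOff + (n + 1) ^ (2 * (D.width + 1)) ≤ x → τ.arr aHead x = 0)
    (by decide) (by decide) (by decide) (by simp) ?_ ?_
  · refine ⟨fun x => ?_, fun x hx => ?_⟩
    · simpa [group, IsChain] using h0 _ (by omega)
    · simpa using h0 x (by omega)
  · intro i τ hi ⟨h1, h2⟩ hx hF
    have e1 : τ.var vS2 = σ₀.arr aStart s := by rw [hF.var_eq _ (by decide)]; simp
    have e2 : τ.var vOff = σ₀.var vOff := by rw [hF.var_eq _ (by decide)]; simp
    have e3 : τ.arr aColCode = σ₀.arr aColCode := by rw [hF.arr_eq _ (by decide)]; simp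
    have hle := hT.le
    have htab : Tab σ₀ s (σ₀.arr aStart s + i) := ⟨by omega, by omega⟩
    have hlt := hT.colCode_lt htab
    set e := σ₀.arr aStart s + i with he
    set y := σ₀.arr aColCode e with hy
    refine Runs.le (Runs.seq (B := 9) (B' := 10) (Q := fun ρ => ρ = (τ.setVar vE2 e).setVar vMp
      (σ₀.var vOff + y)) ((Runs.straight rfl (by simp [e1, e2, e3, hx, ← he, ← hy])).le (by decide))
      ?_) (by omega)
    rintro _ rfl -
    refine (Runs.straight rfl ?_).le (by decide)
    simp only [Program.den, Expr.eval, State.var_setVar, State.var_setArr, State.arr_setArr,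
      State.arr_setVar]
    norm_num
    refine ⟨fun x => ?_, fun x hx => ?_⟩
    · rw [group_succ, ← he, ← hy]
      by_cases hxy : y = x
      · subst hxy
        rw [if_pos rfl, Function.update_self]
        refine ⟨rfl, ?_⟩
        rw [Function.update_self]
        exact (h1 y).congr fun z hz => Function.update_of_ne (by
          have := (mem_group.1 hz).1.2; omega) _ _
      · rw [if_neg hxy, Function.update_of_ne (by omega)]
        exact (h1 x).congr fun z hz => Function.update_of_ne (by
          have := (mem_group.1 hz).1.2; omega) _ _
    · rw [Function.update_of_ne (by omega)]
      exact h2 x hx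

/-- Merge the labels of the candidate along the labels of the entry with the address `vP2`. -/
def Program.mergeLabels : Program :=
  .forBag vJ vV ((.setVar vLa (.get aXLab (.var vV)) ;;
    .setVar vLb (.get aXLab (.get aLab (.add (.var vP2) (.var vV))))) ;; .relabel)

/-- The label of the second entry at v is itself a vertex u in the block of v. Joining every v to
its u links each block of the second partition as a star, so one pass of |L| relabellings generates
the join of the two partitions. -/
theorem runs_mergeLabels {B : Finset (Fin n)} {L : List (Fin n)} (hB : ∀ v, v ∈ L ↔ v ∈ B)
    {l₁ l₂ : Fin n → ℕ} (hL : BagLoaded L σ)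
    (h₁ : ∀ v ∈ L, σ.arr aXLab v = l₁ v)
    (h₂ : ∀ v ∈ L, σ.arr aLab (σ.var vP2 + v) = l₂ v)
    (hrep : ∀ v ∈ L, ∃ u ∈ L, l₂ v = u ∧ l₂ u = l₂ v) :
    Runs .mergeLabels σ (L.length * (L.length * 33 + 30) + 6) fun τ =>
      ∀ x ∈ L, ∀ y ∈ L, τ.arr aXLab x = τ.arr aXLab y ↔
        Relation.EqvGen (fun a b => a ∈ B ∧ b ∈ B ∧ (l₁ a = l₁ b ∨ l₂ a = l₂ b)) x y := by
  have h0 : ∀ x ∈ L, ∀ y ∈ L, l₁ x = l₁ y ↔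
      Relation.EqvGen (fun a b => a ∈ B ∧ b ∈ B ∧ l₁ a = l₁ b) x y := by
    intro x hx y hy
    refine ⟨fun h => .rel _ _ ⟨(hB _).1 hx, (hB _).1 hy, h⟩, fun h => ?_⟩
    clear hx hy
    induction h with
    | rel x y h => exact h.2.2
    | refl x => rfl
    | symm x y _ ih => exact ih.symm
    | trans x y z _ _ ih1 ih2 => exact ih1.trans ih2
  refine Runs.mono (B := L.length * (11 + (L.length * 33 + 6) + 13) + 6)
    (Runs.forBag hL (fun pre τ => ∀ x ∈ L, ∀ y ∈ L, τ.arr aXLab x = τ.arr aXLab y ↔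
      Relation.EqvGen (fun a b => a ∈ B ∧ b ∈ B ∧ (l₁ a = l₁ b ∨ (a ∈ pre ∧ l₂ a = b))) x y)
      ?_ ?_ ?_ ?_ ?_) ?_ ?_
  · decide
  · exact fun _ _ _ h => h
  · exact fun _ _ _ h => h
  · intro x hx y hy
    rw [h₁ x hx, h₁ y hy, h0 x hx y hy]
    simp
  · intro pre v post τ hsplit ih hv hF
    have hvL : v ∈ L := by simp [hsplit]
    obtain ⟨u, hu, hvu, -⟩ := hrep v hvL
    have e1 : τ.arr aLab (τ.var vP2 + v) = u := by
      rw [hF.var_eq _ (by decide), hF.arr_eq _ (by decide), h₂ v hvL, hvu]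
    refine Runs.seq (Q := fun ρ => ρ = (τ.setVar vLa (τ.arr aXLab v)).setVar vLb (τ.arr aXLab u))
      ((Runs.straight rfl (by simp [hv, e1])).le (by decide)) ?_
    rintro τ' hτ' hF'
    have hL' : BagLoaded L τ' := (hL.congr (hF.var_eq _ (by decide)) (hF.var_eq _ (by decide))
      (hF.arr_eq _ (by decide))).congr (hF'.var_eq _ (by decide)) (hF'.var_eq _ (by decide))
      (hF'.arr_eq _ (by decide))
    refine (runs_relabel hL').imp fun ρ hρ _ x hx y hy => ?_
    have h3 : τ'.arr aXLab = τ.arr aXLab := hF'.arr_eq _ (by decide)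
    rw [h3, show τ'.var vLa = τ.arr aXLab v by rw [hτ']; simp,
      show τ'.var vLb = τ.arr aXLab u by rw [hτ']; simp] at hρ
    rw [relabel_iff (l := fun x : Fin n => τ.arr aXLab x) (l' := fun x : Fin n => ρ.arr aXLab x)
      (u := v) (v := u) hρ hx hy, ih x hx y hy, ih x hx v hvL, ih u hu y hy, ih x hx u hu,
      ih v hvL y hy]
    refine (Relation.eqvGen_insert_iff (fun a b => ?_) x y).symm
    constructor
    · rintro ⟨h1, h2, h3 | ⟨h3, h4⟩⟩
      · exact Or.inl ⟨h1, h2, Or.inl h3⟩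
      · rcases List.mem_append.1 h3 with h5 | h5
        · exact Or.inl ⟨h1, h2, Or.inr ⟨h5, h4⟩⟩
        · rw [List.mem_singleton] at h5
          subst h5
          exact Or.inr ⟨rfl, Fin.ext (h4.symm.trans hvu)⟩
    · rintro (⟨h1, h2, h3 | ⟨h3, h4⟩⟩ | ⟨rfl, rfl⟩)
      · exact ⟨h1, h2, Or.inl h3⟩
      · exact ⟨h1, h2, Or.inr ⟨by simp [h3], h4⟩⟩
      · exact ⟨(hB _).1 hvL, (hB _).1 hu, Or.inr ⟨by simp, hvu⟩⟩
  · rw [show 11 + (L.length * 33 + 6) + 13 = L.length * 33 + 30 by ring]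
  · intro τ hτ _ x hx y hy
    rw [hτ x hx y hy]
    constructor
    · refine Relation.eqvGen_imp ?_
      rintro a b ⟨h1, h2, h3 | ⟨h3, h4⟩⟩
      · exact ⟨h1, h2, Or.inl h3⟩
      · obtain ⟨u, hu, hau, hu'⟩ := hrep a h3
        obtain rfl : b = u := Fin.ext (h4.symm.trans hau)
        exact ⟨h1, h2, Or.inr hu'.symm⟩
    · refine Relation.eqvGen_bind ?_
      rintro a b ⟨h1, h2, h3 | h3⟩
      · exact .rel _ _ ⟨h1, h2, Or.inl h3⟩
      · obtain ⟨u, hu, hau, -⟩ := hrep a ((hB _).2 h1)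
        exact (Relation.EqvGen.rel a u ⟨h1, (hB _).1 hu, Or.inr ⟨(hB _).2 h1, hau⟩⟩).trans _ _ _
          ((Relation.EqvGen.rel b u ⟨h2, (hB _).1 hu, Or.inr ⟨(hB _).2 h2, h3 ▸ hau⟩⟩).symm)

def Program.joinStep : Program :=
  (.setVar vE2 (.sub (.var vH) (.const 1)) ;; .setVar vP2 (.get aPtr (.var vE2))) ;; .copy ;;
    (.setVar vCost (.add (.get aCost (.var vE1)) (.get aCost (.var vE2))) ;;
      .setVar vX1 (.var vE1) ;; .setVar vX2 (.var vE2)) ;;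
    .mergeLabels ;; .insert ;; .setVar vH (.get aNext (.var vE2))

def Program.joinNode : Program :=
  .chains ;; .forEntries (.setVar vH (.get aHead (.add (.var vOff) (.get aColCode (.var vE1)))) ;;
    .loop (.le (.const 1) (.var vH)) .joinStep)

/-- Equal colour codes supply the equality of colours that `Trans` demands of a pair of entries. The
second postcondition moves on to the next member of the list. -/
theorem runs_joinStep (hS : NodeStart D k F d r t σ₀) {s₁ s₂ : Fin N}
    (hk : D.kind t = .join s₁ s₂) {S S' : Ent (Fin n) → Prop} {e e' : ℕ}
    (he : Tab σ₀ s₁ e) (he' : Tab σ₀ s₂ e') (hcc : σ₀.arr aColCode e = σ₀.arr aColCode e')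
    (hA : Agree σ₀ σ) (hB : Building (bagL D t) σ₀ S σ) (hE : σ.var vE1 = e)
    (hP : σ.var vP1 = e * n) (hH : σ.var vH = e' + 1)
    (h₁ : ∀ c, S c → S' c)
    (h₂ : ∀ c, Cand D F d r σ₀ t c → c.b1 = e → c.b2 = e' → S' c)
    (h₃ : ∀ c, S' c → S c ∨ Cand D F d r σ₀ t c ∧ c.b1 = e ∧ c.b2 = e') :
    Runs .joinStep σ (stepTime (bagL D t).length) fun ρ => Building (bagL D t) σ₀ S' ρ ∧
      ρ.var vH = σ.arr aNext e' := by
  have hT₁ := hS.table s₁ ((child_join hk).2 (Or.inl rfl))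
  have hT₂ := hS.table s₂ ((child_join hk).2 (Or.inr rfl))
  obtain ⟨-, hb₁, hb₂⟩ := bag_join hk
  have hcol := (hT₁.colCode_eq_iff hT₂ (hb₁.trans hb₂.symm) he he').1 hcc
  have hcnt := hB.cnt_le
  have hlt : e < σ₀.var vCnt := lt_of_lt_of_le he.2 hT₁.le_cnt
  have hlt' : e' < σ₀.var vCnt := lt_of_lt_of_le he'.2 hT₂.le_cnt
  have hent := (hB.old e hlt).1
  have hent' := (hB.old e' hlt').1
  refine Runs.le (Runs.seq (B := 7) (B' := (bagL D t).length * 30 + 6 + (11 +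
    ((bagL D t).length * ((bagL D t).length * 33 + 30) + 6 +
      (insertTime (bagL D t).length + 3)))) (Q := fun τ => τ = (σ.setVar vE2 e').setVar vP2
      (e' * n)) ((Runs.straight rfl (by simp [hH, hB.ptr e' (by omega)])).le (by decide)) ?_) ?_
  swap
  · unfold stepTime; nlinarith
  rintro τ₁ hτ₁ hF₁
  have hA₁ : Agree σ₀ τ₁ := hA.frame hF₁ (by decide)
  have hP₁ : τ₁.var vP1 = e * n := by rw [hF₁.var_eq _ (by decide), hP]
  refine Runs.seq (runs_copy (hA₁.bag hS.bag) hP₁) fun τ₂ h₂' hF₂ => ?_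
  have hA₂ : Agree σ₀ τ₂ := hA₁.frame hF₂ (by decide)
  have hB₂ : Building (bagL D t) σ₀ S τ₂ := (hB.frame hF₁ (by decide)).frame hF₂ (by decide)
  have hent₁ : ent n τ₁ e = ent n σ₀ e := ((hB.frame hF₁ (by decide)).old e hlt).1
  have hent₂ : ent n τ₂ e = ent n σ₀ e := (hB₂.old e hlt).1
  have hent₂' : ent n τ₂ e' = ent n σ₀ e' := (hB₂.old e' hlt').1
  rw [hent₁] at h₂'
  have hE₂ : τ₂.var vE1 = e := by rw [hF₂.var_eq _ (by decide), hF₁.var_eq _ (by decide), hE]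
  have hE₂' : τ₂.var vE2 = e' := by rw [hF₂.var_eq _ (by decide), hτ₁]; simp
  have hP₂ : τ₂.var vP2 = e' * n := by rw [hF₂.var_eq _ (by decide), hτ₁]; simp
  have hc₂ : τ₂.arr aCost e = (ent n σ₀ e).cost := by rw [← hent₂]; rfl
  have hc₂' : τ₂.arr aCost e' = (ent n σ₀ e').cost := by rw [← hent₂']; rfl
  refine Runs.seq (Q := fun ρ => cand n ρ = ⟨(cand n τ₂).col, (cand n τ₂).lab,
      (ent n σ₀ e).cost + (ent n σ₀ e').cost, e, e'⟩)
    ((Runs.straight rfl (by simp [cand, hE₂, hE₂', hc₂, hc₂'])).le (by decide)) fun τ₃ h₃' hF₃ => ?_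
  have hA₃ : Agree σ₀ τ₃ := hA₂.frame hF₃ (by decide)
  have hB₃ : Building (bagL D t) σ₀ S τ₃ := hB₂.frame hF₃ (by decide)
  have hent₃' : ent n τ₃ e' = ent n σ₀ e' := (hB₃.old e' hlt').1
  have hP₃ : τ₃.var vP2 = e' * n := by rw [hF₃.var_eq _ (by decide), hP₂]
  refine Runs.seq (runs_mergeLabels (B := D.bag t) (fun v => mem_bagL) (l₁ := (ent n σ₀ e).lab)
    (l₂ := (ent n σ₀ e').lab) (hA₃.bag hS.bag) (fun v hv => ?_) (fun v hv => ?_) fun v hv => ?_)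
    fun τ₄ h₄ hF₄ => ?_
  · rw [← (h₂' v hv).2]
    exact congrFun (congrArg Ent.lab h₃') v
  · rw [hP₃, ← hent₃']; rfl
  · rw [mem_bagL, ← hb₂] at hv
    obtain ⟨u, hu, h⟩ := hT₂.lab e' he' v hv
    exact ⟨u, mem_bagL.2 (hb₂ ▸ hu), h⟩
  have hA₄ : Agree σ₀ τ₄ := hA₃.frame hF₄ (by decide)
  have hB₄ : Building (bagL D t) σ₀ S τ₄ := hB₃.frame hF₄ (by decide)
  have hc₄ : cand n τ₄ = ⟨(cand n τ₂).col, (cand n τ₄).lab,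
      (ent n σ₀ e).cost + (ent n σ₀ e').cost, e, e'⟩ := by
    have g : cand n τ₄ = ⟨(cand n τ₃).col, (cand n τ₄).lab, (cand n τ₃).cost, (cand n τ₃).b1,
        (cand n τ₃).b2⟩ := by
      simp only [cand, Ent.mk.injEq]
      rw [hF₄.arr_eq _ (by decide), hF₄.var_eq _ (by decide), hF₄.var_eq _ (by decide),
        hF₄.var_eq _ (by decide)]
      simp
    rw [g, h₃']
  have hcand : Cand D F d r σ₀ t (cand n τ₄) := by
    rw [hc₄]
    have hok := (hT₁.trans e he).1
    refine ⟨fun x hx => ?_, ?_⟩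
    · simp only [(h₂' x (mem_bagL.2 hx)).1]
      exact hok x (hb₁ ▸ hx)
    · rw [hk]
      refine ⟨he, he', fun x hx => (h₂' x (mem_bagL.2 hx)).1, fun x hx => ?_,
        fun x hx y hy => ?_, rfl⟩
      · simp only [(h₂' x (mem_bagL.2 hx)).1]
        exact hcol x (hb₁ ▸ hx)
      · exact h₄ x (mem_bagL.2 hx) y (mem_bagL.2 hy)
  have hb1 : (cand n τ₄).b1 = e := by rw [hc₄]
  have hb2 : (cand n τ₄).b2 = e' := by rw [hc₄]
  refine Runs.seq (runs_insert_cand hS hA₄ hB₄ hcand h₁ (fun c hc => h₂ c (hcand.congr hc)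
    (hc.b1.trans hb1) (hc.b2.trans hb2)) ?_) fun τ₅ h₅ hF₅ => ?_
  · intro c hc
    rcases h₃ c hc with h | ⟨h, h', h''⟩
    · exact Or.inl h
    · have := hcand.sim h (hb1.trans h'.symm) (fun _ _ _ => hb2.trans h''.symm) (by simp [hk])
      exact Or.inr ⟨this.1, this.2.le⟩
  · refine (Runs.straight rfl ?_).le (by decide)
    refine ⟨h₅.congr (by simp) (by simp), ?_⟩
    have g1 : τ₅.var vE2 = e' := by
      rw [hF₅.var_eq _ (by decide), hF₄.var_eq _ (by decide), hF₃.var_eq _ (by decide), hE₂']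
    have g2 : τ₅.arr aNext = σ.arr aNext := by
      rw [hF₅.arr_eq _ (by decide), hF₄.arr_eq _ (by decide), hF₃.arr_eq _ (by decide),
        hF₂.arr_eq _ (by decide), hF₁.arr_eq _ (by decide)]
    simp [g1, g2]

/-- For each entry e only the list with the colours of e is searched. Nothing is lost, since `Trans`
forces equal colours, and the list has at most Bell many members. The heads written here are
reported so that they can be shown to vanish beyond the range of the node. -/
theorem runs_joinNode (hS : NodeStart D k F d r t σ₀) {s₁ s₂ : Fin N}
    (hk : D.kind t = .join s₁ s₂) :
    Runs .joinNode σ₀ ((σ₀.arr aEnd s₂ - σ₀.arr aStart s₂) * 40 + 20 +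
      ((σ₀.arr aEnd s₁ - σ₀.arr aStart s₁) *
      (6 + (Nat.bell (bagL D t).length * (stepTime (bagL D t).length + 3) + 3) + 20) + 20)) fun τ =>
      Building (bagL D t) σ₀ (Cand D F d r σ₀ t) τ ∧
      ∀ x, σ₀.var vOff + (n + 1) ^ (2 * (D.width + 1)) ≤ x → τ.arr aHead x = 0 := by
  have hT₁ := hS.table s₁ ((child_join hk).2 (Or.inl rfl))
  have hT₂ := hS.table s₂ ((child_join hk).2 (Or.inr rfl))
  obtain ⟨-, hb₁, hb₂⟩ := bag_join hk
  have hunf : ∀ {c}, Cand D F d r σ₀ t c → Tab σ₀ s₁ c.b1 ∧ Tab σ₀ s₂ c.b2 ∧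
      σ₀.arr aColCode c.b2 = σ₀.arr aColCode c.b1 := by
    intro c hc
    have := hc.2
    rw [hk] at this
    obtain ⟨g1, g2, g3, g4, -⟩ := this
    refine ⟨g1, g2, (hT₂.colCode_eq_iff hT₁ (hb₂.trans hb₁.symm) g2 g1).2 fun v hv => ?_⟩
    rw [← g4 v (hb₂ ▸ hv), ← g3 v (hb₂ ▸ hv)]
  refine Runs.seq (runs_chains (by rw [hS.c2, hk]; rfl) hT₂ hS.head) fun σ₁ ⟨hch, hhd⟩ hF₁ => ?_
  have hA₁ : Agree σ₀ σ₁ := (Agree.refl σ₀).frame hF₁ (by decide)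
  refine (runs_forEntries (s := s₁) (L := bagL D t)
    (H := fun τ => τ.arr aHead = σ₁.arr aHead ∧ τ.arr aNext = σ₁.arr aNext)
    (B := 6 + (Nat.bell (bagL D t).length * (stepTime (bagL D t).length + 3) + 3))
    (S := fun e c => Cand D F d r σ₀ t c ∧ c.b1 < e) hA₁
    (by rw [hF₁.var_eq _ (by decide), hS.c1, hk]; rfl) hT₁.le_cnt hT₁.le ?_ ⟨rfl, rfl⟩
    (fun _ _ _ _ h => h) (by decide) ?_).imp ?_
  · exact (hS.building.frame hF₁ (by decide)).imp fun c => ⟨fun h => h.elim, fun h => by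
      have := (hunf h.1).1.1; omega⟩
  · rintro e τ he hA hE hP hB ⟨hH1, hH2⟩
    have hcnt := hB.cnt_le
    have hlt : e < σ₀.var vCnt := lt_of_lt_of_le he.2 hT₁.le_cnt
    set l := group σ₀ s₂ (σ₀.arr aColCode e) (σ₀.arr aEnd s₂ - σ₀.arr aStart s₂) with hl
    have hlen : l.length ≤ Nat.bell (bagL D t).length := by
      have := hT₂.length_group_le (σ₀.arr aColCode e)
      rwa [show bagL D s₂ = bagL D t by unfold bagL; rw [hb₂]] at this
    have hch' : IsChain (τ.arr aNext) (τ.arr aHead (τ.var vOff + τ.arr aColCode e)) l := by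
      rw [hH1, hH2, hB.off, (hB.old e hlt).2]
      exact hch _
    refine Runs.seq (Q := fun ρ => ρ = τ.setVar vH (τ.arr aHead (τ.var vOff + τ.arr aColCode e)))
      ((Runs.straight rfl (by simp [hE])).le (by decide)) ?_
    rintro τ₁ hτ₁ hF₂
    have hA₂ : Agree σ₀ τ₁ := hA.frame hF₂ (by decide)
    have hE₂ : τ₁.var vE1 = e := by rw [hF₂.var_eq _ (by decide), hE]
    have hP₂ : τ₁.var vP1 = e * n := by rw [hF₂.var_eq _ (by decide), hP]
    have hN₂ : τ₁.arr aNext = τ.arr aNext := hF₂.arr_eq _ (by decide)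
    refine Runs.mono (B := l.length * (stepTime (bagL D t).length + 3) + 3) (Runs.loop l.length
      (fun i ρ => Building (bagL D t) σ₀ (fun c => Cand D F d r σ₀ t c ∧
        (c.b1 < e ∨ (c.b1 = e ∧ c.b2 ∈ l.take i))) ρ ∧
        IsChain (τ.arr aNext) (ρ.var vH) (l.drop i)) ?_ ?_ ?_) (by gcongr) ?_
    · rintro i ρ hi ⟨-, h⟩
      simp only [Test.Holds, Expr.eval, h.pos_iff, ne_eq, List.drop_eq_nil_iff, not_le]
    · refine ⟨(hB.frame hF₂ (by decide)).imp fun c => by simp, ?_⟩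
      rw [hτ₁]
      simpa using hch'
    · rintro i ρ hi ⟨hBρ, hcρ⟩ hF₃
      have hA₃ : Agree σ₀ ρ := hA₂.frame hF₃ (by decide)
      rw [List.drop_eq_getElem_cons hi] at hcρ
      obtain ⟨hmem, hcc⟩ := (mem_full_group hT₂.le).1 (List.getElem_mem hi)
      refine (runs_joinStep hS hk he hmem hcc.symm hA₃ hBρ (by rw [hF₃.var_eq _ (by decide), hE₂])
        (by rw [hF₃.var_eq _ (by decide), hP₂]) hcρ.1 (S' := fun c => Cand D F d r σ₀ t c ∧
        (c.b1 < e ∨ (c.b1 = e ∧ c.b2 ∈ l.take (i + 1)))) ?_ ?_ ?_).imp ?_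
      · rintro c ⟨h1, h2 | ⟨h2, h3⟩⟩
        · exact ⟨h1, Or.inl h2⟩
        · refine ⟨h1, Or.inr ⟨h2, ?_⟩⟩
          rw [← List.take_append_getElem hi]
          exact List.mem_append_left _ h3
      · intro c h1 h2 h3
        refine ⟨h1, Or.inr ⟨h2, ?_⟩⟩
        rw [← List.take_append_getElem hi, h3]
        exact List.mem_append_right _ (List.mem_singleton_self _)
      · rintro c ⟨h1, h2 | ⟨h2, h3⟩⟩
        · exact Or.inl ⟨h1, Or.inl h2⟩
        · rw [← List.take_append_getElem hi, List.mem_append, List.mem_singleton] at h3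
          rcases h3 with h3 | h3
          · exact Or.inl ⟨h1, Or.inr ⟨h2, h3⟩⟩
          · exact Or.inr ⟨h1, h2, h3⟩
      · rintro ρ' ⟨h1, h2⟩ -
        refine ⟨h1, ?_⟩
        rw [h2, hF₃.arr_eq _ (by decide), hN₂]
        exact hcρ.2
    · rintro ρ ⟨h1, -⟩ hF₃
      refine ⟨h1.imp fun c => ?_, ?_, ?_⟩
      · rw [List.take_length]
        constructor
        · rintro ⟨h2, h3 | ⟨h3, -⟩⟩
          · exact ⟨h2, by omega⟩
          · exact ⟨h2, by omega⟩
        · rintro ⟨h2, h3⟩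
          refine ⟨h2, ?_⟩
          by_cases h : c.b1 < e
          · exact Or.inl h
          · have hce : c.b1 = e := by omega
            obtain ⟨-, g1, g2⟩ := hunf h2
            exact Or.inr ⟨hce, (mem_full_group hT₂.le).2 ⟨g1, hce ▸ g2⟩⟩
      · rw [hF₃.arr_eq _ (by decide), hF₂.arr_eq _ (by decide), hH1]
      · rw [hF₃.arr_eq _ (by decide), hF₂.arr_eq _ (by decide), hH2]
  · rintro τ ⟨hτ, h, -⟩ -
    exact ⟨hτ.imp fun c => ⟨fun h => h.1, fun h => ⟨h, (hunf h).1.2⟩⟩, by rw [h]; exact hhd⟩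

end RAM

namespace RAM

open NiceTreeDecomposition

variable {n N : ℕ} {G : SimpleGraph (Fin n)} {D : NiceTreeDecomposition G (Fin N)} {k : ℕ}
  {F : Finset (Fin n)} {d : Fin n → Fin n → ℝ≥0} {σ₀ σ : State} {r : ℝ} {t : Fin N}

/-! ### The table of a node -/

/-- Bounds the addresses used by one node: after the offset has moved on by `vStep`, the next node
finds untouched cells. -/
theorem codeOf_lt {L : List (Fin n)} {c : Ent (Fin n)} (hc : ∀ v ∈ L, c.col v < n + 1) {W : ℕ}
    (hL : L.length ≤ W) : codeOf L c < (n + 1) ^ (2 * W) := by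
  unfold codeOf
  rcases Nat.eq_zero_or_pos n with rfl | hn
  · have : L = [] := List.eq_nil_iff_forall_not_mem.2 fun v => v.elim0
    simp [this, key]
  · refine lt_of_lt_of_le (Nat.ofDigits_lt_base_pow_length (b := n + 1) (by omega) (key_lt hc)) ?_
    rw [length_key]
    exact Nat.pow_le_pow_right (by omega) (by omega)

/-- Tables are not affected by the construction of other tables. -/
theorem Table.stable {s : Fin N} {τ : State} (h : Table D F d r σ s)
    (hch : ∀ s', D.Child s s' → Table D F d r σ s')
    (hst : ∀ s', s' = s ∨ D.Child s s' →
      τ.arr aStart s' = σ.arr aStart s' ∧ τ.arr aEnd s' = σ.arr aEnd s')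
    (hent : ∀ e < σ.var vCnt, ent n τ e = ent n σ e ∧ τ.arr aColCode e = σ.arr aColCode e)
    (hcnt : σ.var vCnt ≤ τ.var vCnt) : Table D F d r τ s := by
  have hT : ∀ s', s' = s ∨ D.Child s s' → ∀ e, Tab τ s' e ↔ Tab σ s' e := fun s' hs' e => by
    unfold Tab; rw [(hst s' hs').1, (hst s' hs').2]
  have hlt : ∀ s', s' = s ∨ D.Child s s' → ∀ e, Tab σ s' e → e < σ.var vCnt := by
    rintro s' (rfl | hs') e he
    · exact lt_of_lt_of_le he.2 h.le_cnt
    · exact lt_of_lt_of_le he.2 (hch s' hs').le_cnt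
  have hE : ∀ s', s' = s ∨ D.Child s s' → ∀ e, Tab σ s' e → ent n τ e = ent n σ e :=
    fun s' hs' e he => (hent e (hlt s' hs' e he)).1
  have hTs := hT s (Or.inl rfl)
  have hEs := hE s (Or.inl rfl)
  obtain ⟨g1, g2⟩ := hst s (Or.inl rfl)
  constructor
  · rw [g1, g2]; exact h.le
  · rw [g2]; exact h.le_cnt.trans hcnt
  · intro e he
    rw [hTs] at he
    rw [hEs e he]
    exact (h.trans e he).congr_table fun s' hs' e' he' =>
      ⟨(hT s' (Or.inr hs') e').2 he', (hE s' (Or.inr hs') e' he').symm⟩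
  · intro c hc
    obtain ⟨e, he, h1, h2⟩ := h.complete c (hc.congr_table fun s' hs' e' he' => by
      rw [hT s' (Or.inr hs')] at he'
      exact ⟨he', hE s' (Or.inr hs') e' he'⟩)
    exact ⟨e, (hTs e).2 he, by rw [hEs e he]; exact h1, by rw [hEs e he]; exact h2⟩
  · intro e he
    rw [hTs] at he
    rw [hEs e he]
    exact h.lab e he
  · intro e he
    rw [hTs] at he
    rw [hEs e he, (hent e (hlt s (Or.inl rfl) e he)).2]
    exact h.colCode e he
  · intro e e' he he'
    rw [hTs] at he he'
    rw [hEs e he, hEs e' he']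
    exact h.inj e e' he he'

/-- The number of entries of a table. -/
theorem Table.card_le (h : Table D F d r σ t) : σ.arr aEnd t - σ.arr aStart t ≤
    F.card ^ (bagL D t).length * Nat.bell (bagL D t).length := by
  classical
  rw [length_bagL, ← Nat.card_Ico]
  let X := Finset.Ico (σ.arr aStart t) (σ.arr aEnd t)
  -- Group the entries by their colours on the bag. There are at most |F|^m groups for a bag of m
  -- vertices, and within a group the partitions are pairwise different.
  let g : ℕ → ((v : Fin n) → v ∈ D.bag t → ℕ) := fun e v _ => (ent n σ e).col v
  have hX : ∀ e ∈ X, Tab σ t e := fun e he => Finset.mem_Ico.1 he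
  have hg : ∀ e ∈ X, g e ∈ (D.bag t).pi fun _ => F.image Fin.val := fun e he => by
    rw [Finset.mem_pi]
    intro v hv
    obtain ⟨c, hc, hc', -⟩ := (h.trans e (hX e he)).1 v hv
    exact Finset.mem_image.2 ⟨c, hc, hc'⟩
  have hcard : ((D.bag t).pi fun _ => F.image Fin.val).card = F.card ^ (D.bag t).card := by
    rw [Finset.card_pi, Finset.prod_const, Finset.card_image_of_injective _ Fin.val_injective]
  change X.card ≤ _
  rw [Finset.card_eq_sum_card_fiberwise hg, ← hcard, ← smul_eq_mul]
  refine Finset.sum_le_card_nsmul _ _ _ fun y _ => ?_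
  refine card_labelings_le_bell (fun e => (ent n σ e).lab) (D.bag t) _ fun i hi j hj hij => ?_
  rw [Finset.mem_filter] at hi hj
  refine h.inj i j (hX i hi.1) (hX j hj.1) ⟨fun v hv => ?_, hij⟩
  exact congrFun (congrFun (hi.2.trans hj.2.symm) v) hv

variable (D k F d) in
/-- The invariant of the dynamic program for the threshold `r`: the tables of the nodes in `done`
are complete. -/
structure Progress (r : ℝ) (done : Fin N → Prop) (σ : State) : Prop where
  env : Env D k F d σ
  th : σ.real rSort (σ.var vTh) = r
  cur : σ.var vCur = σ.var vCnt * n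
  ptr : ∀ e < σ.var vCnt, σ.arr aPtr e = e * n
  idx : ∀ x, σ.var vOff ≤ x → σ.arr aIdx x = 0
  head : ∀ x, σ.var vOff ≤ x → σ.arr aHead x = 0
  table : ∀ s, done s → Table D F d r σ s
  down : ∀ s s', D.Child s s' → done s → done s'

def Program.openNode : Program :=
  .setVar vM (.get aSz (.var vT)) ;; .setVar vRow (.get aBagRow (.var vT)) ;;
  .setVar vC1 (.get aC1 (.var vT)) ;; .setVar vC2 (.get aC2 (.var vT)) ;;
  .setVar vA (.get aU1 (.var vT)) ;; .setVar vB (.get aU2 (.var vT)) ;;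
  .setVar vKind (.get aKind (.var vT)) ;; .setArr aStart (.var vT) (.var vCnt)

def Program.closeNode : Program :=
  .setArr aEnd (.var vT) (.var vCnt) ;; .setVar vOff (.add (.var vOff) (.var vStep))

def Program.dispatch : Program :=
  .ite (.eq (.var vKind) (.const 0)) .leafNode <|
  .ite (.eq (.var vKind) (.const 1)) .introduceVertexNode <|
  .ite (.eq (.var vKind) (.const 2)) .introduceEdgeNode <|
  .ite (.eq (.var vKind) (.const 3)) .forgetNode .joinNode

/-- Construct the table of the node `vT`. -/
def Program.node : Program := .openNode ;; .dispatch ;; .closeNode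

theorem runs_openNode {done : Fin N → Prop} (h : Progress D k F d r done σ) (hT : σ.var vT = t)
    (ht : ¬ done t) (hch : ∀ s, D.Child t s → done s) :
    Runs .openNode σ 30 fun τ => NodeStart D k F d r t τ ∧ Progress D k F d r done τ ∧
      τ.var vKind = nodeCode (D.kind t) 0 ∧ τ.arr aStart t = τ.var vCnt := by
  have hE := h.env
  have hr : Runs .openNode σ 30 fun τ => τ.var vM = (bagL D t).length ∧
      τ.var vRow = t * (D.width + 1) ∧ τ.var vC1 = nodeCode (D.kind t) 1 ∧
      τ.var vC2 = nodeCode (D.kind t) 2 ∧ τ.var vA = nodeCode (D.kind t) 3 ∧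
      τ.var vB = nodeCode (D.kind t) 4 ∧ τ.var vKind = nodeCode (D.kind t) 0 ∧
      τ.arr aStart = Function.update (σ.arr aStart) t (σ.var vCnt) := by
    refine (Runs.straight rfl ?_).le (by decide)
    simp [Program.openNode, hT, hE.hSize, hE.hBagRow, hE.hC1, hE.hC2, hE.hU1, hE.hU2, hE.hKind]
  refine hr.imp ?_
  rintro τ ⟨h1, h2, h3, h4, h5, h6, h7, h8⟩ hF
  have hP : Progress D k F d r done τ := by
    refine ⟨hE.frame hF (by decide), ?_, ?_, ?_, ?_, ?_, fun s hs => ?_, h.down⟩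
    · rw [hF.real_eq _ (by decide), hF.var_eq _ (by decide), h.th]
    · rw [hF.var_eq _ (by decide), hF.var_eq _ (by decide), h.cur]
    · rw [hF.arr_eq _ (by decide), hF.var_eq _ (by decide)]; exact h.ptr
    · rw [hF.arr_eq _ (by decide), hF.var_eq _ (by decide)]; exact h.idx
    · rw [hF.arr_eq _ (by decide), hF.var_eq _ (by decide)]; exact h.head
    · refine (h.table s hs).stable (fun s' hs' => h.table s' (h.down s s' hs' hs))
        (fun s' hs' => ⟨?_, by rw [hF.arr_eq _ (by decide)]⟩)
        (fun e _ => ⟨ent_congr (fun x hx => (hF.keep (vs := []) (as := tabArrs) (rs := [])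
          (by decide)).2.1 x hx) e, by rw [hF.arr_eq _ (by decide)]⟩)
        (by rw [hF.var_eq _ (by decide)])
      rw [h8, Function.update_of_ne]
      intro heq
      obtain rfl := Fin.ext heq
      rcases hs' with rfl | hs'
      · exact ht hs
      · exact ht (h.down _ _ hs' hs)
  refine ⟨⟨hP.env, by rw [hF.var_eq _ (by decide), hT], ⟨h1, fun i hi => ?_⟩, h3, h4, h5, h6, hP.th,
    fun s hs => hP.table s (hch s hs), hP.cur, hP.ptr, hP.idx, hP.head⟩, hP, h7, ?_⟩
  · rw [h2, hP.env.hBag t i hi]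
  · rw [h8, Function.update_self, hF.var_eq _ (by decide)]

/-- All index cells and list heads used by the new table lie below the new offset, since codes are
smaller than `vStep`; hence nothing has to be cleared. Earlier tables survive by `Table.stable`. -/
theorem runs_closeNode {done : Fin N → Prop} (hS : NodeStart D k F d r t σ₀)
    (h : Progress D k F d r done σ₀) (hst : σ₀.arr aStart t = σ₀.var vCnt)
    (ht : ¬ done t) (hch : ∀ s, D.Child t s → done s) (hA : Agree σ₀ σ)
    (hB : Building (bagL D t) σ₀ (Cand D F d r σ₀ t) σ)
    (hhd : ∀ x, σ₀.var vOff + (n + 1) ^ (2 * (D.width + 1)) ≤ x → σ.arr aHead x = 0) :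
    Runs .closeNode σ 10 (Progress D k F d r fun s => s = t ∨ done s) := by
  have hTv : σ.var vT = t := (hA.var _ (by decide)).trans hS.node
  have hr : Runs .closeNode σ 10 fun τ => τ.arr aEnd = Function.update (σ.arr aEnd) t (σ.var vCnt) ∧
      τ.var vOff = σ.var vOff + (n + 1) ^ (2 * (D.width + 1)) := by
    refine (Runs.straight rfl ?_).le (by decide)
    simp [Program.closeNode, hTv, (hA.env hS.env).hStep]
  refine hr.imp ?_
  rintro τ ⟨h1, h2⟩ hF
  have hA0 : σ.arr aStart = σ₀.arr aStart := hA.arr _ (by decide)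
  have hA1 : σ.arr aEnd = σ₀.arr aEnd := hA.arr _ (by decide)
  have hst' : τ.arr aStart = σ₀.arr aStart := by rw [hF.arr_eq _ (by decide), hA0]
  have hcnt : τ.var vCnt = σ.var vCnt := hF.var_eq _ (by decide)
  have hle := hB.cnt_le
  have hentσ : ∀ e, ent n τ e = ent n σ e := ent_congr fun x hx =>
    (hF.keep (vs := []) (as := tabArrs) (rs := []) (by decide)).2.1 x hx
  have hcc : τ.arr aColCode = σ.arr aColCode := hF.arr_eq _ (by decide)
  have hTabs : ∀ s, s ≠ t → ∀ e, Tab τ s e ↔ Tab σ₀ s e := fun s hs e => by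
    unfold Tab
    rw [hst', h1, Function.update_of_ne (fun h => hs (Fin.ext h)), hA1]
  have hTabt : ∀ e, Tab τ t e ↔ σ₀.var vCnt ≤ e ∧ e < σ.var vCnt := fun e => by
    unfold Tab
    rw [hst', h1, Function.update_self, hst]
  have hne : ∀ s, D.Child t s → s ≠ t := fun s hs h => ht (h ▸ hch s hs)
  have hold : ∀ s, D.Child t s → ∀ e, Tab σ₀ s e → ent n τ e = ent n σ₀ e := fun s hs e he => by
    rw [hentσ]
    exact (hB.old e (lt_of_lt_of_le he.2 (hS.table s hs).le_cnt)).1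
  refine ⟨(hA.env hS.env).frame hF (by decide), ?_, ?_, ?_, ?_, ?_, ?_, ?_⟩
  · rw [hF.real_eq _ (by decide), hF.var_eq _ (by decide), hA.real _ (by decide),
      hA.var _ (by decide), hS.th]
  · rw [hF.var_eq _ (by decide), hcnt, hB.cur]
  · rw [hF.arr_eq _ (by decide), hcnt]; exact hB.ptr
  · intro x hx
    rw [hF.arr_eq _ (by decide)]
    by_contra hx0
    obtain ⟨e, he, he', hxe, -⟩ := hB.exists_idx x (by omega) hx0
    have := codeOf_lt (fun v hv => hB.col_lt e he he' v hv) (length_bagL_le D t)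
    omega
  · intro x hx
    rw [hF.arr_eq _ (by decide)]
    exact hhd x (by rw [← hB.off]; omega)
  · rintro s (rfl | hs)
    · constructor
      · rw [hst', h1, Function.update_self, hst]; exact hle
      · rw [h1, Function.update_self, hcnt]
      · intro e he
        rw [hTabt] at he
        rw [hentσ]
        refine (hB.sound e he.1 he.2).congr_table fun s' hs' e' he' =>
          ⟨(hTabs s' (hne s' hs') e').2 he', (hold s' hs' e' he').symm⟩
      · intro c hc
        obtain ⟨e, he, he', h3, h4⟩ := hB.complete c (hc.congr_table fun s' hs' e' he' => by
          rw [hTabs s' (hne s' hs')] at he'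
          exact ⟨he', hold s' hs' e' he'⟩)
        rw [toFinset_bagL] at h3
        exact ⟨e, (hTabt e).2 ⟨he, he'⟩, by rwa [hentσ], by rwa [hentσ]⟩
      · intro e he v hv
        rw [hTabt] at he
        rw [hentσ]
        obtain ⟨u, hu, h⟩ := hB.lab e he.1 he.2 v (mem_bagL.2 hv)
        exact ⟨u, mem_bagL.1 hu, h⟩
      · intro e he
        rw [hTabt] at he
        rw [hentσ, hcc]
        exact hB.colCode e he.1 he.2
      · intro e e' he he' hsim
        rw [hTabt] at he he'
        rw [hentσ, hentσ] at hsim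
        -- Similar entries share one index cell, and this cell stores a single number.
        have i1 := hB.idx e he.1 he.2
        have i2 := hB.idx e' he'.1 he'.2
        unfold codeOf at i1 i2
        rw [(key_eq_iff (fun v => mem_bagL)).2 hsim] at i1
        omega
    · refine (h.table s hs).stable (fun s' hs' => h.table s' (h.down s s' hs' hs))
        (fun s' hs' => ⟨by rw [hst'], ?_⟩)
        (fun e he => ⟨by rw [hentσ]; exact (hB.old e he).1, by rw [hcc]; exact (hB.old e he).2⟩)
        (by rw [hcnt]; exact hle)
      rw [h1, Function.update_of_ne, hA1]
      intro heq
      obtain rfl := Fin.ext heq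
      rcases hs' with rfl | hs'
      · exact ht hs
      · exact ht (h.down _ _ hs' hs)
  · rintro s s' hss' (rfl | hs)
    · exact Or.inr (hch s' hss')
    · exact Or.inr (h.down s s' hss' hs)

/-- A bound for the time to construct one table, for bags with at most `m` vertices and `a`
facilities. -/
def nodeTime (a m : ℕ) : ℕ := a ^ m * Nat.bell m * (Nat.bell m * (stepTime m + 100)) + 200

theorem stepTime_mono : Monotone stepTime := fun m m' h => by
  unfold stepTime insertTime
  gcongr

/-- An introduce vertex node has |F| candidates per entry, but the child's bag is one vertex
smaller, so the factor is absorbed by |F|^(w+1). Only a join node needs the second Bell factor. A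
nonempty F makes the powers monotone in the bag size. -/
theorem runs_dispatch (hS : NodeStart D k F d r t σ₀) (hk : σ₀.var vKind = nodeCode (D.kind t) 0)
    (hF : 1 ≤ F.card) :
    Runs .dispatch σ₀ (nodeTime F.card (D.width + 1) - 100) fun τ =>
      Building (bagL D t) σ₀ (Cand D F d r σ₀ t) τ ∧
      ∀ x, σ₀.var vOff + (n + 1) ^ (2 * (D.width + 1)) ≤ x → τ.arr aHead x = 0 := by
  set W := D.width + 1
  have hm : (bagL D t).length ≤ W := length_bagL_le D t
  set m := (bagL D t).length
  have hst : stepTime m ≤ stepTime W := stepTime_mono hm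
  have hbell : Nat.bell m ≤ Nat.bell W := Nat.bell_mono hm
  have hb1 : 1 ≤ Nat.bell W := Nat.one_le_bell W
  have hA1 : 1 ≤ F.card ^ W := Nat.one_le_pow _ _ hF
  have hM : 1 ≤ F.card ^ W * Nat.bell W := Nat.mul_pos hA1 hb1
  set M := F.card ^ W * Nat.bell W
  have hcard : ∀ s, D.Child t s → σ₀.arr aEnd s - σ₀.arr aStart s ≤ M := fun s hs => by
    refine (hS.table s hs).card_le.trans ?_
    have hs' : (bagL D s).length ≤ W := length_bagL_le D s
    exact Nat.mul_le_mul (Nat.pow_le_pow_right hF hs') (Nat.bell_mono hs')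
  have hMb : M * (stepTime W + 100) ≤ M * (Nat.bell W * (stepTime W + 100)) :=
    Nat.mul_le_mul_left _ (Nat.le_mul_of_pos_left _ hb1)
  have hMs : stepTime W + 100 ≤ M * (stepTime W + 100) := Nat.le_mul_of_pos_left _ hM
  have hnt : nodeTime F.card W = M * (Nat.bell W * (stepTime W + 100)) + 200 := rfl
  have hone : ∀ s, D.Child t s → (σ₀.arr aEnd s - σ₀.arr aStart s) * (stepTime m + 20) + 20 ≤
      M * (Nat.bell W * (stepTime W + 100)) + 20 := fun s hs => by
    have := Nat.mul_le_mul (hcard s hs) (show stepTime m + 20 ≤ stepTime W + 100 by omega)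
    omega
  have key : ∀ {P : Program} {B : ℕ}, Runs P σ₀ B (Building (bagL D t) σ₀ (Cand D F d r σ₀ t)) →
      decide (aHead ∉ P.wa) = true → B ≤ M * (Nat.bell W * (stepTime W + 100)) + 20 →
      Runs P σ₀ (M * (Nat.bell W * (stepTime W + 100)) + 60) fun τ =>
      Building (bagL D t) σ₀ (Cand D F d r σ₀ t) τ ∧
      ∀ x, σ₀.var vOff + (n + 1) ^ (2 * (D.width + 1)) ≤ x → τ.arr aHead x = 0 := by
    intro P B h hd hB
    refine h.mono (by omega) fun τ hτ hF => ⟨hτ, fun x hx => ?_⟩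
    rw [hF.arr_eq _ hd]
    exact hS.head x (by omega)
  refine Runs.le (B := 7 + (7 + (7 + (7 + (M * (Nat.bell W * (stepTime W + 100)) + 60))))) ?_
    (by omega)
  have htest : ∀ i, (Test.eq (.var vKind) (.const i)).Holds σ₀ ↔ σ₀.var vKind = i := fun i => by
    simp
  have yes : ∀ {i B : ℕ} {P P' : Program} {Q : State → Prop}, σ₀.var vKind = i → Runs P σ₀ B Q →
      Runs (.ite (.eq (.var vKind) (.const i)) P P') σ₀ (7 + B) Q := fun h h' =>
    Runs.ite (fun _ => h') fun hq => absurd ((htest _).2 h) hq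
  have no : ∀ {i B : ℕ} {P P' : Program} {Q : State → Prop}, σ₀.var vKind ≠ i → Runs P' σ₀ B Q →
      Runs (.ite (.eq (.var vKind) (.const i)) P P') σ₀ (7 + B) Q := fun h h' =>
    Runs.ite (fun hq => absurd ((htest _).1 hq) h) fun _ => h'
  cases hkt : D.kind t with
  | leaf =>
    have hv : σ₀.var vKind = 0 := by rw [hk, hkt]; rfl
    refine Runs.le (yes (B := M * (Nat.bell W * (stepTime W + 100)) + 60) hv ?_) (by omega)
    exact (key (runs_leafNode hS hkt) (by decide) (show stepTime m ≤ _ by omega))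
  | introduceVertex v s =>
    have hv : σ₀.var vKind = 1 := by rw [hk, hkt]; rfl
    have hch : D.Child t s := (child_introduceVertex hkt).2 rfl
    obtain ⟨hvs, hb⟩ := bag_introduceVertex hkt
    refine no (by rw [hv]; decide) ?_
    refine Runs.le (yes (B := M * (Nat.bell W * (stepTime W + 100)) + 60) hv ?_) (by omega)
    refine (key (runs_introduceVertexNode hS hkt) (by decide) ?_)
    have hms : (bagL D s).length + 1 = m := by
      rw [length_bagL, ← Finset.card_insert_of_notMem hvs, ← hb, ← length_bagL]
    have h1 : (σ₀.arr aEnd s - σ₀.arr aStart s) * F.card ≤ M := by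
      refine (Nat.mul_le_mul_right _ (hS.table s hch).card_le).trans ?_
      calc _ = F.card ^ ((bagL D s).length + 1) * Nat.bell (bagL D s).length := by ring
        _ ≤ _ := by
          rw [hms]
          exact Nat.mul_le_mul (Nat.pow_le_pow_right hF hm) (Nat.bell_mono (by omega))
    have h2 := hcard s hch
    calc _ = ((σ₀.arr aEnd s - σ₀.arr aStart s) * F.card) * (stepTime m + 8) +
          (σ₀.arr aEnd s - σ₀.arr aStart s) * 26 + 20 := by ring
      _ ≤ M * (stepTime W + 8) + M * 26 + 20 := by gcongr
      _ ≤ M * (stepTime W + 100) + 20 := by nlinarith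
      _ ≤ _ := by omega
  | introduceEdge u v s =>
    have hv : σ₀.var vKind = 2 := by rw [hk, hkt]; rfl
    have hch : D.Child t s := (child_introduceEdge hkt).2 rfl
    refine no (by rw [hv]; decide) ?_
    refine no (by rw [hv]; decide) ?_
    refine Runs.le (yes (B := M * (Nat.bell W * (stepTime W + 100)) + 60) hv ?_) (by omega)
    exact (key (runs_introduceEdgeNode hS hkt) (by decide) (hone s hch))
  | forget v s =>
    have hv : σ₀.var vKind = 3 := by rw [hk, hkt]; rfl
    have hch : D.Child t s := (child_forget hkt).2 rfl
    refine no (by rw [hv]; decide) ?_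
    refine no (by rw [hv]; decide) ?_
    refine no (by rw [hv]; decide) ?_
    refine Runs.le (yes (B := M * (Nat.bell W * (stepTime W + 100)) + 60) hv ?_) (by omega)
    exact (key (runs_forgetNode hS hkt) (by decide) (hone s hch))
  | join s₁ s₂ =>
    have hv : σ₀.var vKind = 4 := by rw [hk, hkt]; rfl
    refine no (by rw [hv]; decide) ?_
    refine no (by rw [hv]; decide) ?_
    refine no (by rw [hv]; decide) ?_
    refine no (by rw [hv]; decide) ?_
    refine (runs_joinNode hS hkt).le ?_
    have h1 := hcard s₁ ((child_join hkt).2 (Or.inl rfl))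
    have h2 := hcard s₂ ((child_join hkt).2 (Or.inr rfl))
    calc _ ≤ M * 40 + 20 + (M * (6 + (Nat.bell W * (stepTime W + 3) + 3) + 20) + 20) := by gcongr
      _ = M * (Nat.bell W * (stepTime W + 3)) + M * 69 + 40 := by ring
      _ ≤ M * (Nat.bell W * (stepTime W + 3)) + M * (Nat.bell W * 97) + 40 := by
        gcongr
        omega
      _ = M * (Nat.bell W * (stepTime W + 100)) + 40 := by ring
      _ ≤ _ := by omega

theorem runs_node {done : Fin N → Prop} (h : Progress D k F d r done σ) (hT : σ.var vT = t)
    (ht : ¬ done t) (hch : ∀ s, D.Child t s → done s) (hF : 1 ≤ F.card) :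
    Runs .node σ (nodeTime F.card (D.width + 1)) (Progress D k F d r fun s => s = t ∨ done s) := by
  refine Runs.le (Runs.seq (runs_openNode h hT ht hch) (B' := nodeTime F.card (D.width + 1) - 100 +
    10) fun τ ⟨h1, h2, h3, h4⟩ _ => ?_) (by unfold nodeTime; omega)
  refine Runs.seq (runs_dispatch h1 h3 hF) fun ρ ⟨h5, h6⟩ hF' => ?_
  exact runs_closeNode h1 h2 h4 ht hch ((Agree.refl τ).frame hF' (by decide)) h5 h6

end RAM

notation "vI3" => 60
notation "vRes" => 61

/-! ### Back pointers lead into the tables of the children -/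

namespace NiceTreeDecomposition

variable {n : ℕ} {ι : Type} {G : SimpleGraph (Fin n)} {D : NiceTreeDecomposition G ι}
  {ok : Fin n → ℕ → Prop} {T : ι → ℕ → Prop} {E : ℕ → Ent (Fin n)} {t : ι} {c : Ent (Fin n)}

theorem Trans.fst (h : D.Trans ok T E t c) {s : ι} (hs : (D.kind t).fst = some s) : T s c.b1 := by
  obtain ⟨-, h⟩ := h
  cases hk : D.kind t <;> rw [hk] at h hs <;> simp only [NodeKind.fst, Option.some.injEq,
    reduceCtorEq] at hs <;> subst hs <;> exact h.1

theorem Trans.snd (h : D.Trans ok T E t c) {s : ι} (hs : (D.kind t).snd = some s) : T s c.b2 := by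
  obtain ⟨-, h⟩ := h
  cases hk : D.kind t <;> rw [hk] at h hs <;> simp only [NodeKind.snd, Option.some.injEq,
    reduceCtorEq] at hs
  subst hs
  exact h.2.1

end NiceTreeDecomposition

namespace RAM

open NiceTreeDecomposition

variable {n N : ℕ} {G : SimpleGraph (Fin n)} {D : NiceTreeDecomposition G (Fin N)} {k : ℕ}
  {F : Finset (Fin n)} {d : Fin n → Fin n → ℝ≥0} {σ₀ σ : State} {r : ℝ} {t : Fin N}
  {o : List (Fin N)}

theorem frame_setVar (σ : State) (x m : ℕ) : Frame (.setVar x (.const 0)) σ (σ.setVar x m) :=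
  ⟨fun y hy => by
    have : y ≠ x := by simpa [Program.wv] using hy
    simp [this], fun _ _ => rfl, fun _ _ => rfl⟩

/-! ### The dynamic program -/

variable (D) in
/-- The array `aOrd` contains the list `o` of all nodes, parents before children. -/
structure Ordered (o : List (Fin N)) (σ : State) : Prop where
  nodup : o.Nodup
  mem : ∀ t, t ∈ o
  get : ∀ (i : ℕ) (h : i < o.length), σ.arr aOrd i = o[i]
  pairwise : o.Pairwise fun a b => ¬ D.Child b a

theorem Ordered.length (h : Ordered D o σ) : o.length = N := by
  rw [← List.toFinset_card_of_nodup h.nodup, show o.toFinset = Finset.univ by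
    ext t; simp [h.mem t], Finset.card_univ, Fintype.card_fin]

theorem Ordered.congr {τ : State} (h : Ordered D o σ) (ha : τ.arr aOrd = σ.arr aOrd) :
    Ordered D o τ := ⟨h.nodup, h.mem, by rw [ha]; exact h.get, h.pairwise⟩

theorem Ordered.child_mem (h : Ordered D o σ) {i : ℕ} (hi : i < o.length) {s : Fin N}
    (hs : D.Child o[i] s) : s ∈ o.drop (i + 1) := by
  have hpw := h.pairwise
  have hm := h.mem s
  rw [← List.take_append_drop i o, List.drop_eq_getElem_cons hi] at hpw hm
  rw [List.pairwise_append] at hpw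
  rw [List.mem_append, List.mem_cons] at hm
  rcases hm with hm | rfl | hm
  · exact absurd hs (hpw.2.2 s hm _ (List.mem_cons_self ..))
  · have := hs.2; omega
  · exact hm

theorem Ordered.parent_mem (h : Ordered D o σ) {i : ℕ} (hi : i < o.length)
    (hr : o[i] ≠ D.root) : ∃ p ∈ o.take i, D.Child p o[i] := by
  obtain ⟨p, hp⟩ := exists_parent hr
  refine ⟨p, ?_, hp⟩
  have hpw := h.pairwise
  have hm := h.mem p
  rw [← List.take_append_drop i o, List.drop_eq_getElem_cons hi] at hpw hm
  rw [List.pairwise_append, List.pairwise_cons] at hpw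
  rw [List.mem_append, List.mem_cons] at hm
  rcases hm with hm | hm | hm
  · exact hm
  · have := hp.2; rw [hm] at this; omega
  · exact absurd hp (hpw.2.1.1 p hm)

variable (D k F d) in
/-- The invariant between two runs of the dynamic program. -/
structure Ready (σ : State) : Prop where
  env : Env D k F d σ
  idx : ∀ x, σ.var vOff ≤ x → σ.arr aIdx x = 0
  head : ∀ x, σ.var vOff ≤ x → σ.arr aHead x = 0

theorem Ready.frame {P : Program} {τ : State} (h : Ready D k F d σ) (hF : Frame P σ τ)
    (hd : P.keeps envVars envArrs envReals = true) (h1 : decide (vOff ∉ P.wv) = true)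
    (h2 : decide (aIdx ∉ P.wa) = true) (h3 : decide (aHead ∉ P.wa) = true) :
    Ready D k F d τ :=
  ⟨h.env.frame hF hd, by rw [hF.arr_eq _ h2, hF.var_eq _ h1]; exact h.idx,
    by rw [hF.arr_eq _ h3, hF.var_eq _ h1]; exact h.head⟩

theorem Progress.frame {P : Program} {τ : State} {done : Fin N → Prop}
    (h : Progress D k F d r done σ) (hF : Frame P σ τ)
    (hd : P.keeps (envVars ++ tabVars ++ [vTh]) (envArrs ++ tabArrs ++ [aStart, aEnd, aHead])
      [rDist, rSort] = true) : Progress D k F d r done τ := by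
  obtain ⟨h1, h2, h3⟩ := hF.keep hd
  refine ⟨h.env.congr (fun x hx => h1 x (List.mem_append_left _ (List.mem_append_left _ hx)))
    (fun x hx => h2 x (List.mem_append_left _ (List.mem_append_left _ hx)))
    (fun x hx => h3 x (by simp_all)), ?_, ?_, ?_, ?_, ?_, fun s hs => ?_, h.down⟩
  · rw [h3 _ (by decide), h1 _ (by decide), h.th]
  · rw [h1 vCur (by decide), h1 vCnt (by decide), h.cur]
  · rw [h1 vCnt (by decide), h2 aPtr (by decide)]; exact h.ptr
  · rw [h1 vOff (by decide), h2 aIdx (by decide)]; exact h.idx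
  · rw [h1 vOff (by decide), h2 aHead (by decide)]; exact h.head
  · refine (h.table s hs).stable (fun s' hs' => h.table s' (h.down s s' hs' hs))
      (fun s' _ => ⟨by rw [h2 aStart (by decide)], by rw [h2 aEnd (by decide)]⟩)
      (fun e _ => ⟨ent_congr (fun x hx => h2 x
        (List.mem_append_left _ (List.mem_append_right _ hx))) e, by rw [h2 aColCode (by decide)]⟩)
      (h1 vCnt (by decide)).ge

/-- Compute all tables, for the threshold in cell `vTh` of the array `rSort`. -/
def Program.dp : Program :=
  (.setVar vCnt (.const 0) ;; .setVar vCur (.const 0)) ;;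
  .for vI3 vNodes (.setVar vT (.get aOrd (.sub (.sub (.var vNodes) (.var vI3)) (.const 1))) ;;
    .node)

/-- Nodes are taken in reverse order, so the finished ones form a suffix of o that contains the
children of each of its members. For every threshold the entries are numbered from zero again,
whereas `vOff` keeps growing, so the index cells beyond it are still zero. -/
theorem runs_dp (h : Ready D k F d σ) (ho : Ordered D o σ) (hth : σ.real rSort (σ.var vTh) = r)
    (hF : 1 ≤ F.card) : Runs .dp σ (N * (nodeTime F.card (D.width + 1) + 20) + 20)
      (Progress D k F d r fun _ => True) := by
  have hN := ho.length
  refine Runs.le (Runs.seq (B := 4) (B' := N * ((7 + nodeTime F.card (D.width + 1)) + 8) + 6)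
    (Q := fun τ => τ = (σ.setVar vCnt 0).setVar vCur 0)
    ((Runs.straight rfl (by simp)).le (by decide)) ?_) (by nlinarith)
  rintro σ₁ hσ₁ hF₁
  refine (Runs.for (σ := σ₁) N (fun i τ => Progress D k F d r (fun s => s ∈ o.drop (N - i)) τ)
    (by decide) (by decide) (by decide) ?_ ?_ ?_).imp ?_
  · rw [hF₁.var_eq _ (by decide), h.env.hNodes]
  · refine Progress.frame ?_ (frame_setVar _ _ _) (by decide)
    have c1 : σ₁.var vCnt = 0 := by rw [hσ₁]; simp
    refine ⟨h.env.frame hF₁ (by decide), ?_, ?_, ?_, ?_, ?_, ?_, ?_⟩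
    · rw [hF₁.real_eq _ (by decide), hF₁.var_eq _ (by decide), hth]
    · rw [c1, hσ₁]; simp
    · rw [c1]; intro e he; omega
    · rw [hF₁.arr_eq _ (by decide), hF₁.var_eq _ (by decide)]; exact h.idx
    · rw [hF₁.arr_eq _ (by decide), hF₁.var_eq _ (by decide)]; exact h.head
    · intro s hs; simp [← hN] at hs
    · intro s s' _ hs; simp [← hN] at hs
  · intro i τ hi hP hiτ hFr
    have hj : N - i - 1 < o.length := by omega
    have hd : o.drop (N - i - 1) = o[N - i - 1] :: o.drop (N - i) := by
      rw [List.drop_eq_getElem_cons hj, show N - i - 1 + 1 = N - i by omega]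
    have hget : τ.arr aOrd (N - i - 1) = o[N - i - 1] := by
      rw [hFr.arr_eq _ (by decide), hF₁.arr_eq _ (by decide)]
      exact ho.get _ hj
    refine Runs.seq (Q := fun ρ => ρ = τ.setVar vT (o[N - i - 1] : ℕ)) ((Runs.straight rfl
      (by simp [hiτ, hP.env.hNodes, hget])).le (by decide)) ?_
    rintro ρ hρ hF₂
    refine (runs_node (t := o[N - i - 1]) (hP.frame hF₂ (by decide)) (by rw [hρ]; simp) ?_ ?_
      hF).imp fun ρ' hρ' _ => ?_
    · have hnd := ho.nodup
      rw [← List.take_append_drop (N - i - 1) o, hd] at hnd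
      exact (List.nodup_cons.1 (List.nodup_append.1 hnd).2.1).1
    · intro s hs
      have := ho.child_mem hj hs
      rwa [show N - i - 1 + 1 = N - i by omega] at this
    · refine Progress.frame ?_ (frame_setVar _ _ _) (by decide)
      rw [show N - (i + 1) = N - i - 1 by omega, hd]
      simpa only [List.mem_cons] using hρ'
  · intro τ hτ _
    simpa [ho.mem] using hτ

variable (D k F d) in
/-- `f` is a colouring with facilities in distance at most `r` which has at most `k` connected
monochromatic parts. -/
def IsColoring (r : ℝ) (f : Fin n → ℕ) : Prop :=
  (∀ v, OkAt F d r v (f v)) ∧ D.cost f D.root ≤ k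

theorem IsColoring.mono {r' : ℝ} {f : Fin n → ℕ} (h : IsColoring D k F d r f) (hr : r ≤ r') :
    IsColoring D k F d r' f :=
  ⟨fun v => by
    obtain ⟨c, h1, h2, h3⟩ := h.1 v
    exact ⟨c, h1, h2, h3.trans hr⟩, h.2⟩

theorem exists_dist_le (D : NiceTreeDecomposition G (Fin N)) :
    ∃ m, ∀ t, D.tree.dist D.root t ≤ m :=
  ⟨Finset.univ.sup fun t => D.tree.dist D.root t, fun t =>
    Finset.le_sup (f := fun t => D.tree.dist D.root t) (Finset.mem_univ t)⟩

/-- The tables contain a good entry for every colouring. -/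
theorem exists_entry (hT : ∀ t, Table D F d r σ t) {f : Fin n → ℕ}
    (hf : ∀ v, OkAt F d r v (f v)) (t : Fin N) :
    ∃ e, Tab σ t e ∧ D.Matches f t (ent n σ e) ∧ (ent n σ e).cost ≤ D.cost f t := by
  obtain ⟨M, hM⟩ := exists_dist_le D
  -- Induction on the distance from the deepest level, so that children come before their parents.
  suffices h : ∀ j t, M - D.tree.dist D.root t = j →
      ∃ e, Tab σ t e ∧ D.Matches f t (ent n σ e) ∧ (ent n σ e).cost ≤ D.cost f t from h _ t rfl
  intro j
  induction j using Nat.strong_induction_on with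
  | _ j ih =>
    intro t ht
    obtain ⟨c, hc, hm, hcost⟩ := exists_trans_matches hf (T := Tab σ) (E := ent n σ) (t := t)
      fun s hs => ih _ (by have := hs.2; have := hM s; omega) s rfl
    obtain ⟨e, he, hsim, hle⟩ := (hT t).complete c hc
    exact ⟨e, he, hm.congr hsim, hle.trans hcost⟩

/-- Select one entry for every node, and read off the colouring. -/
def Program.select : Program :=
  .setVar vT (.get aOrd (.var vI3)) ;; .setVar vKind (.get aKind (.var vT)) ;;
  .setVar vE1 (.get aSel (.var vT)) ;;
  .ite (.le (.const 1) (.var vKind))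
    (.setArr aSel (.get aC1 (.var vT)) (.get aB1 (.var vE1))) .skip ;;
  .ite (.eq (.var vKind) (.const 4))
    (.setArr aSel (.get aC2 (.var vT)) (.get aB2 (.var vE1))) .skip ;;
  .ite (.eq (.var vKind) (.const 3))
    (.setArr aHat (.get aU1 (.var vT)) (.get aCol (.add (.get aPtr
      (.get aSel (.get aC1 (.var vT)))) (.get aU1 (.var vT))))) .skip

theorem runs_select (hE : Env D k F d σ) (ht : σ.arr aOrd (σ.var vI3) = t)
    (hptr : ∀ v s, D.kind t = .forget v s →
      σ.arr aPtr (σ.arr aB1 (σ.arr aSel t)) = σ.arr aB1 (σ.arr aSel t) * n) :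
    Runs .select σ 70 fun τ =>
      (∀ s : Fin N, (D.kind t).fst = some s → τ.arr aSel s = (ent n σ (σ.arr aSel t)).b1) ∧
      (∀ s : Fin N, (D.kind t).snd = some s → τ.arr aSel s = (ent n σ (σ.arr aSel t)).b2) ∧
      (∀ s : Fin N, ¬ D.Child t s → τ.arr aSel s = σ.arr aSel s) ∧
      (∀ v s, D.kind t = .forget v s → τ.arr aHat v = (ent n σ (τ.arr aSel s)).col v) ∧
      ∀ v : Fin n, (∀ s, D.kind t ≠ .forget v s) → τ.arr aHat v = σ.arr aHat v := by
  refine (Runs.straight rfl ?_).le (by decide)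
  have h0 := hE.hKind t
  have h1 := hE.hC1 t
  have h2 := hE.hC2 t
  have h3 := hE.hU1 t
  have hval : ∀ {a b : Fin N}, a ≠ b → (a : ℕ) ≠ b := fun h h' => h (Fin.ext h')
  have hval' : ∀ {a b : Fin n}, a ≠ b → (a : ℕ) ≠ b := fun h h' => h (Fin.ext h')
  cases hk : D.kind t with
  | leaf =>
    rw [hk] at h0 h1 h2 h3
    simp [Program.select, ht, h0, nodeCode, NodeKind.fst, NodeKind.snd]
  | introduceVertex v s =>
    rw [hk] at h0 h1 h2 h3
    simp [Program.select, ht, h0, h1, nodeCode, NodeKind.fst, NodeKind.snd, ent,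
      child_introduceVertex hk]
    exact fun s' hs' => Function.update_of_ne (hval hs') _ _
  | introduceEdge u v s =>
    rw [hk] at h0 h1 h2 h3
    simp [Program.select, ht, h0, h1, nodeCode, NodeKind.fst, NodeKind.snd, ent,
      child_introduceEdge hk]
    exact fun s' hs' => Function.update_of_ne (hval hs') _ _
  | forget v s =>
    have hp := hptr v s hk
    rw [hk] at h0 h1 h2 h3
    simp [Program.select, ht, h0, h1, h3, nodeCode, NodeKind.fst, NodeKind.snd, ent,
      child_forget hk, hp]
    exact ⟨fun s' hs' => Function.update_of_ne (hval hs') _ _,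
      fun u hu => Function.update_of_ne (hval' (Ne.symm hu)) _ _⟩
  | join s₁ s₂ =>
    rw [hk] at h0 h1 h2 h3
    obtain ⟨hne, -, -⟩ := bag_join hk
    simp [Program.select, ht, h0, h1, h2, nodeCode, NodeKind.fst, NodeKind.snd, ent,
      child_join hk]
    refine ⟨by rw [Function.update_of_ne (hval hne), Function.update_self], fun s' hs' hs'' => ?_⟩
    rw [Function.update_of_ne (hval hs''), Function.update_of_ne (hval hs')]

/-- Compute a colouring for the threshold in cell `vTh` of the array `rSort`. -/
def Program.attempt : Program :=
  .dp ;; .ite (.conj (.lt (.get aStart (.var vRoot)) (.get aEnd (.var vRoot)))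
      (.le (.get aCost (.get aStart (.var vRoot))) (.var vK)))
    ((.setVar vRes (.const 1) ;; .setArr aSel (.var vRoot) (.get aStart (.var vRoot))) ;;
      .for vI3 vNodes .select)
    (.setVar vRes (.const 0))

/-- Parents precede children and no node has two parents, so a selection is final by the time it is
used; likewise each vertex gets its colour at its only forget node. Then `matches_of_selection`
identifies the cost of the colouring with the one stored at the root. -/
theorem runs_selectAll (h : Progress D k F d r (fun _ => True) σ) (ho : Ordered D o σ)
    (hroot : Tab σ D.root (σ.arr aSel D.root)) :
    Runs (.for vI3 vNodes .select) σ (N * 78 + 6) fun τ => (∀ v, OkAt F d r v (τ.arr aHat v)) ∧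
      D.cost (fun v => τ.arr aHat v) D.root = (ent n σ (σ.arr aSel D.root)).cost := by
  have hN := ho.length
  refine (Runs.for (B := 70) N (fun i τ => τ.arr aSel D.root = σ.arr aSel D.root ∧
    (∀ t, (t = D.root ∨ ∃ p ∈ o.take i, D.Child p t) → Tab σ t (τ.arr aSel t)) ∧
    (∀ t ∈ o.take i, ∀ s, (D.kind t).fst = some s →
      (ent n σ (τ.arr aSel t)).b1 = τ.arr aSel s) ∧
    (∀ t ∈ o.take i, ∀ s, (D.kind t).snd = some s →
      (ent n σ (τ.arr aSel t)).b2 = τ.arr aSel s) ∧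
    (∀ t ∈ o.take i, ∀ v s, D.kind t = .forget v s →
      τ.arr aHat v = (ent n σ (τ.arr aSel s)).col v)) (by decide) (by decide) (by decide)
    h.env.hNodes ?_ ?_).imp ?_
  · refine ⟨rfl, ?_, by simp, by simp, by simp⟩
    rintro t (rfl | ⟨p, hp, -⟩)
    · exact hroot
    · simp at hp
  · rintro i τ hi ⟨a0, a1, a2, a3, a4⟩ hiτ hF
    have hio : i < o.length := by omega
    obtain ⟨t, ht⟩ : ∃ t, t = o[i] := ⟨_, rfl⟩
    have htake : o.take (i + 1) = o.take i ++ [t] := by rw [ht, List.take_append_getElem]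
    have hent : ∀ e, ent n τ e = ent n σ e := ent_congr fun x hx =>
      (hF.keep (vs := []) (as := tabArrs) (rs := []) (by decide)).2.1 x hx
    have htab : Tab σ t (τ.arr aSel t) := by
      refine a1 t ?_
      by_cases hr : t = D.root
      · exact Or.inl hr
      · subst ht; exact Or.inr (ho.parent_mem hio hr)
    have htr := (h.table t trivial).trans _ htab
    have hnd := ho.nodup
    have hpw := ho.pairwise
    rw [← List.take_append_drop i o, List.drop_eq_getElem_cons hio, ← ht] at hnd hpw
    have hnotin : t ∉ o.take i := fun hm =>
      (List.nodup_append.1 hnd).2.2 t hm t (List.mem_cons_self ..) rfl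
    have hnochild : ∀ a ∈ o.take i, ¬ D.Child t a := fun a ha =>
      (List.pairwise_append.1 hpw).2.2 a ha t (List.mem_cons_self ..)
    have hself : ¬ D.Child t t := fun hc => by have := hc.2; omega
    have hother : ∀ p ∈ o.take i, ∀ s, D.Child p s → ¬ D.Child t s := fun p hp s h1 h2 =>
      hnotin (parent_unique h1 h2 ▸ hp)
    refine (runs_select (t := t) (h.env.frame hF (by decide)) ?_ ?_).imp ?_
    · rw [hiτ, hF.arr_eq _ (by decide), ho.get i hio, ht]
    · intro v s hk
      have : Tab σ s ((ent n σ (τ.arr aSel t)).b1) := htr.fst (by rw [hk]; rfl)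
      rw [hF.arr_eq aPtr (by decide), hF.arr_eq aB1 (by decide)]
      exact h.ptr _ (lt_of_lt_of_le this.2 (h.table s trivial).le_cnt)
    · rintro ρ ⟨b1, b2, b3, b4, b5⟩ -
      simp only [hent] at b1 b2 b4
      simp only [State.arr_setVar, htake, List.mem_append, List.mem_singleton]
      have c1 : ∀ s, D.Child t s → Tab σ s (ρ.arr aSel s) := fun s hs => by
        rcases child_iff.1 hs with h1 | h1
        · rw [b1 s h1]; exact htr.fst h1
        · rw [b2 s h1]; exact htr.snd h1
      have keep : ∀ a ∈ o.take i, ρ.arr aSel a = τ.arr aSel a := fun a ha => b3 a (hnochild a ha)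
      have keept : ρ.arr aSel t = τ.arr aSel t := b3 t hself
      refine ⟨?_, ?_, ?_, ?_, ?_⟩
      · rw [b3 _ (not_child_root), a0]
      · rintro s (rfl | ⟨p, hp | rfl, hps⟩)
        · rw [b3 _ not_child_root]; exact a1 _ (Or.inl rfl)
        · rw [b3 s (hother p hp s hps)]; exact a1 s (Or.inr ⟨p, hp, hps⟩)
        · exact c1 s hps
      · rintro a (ha | rfl) s hs
        · rw [keep a ha, a2 a ha s hs, b3 s (hother a ha s (child_iff.2 (Or.inl hs)))]
        · rw [keept, b1 s hs]
      · rintro a (ha | rfl) s hs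
        · rw [keep a ha, a3 a ha s hs, b3 s (hother a ha s (child_iff.2 (Or.inr hs)))]
        · rw [keept, b2 s hs]
      · rintro a (ha | rfl) v s hs
        · rw [b5 v, a4 a ha v s hs, b3 s (hother a ha s ((child_forget hs).2 rfl))]
          intro s' hs'
          obtain ⟨q, -, hq⟩ := D.vertex_forgotten_once v
          exact hnotin ((hq t ⟨s', hs'⟩).trans (hq a ⟨s, hs⟩).symm ▸ ha)
        · exact b4 v s hs
  · rintro τ ⟨a0, a1, a2, a3, a4⟩ -
    have hmem : ∀ t, t ∈ o.take N := fun t => by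
      rw [List.take_of_length_le hN.le]; exact ho.mem t
    have htab : ∀ t, Tab σ t (τ.arr aSel t) := fun t => by
      refine a1 t ?_
      by_cases hr : t = D.root
      · exact Or.inl hr
      · obtain ⟨p, hp⟩ := exists_parent hr
        exact Or.inr ⟨p, hmem p, hp⟩
    have key := matches_of_selection (T := Tab σ) (E := ent n σ) (D := D)
      (f := fun v => τ.arr aHat v) (fun t => τ.arr aSel t)
      (fun t => (h.table t trivial).trans _ (htab t)) (fun t s hs => a2 t (hmem t) s hs)
      (fun t s hs => a3 t (hmem t) s hs) (fun t v s hk => a4 t (hmem t) v s hk)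
      (exists_dist_le D)
    refine ⟨fun v => ?_, ?_⟩
    · obtain ⟨t, ⟨s, hk⟩, -⟩ := D.vertex_forgotten_once v
      rw [a4 t (hmem t) v s hk]
      exact ((h.table s trivial).trans _ (htab s)).1 v (bag_forget hk).1
    · rw [← (key D.root).2, a0]

def attemptTime (N a m : ℕ) : ℕ := N * (nodeTime a m + 98) + 100

theorem runs_attempt (h : Ready D k F d σ) (ho : Ordered D o σ)
    (hth : σ.real rSort (σ.var vTh) = r) (hF : 1 ≤ F.card) :
    Runs .attempt σ (attemptTime N F.card (D.width + 1)) fun τ => Ready D k F d τ ∧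
      ((τ.var vRes = 1 ∧ IsColoring D k F d r fun v => τ.arr aHat v) ∨
        (τ.var vRes = 0 ∧ ∀ f, ¬ IsColoring D k F d r f)) := by
  refine Runs.le (Runs.seq (runs_dp h ho hth hF) (B' := 20 + (10 + (N * 78 + 6)))
    fun τ hP hF₁ => ?_) (by unfold attemptTime; nlinarith)
  have hE := hP.env
  have ho₁ : Ordered D o τ := ho.congr (hF₁.arr_eq _ (by decide))
  have hRd : Ready D k F d τ := ⟨hE, hP.idx, hP.head⟩
  have hTr := hP.table D.root trivial
  -- The bag of the root is empty, so all its entries are similar and there is at most one.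
  have huniq : ∀ e, Tab τ D.root e → e = τ.arr aStart D.root := fun e he =>
    hTr.inj e _ he ⟨le_rfl, lt_of_le_of_lt he.1 he.2⟩
      ⟨by simp [D.bag_root], by simp [D.bag_root]⟩
  have htest : (Test.conj (.lt (.get aStart (.var vRoot)) (.get aEnd (.var vRoot)))
      (.le (.get aCost (.get aStart (.var vRoot))) (.var vK))).Holds τ ↔
      Tab τ D.root (τ.arr aStart D.root) ∧ (ent n τ (τ.arr aStart D.root)).cost ≤ k := by
    simp [hE.hRoot, hE.hK, Tab, ent]
  refine Runs.le (B := Test.cost (Test.conj (.lt (.get aStart (.var vRoot))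
    (.get aEnd (.var vRoot))) (.le (.get aCost (.get aStart (.var vRoot))) (.var vK))) +
      (10 + (N * 78 + 6))) ?_ (by simp [Test.cost, Test.lt, Expr.cost])
  refine Runs.ite (fun hq => ?_) fun hq => ?_
  · rw [htest] at hq
    refine Runs.seq (Q := fun ρ => ρ = (τ.setVar vRes 1).setArr aSel D.root
      (τ.arr aStart D.root)) ((Runs.straight rfl (by simp [hE.hRoot])).le (by decide)) ?_
    rintro ρ hρ hF₂
    have hP₂ := hP.frame hF₂ (by decide)
    have hsel : ρ.arr aSel D.root = τ.arr aStart D.root := by rw [hρ]; simp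
    have hent : ent n ρ = ent n τ := funext (ent_congr fun x hx =>
      (hF₂.keep (vs := []) (as := tabArrs) (rs := []) (by decide)).2.1 x hx)
    refine (runs_selectAll hP₂ (ho₁.congr (hF₂.arr_eq _ (by decide))) ?_).imp ?_
    · unfold Tab
      rw [hsel, hF₂.arr_eq _ (by decide), hF₂.arr_eq _ (by decide)]
      exact hq.1
    · rintro τ' ⟨h1, h2⟩ hF₃
      refine ⟨(hRd.frame hF₂ (by decide) (by decide) (by decide) (by decide)).frame hF₃ (by decide)
        (by decide) (by decide) (by decide), Or.inl ⟨?_, h1, ?_⟩⟩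
      · rw [hF₃.var_eq _ (by decide), hρ]; simp
      · rw [h2, hsel, hent]; exact hq.2
  · rw [htest] at hq
    refine ((Runs.straight rfl ?_).le (show Program.len (.setVar vRes (.const 0)) ≤ _ by
      simp only [Program.len, Expr.cost]; omega))
    refine ⟨hRd.frame (frame_setVar _ _ _) (by decide) (by decide) (by decide) (by decide),
      Or.inr ⟨by simp, fun f hf => hq ?_⟩⟩
    obtain ⟨e, he, -, hle⟩ := exists_entry (fun t => hP.table t trivial) hf.1 D.root
    obtain rfl := huniq e he
    exact ⟨he, hle.trans hf.2⟩

end RAM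

notation "vI4" => 62
notation "vBlk" => 63
notation "vNb" => 64
notation "vS" => 65
notation "vSS" => 66
notation "vBase" => 67
notation "vX" => 68
notation "vY" => 69
notation "vO" => 70

namespace RAM

variable {σ : State}

/-! ### Powers of two -/

def Program.powers : Program :=
  (.setVar vSize (.const 1) ;; .setVar vLog (.const 0) ;; .setArr aPow (.const 0) (.const 1)) ;;
  .loop (.lt (.var vSize) (.var vSq)) (.setVar vSize (.add (.var vSize) (.var vSize)) ;;
    .incr vLog ;; .setArr aPow (.var vLog) (.var vSize))

theorem runs_powers {q : ℕ} (hq : σ.var vSq = q) :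
    Runs .powers σ (Nat.clog 2 q * 20 + 20) fun τ => τ.var vLog = Nat.clog 2 q ∧
      τ.var vSize = 2 ^ Nat.clog 2 q ∧ ∀ i ≤ Nat.clog 2 q, τ.arr aPow i = 2 ^ i := by
  refine Runs.le (Runs.seq (B := 7) (Q := fun τ => τ = ((σ.setVar vSize 1).setVar vLog 0).setArr
    aPow 0 1) ((Runs.straight rfl (by simp)).le (by decide)) (B' := Nat.clog 2 q * (11 + 4) + 4) ?_)
    (by omega)
  rintro σ₁ hσ₁ hF₁
  refine (Runs.loop (Nat.clog 2 q) (fun i τ => τ.var vLog = i ∧ τ.var vSize = 2 ^ i ∧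
    τ.var vSq = q ∧ ∀ j ≤ i, τ.arr aPow j = 2 ^ j) ?_ ?_ ?_).imp ?_
  · rintro i τ hi ⟨h1, h2, h3, h4⟩
    -- The doubling stops at the first power of two that is at least q.
    rw [Test.holds_lt, Nat.lt_clog_iff_pow_lt (by omega)]
    simp [h2, h3]
  · simp [hσ₁, hq]
  · rintro i τ hi ⟨h1, h2, h3, h4⟩ hF
    refine (Runs.straight rfl ?_).le (by decide)
    simp only [Program.den, Program.incr, Expr.eval]
    refine ⟨by simp [h1], by simp [h2, pow_succ]; ring, by simp [h3], fun j hj => ?_⟩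
    by_cases hji : j = i + 1
    · simp [h1, h2, hji, pow_succ]; ring
    · simp [h1, hji, h4 j (by omega)]
  · rintro τ ⟨h1, h2, -, h4⟩ -
    exact ⟨h1, h2, h4⟩

/-! ### Sorting -/

/-- `g` is monotone on the cells from `a` to `b - 1`. -/
def SortedOn (g : ℕ → ℝ) (a b : ℕ) : Prop := ∀ i j, a ≤ i → i ≤ j → j < b → g i ≤ g j

/-- Every value of `g` on the cells from `a` to `b - 1` is also a value of `h` there. -/
def Covers (g h : ℕ → ℝ) (a b : ℕ) : Prop := ∀ j, a ≤ j → j < b → ∃ i, a ≤ i ∧ i < b ∧ h i = g j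

theorem SortedOn.congr {g h : ℕ → ℝ} {a b : ℕ} (hg : SortedOn g a b)
    (hh : ∀ j, a ≤ j → j < b → h j = g j) : SortedOn h a b := fun i j hi hij hj => by
  rw [hh i hi (by omega), hh j (by omega) hj]
  exact hg i j hi hij hj

theorem Covers.congr {g h h' : ℕ → ℝ} {a b : ℕ} (hg : Covers g h a b)
    (hh : ∀ j, a ≤ j → j < b → h' j = h j) : Covers g h' a b := fun j hj hj' => by
  obtain ⟨i, h1, h2, h3⟩ := hg j hj hj'
  exact ⟨i, h1, h2, (hh i h1 h2).trans h3⟩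

/-- The left block is served if it is not exhausted and the right one is exhausted or has a head
that is not smaller. -/
def Program.mergeStep : Program :=
  .ite (.conj (.lt (.var vX) (.var vS)) (.neg (.conj (.lt (.var vY) (.var vS)) (.neg
      (.realLe rSort (.add (.var vBase) (.var vX)) rSort
        (.add (.add (.var vBase) (.var vS)) (.var vY)))))))
    (.setReal rTmp (.add (.var vBase) (.var vO)) rSort (.add (.var vBase) (.var vX)) ;; .incr vX)
    (.setReal rTmp (.add (.var vBase) (.var vO)) rSort
      (.add (.add (.var vBase) (.var vS)) (.var vY)) ;; .incr vY)

/-- Merge two adjacent sorted blocks. -/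
def Program.mergeBlock : Program :=
  (.setVar vX (.const 0) ;; .setVar vY (.const 0)) ;; .for vO vSS .mergeStep ;;
    .setVar vBase (.add (.var vBase) (.var vSS))

/-- The first `x` values of a sorted block have been moved. -/
structure Moved (g T : ℕ → ℝ) (b o a s x : ℕ) : Prop where
  le : x ≤ s
  covers : ∀ j < x, ∃ i, b ≤ i ∧ i < b + o ∧ T i = g (a + j)
  bound : x < s → ∀ i, b ≤ i → i < b + o → T i ≤ g (a + x)

/-- The two blocks play interchangeable roles, so both branches of `mergeStep` are covered. By
`bound` the moved value is at least everything written so far, and by `hle` it is at most the head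
of the other block, so all bounds persist. -/
theorem Moved.step {g T : ℕ → ℝ} {b o a s x a' s' x' : ℕ} (h : Moved g T b o a s x)
    (h' : Moved g T b o a' s' x') (hT : SortedOn T b (b + o)) (hs : SortedOn g a (a + s))
    (hx : x < s) (hle : x' < s' → g (a + x) ≤ g (a' + x')) :
    SortedOn (Function.update T (b + o) (g (a + x))) b (b + (o + 1)) ∧
      Moved g (Function.update T (b + o) (g (a + x))) b (o + 1) a s (x + 1) ∧
      Moved g (Function.update T (b + o) (g (a + x))) b (o + 1) a' s' x' := by
  have hup : ∀ i, i < b + o → Function.update T (b + o) (g (a + x)) i = T i := fun i hi =>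
    Function.update_of_ne hi.ne _ _
  have hub : ∀ i, b ≤ i → i < b + (o + 1) →
      Function.update T (b + o) (g (a + x)) i ≤ g (a + x) := fun i h1 h2 => by
    by_cases hi : i < b + o
    · rw [hup i hi]; exact h.bound hx i h1 hi
    · obtain rfl : i = b + o := by omega
      rw [Function.update_self]
  refine ⟨fun i j hi hij hj => ?_, ⟨hx, fun j hj => ?_, fun hx' i h1 h2 => ?_⟩,
    h'.le, fun j hj => ?_, fun hx' i h1 h2 => (hub i h1 h2).trans (hle hx')⟩
  · by_cases hj' : j < b + o
    · rw [hup i (by omega), hup j hj']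
      exact hT i j hi hij hj'
    · obtain rfl : j = b + o := by omega
      rw [Function.update_self]
      exact hub i hi (by omega)
  · by_cases hjx : j < x
    · obtain ⟨i, h1, h2, h3⟩ := h.covers j hjx
      exact ⟨i, h1, by omega, by rw [hup i h2, h3]⟩
    · obtain rfl : j = x := by omega
      exact ⟨b + o, by omega, by omega, Function.update_self ..⟩
  · exact (hub i h1 h2).trans (hs _ _ (by omega) (by omega) (by omega))
  · obtain ⟨i, h1, h2, h3⟩ := h'.covers j hj
    exact ⟨i, h1, by omega, by rw [hup i h2, h3]⟩

theorem runs_mergeBlock {b s : ℕ} (hb : σ.var vBase = b) (hs : σ.var vS = s)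
    (hss : σ.var vSS = s + s) (h₁ : SortedOn (σ.real rSort) b (b + s))
    (h₂ : SortedOn (σ.real rSort) (b + s) (b + s + s)) :
    Runs .mergeBlock σ ((s + s) * 60 + 20) fun τ => τ.var vBase = b + (s + s) ∧
      SortedOn (τ.real rTmp) b (b + (s + s)) ∧
      Covers (σ.real rSort) (τ.real rTmp) b (b + (s + s)) ∧
      ∀ j < b, τ.real rTmp j = σ.real rTmp j := by
  refine Runs.le (Runs.seq (B := 4) (B' := (s + s) * (52 + 8) + 6 + 4)
    (Q := fun τ => τ = (σ.setVar vX 0).setVar vY 0)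
    ((Runs.straight rfl (by simp)).le (by decide)) ?_) (by omega)
  rintro σ₁ hσ₁ hF₁
  have hr₁ : σ₁.real = σ.real := by rw [hσ₁]; rfl
  refine Runs.seq (Runs.for (s + s) (fun o τ => ∃ x y, τ.var vX = x ∧ τ.var vY = y ∧ x + y = o ∧
    SortedOn (τ.real rTmp) b (b + o) ∧ Moved (σ.real rSort) (τ.real rTmp) b o b s x ∧
    Moved (σ.real rSort) (τ.real rTmp) b o (b + s) s y ∧
    ∀ j < b, τ.real rTmp j = σ.real rTmp j) (by decide) (by decide) (by decide) ?_ ?_ ?_) ?_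
  · rw [hF₁.var_eq _ (by decide), hss]
  · refine ⟨0, 0, by simp [hσ₁], by simp [hσ₁], rfl, ?_, ⟨Nat.zero_le _, by simp, ?_⟩,
      ⟨Nat.zero_le _, by simp, ?_⟩, by simp [hr₁]⟩
    · intro i j h1 h2 h3; omega
    · intro _ i h1 h2; omega
    · intro _ i h1 h2; omega
  · rintro o τ ho ⟨x, y, hx, hy, hxy, h3, h4, h5, h6⟩ hoτ hF
    have e1 : τ.var vBase = b := by rw [hF.var_eq _ (by decide), hF₁.var_eq _ (by decide), hb]
    have e2 : τ.var vS = s := by rw [hF.var_eq _ (by decide), hF₁.var_eq _ (by decide), hs]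
    have e3 : τ.real rSort = σ.real rSort := by
      rw [hF.real_eq _ (by decide), hr₁]
    have htest : (Test.conj (.lt (.var vX) (.var vS)) (.neg (.conj (.lt (.var vY) (.var vS)) (.neg
      (.realLe rSort (.add (.var vBase) (.var vX)) rSort
        (.add (.add (.var vBase) (.var vS)) (.var vY))))))).Holds τ ↔
        x < s ∧ (y < s → σ.real rSort (b + x) ≤ σ.real rSort (b + s + y)) := by
      simp [hx, hy, e1, e2, e3]
    refine (Runs.straight rfl ?_).le (by decide)
    simp only [Program.mergeStep, Program.incr, Program.den, htest]
    split_ifs with hq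
    · obtain ⟨g1, g2, g3⟩ := h4.step h5 h3 h₁ hq.1 hq.2
      refine ⟨x + 1, y, by simp [hx], by simp [hy], by omega, ?_, ?_, ?_, fun j hj => ?_⟩
      · simpa [e1, hoτ, e3, hx] using g1
      · simpa [e1, hoτ, e3, hx] using g2
      · simpa [e1, hoτ, e3, hx] using g3
      · have : j ≠ b + o := by omega
        simp [e1, hoτ, this, h6 j hj]
    · have hys : y < s := by
        by_contra hys
        exact hq ⟨by have := h4.le; omega, fun h => absurd h hys⟩
      obtain ⟨g1, g2, g3⟩ := h5.step h4 h3 h₂ hys fun hxs => by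
        by_contra hlt
        exact hq ⟨hxs, fun _ => (not_le.1 hlt).le⟩
      refine ⟨x, y + 1, by simp [hx], by simp [hy], by omega, ?_, ?_, ?_, fun j hj => ?_⟩
      · simpa [e1, hoτ, e2, e3, hy] using g1
      · simpa [e1, hoτ, e2, e3, hy] using g3
      · simpa [e1, hoτ, e2, e3, hy] using g2
      · have : j ≠ b + o := by omega
        simp [e1, hoτ, this, h6 j hj]
  · rintro τ ⟨x, y, -, -, hxy, h3, h4, h5, h6⟩ hF
    refine (Runs.straight rfl ?_).le (by decide)
    have e1 : τ.var vBase = b := by rw [hF.var_eq _ (by decide), hF₁.var_eq _ (by decide), hb]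
    have e2 : τ.var vSS = s + s := by rw [hF.var_eq _ (by decide), hF₁.var_eq _ (by decide), hss]
    have hx := h4.le
    have hy := h5.le
    refine ⟨by simp [e1, e2], h3, fun j h1 h2 => ?_, h6⟩
    change ∃ i, b ≤ i ∧ i < b + (s + s) ∧ τ.real rTmp i = σ.real rSort j
    by_cases hj : j < b + s
    · obtain ⟨i, g1, g2, g3⟩ := h4.covers (j - b) (by omega)
      exact ⟨i, g1, g2, by rw [g3, show b + (j - b) = j by omega]⟩
    · obtain ⟨i, g1, g2, g3⟩ := h5.covers (j - (b + s)) (by omega)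
      exact ⟨i, g1, g2, by rw [g3, show b + s + (j - (b + s)) = j by omega]⟩

/-- Copy the first `vSize` cells of a real array. -/
def Program.copyReal (a b : ℕ) : Program := .for vO vSize (.setReal a (.var vO) b (.var vO))

theorem runs_copyReal {a b M : ℕ} (hab : b ≠ a) (hM : σ.var vSize = M) :
    Runs (.copyReal a b) σ (M * 11 + 6) fun τ => ∀ j < M, τ.real a j = σ.real b j := by
  refine Runs.for (B := 3) M (fun i τ => ∀ j < i, τ.real a j = σ.real b j) (by simp [Program.wv])
    (by simp [Program.wv]) (by decide) hM (by simp) ?_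
  intro i τ hi h hx hF
  refine (Runs.straight rfl ?_).le (by simp [Program.len, Expr.cost])
  intro j hj
  have e : τ.real b = σ.real b := hF.real _ (by
    simpa [Program.for, Program.wr, Program.incr] using hab)
  by_cases hji : j = i
  · simp [hx, hji, e]
  · simp [hx, hji, h j (by omega)]

def Program.pass : Program :=
  (.setVar vBase (.const 0) ;;
    .setVar vNb (.get aPow (.sub (.sub (.var vLog) (.var vI4)) (.const 1))) ;;
    .setVar vS (.get aPow (.var vI4)) ;; .setVar vSS (.add (.var vS) (.var vS))) ;;
  .for vBlk vNb .mergeBlock ;; .copyReal rSort rTmp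

/-- Pass i merges pairs of blocks of length 2^i. The padded length is a power of two, so no block is
incomplete and the number of pairs is an entry of `aPow`, which avoids a division. -/
theorem runs_pass {L i : ℕ} (hi : i < L) (hL : σ.var vLog = L) (hM : σ.var vSize = 2 ^ L)
    (hpow : ∀ j ≤ L, σ.arr aPow j = 2 ^ j) (hiv : σ.var vI4 = i)
    (hs : ∀ q < 2 ^ (L - i), SortedOn (σ.real rSort) (q * 2 ^ i) ((q + 1) * 2 ^ i)) :
    Runs .pass σ (2 ^ L * 100 + 50) fun τ =>
      (∀ q < 2 ^ (L - (i + 1)),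
        SortedOn (τ.real rSort) (q * 2 ^ (i + 1)) ((q + 1) * 2 ^ (i + 1))) ∧
      Covers (σ.real rSort) (τ.real rSort) 0 (2 ^ L) := by
  obtain ⟨s, hsd⟩ : ∃ s, s = 2 ^ i := ⟨_, rfl⟩
  obtain ⟨nb, hnb⟩ : ∃ nb, nb = 2 ^ (L - (i + 1)) := ⟨_, rfl⟩
  have hss : 2 ^ (i + 1) = s + s := by rw [hsd, pow_succ]; ring
  have hnbs : nb * (s + s) = 2 ^ L := by
    rw [hnb, ← hss, ← pow_add]; congr 1; omega
  have hnb2 : 2 ^ (L - i) = nb + nb := by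
    rw [hnb, show L - i = L - (i + 1) + 1 by omega, pow_succ]; ring
  have hs1 : 1 ≤ s := by rw [hsd]; exact Nat.one_le_two_pow
  have hnble : nb ≤ 2 ^ L := by rw [← hnbs]; exact Nat.le_mul_of_pos_right _ (by omega)
  rw [hss, ← hnb]
  rw [← hsd, hnb2] at hs
  have htime : nb * ((s + s) * 60 + 20 + 8) ≤ 2 ^ L * 88 := by
    calc _ = nb * (s + s) * 60 + nb * 28 := by ring
      _ ≤ 2 ^ L * 60 + 2 ^ L * 28 := by rw [hnbs]; gcongr
      _ = _ := by ring
  refine Runs.le (Runs.seq (B := 20) (B' := nb * ((s + s) * 60 + 20 + 8) + 6 + (2 ^ L * 11 + 6))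
    (Q := fun τ => τ.var vBase = 0 ∧ τ.var vNb = nb ∧ τ.var vS = s ∧ τ.var vSS = s + s)
    ((Runs.straight rfl ?_).le (by decide)) ?_) (by omega)
  · have := hpow (L - (i + 1)) (by omega)
    simp [hL, hiv, this, hpow i hi.le, hnb, hsd, show L - i - 1 = L - (i + 1) by omega]
  rintro σ₁ ⟨g1, g2, g3, g4⟩ hF₁
  have hr₁ : σ₁.real rSort = σ.real rSort := hF₁.real_eq _ (by decide)
  refine Runs.seq (Runs.for (σ := σ₁) nb (fun q τ => τ.var vBase = q * (s + s) ∧ ∀ q' < q,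
      SortedOn (τ.real rTmp) (q' * (s + s)) ((q' + 1) * (s + s)) ∧
      Covers (σ.real rSort) (τ.real rTmp) (q' * (s + s)) ((q' + 1) * (s + s)))
      (by decide) (by decide) (by decide) g2 ?_ ?_) ?_
  · simp [g1]
  · rintro q τ hq ⟨h1, h2⟩ - hF
    have e3 : τ.real rSort = σ.real rSort := by rw [hF.real_eq _ (by decide), hr₁]
    refine (runs_mergeBlock h1 (by rw [hF.var_eq _ (by decide), g3])
      (by rw [hF.var_eq _ (by decide), g4]) ?_ ?_).imp ?_
    · have := hs (q + q) (by omega)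
      rw [e3]
      rwa [show (q + q) * s = q * (s + s) by ring,
        show (q + q + 1) * s = q * (s + s) + s by ring] at this
    · have := hs (q + q + 1) (by omega)
      rw [e3]
      rwa [show (q + q + 1) * s = q * (s + s) + s by ring,
        show (q + q + 1 + 1) * s = q * (s + s) + s + s by ring] at this
    · rintro ρ ⟨k1, k2, k3, k4⟩ -
      rw [e3] at k3
      refine ⟨by simp [k1]; ring, fun q' hq' => ?_⟩
      simp only [State.real_setVar]
      by_cases hqq : q' = q
      · subst hqq
        rw [show (q' + 1) * (s + s) = q' * (s + s) + (s + s) by ring]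
        exact ⟨k2, k3⟩
      · have hlt : (q' + 1) * (s + s) ≤ q * (s + s) := Nat.mul_le_mul_right _ (by omega)
        obtain ⟨f1, f2⟩ := h2 q' (by omega)
        exact ⟨f1.congr fun j _ hj => k4 j (by omega), f2.congr fun j _ hj => k4 j (by omega)⟩
  · rintro τ ⟨-, h⟩ hF
    refine (runs_copyReal (M := 2 ^ L) (by decide) ?_).imp fun ρ hρ _ => ?_
    · rw [hF.var_eq _ (by decide), hF₁.var_eq _ (by decide), hM]
    · refine ⟨fun q hq => (h q hq).1.congr fun j _ hj => hρ j ?_, fun j _ hj => ?_⟩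
      · refine lt_of_lt_of_le hj ?_
        rw [← hnbs]
        exact Nat.mul_le_mul_right _ hq
      -- Cell j lies in the merged block with number j / (s + s), whose values all survive inside
      -- it.
      · have hjd := Nat.div_add_mod j (s + s)
        have hjm := Nat.mod_lt j (show 0 < s + s by omega)
        have hjq : j / (s + s) < nb := by
          rw [Nat.div_lt_iff_lt_mul (by omega), hnbs]; exact hj
        obtain ⟨i', h1, h2, h3⟩ := (h _ hjq).2 j (by rw [mul_comm]; omega)
          (by rw [add_mul, mul_comm]; omega)
        have hi' : i' < 2 ^ L := by
          refine lt_of_lt_of_le h2 ?_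
          rw [← hnbs]
          exact Nat.mul_le_mul_right _ hjq
        exact ⟨i', Nat.zero_le _, hi', by rw [hρ i' hi', h3]⟩

/-- Sort the first `vSize` cells of the distance matrix into `rSort`. -/
def Program.sort : Program := .copyReal rSort rDist ;; .for vI4 vLog .pass

/-- It is enough that every original value reappears in the sorted array. Additional values, such as
those in the padding, are harmless as thresholds, so it need not be shown that the result is a
permutation. -/
theorem runs_sort {L : ℕ} (hL : σ.var vLog = L) (hM : σ.var vSize = 2 ^ L)
    (hpow : ∀ j ≤ L, σ.arr aPow j = 2 ^ j) :
    Runs .sort σ (2 ^ L * 11 + 6 + (L * (2 ^ L * 100 + 50 + 8) + 6)) fun τ =>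
      SortedOn (τ.real rSort) 0 (2 ^ L) ∧ Covers (σ.real rDist) (τ.real rSort) 0 (2 ^ L) := by
  refine Runs.seq (runs_copyReal (by decide) hM) fun σ₁ h₁ hF₁ => ?_
  refine (Runs.for L (fun i τ => (∀ q < 2 ^ (L - i),
      SortedOn (τ.real rSort) (q * 2 ^ i) ((q + 1) * 2 ^ i)) ∧
      Covers (σ.real rDist) (τ.real rSort) 0 (2 ^ L)) (by decide) (by decide) (by decide) ?_ ?_
      ?_).imp ?_
  · rw [hF₁.var_eq _ (by decide), hL]
  · refine ⟨fun q _ i j h1 h2 h3 => ?_, fun j _ hj => ⟨j, Nat.zero_le _, hj, h₁ j hj⟩⟩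
    obtain rfl : i = j := by rw [pow_zero] at h1 h3; omega
    exact le_rfl
  · rintro i τ hi ⟨h1, h2⟩ hiτ hF
    refine (runs_pass hi ?_ ?_ ?_ hiτ h1).imp ?_
    · rw [hF.var_eq _ (by decide), hF₁.var_eq _ (by decide), hL]
    · rw [hF.var_eq _ (by decide), hF₁.var_eq _ (by decide), hM]
    · rw [hF.arr_eq _ (by decide), hF₁.arr_eq _ (by decide)]; exact hpow
    · rintro ρ ⟨h3, h4⟩ -
      refine ⟨h3, fun j hj hj' => ?_⟩
      obtain ⟨i₁, f1, f2, f3⟩ := h2 j hj hj'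
      obtain ⟨i₂, f4, f5, f6⟩ := h4 i₁ f1 f2
      exact ⟨i₂, f4, f5, f6.trans f3⟩
  · rintro τ ⟨h1, h2⟩ -
    refine ⟨?_, h2⟩
    simpa using h1 0 (by simp)

end RAM

notation "vLen" => 71
notation "vPosn" => 72
notation "vI5" => 73

/-- The list of the children of a node. -/
def NodeKind.children {V ι : Type} : NodeKind V ι → List ι
  | .leaf => []
  | .introduceVertex _ s => [s]
  | .introduceEdge _ _ s => [s]
  | .forget _ s => [s]
  | .join s₁ s₂ => [s₁, s₂]

namespace NiceTreeDecomposition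

variable {V ι : Type} [DecidableEq V] {G : SimpleGraph V} {D : NiceTreeDecomposition G ι} {t : ι}

theorem mem_children {s : ι} : s ∈ (D.kind t).children ↔ D.Child t s := by
  cases hk : D.kind t with
  | leaf => simp [NodeKind.children, child_leaf hk]
  | introduceVertex v s => simp [NodeKind.children, child_introduceVertex hk]
  | introduceEdge u v s => simp [NodeKind.children, child_introduceEdge hk]
  | forget v s => simp [NodeKind.children, child_forget hk]
  | join s₁ s₂ => simp [NodeKind.children, child_join hk]

theorem nodup_children (D : NiceTreeDecomposition G ι) (t : ι) : (D.kind t).children.Nodup := by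
  cases hk : D.kind t with
  | join s₁ s₂ => simpa [NodeKind.children] using (bag_join hk).1
  | _ => simp [NodeKind.children]

end NiceTreeDecomposition

namespace RAM

open NiceTreeDecomposition

variable {n N : ℕ} {G : SimpleGraph (Fin n)} {D : NiceTreeDecomposition G (Fin N)} {k : ℕ}
  {F : Finset (Fin n)} {d : Fin n → Fin n → ℝ≥0} {σ : State} {t : Fin N}
  {o : List (Fin N)}

/-! ### The order of the nodes -/

/-- The first cells of `g` contain the list `l`. -/
def Stores (l : List (Fin N)) (g : ℕ → ℕ) : Prop := ∀ (j : ℕ) (h : j < l.length), g j = l[j]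

theorem Stores.concat {l : List (Fin N)} {g : ℕ → ℕ} (h : Stores l g) (s : Fin N) :
    Stores (l ++ [s]) (Function.update g l.length s) := fun j hj => by
  by_cases hjl : j = l.length
  · subst hjl; simp
  · have hj' : j < l.length := by simp at hj; omega
    rw [Function.update_of_ne hjl, h j hj', List.getElem_append_left]

/-- Append the children of the node number `vI3` to the list of nodes. -/
def Program.expand : Program :=
  .setVar vT (.get aOrd (.var vI3)) ;; .setVar vKind (.get aKind (.var vT)) ;;
  .ite (.le (.const 1) (.var vKind))
    (.setArr aOrd (.var vLen) (.get aC1 (.var vT)) ;; .incr vLen) .skip ;;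
  .ite (.eq (.var vKind) (.const 4))
    (.setArr aOrd (.var vLen) (.get aC2 (.var vT)) ;; .incr vLen) .skip

/-- Breadth first search from the root. -/
def Program.order : Program :=
  (.setArr aOrd (.const 0) (.var vRoot) ;; .setVar vLen (.const 1)) ;; .for vI3 vNodes .expand

theorem runs_expand {l : List (Fin N)} (hl : Stores l (σ.arr aOrd)) (hlen : σ.var vLen = l.length)
    (ht : σ.arr aOrd (σ.var vI3) = t) (hk : σ.arr aKind t = nodeCode (D.kind t) 0)
    (hC1 : σ.arr aC1 t = nodeCode (D.kind t) 1) (hC2 : σ.arr aC2 t = nodeCode (D.kind t) 2) :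
    Runs .expand σ 60 fun τ => Stores (l ++ (D.kind t).children) (τ.arr aOrd) ∧
      τ.var vLen = (l ++ (D.kind t).children).length := by
  refine (Runs.straight rfl ?_).le (by decide)
  cases hkt : D.kind t with
  | leaf =>
    rw [hkt] at hk
    simpa [Program.expand, ht, hk, nodeCode, NodeKind.children, hlen] using hl
  | join s₁ s₂ =>
    rw [hkt] at hk hC1 hC2
    simp [Program.expand, Program.incr, ht, hk, nodeCode, NodeKind.children, hlen, hC1, hC2]
    simpa using (hl.concat s₁).concat s₂
  | introduceVertex v s =>
    rw [hkt] at hk hC1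
    simp [Program.expand, Program.incr, ht, hk, nodeCode, NodeKind.children, hlen, hC1]
    exact hl.concat s
  | introduceEdge u v s =>
    rw [hkt] at hk hC1
    simp [Program.expand, Program.incr, ht, hk, nodeCode, NodeKind.children, hlen, hC1]
    exact hl.concat s
  | forget v s =>
    rw [hkt] at hk hC1
    simp [Program.expand, Program.incr, ht, hk, nodeCode, NodeKind.children, hlen, hC1]
    exact hl.concat s

theorem mem_of_closed {l : List (Fin N)} (h0 : D.root ∈ l)
    (h : ∀ p ∈ l, ∀ s, D.Child p s → s ∈ l) (t : Fin N) : t ∈ l := by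
  have := Desc.root (D := D) t
  induction this with
  | refl => exact h0
  | tail _ hbc ih => exact h _ ih _ hbc

/-- After i rounds the list consists of the root and the children of its first i members. A child
found in the next round is new, because its only parent has not been expanded before; so no child is
ever listed before its parent. -/
theorem runs_order (hN : σ.var vNodes = N) (hR : σ.var vRoot = D.root)
    (hk : ∀ t : Fin N, σ.arr aKind t = nodeCode (D.kind t) 0)
    (hC1 : ∀ t : Fin N, σ.arr aC1 t = nodeCode (D.kind t) 1)
    (hC2 : ∀ t : Fin N, σ.arr aC2 t = nodeCode (D.kind t) 2) :
    Runs .order σ (N * 68 + 20) fun τ => ∃ o, Ordered D o τ := by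
  refine Runs.le (Runs.seq (B := 5) (B' := N * (60 + 8) + 6)
    (Q := fun τ => τ = (σ.setArr aOrd 0 D.root).setVar vLen 1)
    ((Runs.straight rfl (by simp [hR])).le (by decide)) ?_) (by omega)
  rintro σ₁ hσ₁ hF₁
  refine (Runs.for (σ := σ₁) N (fun i τ => ∃ l : List (Fin N), Stores l (τ.arr aOrd) ∧
    τ.var vLen = l.length ∧ l.Nodup ∧ D.root ∈ l ∧ i ≤ l.length ∧
    (∀ s ∈ l, s = D.root ∨ ∃ p ∈ l.take i, D.Child p s) ∧
    (∀ p ∈ l.take i, ∀ s, D.Child p s → s ∈ l) ∧ l.Pairwise fun a b => ¬ D.Child b a)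
    (by decide) (by decide) (by decide) ?_ ?_ ?_).imp ?_
  · rw [hF₁.var_eq _ (by decide), hN]
  · refine ⟨[D.root], fun j hj => ?_, by simp [hσ₁], by simp, by simp, by simp, by simp, by simp,
      by simp⟩
    obtain rfl : j = 0 := by simpa using hj
    simp [hσ₁]
  · rintro i τ hi ⟨l, h1, h2, h3, h4, h5, h6, h7, h8⟩ hiτ hF
    -- The queue cannot run dry early: a list whose members have all been expanded is closed under
    -- children and so contains all N nodes.
    have hil : i < l.length := by
      by_contra hil
      rw [List.take_of_length_le (by omega)] at h7
      have hall := mem_of_closed h4 h7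
      have : Finset.univ.card ≤ l.toFinset.card :=
        Finset.card_le_card fun t _ => List.mem_toFinset.2 (hall t)
      rw [Finset.card_univ, Fintype.card_fin, List.toFinset_card_of_nodup h3] at this
      omega
    obtain ⟨t, ht⟩ : ∃ t, t = l[i] := ⟨_, rfl⟩
    have htake : l.take (i + 1) = l.take i ++ [t] := by rw [ht, List.take_append_getElem]
    have hnotin : t ∉ l.take i := by
      have hnd := h3
      rw [← List.take_append_drop i l, List.drop_eq_getElem_cons hil, ← ht] at hnd
      exact fun hm => (List.nodup_append.1 hnd).2.2 t hm t (List.mem_cons_self ..) rfl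
    have hnew : ∀ s, D.Child t s → s ∉ l := fun s hs hsl => by
      rcases h6 s hsl with rfl | ⟨p, hp, hps⟩
      · exact not_child_root hs
      · exact hnotin (parent_unique hs hps ▸ hp)
    refine (runs_expand (t := t) (D := D) h1 h2 ?_ ?_ ?_ ?_).imp ?_
    · rw [hiτ, h1 i hil, ht]
    · rw [hF.arr_eq _ (by decide), hF₁.arr_eq _ (by decide), hk]
    · rw [hF.arr_eq _ (by decide), hF₁.arr_eq _ (by decide), hC1]
    · rw [hF.arr_eq _ (by decide), hF₁.arr_eq _ (by decide), hC2]
    · rintro ρ ⟨g1, g2⟩ -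
      have htake' : (l ++ (D.kind t).children).take (i + 1) = l.take i ++ [t] := by
        rw [List.take_append_of_le_length (by omega), htake]
      refine ⟨l ++ (D.kind t).children, g1, by simpa using g2, ?_, by simp [h4], ?_, ?_, ?_, ?_⟩
      · refine List.nodup_append.2 ⟨h3, D.nodup_children t, ?_⟩
        rintro a ha b hb rfl
        exact hnew a (mem_children.1 hb) ha
      · rw [List.length_append]; omega
      · intro s hs
        rw [htake']
        rcases List.mem_append.1 hs with hs | hs
        · rcases h6 s hs with h | ⟨p, hp, hps⟩
          · exact Or.inl h
          · exact Or.inr ⟨p, by simp [hp], hps⟩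
        · exact Or.inr ⟨t, by simp, mem_children.1 hs⟩
      · intro p hp s hps
        rw [htake', List.mem_append, List.mem_singleton] at hp
        rcases hp with hp | rfl
        · exact List.mem_append_left _ (h7 p hp s hps)
        · exact List.mem_append_right _ (mem_children.2 hps)
      · refine List.pairwise_append.2 ⟨h8, List.pairwise_of_forall_mem_list ?_, ?_⟩
        · intro a ha b hb hba
          obtain rfl := parent_unique hba (mem_children.1 ha)
          have := (mem_children.1 hb).2
          omega
        · intro a ha b hb hba
          rcases h6 a ha with rfl | ⟨p, hp, hpa⟩
          · exact not_child_root hba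
          · obtain rfl := parent_unique hba hpa
            exact hnew b (mem_children.1 hb) (List.mem_of_mem_take hp)
  · rintro τ ⟨l, h1, h2, h3, h4, h5, h6, h7, h8⟩ -
    have hle : l.length ≤ N := by simpa using h3.length_le_card
    rw [List.take_of_length_le hle] at h7
    exact ⟨l, h3, mem_of_closed h4 h7, h1, h8⟩

/-! ### The search for the best threshold -/

/-- Search for the first threshold that admits a colouring. -/
def Program.search : Program :=
  .setVar vPosn (.const 0) ;;
  .for vI5 vLog
    (.setVar vTh (.sub (.add (.var vPosn)
      (.get aPow (.sub (.sub (.var vLog) (.var vI5)) (.const 1)))) (.const 1)) ;; .attempt ;;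
    .ite (.eq (.var vRes) (.const 0)) (.setVar vPosn (.add (.var vPosn)
      (.get aPow (.sub (.sub (.var vLog) (.var vI5)) (.const 1))))) .skip) ;;
  .setVar vTh (.var vPosn) ;; .attempt

/-- The window of 2^(L - i) cells starting at p keeps two properties: all cells before it fail, and
its last cell succeeds unless the window reaches the end of the array. Success is monotone since the
thresholds are sorted. The final attempt at p recomputes the colouring, which later failures may
have left behind. -/
theorem runs_search {L : ℕ} (h : Ready D k F d σ) (ho : Ordered D o σ) (hF : 1 ≤ F.card)
    (hL : σ.var vLog = L) (hpow : ∀ j ≤ L, σ.arr aPow j = 2 ^ j)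
    (hs : SortedOn (σ.real rSort) 0 (2 ^ L)) :
    Runs .search σ ((L + 1) * (attemptTime N F.card (D.width + 1) + 60)) fun τ =>
      Env D k F d τ ∧
      ((∃ p < 2 ^ L, τ.var vRes = 1 ∧
        IsColoring D k F d (σ.real rSort p) (fun v => τ.arr aHat v) ∧
        ∀ j < p, ∀ f, ¬ IsColoring D k F d (σ.real rSort j) f) ∨
      (τ.var vRes = 0 ∧ ∀ j < 2 ^ L, ∀ f, ¬ IsColoring D k F d (σ.real rSort j) f)) := by
  set A := attemptTime N F.card (D.width + 1)
  refine Runs.le (Runs.seq (B := 2) (B' := L * ((11 + (A + 20)) + 8) + 6 + (2 + A))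
    (Q := fun τ => τ = σ.setVar vPosn 0)
    ((Runs.straight rfl (by simp)).le (by decide)) ?_) (by nlinarith)
  rintro σ₁ hσ₁ hF₁
  have hR₁ : Ready D k F d σ₁ :=
    h.frame hF₁ (by decide) (by decide) (by decide) (by decide)
  refine Runs.seq (Runs.for L (fun i τ => Ready D k F d τ ∧ ∃ p, τ.var vPosn = p ∧
    p + 2 ^ (L - i) ≤ 2 ^ L ∧ (∀ j < p, ∀ f, ¬ IsColoring D k F d (σ.real rSort j) f) ∧
    (p + 2 ^ (L - i) = 2 ^ L ∨ ∃ f, IsColoring D k F d (σ.real rSort (p + 2 ^ (L - i) - 1)) f))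
    (by decide) (by decide) (by decide) ?_ ?_ ?_) ?_
  · rw [hF₁.var_eq _ (by decide), hL]
  · refine ⟨hR₁.frame (frame_setVar _ _ _) (by decide) (by decide) (by decide) (by decide), 0,
      by simp [hσ₁], by simp, by simp, by simp⟩
  · rintro i τ hi ⟨hR, p, hp, h1, h2, h3⟩ hiτ hFr
    obtain ⟨b, hb⟩ : ∃ b, b = 2 ^ (L - (i + 1)) := ⟨_, rfl⟩
    have hb2 : 2 ^ (L - i) = b + b := by
      rw [hb, show L - i = L - (i + 1) + 1 by omega, pow_succ]; ring
    have hb1 : 1 ≤ b := by rw [hb]; exact Nat.one_le_two_pow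
    rw [hb2] at h1 h3
    have e1 : τ.var vLog = L := by rw [hFr.var_eq _ (by decide), hF₁.var_eq _ (by decide), hL]
    have e2 : τ.arr aPow (L - i - 1) = b := by
      rw [hFr.arr_eq _ (by decide), hF₁.arr_eq _ (by decide), hpow _ (by omega), hb,
        show L - i - 1 = L - (i + 1) by omega]
    have e3 : τ.real rSort = σ.real rSort := by
      rw [hFr.real_eq _ (by decide), hF₁.real_eq _ (by decide)]
    -- The last cell of the lower half is tested. By monotonicity its failure excludes the whole
    -- lower half.
    refine Runs.seq (Q := fun ρ => ρ = τ.setVar vTh (p + b - 1))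
      ((Runs.straight rfl (by simp [e1, hiτ, e2, hp])).le (by decide)) ?_
    rintro τ₁ hτ₁ hF₂
    have hR₂ : Ready D k F d τ₁ := hR.frame hF₂ (by decide) (by decide) (by decide) (by decide)
    have ho₂ : Ordered D o τ₁ := ho.congr (by
      rw [hF₂.arr_eq _ (by decide), hFr.arr_eq _ (by decide), hF₁.arr_eq _ (by decide)])
    refine Runs.seq (runs_attempt hR₂ ho₂ (r := σ.real rSort (p + b - 1)) ?_ hF) ?_
    · rw [hF₂.real_eq _ (by decide), e3, hτ₁]; simp
    rintro τ₂ ⟨hR₃, hres⟩ hF₃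
    have f1 : τ₂.var vLog = L := by rw [hF₃.var_eq _ (by decide), hF₂.var_eq _ (by decide), e1]
    have f2 : τ₂.arr aPow (L - i - 1) = b := by
      rw [hF₃.arr_eq _ (by decide), hF₂.arr_eq _ (by decide), e2]
    have f3 : τ₂.var vPosn = p := by rw [hF₃.var_eq _ (by decide), hF₂.var_eq _ (by decide), hp]
    have f4 : τ₂.var vI5 = i := by rw [hF₃.var_eq _ (by decide), hF₂.var_eq _ (by decide), hiτ]
    have hRd : ∀ m x, Ready D k F d ((τ₂.setVar vPosn m).setVar vI5 x) := fun m x =>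
      (hR₃.frame (frame_setVar _ _ _) (by decide) (by decide) (by decide) (by decide)).frame
        (frame_setVar _ _ _) (by decide) (by decide) (by decide) (by decide)
    have hRd' : ∀ x, Ready D k F d (τ₂.setVar vI5 x) := fun x =>
      hR₃.frame (frame_setVar _ _ _) (by decide) (by decide) (by decide) (by decide)
    refine (Runs.straight rfl ?_).le (by decide)
    rw [← hb]
    rcases hres with ⟨g1, g2⟩ | ⟨g1, g2⟩
    · simp only [Program.den, Test.holds_eq, Expr.eval, g1, one_ne_zero, if_false]
      refine ⟨hRd' _, p, by simp [f3], by omega, h2, Or.inr ⟨_, g2⟩⟩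
    · simp only [Program.den, Test.holds_eq, Expr.eval, g1, if_true, f1, f2, f3, f4]
      refine ⟨hRd _ _, p + b, by simp, by omega, fun j hj f hf => ?_, ?_⟩
      · exact g2 f (hf.mono (hs _ _ (Nat.zero_le _) (by omega) (by omega)))
      · rw [add_assoc]; exact h3
  · rintro τ ⟨hR, p, hp, h1, h2, h3⟩ hFr
    rw [Nat.sub_self, pow_zero] at h1 h3
    rw [Nat.add_sub_cancel] at h3
    refine Runs.seq (Q := fun ρ => ρ = τ.setVar vTh p)
      ((Runs.straight rfl (by simp [hp])).le (by decide)) ?_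
    rintro τ₁ hτ₁ hF₂
    have hR₂ : Ready D k F d τ₁ := hR.frame hF₂ (by decide) (by decide) (by decide) (by decide)
    have ho₂ : Ordered D o τ₁ := ho.congr (by
      rw [hF₂.arr_eq _ (by decide), hFr.arr_eq _ (by decide), hF₁.arr_eq _ (by decide)])
    refine (runs_attempt hR₂ ho₂ (r := σ.real rSort p) ?_ hF).imp ?_
    · rw [hF₂.real_eq _ (by decide), hFr.real_eq _ (by decide), hF₁.real_eq _ (by decide), hτ₁]
      simp
    rintro τ₂ ⟨hR₃, ⟨g1, g2⟩ | ⟨g1, g2⟩⟩ -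
    · exact ⟨hR₃.env, Or.inl ⟨p, by omega, g1, g2, h2⟩⟩
    · refine ⟨hR₃.env, Or.inr ⟨g1, fun j hj f hf => ?_⟩⟩
      -- The window is now the single cell p. Either it is the last cell, and its failure excludes
      -- every threshold, or it was already known to succeed.
      rcases h3 with h3 | ⟨f', hf'⟩
      · exact g2 f (hf.mono (hs _ _ (Nat.zero_le _) (by omega) (by omega)))
      · exact g2 f' hf'

end RAM

notation "vCl" => 74
notation "vIu" => 75
notation "vIv" => 76
notation "vIx" => 77
notation "vNum" => 78

/-! ### Splitting a colouring into clusters -/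

/-- `l` maps every vertex to the representative of its part; the parts are connected and
monochromatic, and there are `c ≥ k` of them. -/
structure IsParts {n : ℕ} (G : SimpleGraph (Fin n)) (f : Fin n → ℕ) (k : ℕ)
    (l : Fin n → Fin n) (c : ℕ) : Prop where
  idem : ∀ v, l (l v) = l v
  conn : ∀ x, l x = x → (G.induce {v | l v = x}).Connected
  color : ∀ v, f (l v) = f v
  card : (Finset.univ.filter fun x => l x = x).card = c
  le : k ≤ c

theorem isParts_id {n : ℕ} (G : SimpleGraph (Fin n)) (f : Fin n → ℕ) {k : ℕ} (hk : k ≤ n) :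
    IsParts G f k id n where
  idem _ := rfl
  conn x _ := by
    have : {v | id v = x} = {x} := by ext; simp
    rw [this]
    exact SimpleGraph.Connected.mk (fun a b => by
      obtain rfl := Subsingleton.elim a b
      exact SimpleGraph.Reachable.refl _)
  color _ := rfl
  card := by simp
  le := hk

/-- The enlarged part is the union of the two old parts and the edge uv, which meets both of them,
hence it is connected. The only representative that disappears is l u. -/
theorem IsParts.merge {n k c : ℕ} {G : SimpleGraph (Fin n)} {f : Fin n → ℕ} {l : Fin n → Fin n}
    (h : IsParts G f k l c) {u v : Fin n} (huv : G.Adj u v) (hf : f u = f v) (hl : l u ≠ l v)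
    (hk : k < c) : IsParts G f k (fun x => if l x = l u then l v else l x) (c - 1) where
  idem x := by
    have := h.idem x
    have := h.idem v
    grind
  conn x hx := by
    by_cases hxv : x = l v
    · subst hxv
      have hu := h.conn (l u) (h.idem u)
      have hv := h.conn (l v) (h.idem v)
      have h1 := SimpleGraph.induce_union_connected (G := G) (s := {w | l w = l u}) (t := {u, v})
        hu.preconnected (SimpleGraph.induce_pair_connected_of_adj huv).preconnected ⟨u, by simp⟩
      have h2 := SimpleGraph.induce_union_connected h1.preconnected hv.preconnected ⟨v, by simp⟩
      suffices hset : {w | (if l w = l u then l v else l w) = l v} =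
          {w | l w = l u} ∪ {u, v} ∪ {w | l w = l v} from hset ▸ h2
      ext w
      simp only [Set.mem_ofPred_eq, Set.mem_union, Set.mem_insert_iff, Set.mem_singleton_iff]
      split_ifs with hw
      · simp [hw]
      · simp only [hw, false_or]
        constructor
        · exact fun h => Or.inr h
        · rintro ((rfl | rfl) | h)
          · exact absurd rfl hw
          · rfl
          · exact h
    · have hx' : l x ≠ l u ∧ l x = x := by
        split_ifs at hx with hq
        · exact absurd hx.symm hxv
        · exact ⟨hq, hx⟩
      have hset : {w | (if l w = l u then l v else l w) = x} = {w | l w = x} := by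
        ext w
        simp only [Set.mem_ofPred_eq]
        have := hx'.1
        grind
      exact hset ▸ h.conn x hx'.2
  color x := by
    split_ifs with hq
    · rw [h.color v, ← hf, ← h.color u, ← hq, h.color x]
    · exact h.color x
  card := by
    have : (Finset.univ.filter fun x => (if l x = l u then l v else l x) = x) =
        (Finset.univ.filter fun x => l x = x).erase (l u) := by
      ext x
      have := h.idem u
      have := h.idem v
      simp only [Finset.mem_filter, Finset.mem_univ, true_and, Finset.mem_erase]
      grind
    rw [this, Finset.card_erase_of_mem (by simp [h.idem u]), h.card]
  le := by omega

/-! ### Merging monochromatic parts in quadratic time -/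

namespace RAM

open NiceTreeDecomposition

variable {n N : ℕ} {G : SimpleGraph (Fin n)} {D : NiceTreeDecomposition G (Fin N)} {k : ℕ}
  {F : Finset (Fin n)} {d : Fin n → Fin n → ℝ≥0} {σ : State} {r : ℝ}

def Program.mergeParts : Program :=
  (.setVar vLa (.get aLbl (.var vIu)) ;; .setVar vLb (.get aLbl (.var vIv))) ;;
    .for vIx vN (.ite (.eq (.get aLbl (.var vIx)) (.var vLa))
      (.setArr aLbl (.var vIx) (.var vLb)) .skip) ;;
    .setVar vCl (.sub (.var vCl) (.const 1))

/-- The edge between `vIu` and `vIv` joins two parts that have to be merged. -/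
def Test.joins : Test :=
  .conj (.conj (.le (.const 1) (.get aAdj (.add (.get aRow (.var vIu)) (.var vIv))))
      (.eq (.get aHat (.var vIu)) (.get aHat (.var vIv))))
    (.conj (.neg (.eq (.get aLbl (.var vIu)) (.get aLbl (.var vIv)))) (.lt (.var vK) (.var vCl)))

/-- Merge the monochromatic parts along the edges, as long as there are more than `k`. -/
def Program.parts : Program :=
  .for vIx vN (.setArr aLbl (.var vIx) (.var vIx)) ;; .setVar vCl (.var vN) ;;
  .for vIu vN (.for vIv vN (.ite .joins .mergeParts .skip))

theorem runs_mergeParts {l : Fin n → Fin n} (hN : σ.var vN = n)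
    (hl : ∀ x : Fin n, σ.arr aLbl x = l x) {u v : Fin n} (hu : σ.var vIu = u)
    (hv : σ.var vIv = v) : Runs .mergeParts σ (n * 30 + 20) fun τ =>
      (∀ x : Fin n, τ.arr aLbl x = ((if l x = l u then l v else l x : Fin n) : ℕ)) ∧
      τ.var vCl = σ.var vCl - 1 := by
  refine Runs.le (Runs.seq (B := 6) (B' := n * (13 + 8) + 6 + 4)
    (Q := fun τ => τ = (σ.setVar vLa (l u)).setVar vLb (l v))
    ((Runs.straight rfl (by simp [hu, hv, hl])).le (by decide)) ?_) (by omega)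
  rintro σ₁ hσ₁ hF₁
  refine Runs.seq (Runs.for n (fun i τ => ∀ x : Fin n, τ.arr aLbl x =
    if (x : ℕ) < i ∧ l x = l u then (l v : ℕ) else l x) (by decide) (by decide) (by decide) ?_ ?_
    ?_) ?_
  · rw [hF₁.var_eq _ (by decide), hN]
  · simp [hσ₁, hl]
  · intro i τ hi h hx hF
    have e1 : τ.var vLa = l u := by rw [hF.var_eq _ (by decide), hσ₁]; simp
    have e2 : τ.var vLb = l v := by rw [hF.var_eq _ (by decide), hσ₁]; simp
    refine (Runs.straight rfl ?_).le (by decide)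
    intro x
    have h1 := h x
    have h2 := h ⟨i, hi⟩
    simp only [lt_irrefl, false_and, if_false] at h2
    simp only [Program.den, Test.holds_eq, Expr.eval, hx, e1, e2, State.arr_setVar, h2]
    by_cases hxi : (x : ℕ) = i
    · obtain rfl : x = ⟨i, hi⟩ := Fin.ext hxi
      by_cases hq : l ⟨i, hi⟩ = l u
      · simp [hq]
      · have : (l ⟨i, hi⟩ : ℕ) ≠ l u := fun h => hq (Fin.ext h)
        simp [hq, this, h2]
    · have hlt : (x : ℕ) < i + 1 ↔ (x : ℕ) < i := by omega
      simp only [hlt]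
      rw [← h1]
      split_ifs <;> simp [hxi]
  · intro τ h hF
    refine (Runs.straight rfl ?_).le (by decide)
    refine ⟨fun x => ?_, ?_⟩
    · simp only [Program.den, State.arr_setVar, h x]
      simp only [x.2, true_and]
      split_ifs <;> rfl
    · simp [hF.var_eq vCl (by decide), hF₁.var_eq vCl (by decide)]

variable (k) in
/-- The loop invariant of `Program.parts`: the edges that satisfy `P` have been processed. -/
structure PartsInv (G : SimpleGraph (Fin n)) (f : Fin n → ℕ) (P : Fin n → Fin n → Prop)
    (τ : State) : Prop where
  parts : ∃ l : Fin n → Fin n, (∀ x : Fin n, τ.arr aLbl x = l x) ∧ IsParts G f k l (τ.var vCl) ∧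
    (k < τ.var vCl → ∀ u v, P u v → G.Adj u v → f u = f v → l u = l v)

theorem PartsInv.congr {f : Fin n → ℕ} {P P' : Fin n → Fin n → Prop} {τ ρ : State}
    (h : PartsInv k G f P τ) (h1 : ρ.arr aLbl = τ.arr aLbl) (h2 : ρ.var vCl = τ.var vCl)
    (hP : ∀ u v, P' u v → P u v) : PartsInv k G f P' ρ := by
  obtain ⟨l, a, b, c⟩ := h
  exact ⟨l, by rwa [h1], by rwa [h2], by rw [h2]; exact fun hk u v huv => c hk u v (hP u v huv)⟩

/-- A merge takes linear time but lowers `vCl`. With this potential all merges together cost O(n²),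
on top of constant time per pair of vertices. The invariant about processed edges is claimed only
while more than k parts remain, because merging stops at k. -/
theorem runs_parts (hE : Env D k F d σ) (hk : k ≤ n) :
    Runs .parts σ (n * (n * 90 + 100) + 50) fun τ =>
      PartsInv k G (fun v => σ.arr aHat v) (fun _ _ => True) τ := by
  set f : Fin n → ℕ := fun v => σ.arr aHat v with hf
  refine Runs.le (Runs.seq (B := n * 11 + 6) (B' := 2 + (n * (n * (38 + 8) + 6 + 8) + 6 +
    (n * 30 + 20) * n)) (Q := fun τ => ∀ x : Fin n, τ.arr aLbl x = x)
    ((Runs.for (B := 3) n (fun i τ => ∀ x < i, τ.arr aLbl x = x) (by decide) (by decide)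
    (by decide) hE.hN (by simp) ?_).imp fun τ hτ _ x => hτ x x.2) ?_) (by nlinarith)
  · intro i τ hi h hx hF
    refine (Runs.straight rfl ?_).le (by decide)
    intro x hxi
    by_cases hne : x = i
    · simp [hx, hne]
    · simp [hx, hne, h x (by omega)]
  intro σ₁ h₁ hF₁
  have hN₁ : σ₁.var vN = n := by rw [hF₁.var_eq _ (by decide), hE.hN]
  refine Runs.seq (Q := fun τ => τ = σ₁.setVar vCl n)
    ((Runs.straight rfl (by simp [hN₁])).le (by decide)) ?_
  rintro σ₂ hσ₂ hF₂
  have hE₂ : Env D k F d σ₂ := (hE.frame hF₁ (by decide)).frame hF₂ (by decide)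
  have hhat₂ : σ₂.arr aHat = σ.arr aHat := by
    rw [hF₂.arr_eq _ (by decide), hF₁.arr_eq _ (by decide)]
  have hcl₂ : σ₂.var vCl = n := by rw [hσ₂]; simp
  have key := Runs.forAmortized (σ := σ₂) (x := vIu) (y := vN)
    (P := .for vIv vN (.ite .joins .mergeParts .skip)) (B := n * (38 + 8) + 6) n
    (fun i τ => PartsInv k G f (fun u _ => (u : ℕ) < i) τ) (fun τ => τ.var vCl) (n * 30 + 20)
    (by decide) (by decide) (by decide) hE₂.hN (fun τ i => by simp) ?_ ?_
  · obtain ⟨T, τ, hex, hT, hI, -⟩ := key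
    refine ⟨T, τ, hex, ?_, hI.congr rfl rfl fun u _ _ => u.2, hex.frame⟩
    simp only [hcl₂] at hT
    omega
  · refine ⟨⟨id, fun x => ?_, ?_, by simp⟩⟩
    · rw [State.arr_setVar, hF₂.arr_eq _ (by decide), h₁]; rfl
    · rw [State.var_setVar, if_neg (by decide), hcl₂]
      exact isParts_id G f hk
  intro i τ hi hI hiτ hF
  have hEτ : Env D k F d τ := hE₂.frame hF (by decide)
  have hhatτ : τ.arr aHat = σ.arr aHat := by rw [hF.arr_eq _ (by decide), hhat₂]
  obtain ⟨u, hu⟩ : ∃ u : Fin n, (u : ℕ) = i := ⟨⟨i, hi⟩, rfl⟩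
  have key := Runs.forAmortized (σ := τ) (x := vIv) (y := vN)
    (P := .ite .joins .mergeParts .skip) (B := 38) n
    (fun j τ => PartsInv k G f (fun u v => (u : ℕ) < i ∨ ((u : ℕ) = i ∧ (v : ℕ) < j)) τ)
    (fun τ => τ.var vCl) (n * 30 + 20) (by decide) (by decide) (by decide) hEτ.hN
    (fun τ i => by simp) (hI.congr rfl (by simp) (by simp)) ?_
  · obtain ⟨T, ρ, hex, hT, hJ, -⟩ := key
    refine ⟨T, ρ, hex, hT, hJ.congr rfl (by simp) fun u v huv => ?_⟩
    rcases Nat.lt_succ_iff_lt_or_eq.1 huv with h | h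
    · exact Or.inl h
    · exact Or.inr ⟨h, v.2⟩
  rintro j ρ hj ⟨l, g1, g2, g3⟩ hjρ hFρ
  obtain ⟨v, hv⟩ : ∃ v : Fin n, (v : ℕ) = j := ⟨⟨j, hj⟩, rfl⟩
  have hEρ : Env D k F d ρ := hEτ.frame hFρ (by decide)
  have hhatρ : ρ.arr aHat = σ.arr aHat := by rw [hFρ.arr_eq _ (by decide), hhatτ]
  have huρ : ρ.var vIu = u := by rw [hFρ.var_eq _ (by decide), hiτ, hu]
  have hvρ : ρ.var vIv = v := by rw [hjρ, hv]
  have htest : Test.joins.Holds ρ ↔ (G.Adj u v ∧ f u = f v) ∧ l u ≠ l v ∧ k < ρ.var vCl := by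
    simp only [Test.joins, Test.Holds, Test.holds_eq, Test.holds_lt, Expr.eval, huρ, hvρ,
      hEρ.hRow, hEρ.hAdj, hhatρ, g1, hEρ.hK, hf, Fin.val_inj]
    split_ifs with h <;> simp [h]
  have hsplit : ∀ a b : Fin n, ((a : ℕ) < i ∨ ((a : ℕ) = i ∧ (b : ℕ) < j + 1)) →
      ((a : ℕ) < i ∨ ((a : ℕ) = i ∧ (b : ℕ) < j)) ∨ (a = u ∧ b = v) := fun a b hab => by
    rcases hab with h | ⟨h, h'⟩
    · exact Or.inl (Or.inl h)
    · by_cases hb : (b : ℕ) < j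
      · exact Or.inl (Or.inr ⟨h, hb⟩)
      · exact Or.inr ⟨Fin.ext (by omega), Fin.ext (by omega)⟩
  by_cases hq : Test.joins.Holds ρ
  · obtain ⟨T, ρ', hex, hT, ⟨k1, k2⟩, -⟩ := runs_mergeParts hEρ.hN g1 huρ hvρ
    have hq' := htest.1 hq
    have hpos : 1 ≤ ρ.var vCl := by omega
    refine ⟨_, ρ', .iteTrue hq hex, ?_, ⟨_, k1, ?_, fun hlt a b hab hadj hfab => ?_⟩⟩
    · have : (n * 30 + 20) * ρ.var vCl = (n * 30 + 20) * (ρ.var vCl - 1) + (n * 30 + 20) := by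
        obtain ⟨c, hc⟩ : ∃ c, ρ.var vCl = c + 1 := ⟨ρ.var vCl - 1, by omega⟩
        rw [hc, Nat.add_sub_cancel]; ring
      have hc : Test.joins.cost = 37 := rfl
      rw [k2, hc]
      omega
    · rw [State.var_setVar, if_neg (by decide), k2]
      exact g2.merge hq'.1.1 hq'.1.2 hq'.2.1 hq'.2.2
    · rcases hsplit a b hab with h | ⟨rfl, rfl⟩
      · simp only [g3 hq'.2.2 a b h hadj hfab]
      · simp
  · refine ⟨_, ρ, .iteFalse hq (.skip ρ), by rw [show Test.joins.cost = 37 from rfl],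
      ⟨l, g1, by simpa using g2, fun hlt a b hab hadj hfab => ?_⟩⟩
    have hlt' : k < ρ.var vCl := by simpa using hlt
    rcases hsplit a b hab with h | ⟨rfl, rfl⟩
    · exact g3 hlt' a b h hadj hfab
    · by_contra hne
      exact hq (htest.2 ⟨⟨hadj, hfab⟩, hne, hlt'⟩)

end RAM

/-! ### From clusterings to colourings and back -/

namespace Clustering

variable {n k : ℕ} {G : SimpleGraph (Fin n)} {F : Finset (Fin n)} {d : Fin n → Fin n → ℝ≥0}
  {S : Clustering (Fin n) k}

theorem radius_le_iff {r : ℝ≥0} :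
    S.radius d ≤ r ↔ ∀ i, ∀ v ∈ S.cluster i, d v (S.center i) ≤ r := by
  simp [radius, Finset.sup_le_iff]

namespace IsFeasible

theorem nonempty (h : S.IsFeasible G F) (i : Fin k) : ∃ v, v ∈ S.cluster i := by
  obtain ⟨⟨v, hv⟩⟩ := (h.connected i).nonempty
  exact ⟨v, hv⟩

theorem eq_of_mem (h : S.IsFeasible G F) {v : Fin n} {i j : Fin k} (hi : v ∈ S.cluster i)
    (hj : v ∈ S.cluster j) : i = j :=
  (h.partition v).unique hi hj

theorem le_card (h : S.IsFeasible G F) : k ≤ n := by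
  choose v hv using h.nonempty
  have := Fintype.card_le_of_injective v fun i j hij => h.eq_of_mem (hv i) (hij ▸ hv j)
  simpa using this

theorem pos (h : S.IsFeasible G F) (hn : 0 < n) : 0 < k := by
  obtain ⟨i, -⟩ := (h.partition ⟨0, hn⟩).exists
  exact i.pos

theorem facility_pos (h : S.IsFeasible G F) (hn : 0 < n) : 0 < F.card :=
  Finset.card_pos.2 ⟨_, h.center_mem ⟨0, h.pos hn⟩⟩

theorem exists_radius_eq (h : S.IsFeasible G F) (hn : 0 < n) :
    ∃ u v : Fin n, S.radius d = d u v := by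
  obtain ⟨j, -, hj⟩ := Finset.exists_mem_eq_sup Finset.univ ⟨⟨0, h.pos hn⟩, Finset.mem_univ _⟩
    fun i => (S.cluster i).sup fun v => d v (S.center i)
  obtain ⟨u, -, hu⟩ := Finset.exists_mem_eq_sup (S.cluster j) (h.nonempty j)
    fun v => d v (S.center j)
  exact ⟨u, S.center j, hj.trans hu⟩

/-- Colour each vertex by its centre. A cluster is connected and monochromatic, so it lies in one
component and contains at most one closing vertex. Clusters with a common centre may fall together,
which can only lower the cost. -/
theorem isColoring {N : ℕ} {D : NiceTreeDecomposition G (Fin N)} (h : S.IsFeasible G F) {r : ℝ≥0}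
    (hr : S.radius d ≤ r) : ∃ f : Fin n → ℕ, RAM.IsColoring D k F d r f := by
  choose c hc _ using h.partition
  have huniq : ∀ v i, v ∈ S.cluster i → c v = i := fun v i hv => h.eq_of_mem (hc v) hv
  set f : Fin n → ℕ := fun v => S.center (c v) with hf
  refine ⟨f, fun v => ⟨S.center (c v), h.center_mem _, rfl, ?_⟩, ?_⟩
  · exact_mod_cast radius_le_iff.1 hr (c v) v (hc v)
  have hinj : Set.InjOn c {v | D.Closes f D.root v} := by
    intro u hu v hv huv
    refine NiceTreeDecomposition.closes_unique hu hv ?_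
    obtain ⟨p⟩ := (h.connected (c u)).preconnected ⟨u, hc u⟩ ⟨v, huv ▸ hc v⟩
    have key : ∀ (a b : {x // x ∈ (S.cluster (c u) : Set (Fin n))})
        (_ : (G.induce (S.cluster (c u) : Set (Fin n))).Walk a b), D.Rel f D.root a b := by
      intro a b p
      induction p with
      | nil => exact .refl _
      | @cons a b _ hab _ ih =>
        refine .trans _ _ _ (NiceTreeDecomposition.rel_root_of_adj hab ?_) ih
        rw [hf]
        exact congrArg (fun i => (S.center i : ℕ))
          ((huniq _ _ a.2).trans (huniq _ _ b.2).symm)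
    exact key _ _ p
  have := Set.ncard_le_ncard_of_injOn (t := Set.univ) c (fun _ _ => Set.mem_univ _) hinj
  rw [Set.ncard_univ, Nat.card_fin] at this
  exact this

end IsFeasible

end Clustering

/-! ### From a colouring to the output arrays -/

namespace RAM

open NiceTreeDecomposition

variable {n N : ℕ} {G : SimpleGraph (Fin n)} {D : NiceTreeDecomposition G (Fin N)} {k : ℕ}
  {F : Finset (Fin n)} {d : Fin n → Fin n → ℝ≥0} {σ : State} {r : ℝ}

/-- If no monochromatic edge leaves a part, every component lies inside one part. Sending each
representative to a closing vertex of its component is then injective. -/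
theorem IsParts.le_cost {f : Fin n → ℕ} {l : Fin n → Fin n} {c : ℕ} (h : IsParts G f k l c)
    (hE : ∀ u v, G.Adj u v → f u = f v → l u = l v) : c ≤ D.cost f D.root := by
  have hrel : ∀ u v, D.Rel f D.root u v → l u = l v := by
    intro u v huv
    induction huv with
    | rel a b hab =>
      obtain ⟨h1, q, s, -, h3⟩ := hab
      exact hE a b (bag_introduceEdge h3).1 h1
    | refl => rfl
    | symm _ _ _ ih => exact ih.symm
    | trans _ _ _ _ _ ih1 ih2 => exact ih1.trans ih2
  choose g hg1 hg2 using fun v => exists_closes (D := D) (f := f) v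
  rw [← h.card, ← Set.ncard_coe_finset]
  refine Set.ncard_le_ncard_of_injOn g (fun v _ => hg2 v) ?_ (Set.toFinite _)
  intro u hu v hv huv
  have h1 : l u = u := by simpa using hu
  have h2 : l v = v := by simpa using hv
  rw [← h1, ← h2]
  exact hrel u v ((hg1 u).trans _ _ _ (huv ▸ (hg1 v).symm))

/-- More than k remaining parts would mean that every edge has been used, and then there are at most
`cost` many, hence at most k. Fewer than k parts never occur. -/
theorem PartsInv.exists_parts {f : Fin n → ℕ} {τ : State}
    (h : PartsInv k G f (fun _ _ => True) τ) (hcost : D.cost f D.root ≤ k) :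
    ∃ l : Fin n → Fin n, (∀ x : Fin n, τ.arr aLbl x = l x) ∧ IsParts G f k l k := by
  obtain ⟨l, h1, h2, h3⟩ := h
  refine ⟨l, h1, ?_⟩
  have hk := h2.le
  by_cases hlt : k < τ.var vCl
  · have := (IsParts.le_cost (D := D) h2 fun u v huv => h3 hlt u v trivial huv)
    omega
  · obtain hk' : τ.var vCl = k := by omega
    rwa [hk'] at h2

theorem exists_count_eq (p : ℕ → Prop) [DecidablePred p] (m : ℕ) {i : ℕ} (hi : i < Nat.count p m) :
    ∃ x < m, p x ∧ Nat.count p x = i := by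
  induction m with
  | zero => simp at hi
  | succ m ih =>
    by_cases h : i < Nat.count p m
    · obtain ⟨x, h1, h2⟩ := ih h
      exact ⟨x, by omega, h2⟩
    · rw [Nat.count_succ] at hi
      by_cases hp : p m
      · rw [if_pos hp] at hi
        exact ⟨m, by omega, hp, by omega⟩
      · rw [if_neg hp] at hi
        omega

/-- Number the parts and write the clustering to the output arrays. -/
def Program.number : Program :=
  .setVar vNum (.const 0) ;;
  .for vIx vN (.ite (.eq (.get aLbl (.var vIx)) (.var vIx))
    (.setArr aNum (.var vIx) (.var vNum) ;; .setArr aCenter (.var vNum) (.get aHat (.var vIx)) ;;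
      .incr vNum) .skip) ;;
  .for vIx vN (.setArr aCluster (.var vIx) (.get aNum (.get aLbl (.var vIx))))

/-- A part is numbered by the count of smaller representatives. This is strictly increasing on
representatives, so a later part does not overwrite the centre of an earlier one. -/
theorem runs_number {l : Fin n → Fin n} (hN : σ.var vN = n)
    (hl : ∀ x : Fin n, σ.arr aLbl x = l x) (hidem : ∀ x, l (l x) = l x) :
    Runs .number σ (n * 60 + 20) fun τ =>
      (∀ x : Fin n, τ.arr aCluster x = Nat.count (fun y => σ.arr aLbl y = y) (l x)) ∧
      ∀ x : Fin n, l x = x →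
        τ.arr aCenter (Nat.count (fun y => σ.arr aLbl y = y) x) = σ.arr aHat x := by
  set p : ℕ → Prop := fun y => σ.arr aLbl y = y with hp
  refine Runs.le (Runs.seq (B := 2) (B' := n * (7 + 15 + 8) + 6 + (n * (6 + 8) + 6))
    (Q := fun τ => τ = σ.setVar vNum 0)
    ((Runs.straight rfl (by simp)).le (by decide)) ?_) (by omega)
  rintro σ₁ hσ₁ hF₁
  refine Runs.seq (Runs.for n (fun i τ => τ.var vNum = Nat.count p i ∧ ∀ x < i, p x →
    τ.arr aNum x = Nat.count p x ∧ τ.arr aCenter (Nat.count p x) = σ.arr aHat x)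
    (by decide) (by decide) (by decide) ?_ ?_ ?_) ?_
  · rw [hF₁.var_eq _ (by decide), hN]
  · simp [hσ₁]
  · rintro i τ hi ⟨h1, h2⟩ hx hF
    have e1 : τ.arr aLbl = σ.arr aLbl := by
      rw [hF.arr_eq _ (by decide), hF₁.arr_eq _ (by decide)]
    have e2 : τ.arr aHat = σ.arr aHat := by
      rw [hF.arr_eq _ (by decide), hF₁.arr_eq _ (by decide)]
    refine (Runs.straight rfl ?_).le (by decide)
    by_cases hpi : p i
    · have hpi' : σ.arr aLbl i = i := hpi
      simp only [Program.den, Test.holds_eq, Expr.eval, hx, e1, hpi', if_true, Program.incr]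
      refine ⟨by simp [h1, Nat.count_succ, hpi], fun x hxi hpx => ?_⟩
      by_cases hne : x = i
      · subst hne
        simp [h1, e2, hx]
      · have hlt : x < i := by omega
        have hcne : Nat.count p x ≠ Nat.count p i := (Nat.count_strict_mono hpx hlt).ne
        simp [h1, hne, hcne, h2 x hlt hpx]
    · have hpi' : ¬ σ.arr aLbl i = i := hpi
      simp only [Program.den, Test.holds_eq, Expr.eval, hx, e1, hpi', if_false]
      refine ⟨by simp [h1, Nat.count_succ, hpi], fun x hxi hpx => ?_⟩
      have hlt : x < i := by
        rcases Nat.lt_succ_iff_lt_or_eq.1 hxi with h | h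
        · exact h
        · exact absurd (h ▸ hpx) hpi
      simpa using h2 x hlt hpx
  rintro σ₂ ⟨-, h₂⟩ hF₂
  have e1 : σ₂.arr aLbl = σ.arr aLbl := by
    rw [hF₂.arr_eq _ (by decide), hF₁.arr_eq _ (by decide)]
  have hpl : ∀ x : Fin n, p (l x) := fun x => by simp only [hp, hl, hidem]
  refine (Runs.for n (fun i τ => ∀ x : Fin n, (x : ℕ) < i → τ.arr aCluster x = Nat.count p (l x))
    (by decide) (by decide) (by decide) ?_ (by simp) ?_).imp fun τ hτ hF => ⟨fun x => hτ x x.2,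
      fun x hx => ?_⟩
  · rw [hF₂.var_eq _ (by decide), hF₁.var_eq _ (by decide), hN]
  · intro i τ hi h hx hF
    refine (Runs.straight rfl ?_).le (by decide)
    intro x hxi
    by_cases hne : (x : ℕ) = i
    · simp [hx, ← hne, hF.arr_eq aNum (by decide), hF.arr_eq aLbl (by decide), e1, hl,
        (h₂ (l x) (l x).2 (hpl x)).1]
    · simp [hx, hne, h x (by omega)]
  · rw [hF.arr_eq _ (by decide)]
    exact (h₂ x x.2 (by rw [← hx]; exact hpl x)).2

/-- Turn the colouring in `aHat` into a clustering. -/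
def Program.clusters : Program := .parts ;; .number

/-- All vertices of a part have the colour of its representative. This facility becomes the centre,
and by `IsColoring` it is within distance r of each of them. -/
theorem runs_clusters (hE : Env D k F d σ) (hk : k ≤ n)
    (hc : IsColoring D k F d r fun v => σ.arr aHat v) :
    Runs .clusters σ (n * (n * 90 + 160) + 70) fun τ => ∃ S : Clustering (Fin n) k,
      Represents τ S ∧ S.IsFeasible G F ∧ ∀ i, ∀ v ∈ S.cluster i, (d v (S.center i) : ℝ) ≤ r := by
  refine Runs.le (Runs.seq (runs_parts hE hk) (B' := n * 60 + 20) ?_) (by nlinarith)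
  intro σ₁ h₁ hF₁
  obtain ⟨l, hl, hP⟩ := h₁.exists_parts (D := D) hc.2
  refine (runs_number ((hF₁.var_eq _ (by decide)).trans hE.hN) hl hP.idem).imp
    fun τ ⟨g1, g2⟩ _ => ?_
  set p : ℕ → Prop := fun y => σ₁.arr aLbl y = y with hp
  have hpx : ∀ x : Fin n, p x ↔ l x = x := fun x => by simp [hp, hl, Fin.ext_iff]
  have hcount : Nat.count p n = k := by
    rw [Nat.count_eq_card_filter_range, ← hP.card, ← Nat.Iio_eq_range, ← Fin.map_valEmbedding_univ,
      Finset.filter_map, Finset.card_map]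
    congr 1
    ext x
    simp [hpx]
  have hrep : ∀ i : Fin k, ∃ x : Fin n, l x = x ∧ Nat.count p x = i := fun i => by
    obtain ⟨x, hx, h1, h2⟩ := exists_count_eq p n (i.2.trans_eq hcount.symm)
    exact ⟨⟨x, hx⟩, (hpx ⟨x, hx⟩).1 h1, h2⟩
  choose x hx1 hx2 using hrep
  choose c hc1 hc2 hc3 using hc.1
  have hlt : ∀ v, Nat.count p (l v) < k := fun v => by
    rw [← hcount]
    exact Nat.count_strict_mono ((hpx _).2 (hP.idem v)) (l v).2
  have hmem : ∀ v (i : Fin k), Nat.count p (l v) = i ↔ l v = x i := fun v i => by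
    rw [← hx2 i]
    refine ⟨fun h => Fin.ext (Nat.count_injective ((hpx _).2 (hP.idem v))
      ((hpx _).2 (hx1 i)) h), fun h => by rw [h]⟩
  have hcol : ∀ v, c (l v) = c v := fun v => Fin.ext (by
    rw [hc2, hc2]
    simpa [hF₁.arr_eq aHat (by decide)] using hP.color v)
  refine ⟨⟨fun i => c (x i), fun i => Finset.univ.filter fun v => l v = x i⟩, ⟨fun i => ?_,
    fun v i => ?_⟩, ⟨fun i => hc1 _, fun v => ?_, fun i => ?_⟩, fun i v hv => ?_⟩
  · rw [← hx2 i, g2 _ (hx1 i), hF₁.arr_eq _ (by decide), hc2]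
  · rw [g1, hmem]
    simp
  · refine ⟨⟨_, hlt v⟩, by simpa using (hmem v _).1 rfl, fun j hj => ?_⟩
    have : l v = x j := by simpa using hj
    exact Fin.ext ((hmem v j).2 this).symm
  · have : ((Finset.univ.filter fun v => l v = x i : Finset (Fin n)) : Set (Fin n)) =
        {v | l v = x i} := by ext; simp
    have hconn := hP.conn _ (hx1 i)
    rw [← this] at hconn
    exact hconn
  · have hv' : l v = x i := by simpa using hv
    change (d v (c (x i)) : ℝ) ≤ r
    rw [← hv', hcol]
    exact hc3 v

end RAM

/-! ### Reading the input -/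

theorem cells_apply {α : Type} [Zero α] {m : ℕ} (f : Fin m → α) (i : Fin m) : cells f i = f i := by
  simp [cells]

theorem matrixCells_apply {α : Type} [Zero α] {l m : ℕ} (f : Fin l → ℕ → α) (i : Fin l) {j : ℕ}
    (hj : j < m) : matrixCells (m := m) f (i * m + j) = f i j := by
  have h1 : (i * m + j) / m = i := by
    rw [mul_comm, Nat.mul_add_div (by omega), Nat.div_eq_of_lt hj, add_zero]
  have h2 : (i * m + j) % m = j := by
    rw [mul_comm, Nat.mul_add_mod, Nat.mod_eq_of_lt hj]
  rw [matrixCells, h1, h2, cells_apply]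

namespace RAM

open NiceTreeDecomposition

variable {n N : ℕ} {G : SimpleGraph (Fin n)} {D : NiceTreeDecomposition G (Fin N)} {k : ℕ}
  {F : Finset (Fin n)} {d : Fin n → Fin n → ℝ≥0} {σ : State} {r : ℝ}

/-- List the facilities. -/
def Program.listFacilities : Program :=
  .setVar vNF (.const 0) ;;
  .for vIx vN (.ite (.le (.const 1) (.get aFac (.var vIx)))
    (.setArr aFL (.var vNF) (.var vIx) ;; .incr vNF) .skip)

open Classical in
theorem runs_listFacilities (hN : σ.var vN = n)
    (hf : ∀ v : Fin n, σ.arr aFac v = if v ∈ F then 1 else 0) :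
    Runs .listFacilities σ (n * 30 + 10) fun τ => τ.var vNF = F.card ∧
      (∀ i < F.card, ∃ a ∈ F, τ.arr aFL i = (a : ℕ)) ∧
      ∀ a ∈ F, ∃ i < F.card, τ.arr aFL i = (a : ℕ) := by
  set p : ℕ → Prop := fun y => 1 ≤ σ.arr aFac y with hp
  have hpv : ∀ v : Fin n, p v ↔ v ∈ F := fun v => by
    simp only [hp, hf]
    split_ifs with h <;> simp [h]
  have hcount : Nat.count p n = F.card := by
    rw [Nat.count_eq_card_filter_range, ← Nat.Iio_eq_range, ← Fin.map_valEmbedding_univ,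
      Finset.filter_map, Finset.card_map]
    congr 1
    ext x
    simp [hpv]
  refine Runs.le (Runs.seq (B := 2) (B' := n * (12 + 8) + 6)
    (Q := fun τ => τ = σ.setVar vNF 0)
    ((Runs.straight rfl (by simp)).le (by decide)) ?_) (by omega)
  rintro σ₁ hσ₁ hF₁
  refine (Runs.for n (fun i τ => τ.var vNF = Nat.count p i ∧ ∀ x < i, p x →
    τ.arr aFL (Nat.count p x) = x) (by decide) (by decide) (by decide) ?_ ?_ ?_).imp ?_
  · rw [hF₁.var_eq _ (by decide), hN]
  · simp [hσ₁]
  · rintro i τ hi ⟨h1, h2⟩ hx hF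
    have e1 : τ.arr aFac = σ.arr aFac := by
      rw [hF.arr_eq _ (by decide), hF₁.arr_eq _ (by decide)]
    refine (Runs.straight rfl ?_).le (by decide)
    by_cases hpi : p i
    · have hpi' : 1 ≤ σ.arr aFac i := hpi
      simp only [Program.den, Test.Holds, Expr.eval, hx, e1, hpi', if_true, Program.incr]
      refine ⟨by simp [h1, Nat.count_succ, hpi], fun x hxi hpx => ?_⟩
      by_cases hne : x = i
      · subst hne
        simp [h1]
      · have hlt : x < i := by omega
        have hcne : Nat.count p x ≠ Nat.count p i := (Nat.count_strict_mono hpx hlt).ne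
        simp [h1, hcne, h2 x hlt hpx]
    · have hpi' : ¬ 1 ≤ σ.arr aFac i := hpi
      simp only [Program.den, Test.Holds, Expr.eval, hx, e1, hpi', if_false]
      refine ⟨by simp [h1, Nat.count_succ, hpi], fun x hxi hpx => ?_⟩
      have hlt : x < i := by
        rcases Nat.lt_succ_iff_lt_or_eq.1 hxi with h | h
        · exact h
        · exact absurd (h ▸ hpx) hpi
      simpa using h2 x hlt hpx
  · rintro τ ⟨h1, h2⟩ -
    refine ⟨h1.trans hcount, fun i hi => ?_, fun a ha => ?_⟩
    · obtain ⟨x, hx, hpx, rfl⟩ := exists_count_eq p n (hi.trans_eq hcount.symm)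
      exact ⟨⟨x, hx⟩, (hpv ⟨x, hx⟩).1 hpx, h2 x hx hpx⟩
    · refine ⟨Nat.count p a, ?_, h2 a a.2 ((hpv a).2 ha)⟩
      rw [← hcount]
      exact Nat.count_strict_mono ((hpv a).2 ha) a.2

/-- Write the first `y` multiples of `z` into the array `a`, and the next one into `vS`. -/
def Program.multiples (a y z : ℕ) : Program :=
  .setVar vS (.const 0) ;;
  .for vIx y (.setArr a (.var vIx) (.var vS) ;; .setVar vS (.add (.var vS) (.var z)))

theorem runs_multiples {a y z m s : ℕ} (hy : σ.var y = m) (hz : σ.var z = s)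
    (hd : (decide (y ≠ vS) && decide (y ≠ vIx) && decide (z ≠ vS) && decide (z ≠ vIx)) = true) :
    Runs (.multiples a y z) σ (m * 15 + 10) fun τ => τ.var vS = m * s ∧
      ∀ i < m, τ.arr a i = i * s := by
  simp only [Bool.and_eq_true, decide_eq_true_eq] at hd
  obtain ⟨⟨⟨d1, d2⟩, d3⟩, d4⟩ := hd
  refine Runs.le (Runs.seq (B := 2) (B' := m * (7 + 8) + 6)
    (Q := fun τ => τ = σ.setVar vS 0)
    ((Runs.straight rfl (by simp)).le (by decide)) ?_) (by omega)
  rintro σ₁ hσ₁ -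
  refine (Runs.for m (fun i τ => τ.var vS = i * s ∧ ∀ j < i, τ.arr a j = j * s)
    (by simp [Program.wv]) (by simp [Program.wv, d1]) (Ne.symm d2) (by simp [hσ₁, d1, hy])
    (by simp [hσ₁]) ?_).imp fun τ h _ => h
  rintro i τ hi ⟨h1, h2⟩ hx hF
  have e1 : τ.var z = s := by
    rw [hF.var z (by simp [Program.wv, Program.for, Program.incr, d3, d4]), hσ₁]
    simp [d3, hz]
  refine (Runs.straight rfl ?_).le le_rfl
  simp only [Program.den, Expr.eval]
  refine ⟨by simp [h1, e1]; ring, fun j hj => ?_⟩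
  by_cases hne : j = i
  · simp [hx, hne, h1]
  · simp [hx, hne, h2 j (by omega)]

/-- Tabulate the multiples of the powers of `vQ`. -/
def Program.powerTable : Program :=
  (.setVar vStep (.const 1) ;; .setVar vS (.const 0) ;; .setVar vSS (.add (.var vW) (.var vW))) ;;
  .for vIu vSS (.setVar vX (.const 0) ;;
    .for vIv vQ (.setArr aMul (.add (.var vS) (.var vIv)) (.var vX) ;;
      .setVar vX (.add (.var vX) (.var vStep))) ;;
    (.setVar vStep (.var vX) ;; .setVar vS (.add (.var vS) (.var vQ))))

/-- The running sum at the end of the row for q^i is q·q^i, the next power, so the whole table is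
produced by additions. The last power is the length `vStep` of the address range of a node. -/
theorem runs_powerTable {w q : ℕ} (hW : σ.var vW = w) (hQ : σ.var vQ = q) :
    Runs .powerTable σ (w * (q * 50 + 50) + 20) fun τ => τ.var vStep = q ^ (2 * w) ∧
      ∀ i < 2 * w, ∀ a < q, τ.arr aMul (i * q + a) = a * q ^ i := by
  refine Runs.le (Runs.seq (B := 8) (B' := (2 * w) * ((2 + ((q * (9 + 8) + 6) + 6)) + 8) + 6)
    (Q := fun τ => τ = ((σ.setVar vStep 1).setVar vS 0).setVar vSS (2 * w))
    ((Runs.straight rfl (by simp [hW, two_mul])).le (by decide)) ?_) (by nlinarith)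
  rintro σ₁ hσ₁ hF₁
  refine (Runs.for (2 * w) (fun i τ => τ.var vStep = q ^ i ∧ τ.var vS = i * q ∧
    ∀ j < i, ∀ a < q, τ.arr aMul (j * q + a) = a * q ^ j)
    (by decide) (by decide) (by decide) (by simp [hσ₁]) (by simp [hσ₁]) ?_).imp
    fun τ h _ => ⟨h.1, h.2.2⟩
  rintro i τ hi ⟨h1, h2, h3⟩ hx hF
  refine Runs.seq (Q := fun ρ => ρ = τ.setVar vX 0)
    ((Runs.straight rfl (by simp)).le (by decide)) ?_
  rintro τ₁ hτ₁ hG₁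
  have hq₁ : τ₁.var vQ = q := by
    rw [hG₁.var_eq _ (by decide), hF.var_eq _ (by decide), hF₁.var_eq _ (by decide), hQ]
  refine Runs.seq (Runs.for q (fun b ρ => ρ.var vX = b * q ^ i ∧
    (∀ j < i, ∀ a < q, ρ.arr aMul (j * q + a) = a * q ^ j) ∧
    ∀ a < b, ρ.arr aMul (i * q + a) = a * q ^ i)
    (by decide) (by decide) (by decide) hq₁ ?_ ?_) ?_
  · simp only [hτ₁]
    exact ⟨by simp, h3, by simp⟩
  · rintro b ρ hb ⟨g1, g2, g3⟩ hbρ hG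
    have e1 : ρ.var vStep = q ^ i := by
      rw [hG.var_eq _ (by decide), hG₁.var_eq _ (by decide), h1]
    have e2 : ρ.var vS = i * q := by
      rw [hG.var_eq _ (by decide), hG₁.var_eq _ (by decide), h2]
    refine (Runs.straight rfl ?_).le (by decide)
    simp only [Program.den, Expr.eval]
    refine ⟨by simp [g1, e1]; ring, fun j hj a ha => ?_, fun a ha => ?_⟩
    · have hne : j * q + a ≠ i * q + b := by
        have : (j + 1) * q ≤ i * q := Nat.mul_le_mul_right _ hj
        rw [add_mul, one_mul] at this
        omega
      simp [e2, hbρ, hne, g2 j hj a ha]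
    · by_cases hne : a = b
      · simp [e2, hbρ, hne, g1]
      · simp [e2, hbρ, hne, g3 a (by omega)]
  · rintro ρ ⟨g1, g2, g3⟩ hG
    have e2 : ρ.var vS = i * q := by
      rw [hG.var_eq _ (by decide), hG₁.var_eq _ (by decide), h2]
    have e3 : ρ.var vQ = q := by rw [hG.var_eq _ (by decide), hq₁]
    refine (Runs.straight rfl ?_).le (by decide)
    simp only [Program.den, Expr.eval]
    refine ⟨by simp [g1, pow_succ'], by simp [e2, e3]; ring, fun j hj a ha => ?_⟩
    simp only [State.arr_setVar]
    rcases Nat.lt_succ_iff_lt_or_eq.1 hj with h | rfl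
    · exact g2 j h a ha
    · exact g3 a ha

end RAM

namespace RAM

open NiceTreeDecomposition

variable {n N : ℕ} {G : SimpleGraph (Fin n)} {D : NiceTreeDecomposition G (Fin N)} {k : ℕ}
  {F : Finset (Fin n)} {d : Fin n → Fin n → ℝ≥0} {σ : State} {r : ℝ}

/-- Compute the global tables. -/
def Program.setup : Program :=
  (.setVar vW (.add (.var vWidth) (.const 1)) ;; .setVar vQ (.add (.var vN) (.const 1))) ;;
  .multiples aRow vN vN ;; .setVar vSq (.var vS) ;; .multiples aBagRow vNodes vW ;; .powerTable

open Classical in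
theorem runs_setup (hF : Frame .listFacilities (inputState G D k F d) σ)
    (hNf : σ.var vNF = F.card) (hFac : ∀ i < F.card, ∃ a ∈ F, σ.arr aFL i = (a : ℕ))
    (hFac' : ∀ a ∈ F, ∃ i < F.card, σ.arr aFL i = (a : ℕ)) :
    Runs .setup σ (n * 15 + N * 15 + (D.width + 1) * (n * 50 + 100) + 60) fun τ =>
      Env D k F d τ ∧ τ.var vSq = n * n := by
  have hN : σ.var vN = n := hF.var_eq _ (by decide)
  have hNodes : σ.var vNodes = N := hF.var_eq _ (by decide)
  have hWidth : σ.var vWidth = D.width := hF.var_eq _ (by decide)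
  refine Runs.le (Runs.seq (B := 8) (B' := (n * 15 + 10) + (2 + ((N * 15 + 10) +
    ((D.width + 1) * ((n + 1) * 50 + 50) + 20))))
    (Q := fun τ => τ = (σ.setVar vW (D.width + 1)).setVar vQ (n + 1))
    ((Runs.straight rfl (by simp [hWidth, hN])).le (by decide)) ?_) (by nlinarith)
  rintro σ₁ hσ₁ hF₁
  refine Runs.seq (runs_multiples (m := n) (s := n) (by simp [hσ₁, hN]) (by simp [hσ₁, hN])
    (by decide)) ?_
  rintro σ₂ ⟨a1, a2⟩ hF₂
  -- The sum left over from the table of multiples of n is n², the number of distances.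
  refine Runs.seq (Q := fun τ => τ.var vSq = n * n)
    ((Runs.straight rfl (by simp [a1])).le (by decide)) ?_
  rintro σ₃ hσ₃ hF₃
  have hvar : ∀ x, (decide (x ≠ vSq) && decide (x ≠ vS) && decide (x ≠ vIx)) = true →
      σ₃.var x = σ₁.var x := fun x hx => by
    simp only [Bool.and_eq_true, decide_eq_true_eq] at hx
    rw [hF₃.var x (by simp [Program.wv, hx]),
      hF₂.var x (by simp [Program.wv, Program.multiples, Program.for, Program.incr, hx])]
  refine Runs.seq (runs_multiples (m := N) (s := D.width + 1)
    (by rw [hvar _ (by decide), hσ₁]; simp [hNodes])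
    (by rw [hvar _ (by decide), hσ₁]; simp) (by decide)) ?_
  rintro σ₄ ⟨b1, b2⟩ hF₄
  have hvar' : ∀ x, (decide (x ≠ vSq) && decide (x ≠ vS) && decide (x ≠ vIx)) = true →
      σ₄.var x = σ₁.var x := fun x hx => by
    rw [← hvar x hx]
    simp only [Bool.and_eq_true, decide_eq_true_eq] at hx
    rw [hF₄.var x (by simp [Program.wv, Program.multiples, Program.for, Program.incr, hx])]
  refine (runs_powerTable (w := D.width + 1) (q := n + 1)
    (by rw [hvar' _ (by decide), hσ₁]; simp)
    (by rw [hvar' _ (by decide), hσ₁]; simp)).imp ?_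
  rintro τ ⟨c1, c2⟩ hF₅
  have hF₆ : Frame (.listFacilities ;; .setup) (inputState G D k F d) τ :=
    (hF.mono (by decide) (by decide) (by decide)).trans <|
    (hF₁.mono (by decide) (by decide) (by decide)).trans <|
    (hF₂.mono (by decide) (by decide) (by decide)).trans <|
    (hF₃.mono (by decide) (by decide) (by decide)).trans <|
    (hF₄.mono (by decide) (by decide) (by decide)).trans
    (hF₅.mono (by decide) (by decide) (by decide))
  have hFL : τ.arr aFL = σ.arr aFL := by
    rw [hF₅.arr_eq _ (by decide), hF₄.arr_eq _ (by decide), hF₃.arr_eq _ (by decide),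
      hF₂.arr_eq _ (by decide), hF₁.arr_eq _ (by decide)]
  refine ⟨⟨hF₆.var_eq _ (by decide), hF₆.var_eq _ (by decide), hF₆.var_eq _ (by decide),
    hF₆.var_eq _ (by decide), ?_, ?_, ?_, c1, fun u v => ?_, fun t => ?_, fun t => ?_, fun t => ?_,
    fun t => ?_, fun t => ?_, fun t => ?_, fun t i h => ?_, ?_, ?_, fun v => ?_, fun t => ?_, c2,
    fun u v => ?_⟩, ?_⟩
  · rw [hF₅.var_eq _ (by decide), hvar' _ (by decide), hσ₁]; simpa using hNf
  · rw [hF₅.var_eq _ (by decide), hvar' _ (by decide), hσ₁]; simp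
  · rw [hF₅.var_eq _ (by decide), hvar' _ (by decide), hσ₁]; simp
  · rw [hF₆.arr_eq _ (by decide)]
    exact (matrixCells_apply (fun u => cells fun v => if G.Adj u v then 1 else 0) u v.2).trans
      (cells_apply _ v)
  · rw [hF₆.arr_eq _ (by decide)]; exact cells_apply (fun t => nodeCode (D.kind t) 0) t
  · rw [hF₆.arr_eq _ (by decide)]; exact cells_apply (fun t => nodeCode (D.kind t) 1) t
  · rw [hF₆.arr_eq _ (by decide)]; exact cells_apply (fun t => nodeCode (D.kind t) 2) t
  · rw [hF₆.arr_eq _ (by decide)]; exact cells_apply (fun t => nodeCode (D.kind t) 3) t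
  · rw [hF₆.arr_eq _ (by decide)]; exact cells_apply (fun t => nodeCode (D.kind t) 4) t
  · rw [hF₆.arr_eq _ (by decide), length_bagL]; exact cells_apply (fun t => (D.bag t).card) t
  · rw [hF₆.arr_eq _ (by decide)]
    refine (matrixCells_apply (fun t j => ((bagL D t).map fun v : Fin n => (v : ℕ)).getD j 0) t
      (h.trans_le (length_bagL_le D t))).trans ?_
    simp [List.getD_eq_getElem?_getD, h]
  · rw [hFL]; exact hFac
  · rw [hFL]; exact hFac'
  · rw [hF₅.arr_eq _ (by decide), hF₄.arr_eq _ (by decide), hF₃.arr_eq _ (by decide), a2 v v.2]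
  · rw [hF₅.arr_eq _ (by decide), b2 t t.2]
  · rw [hF₆.real_eq _ (by decide)]
    exact (matrixCells_apply (fun u => cells fun v => (d u v : ℝ)) u v.2).trans (cells_apply _ v)
  · rw [hF₅.var_eq _ (by decide), hF₄.var_eq _ (by decide)]; exact hσ₃

end RAM

/-! ### The complete algorithm and its correctness -/

namespace RAM

open NiceTreeDecomposition

variable {n N : ℕ} {G : SimpleGraph (Fin n)} {D : NiceTreeDecomposition G (Fin N)} {k : ℕ}
  {F : Finset (Fin n)} {d : Fin n → Fin n → ℝ≥0} {σ : State} {r : ℝ}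

/-- The part of the algorithm for instances with a facility and `1 ≤ k ≤ n`. -/
def Program.optimize : Program :=
  .setup ;; .order ;; .powers ;; .sort ;; .search ;;
    .ite (.le (.const 1) (.var vRes)) (.clusters ;; .setVar vOut (.const 1)) .skip

def optimizeTime (n N a m : ℕ) : ℕ :=
  (n * 15 + N * 15 + m * (n * 50 + 100) + 60) + ((N * 68 + 20) +
    ((Nat.clog 2 (n * n) * 20 + 20) +
    ((2 ^ Nat.clog 2 (n * n) * 11 + 6 + (Nat.clog 2 (n * n) *
      (2 ^ Nat.clog 2 (n * n) * 100 + 50 + 8) + 6)) +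
    ((Nat.clog 2 (n * n) + 1) * (attemptTime N a m + 60) + (3 + (n * (n * 90 + 160) + 70 + 2))))))

theorem runs_optimize (hF : Frame .listFacilities (inputState G D k F d) σ)
    (hNf : σ.var vNF = F.card) (hFac : ∀ i < F.card, ∃ a ∈ F, σ.arr aFL i = (a : ℕ))
    (hFac' : ∀ a ∈ F, ∃ i < F.card, σ.arr aFL i = (a : ℕ)) (hn : 0 < n) (hkn : k ≤ n)
    (hFpos : 1 ≤ F.card) :
    Runs .optimize σ (optimizeTime n N F.card (D.width + 1)) (IsCorrectOutput G k F d) := by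
  refine Runs.seq (runs_setup hF hNf hFac hFac') ?_
  rintro σ₁ ⟨hE₁, hSq⟩ hF₁
  refine Runs.seq (runs_order hE₁.hNodes hE₁.hRoot hE₁.hKind hE₁.hC1 hE₁.hC2) ?_
  rintro σ₂ ⟨o, ho⟩ hF₂
  refine Runs.seq (runs_powers (q := n * n) ((hF₂.var_eq _ (by decide)).trans hSq)) ?_
  rintro σ₃ ⟨hL₃, hM₃, hP₃⟩ hF₃
  refine Runs.seq (runs_sort hL₃ hM₃ hP₃) ?_
  rintro σ₄ ⟨hS₄, hC₄⟩ hF₄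
  have hE₃ : Env D k F d σ₃ := (hE₁.frame hF₂ (by decide)).frame hF₃ (by decide)
  have hE₄ : Env D k F d σ₄ := hE₃.frame hF₄ (by decide)
  have hF₅ : Frame (.listFacilities ;; .setup ;; .order ;; .powers ;; .sort)
      (inputState G D k F d) σ₄ :=
    (hF.mono (by decide) (by decide) (by decide)).trans <|
    (hF₁.mono (by decide) (by decide) (by decide)).trans <|
    (hF₂.mono (by decide) (by decide) (by decide)).trans <|
    (hF₃.mono (by decide) (by decide) (by decide)).trans
    (hF₄.mono (by decide) (by decide) (by decide))
  -- Index cells and list heads have not been written since the start, so they are still zero.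
  have hR₄ : Ready D k F d σ₄ := ⟨hE₄, fun x _ => by rw [hF₅.arr_eq _ (by decide)]; rfl,
    fun x _ => by rw [hF₅.arr_eq _ (by decide)]; rfl⟩
  have ho₄ : Ordered D o σ₄ := ⟨ho.nodup, ho.mem, fun i h => by
    rw [hF₄.arr_eq _ (by decide), hF₃.arr_eq _ (by decide)]; exact ho.get i h, ho.pairwise⟩
  refine Runs.seq (runs_search (L := Nat.clog 2 (n * n)) hR₄ ho₄ hFpos
    ((hF₄.var_eq _ (by decide)).trans hL₃)
    (fun j hj => by rw [hF₄.arr_eq _ (by decide)]; exact hP₃ j hj) hS₄) ?_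
  rintro σ₆ ⟨hE₆, hres⟩ hF₆
  -- The radius of a solution is one of the n² distances, so it occurs among the sorted thresholds.
  have hcell : ∀ S : Clustering (Fin n) k, S.IsFeasible G F →
      ∃ j < 2 ^ Nat.clog 2 (n * n), σ₄.real rSort j = S.radius d := fun S hS => by
    obtain ⟨u, v, huv⟩ := hS.exists_radius_eq (d := d) hn
    have hlt : (u : ℕ) * n + v < n * n := by
      calc (u : ℕ) * n + v < (u + 1) * n := by
            rw [add_mul, one_mul]; exact Nat.add_lt_add_left v.2 _
        _ ≤ n * n := Nat.mul_le_mul_right _ u.2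
    obtain ⟨j, -, hj, h⟩ := hC₄ (u * n + v) (Nat.zero_le _)
      (hlt.trans_le (Nat.le_pow_clog one_lt_two _))
    exact ⟨j, hj, by rw [h, hE₃.hDist, huv]⟩
  rcases hres with ⟨p, hp, hres, hcol, hmin⟩ | ⟨hres, hno⟩
  · refine Runs.ite (q := .le (.const 1) (.var vRes)) (B := n * (n * 90 + 160) + 70 + 2)
      (fun _ => ?_) (fun h => absurd (by simp [Test.Holds, hres]) h)
    refine Runs.seq (runs_clusters hE₆ hkn hcol) ?_
    rintro σ₇ ⟨S, hrep, hfeas, hrad⟩ -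
    refine (Runs.straight rfl ⟨fun _ => ⟨by simp, S, hrep, hfeas, fun S' hS' => ?_⟩,
      fun h => absurd ⟨S, hfeas⟩ h⟩).le (by decide)
    rw [Clustering.radius_le_iff]
    intro i v hv
    obtain ⟨j, hj, hj'⟩ := hcell S' hS'
    -- The competitor gives a colouring at its own threshold, so the first successful cell p does
    -- not come after that threshold.
    obtain ⟨f, hf⟩ := hS'.isColoring (D := D) (d := d) le_rfl
    rw [← hj'] at hf
    have hpj : p ≤ j := by
      by_contra hlt
      exact hmin j (by omega) f hf
    have h1 := hS₄ p j (Nat.zero_le _) hpj hj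
    rw [hj'] at h1
    exact_mod_cast (hrad i v hv).trans h1
  · refine Runs.ite (q := .le (.const 1) (.var vRes)) (B := n * (n * 90 + 160) + 70 + 2)
      (fun h => absurd h (by simp [Test.Holds, hres]))
      (fun _ => (Runs.straight rfl ⟨?_, fun _ => ?_⟩).le (by simp [Program.len]))
    · rintro ⟨S, hS⟩
      obtain ⟨j, hj, hj'⟩ := hcell S hS
      obtain ⟨f, hf⟩ := hS.isColoring (D := D) (d := d) le_rfl
      exact absurd (hj' ▸ hf) (hno j hj f)
    · change σ₆.var vOut = 0
      rw [hF₆.var_eq _ (by decide), hF₅.var_eq _ (by decide)]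
      rfl

/-- The algorithm. -/
def Program.solve : Program :=
  .ite (.conj (.le (.var vN) (.const 0)) (.le (.var vK) (.const 0))) (.setVar vOut (.const 1))
    (.listFacilities ;; .ite (.conj (.le (.const 1) (.var vNF)) (.le (.var vK) (.var vN)))
      .optimize .skip)

variable (G D k F d) in
-- The case n = k = 0 has the empty solution and is treated apart. Otherwise a feasible solution
-- needs a facility and k ≤ n. The case k = 0 < n needs no test of its own, since every colouring
-- has at least one component and the search fails.
theorem runs_solve : Runs .solve (inputState G D k F d)
    (n * 30 + 30 + if 1 ≤ F.card then optimizeTime n N F.card (D.width + 1) else 0)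
    (IsCorrectOutput G k F d) := by
  classical
  set T := if 1 ≤ F.card then optimizeTime n N F.card (D.width + 1) else 0 with hT
  refine Runs.le (Runs.ite (B := (n * 30 + 10) + (7 + (T + 1))) (fun h => ?_) (fun h => ?_))
    (by rw [show Test.cost _ = 7 from rfl]; omega)
  · obtain ⟨h1, h2⟩ : n ≤ 0 ∧ k ≤ 0 := h
    obtain rfl : n = 0 := by omega
    obtain rfl : k = 0 := by omega
    refine (Runs.straight rfl ?_).le (by simp [Program.len, Expr.cost]; omega)
    have hfeas : Clustering.IsFeasible G F ⟨Fin.elim0, Fin.elim0⟩ :=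
      ⟨fun i => i.elim0, fun v => v.elim0, fun i => i.elim0⟩
    refine ⟨fun _ => ⟨by simp, _, ⟨fun i => i.elim0, fun v => v.elim0⟩, hfeas, fun S' _ => ?_⟩,
      fun h => absurd ⟨_, hfeas⟩ h⟩
    rw [Clustering.radius_le_iff]
    exact fun i => i.elim0
  replace h : ¬ (n ≤ 0 ∧ k ≤ 0) := h
  refine Runs.seq (runs_listFacilities (F := F) rfl fun v => ?_) ?_
  · exact cells_apply (fun v => if v ∈ F then 1 else 0) v
  rintro σ ⟨h1, h2, h3⟩ hF
  have hN : σ.var vN = n := hF.var_eq _ (by decide)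
  have hK : σ.var vK = k := hF.var_eq _ (by decide)
  have hneg : ∀ τ : State, τ = σ → (¬ (1 ≤ F.card ∧ k ≤ n)) → IsCorrectOutput G k F d τ := by
    rintro τ rfl hc
    refine ⟨?_, fun _ => hF.var_eq vOut (by decide)⟩
    rintro ⟨S, hS⟩
    rcases Nat.eq_zero_or_pos n with rfl | hn
    · have hk : 0 < k := by omega
      exact (S.center ⟨0, hk⟩).elim0
    · exact absurd ⟨hS.facility_pos hn, hS.le_card⟩ hc
  refine Runs.ite (fun hq => ?_) (fun hq => ?_)
  · simp only [Test.Holds, Expr.eval, h1, hN, hK] at hq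
    have hn : 0 < n := by
      obtain ⟨a, -⟩ := Finset.card_pos.1 hq.1
      exact a.pos
    rw [hT, if_pos hq.1]
    exact (runs_optimize hF h1 h2 h3 hn hq.2 hq.1).le (Nat.le_succ _)
  · simp only [Test.Holds, Expr.eval, h1, hN, hK] at hq
    exact (Runs.straight rfl (hneg _ rfl hq)).le (by simp [Program.len])

end RAM

/-! ### The running time -/

namespace RAM

/-- Every term is charged either to n² or to the work on tables. The padded array has at most 2n²
cells. The factor a^(w+1) · b² is at least one and absorbs the overhead per node, and the bound on N
turns the work per node into n times a polynomial in w. The power table does not depend on N, whence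
c + 1 in place of c. -/
theorem optimizeTime_le {n N a w c : ℕ} (hn : 2 ≤ n) (hN : 1 ≤ N) (ha : 1 ≤ a)
    (hNc : N ≤ c * (n * (w + 1))) :
    optimizeTime n N a (w + 1) + (n * 30 + 30) ≤ (Nat.clog 2 (n * n) + 1) * (2000 * n ^ 2 +
      (c + 1) * (n * (a ^ (w + 1) * Nat.bell (w + 1) ^ 2 *
        ((w + 1) * (stepTime (w + 1) + 700))))) := by
  have hn4 : 4 ≤ n * n := Nat.mul_le_mul hn hn
  have hpow : 2 ^ Nat.clog 2 (n * n) ≤ 2 * (n * n) := by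
    have h := Nat.pow_pred_clog_lt_self one_lt_two (x := n * n) (by omega)
    have h' : 0 < Nat.clog 2 (n * n) := Nat.clog_pos one_lt_two (by omega)
    obtain ⟨l, hl⟩ : ∃ l, Nat.clog 2 (n * n) = l + 1 := ⟨Nat.clog 2 (n * n) - 1, by omega⟩
    rw [hl] at h ⊢
    simp only [Nat.pred_succ] at h
    rw [pow_succ]
    omega
  have hX : 1 ≤ a ^ (w + 1) * Nat.bell (w + 1) ^ 2 :=
    Nat.mul_pos (pow_pos ha _) (pow_pos (Nat.one_le_bell _) _)
  have hnode : nodeTime a (w + 1) =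
      a ^ (w + 1) * Nat.bell (w + 1) ^ 2 * (stepTime (w + 1) + 100) + 200 := by
    unfold nodeTime; ring
  unfold optimizeTime attemptTime
  rw [hnode]
  -- What remains are polynomial inequalities in quantities that may be treated as independent.
  generalize Nat.clog 2 (n * n) = L at hpow ⊢
  generalize a ^ (w + 1) * Nat.bell (w + 1) ^ 2 = X at hX ⊢
  generalize stepTime (w + 1) = s
  generalize 2 ^ L = M at hpow ⊢
  generalize w + 1 = W at hNc ⊢
  have h1 : N * (X * (s + 100) + 200 + 98) + 100 + 60 ≤ c * (n * (X * (W * (s + 558)))) := by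
    calc N * (X * (s + 100) + 200 + 98) + 100 + 60 ≤ N * (X * (s + 100) + 200 + 98 + 160) := by
          nlinarith
      _ ≤ N * (X * (s + 558)) := Nat.mul_le_mul_left _ (by nlinarith)
      _ ≤ c * (n * W) * (X * (s + 558)) := Nat.mul_le_mul_right _ hNc
      _ = c * (n * (X * (W * (s + 558)))) := by ring
  have h2 : N * 83 + W * (n * 50 + 100) ≤ (c + 1) * (n * (X * (W * 100))) := by
    calc N * 83 + W * (n * 50 + 100) ≤ c * (n * W) * 100 + n * W * 100 := by nlinarith
      _ = (c + 1) * (n * W) * 100 * 1 := by ring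
      _ ≤ (c + 1) * (n * W) * 100 * X := Nat.mul_le_mul_left _ hX
      _ = (c + 1) * (n * (X * (W * 100))) := by ring
  have h3 : L * (M * 100 + 50 + 8) ≤ L * (300 * n ^ 2) := Nat.mul_le_mul_left _ (by nlinarith)
  have h4 : L * 20 ≤ L * (20 * n ^ 2) := Nat.mul_le_mul_left _ (by nlinarith)
  have h5 : (L + 1) * (N * (X * (s + 100) + 200 + 98) + 100 + 60) + (N * 83 + W * (n * 50 + 100)) ≤
      (L + 1) * ((c + 1) * (n * (X * (W * (s + 700))))) := by
    calc _ ≤ (L + 1) * (c * (n * (X * (W * (s + 558))))) +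
          (L + 1) * ((c + 1) * (n * (X * (W * 100)))) :=
          Nat.add_le_add (Nat.mul_le_mul_left _ h1)
            (h2.trans (Nat.le_mul_of_pos_left _ (Nat.succ_pos _)))
      _ ≤ (L + 1) * ((c + 1) * (n * (X * (W * (s + 558))))) +
          (L + 1) * ((c + 1) * (n * (X * (W * 100)))) := by gcongr; omega
      _ = (L + 1) * ((c + 1) * (n * (X * (W * (s + 658))))) := by ring
      _ ≤ _ := by gcongr; omega
  have h6 : n * 15 + 60 + 20 + 20 + M * 11 + 6 + 6 + 3 + (n * (n * 90 + 160) + 70 + 2) +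
      (n * 30 + 30) ≤ 2000 * n ^ 2 := by nlinarith
  have h7 : (L + 1) * (2000 * n ^ 2) = L * (300 * n ^ 2) + L * (20 * n ^ 2) +
      L * (1680 * n ^ 2) + 2000 * n ^ 2 := by ring
  rw [mul_add (L + 1) (2000 * n ^ 2), h7]
  omega

/-- The logarithm rounded up is l + 1 with 2^l < n², so l · log 2 ≤ 2 log n. As log 2 > 0.69 and n ≥
2, both l and the additive 2 are at most 3 log n, so the factor 8 leaves room. -/
theorem clog_sq_succ_le {n : ℕ} (hn : 2 ≤ n) :
    ((Nat.clog 2 (n * n) : ℕ) : ℝ) + 1 ≤ 8 * Real.log n := by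
  have hlog2 := Real.log_two_gt_d9
  have hlogn : Real.log 2 ≤ Real.log n :=
    Real.log_le_log (by norm_num) (by exact_mod_cast hn)
  have hn4 : 4 ≤ n * n := Nat.mul_le_mul hn hn
  have h := Nat.pow_pred_clog_lt_self one_lt_two (x := n * n) (by omega)
  have h' : 0 < Nat.clog 2 (n * n) := Nat.clog_pos one_lt_two (by omega)
  obtain ⟨l, hl⟩ : ∃ l, Nat.clog 2 (n * n) = l + 1 := ⟨Nat.clog 2 (n * n) - 1, by omega⟩
  rw [hl] at h ⊢
  simp only [Nat.pred_succ] at h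
  have hr : ((2 : ℝ) ^ l) ≤ (n : ℝ) * n := by exact_mod_cast h.le
  have hlog := Real.log_le_log (by positivity) hr
  have hn0 : (n : ℝ) ≠ 0 := by positivity
  rw [Real.log_pow, Real.log_mul hn0 hn0] at hlog
  push_cast
  have hl0 : (0 : ℝ) ≤ l := Nat.cast_nonneg _
  nlinarith

end RAM

/-! ### The main theorem -/

open Polynomial in
theorem mainTheorem8 :
    ∃ (P : RAM.Program) (p : Polynomial ℕ), ∀ c : ℕ, ∃ C : ℝ,
      ∀ (n N k : ℕ) (G : SimpleGraph (Fin n)) (D : NiceTreeDecomposition G (Fin N))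
        (F : Finset (Fin n)) (d : Fin n → Fin n → ℝ≥0), IsMetric d →
        ∃ (T : ℕ) (τ : RAM.State), RAM.Exec P (inputState G D k F d) T τ ∧
          IsCorrectOutput G k F d τ ∧
          (2 ≤ n → N ≤ c * (n * (D.width + 1)) →
            (T : ℝ) ≤ C * ((n : ℝ) ^ 2 * Real.log n +
              Real.log n * n * (F.card : ℝ) ^ (D.width + 1) *
                (Nat.bell (D.width + 1) : ℝ) ^ 2 * ((p.eval D.width : ℕ) : ℝ))) := by
  let m : Polynomial ℕ := Polynomial.X + 1
  -- With m = w + 1 for the largest bag size this is m · (`stepTime` m + 700), written out as a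
  -- polynomial in w.
  let p : Polynomial ℕ := m * ((m * (m * 40 + 120) + 200 + m * (m * 60 + 150) + 150) + 700)
  have hp : ∀ w : ℕ, p.eval w = (w + 1) * (RAM.stepTime (w + 1) + 700) := fun w => by
    simp [p, m, RAM.stepTime, RAM.insertTime]
  -- 16000 = 8 · 2000: the factor from the logarithm times the constant of `optimizeTime_le`. The
  -- factor c + 1 ≥ 1 also covers the n² term.
  refine ⟨RAM.Program.solve, p, fun c => ⟨16000 * (c + 1), fun n N k G D F d _ => ?_⟩⟩
  obtain ⟨T, τ, hex, hT, hout, -⟩ := RAM.runs_solve G D k F d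
  refine ⟨T, τ, hex, hout, fun hn hN => ?_⟩
  rw [hp]
  have hlog := RAM.clog_sq_succ_le hn
  set L := Nat.clog 2 (n * n)
  set E : ℕ := (D.width + 1) * (RAM.stepTime (D.width + 1) + 700)
  have hbound : T ≤ (L + 1) * (2000 * n ^ 2 +
      (c + 1) * (n * (F.card ^ (D.width + 1) * Nat.bell (D.width + 1) ^ 2 * E))) := by
    refine hT.trans ?_
    split_ifs with hF
    · rw [add_comm]
      exact RAM.optimizeTime_le hn D.root.pos hF hN
    -- Without facilities the algorithm stops after scanning for them, and the term n² log n pays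
    -- for that.
    · have h1 : n * 30 + 30 + 0 ≤ 2000 * n ^ 2 := by nlinarith
      refine h1.trans ((Nat.le_add_right _ _).trans (Nat.le_mul_of_pos_left _ (Nat.succ_pos _)))
  have hreal : (T : ℝ) ≤ ((L : ℝ) + 1) * (2000 * (n : ℝ) ^ 2 + ((c : ℝ) + 1) *
      (n * ((F.card : ℝ) ^ (D.width + 1) * (Nat.bell (D.width + 1) : ℝ) ^ 2 * (E : ℝ)))) := by
    exact_mod_cast hbound
  set Y : ℝ := n * ((F.card : ℝ) ^ (D.width + 1) * (Nat.bell (D.width + 1) : ℝ) ^ 2 * (E : ℝ))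
    with hY
  have hY0 : 0 ≤ Y := by positivity
  have hl0 : 0 ≤ Real.log n := Real.log_natCast_nonneg n
  have hc0 : (0 : ℝ) ≤ c := Nat.cast_nonneg c
  calc (T : ℝ) ≤ ((L : ℝ) + 1) * (2000 * (n : ℝ) ^ 2 + ((c : ℝ) + 1) * Y) := hreal
    _ ≤ (8 * Real.log n) * (2000 * ((c : ℝ) + 1) * (n : ℝ) ^ 2 + 2000 * ((c : ℝ) + 1) * Y) := by
      gcongr
      · nlinarith [sq_nonneg (n : ℝ)]
      · linarith
    _ = 16000 * ((c : ℝ) + 1) * ((n : ℝ) ^ 2 * Real.log n + Real.log n * Y) := by ring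
    _ = _ := by rw [hY]; ring
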